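/- **Theorem (Existence of a global first return section through $\Gamma$).** *Setting.* For a $3\times 3$ matrix $M$ put $H(p,q)=\max_i (Mq)_i-\min_j (p'M)_j$ on the product of the hyperplanes $\{\sum_i p_i=1\}\times\{\sum_j q_j=1\}\subset\mathbb R^3\times\mathbb R^3$. Let $\Sigma$ be the simplex of probability vectors in $\mathbb R^3$, and let $BR_p(q)=\operatorname{argmax}_{p\in\Sigma}p'Mq$ and $BR_q(p)=\operatorname{argmin}_{q\in\Sigma}p'Mq$ be the set-valued best responses. Let $X_H$ be the set-valued Hamiltonian vector field of $H$ with respect to the two-form $\omega=\sum_{i,j}m_{ij}\,dp_i\wedge dq_j$: the tangent vectors $w$ with $\omega(w,Y)=dH(Y)$ for all tangent $Y$, where $\partial H/\partial q=M'a$ and $\partial H/\partial p=-Mb$ with $a\in BR_p(q)$, $b\in BR_q(p)$ arbitrary. Solutions of the differential inclusion $(\dot p,\dot q)\in X_H(p,q)$ are locally absolutely continuous curves satisfying it almost everywhere. Let $$B_\beta=\begin{pmatrix}1&0&\beta\\ \beta&1&0\\ 0&\beta&1\end{pmatrix}.$$ *Statement.* For every $\beta$ sufficiently close to $\sigma=(\sqrt5-1)/2$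 and every $M$ sufficiently close to $B_\beta$ the following holds. The set $H^{-1}(1)$ is homeomorphic to $S^3$, through each of its points there is exactly one solution, and the solutions form a continuous flow $\phi_t$ on $H^{-1}(1)$. The flow has a periodic orbit $\Gamma$ that is a hexagon and at all points of which both best responses are multivalued. There is a topological disc $S\subset H^{-1}(1)$ with boundary $\partial S=\Gamma$ that is the union of four non-degenerate triangles, any two of which meet exactly in the convex hull of their common vertices, such that: 1. The orbit through each $x\in H^{-1}(1)\setminus\Gamma$ meets $S$ at arbitrarily large positive and negative times, and each of these intersections is transversal: the left and right velocities are not tangent to the triangles of $S$ through the intersection point, and near this point $S$ is a local cross-section of the flow (there is a flow box). So the first return time $\tau(z)$ and the first return map $R_S(z)=\phi_{\tau(z)}(z)$ are well defined for $z\in S\setminus\Gamma$. 2. $\tau(z)\to 0$ as $z\in S\setminus\Gamma$ tends to a point of $\Gamma$. 3. $R_S$ extends continuously to $S$ with $R_S=\mathrm{id}$ on $\partial S=\Gamma$. 4. $R_S$ is piecewise affine (affine on each of finitely many convex polytopes covering $S$), and it preserves the area on $S$ induced by $\omega$, that is, the measure which on each triangle with vertices $v_0,v_1,v_2$ is $|\omega(v_1-v_0,v_2-v_0)|\neq0$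 times Lebesgue measure $ds\,dt$ in the affine coordinates $v_0+s(v_1-v_0)+t(v_2-v_0)$. 5. $R_S$ has a periodic point $x$ of saddle type, near which the corresponding iterate of $R_S$ is affine with one eigenvalue of modulus less than one and one of modulus greater than one, and the stable and unstable sets of $x$ intersect transversally at a point $y\neq x$. Moreover $R_S$ has a horseshoe: some iterate $R_S^m$, $m\ge1$, restricted to some compact invariant subset of $S\setminus\Gamma$ is topologically conjugate to the full two-sided shift on two symbols. -/

import Mathlib

open Set Filter Topology MeasureTheory

noncomputable section

namespace PWHam

/-- Points `(p, q)` of `ℝ³ × ℝ³`. The phase space is the product of the two hyperplanes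
`∑ pᵢ = 1`, `∑ qⱼ = 1`, hence four-dimensional; see `hyperplanes`. -/
abbrev Phase : Type := (Fin 3 → ℝ) × (Fin 3 → ℝ)

/-- The matrix with rows `(1, 0, β)`, `(β, 1, 0)`, `(0, β, 1)`. -/
def matB (β : ℝ) : Matrix (Fin 3) (Fin 3) ℝ :=
  !![1, 0, β; β, 1, 0; 0, β, 1]

/-- The product of the two hyperplanes that contain the simplex of probability vectors. -/
def hyperplanes : Set Phase := {x | ∑ i, x.1 i = 1 ∧ ∑ j, x.2 j = 1}

/-- The vectors tangent to `hyperplanes`. -/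
def tangentVectors : Set Phase := {w | ∑ i, w.1 i = 0 ∧ ∑ j, w.2 j = 0}

/-- `H(p, q) = maxᵢ (M q)ᵢ - minⱼ (p' M)ⱼ`. -/
def ham (M : Matrix (Fin 3) (Fin 3) ℝ) (x : Phase) : ℝ :=
  (⨆ i, Matrix.mulVec M x.2 i) - ⨅ j, Matrix.vecMul x.1 M j

/-- The level set `H⁻¹(1)`, with `H` defined on the product of the two hyperplanes. -/
def levelSet (M : Matrix (Fin 3) (Fin 3) ℝ) : Set Phase :=
  {x | x ∈ hyperplanes ∧ ham M x = 1}

/-- The set-valued best response `BR_p(q) = argmax_{p ∈ Σ} p' M q`. -/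
def bestRespP (M : Matrix (Fin 3) (Fin 3) ℝ) (q : Fin 3 → ℝ) : Set (Fin 3 → ℝ) :=
  {a | a ∈ stdSimplex ℝ (Fin 3) ∧ ∀ a' ∈ stdSimplex ℝ (Fin 3),
    a' ⬝ᵥ Matrix.mulVec M q ≤ a ⬝ᵥ Matrix.mulVec M q}

/-- The set-valued best response `BR_q(p) = argmin_{q ∈ Σ} p' M q`. -/
def bestRespQ (M : Matrix (Fin 3) (Fin 3) ℝ) (p : Fin 3 → ℝ) : Set (Fin 3 → ℝ) :=
  {b | b ∈ stdSimplex ℝ (Fin 3) ∧ ∀ b' ∈ stdSimplex ℝ (Fin 3),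
    p ⬝ᵥ Matrix.mulVec M b ≤ p ⬝ᵥ Matrix.mulVec M b'}

/-- The two-form `ω = ∑ aᵢⱼ dpᵢ ∧ dqⱼ`. -/
def symp (A : Matrix (Fin 3) (Fin 3) ℝ) (x y : Phase) : ℝ :=
  x.1 ⬝ᵥ Matrix.mulVec A y.2 - y.1 ⬝ᵥ Matrix.mulVec A x.2

/-- The set-valued Hamiltonian vector field of `ham M` with respect to `symp A`: the tangent
vectors `w` such that `ω(w, Y) = dH(Y)` for all tangent `Y`. Where the best responses are
single-valued, `∂H/∂q = M' BR_p(q)` and `∂H/∂p = - M BR_q(p)`; elsewhere all elements of the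
best response sets are admitted. -/
def hamField (M A : Matrix (Fin 3) (Fin 3) ℝ) (x : Phase) : Set Phase :=
  {w | w ∈ tangentVectors ∧ ∃ a ∈ bestRespP M x.2, ∃ b ∈ bestRespQ M x.1,
    ∀ Y ∈ tangentVectors,
      symp A w Y = a ⬝ᵥ Matrix.mulVec M Y.2 - Y.1 ⬝ᵥ Matrix.mulVec M b}

/-- (Carathéodory) solutions of the differential inclusion `x' ∈ X_H(x)`: locally absolutely
continuous curves that satisfy it almost everywhere. -/
def IsSolution (M A : Matrix (Fin 3) (Fin 3) ℝ) (γ : ℝ → Phase) : Prop :=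
  (∀ a b : ℝ, AbsolutelyContinuousOnInterval γ a b) ∧
    ∀ᵐ t : ℝ, ∃ w ∈ hamField M A (γ t), HasDerivAt γ w t

/-- `φ` is the continuous flow on `H⁻¹(1)` of the differential inclusion: through each point
there is exactly one solution. (The values `φ t x` for `x` off the level set are irrelevant.) -/
def IsFlow (M A : Matrix (Fin 3) (Fin 3) ℝ) (φ : ℝ → Phase → Phase) : Prop :=
  (∀ x ∈ levelSet M, φ 0 x = x ∧ (∀ t, φ t x ∈ levelSet M) ∧
    IsSolution M A (fun t => φ t x) ∧
    ∀ γ : ℝ → Phase, IsSolution M A γ → γ 0 = x → ∀ t, γ t = φ t x) ∧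
  ContinuousOn (fun z : ℝ × Phase => φ z.1 z.2) (univ ×ˢ levelSet M)

/-- `Γ` is a periodic orbit of `φ` in `X`. -/
def IsPeriodicOrbit (φ : ℝ → Phase → Phase) (X Γ : Set Phase) : Prop :=
  ∃ x ∈ X, ∃ T : ℝ, 0 < T ∧ φ T x = x ∧ Γ = range (fun t => φ t x)

/-- `Γ` is a (simple, closed, non-degenerate) hexagon. The index `i + 1` is taken mod `6`. -/
def IsHexagon (Γ : Set Phase) : Prop :=
  ∃ w : Fin 6 → Phase, Function.Injective w ∧
    (∀ i, ¬ Collinear ℝ {w i, w (i + 1), w (i + 2)}) ∧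
    (∀ i j, i ≠ j → segment ℝ (w i) (w (i + 1)) ∩ segment ℝ (w j) (w (j + 1)) =
      ({w i, w (i + 1)} : Set Phase) ∩ {w j, w (j + 1)}) ∧
    Γ = ⋃ i, segment ℝ (w i) (w (i + 1))

/-- `S` is a topological disc with boundary `Γ`. (An injective continuous map on the compact
disc is a homeomorphism onto its image.) -/
def IsDiscWithBoundary (S Γ : Set Phase) : Prop :=
  ∃ f : EuclideanSpace ℝ (Fin 2) → Phase,
    ContinuousOn f (Metric.closedBall 0 1) ∧ InjOn f (Metric.closedBall 0 1) ∧
    f '' Metric.closedBall 0 1 = S ∧ f '' Metric.sphere 0 1 = Γ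

/-- The triangle with vertices `v 0, v 1, v 2`. -/
def tri (v : Fin 3 → Phase) : Set Phase := convexHull ℝ (range v)

/-- The plane of directions of the triangle `v`. -/
def triDir (v : Fin 3 → Phase) : Submodule ℝ Phase := vectorSpan ℝ (range v)

/-- The four non-degenerate triangles `T k` have union `S`, and any two of them meet exactly
in the convex hull of their common vertices. -/
def IsTriangulation (T : Fin 4 → Fin 3 → Phase) (S : Set Phase) : Prop :=
  (∀ k, AffineIndependent ℝ (T k)) ∧
  (∀ k l, k ≠ l → tri (T k) ∩ tri (T l) = convexHull ℝ (range (T k) ∩ range (T l))) ∧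
  S = ⋃ k, tri (T k)

/-- The orbit through `y ∈ S` crosses `S = ⋃ k, tri (T k)` transversally at `y`: its left and
right velocities at `y` are not tangent to any of the triangles through `y`, and it really
crosses, i.e. near `y` the surface `S` is a local cross-section of the flow on `X` (there is a
flow box around `y`). -/
def CrossesTransversally (φ : ℝ → Phase → Phase) (X S : Set Phase)
    (T : Fin 4 → Fin 3 → Phase) (y : Phase) : Prop :=
  (∃ vl vr : Phase,
    HasDerivWithinAt (fun t => φ t y) vl (Iic 0) 0 ∧
    HasDerivWithinAt (fun t => φ t y) vr (Ici 0) 0 ∧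
    ∀ k, y ∈ tri (T k) → vl ∉ triDir (T k) ∧ vr ∉ triDir (T k)) ∧
  ∃ ε : ℝ, 0 < ε ∧ ∃ U ∈ 𝓝 y,
    InjOn (fun z : ℝ × Phase => φ z.1 z.2) (Ioo (-ε) ε ×ˢ (S ∩ U)) ∧
    (fun z : ℝ × Phase => φ z.1 z.2) '' (Ioo (-ε) ε ×ˢ (S ∩ U)) ∈ 𝓝[X] y

/-- `R` is affine on each of finitely many convex polytopes that cover `S`. -/
def IsPiecewiseAffineOn (R : Phase → Phase) (S : Set Phase) : Prop :=
  ∃ (n : ℕ) (F : Fin n → Finset Phase),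
    S = ⋃ k, convexHull ℝ (F k : Set Phase) ∧
    ∀ k, ∃ L : Phase →ᵃ[ℝ] Phase, EqOn R L (convexHull ℝ (F k : Set Phase))

/-- The area on the triangle `v` induced by the two-form `symp A`: the constant `|ω|` of the
two edges at `v 0` times the Lebesgue measure in the affine coordinates
`(s, t) ↦ v 0 + s (v 1 - v 0) + t (v 2 - v 0)`. -/
def triArea (A : Matrix (Fin 3) (Fin 3) ℝ) (v : Fin 3 → Phase) : Measure Phase :=
  ENNReal.ofReal |symp A (v 1 - v 0) (v 2 - v 0)| •
    ((volume : Measure (ℝ × ℝ)).restrict {s | 0 ≤ s.1 ∧ 0 ≤ s.2 ∧ s.1 + s.2 ≤ 1}).map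
      (fun s => v 0 + s.1 • (v 1 - v 0) + s.2 • (v 2 - v 0))

/-- The area on `⋃ k, tri (T k)` induced by the two-form `symp A`. -/
def sympArea (A : Matrix (Fin 3) (Fin 3) ℝ) (T : Fin 4 → Fin 3 → Phase) : Measure Phase :=
  ∑ k, triArea A (T k)

/-- `x` is a saddle point of period `N` of `R`: it is a fixed point of `R^N` in the relative
interior of one of the triangles, and near `x` the map `R^N` is affine with an eigenvalue of
modulus less than one and an eigenvalue of modulus greater than one. -/
def IsSaddle (R : Phase → Phase) (T : Fin 4 → Fin 3 → Phase) (N : ℕ) (x : Phase) : Prop :=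
  0 < N ∧ R^[N] x = x ∧
  ∃ k, x ∈ intrinsicInterior ℝ (tri (T k)) ∧
    ∃ e₁ ∈ triDir (T k), ∃ e₂ ∈ triDir (T k), LinearIndependent ℝ ![e₁, e₂] ∧
      ∃ l m : ℝ, |l| < 1 ∧ 1 < |m| ∧
        ∃ ε : ℝ, 0 < ε ∧ ∀ s t : ℝ, |s| < ε → |t| < ε →
          R^[N] (x + s • e₁ + t • e₂) = x + (l * s) • e₁ + (m * t) • e₂

/-- The stable set of the fixed point `x` of `R^N` in `S`. -/
def stableSet (R : Phase → Phase) (S : Set Phase) (N : ℕ) (x : Phase) : Set Phase :=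
  {z | z ∈ S ∧ Tendsto (fun n => (R^[N])^[n] z) atTop (𝓝 x)}

/-- The unstable set of the fixed point `x` of `R^N` in `S`: the points with a backward orbit
in `S` that converges to `x`. -/
def unstableSet (R : Phase → Phase) (S : Set Phase) (N : ℕ) (x : Phase) : Set Phase :=
  {z | ∃ y : ℕ → Phase, y 0 = z ∧ (∀ n, y n ∈ S ∧ R^[N] (y (n + 1)) = y n) ∧
    Tendsto y atTop (𝓝 x)}

/-- At `y ≠ x`, in the relative interior of one of the triangles, a segment of the stable set of
`x` and a segment of the unstable set of `x` cross transversally. -/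
def IsTransverseHomoclinic (R : Phase → Phase) (S : Set Phase) (T : Fin 4 → Fin 3 → Phase)
    (N : ℕ) (x y : Phase) : Prop :=
  y ≠ x ∧ ∃ k, y ∈ intrinsicInterior ℝ (tri (T k)) ∧
    ∃ a ∈ triDir (T k), ∃ b ∈ triDir (T k), LinearIndependent ℝ ![a, b] ∧
      ∃ ε : ℝ, 0 < ε ∧ ∀ s : ℝ, |s| < ε →
        y + s • a ∈ stableSet R S N x ∧ y + s • b ∈ unstableSet R S N x

/-- `R` has a horseshoe in `D`: a compact subset of `D` that is invariant under some iterate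
`R^m`, `m ≥ 1`, on which `R^m` is topologically conjugate (through `h`) to the full two-sided
shift on two symbols. -/
def HasHorseshoe (R : Phase → Phase) (D : Set Phase) : Prop :=
  ∃ m : ℕ, 0 < m ∧ ∃ h : (ℤ → Bool) → Phase, Continuous h ∧ Function.Injective h ∧
    ∀ ξ, h ξ ∈ D ∧ R^[m] (h ξ) = h (fun n => ξ (n + 1))

end PWHam

end

/-!
For `M` near `matB β` with `β` near the golden mean `σ` the game has a unique, completely mixed
equilibrium `(p*, q*)`, and the tangency condition determines `X_H(p, q)` as the set of all
`(a - p*, b - q*)` with `a`, `b` best responses (`IsCyclic.mem_hamField_iff`). All arguments on the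
flow use only the order of the entries, the invertibility of `M` and the positivity of the
equilibrium, which is the content of `IsCyclic`.

*Flow.* The field is upper semicontinuous with compact convex values, so Euler polygons converge to
solutions, and uniqueness implies continuous dependence (`exists_isTraj`, `exists_isUniqueFlow`).
Uniqueness is local. Where the tied best responses admit a strictly dominant pair, the solution must
enter one region (`IsCyclic.eq_line_of_dominant`). The other points lie on the hexagon `Γ`, along which
a cyclic `2 × 2` subgame without dominated strategies is tied. If `θ`, `κ` are its equilibrium
strategies, the functional `θ · Mq - κ · M'p` is at most `H`, with equality only where the subgame is
tied, and it does not decrease in the relevant time direction; as `H` is constant, the solution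
stays on the edge (`IsCyclic.eq_line_of_subgame`).

*Geometry.* The function `H` is convex with bounded sublevel sets, so its level set is a sphere. It is
also a simplicial complex: the nine regions with prescribed best responses are tetrahedra on six
vertices, namely the points where all strategies of one player are tied and one strategy of the other
player is not used. In the barycentric coordinates `coord` the level set is the join of two triangle
boundaries, `Γ` is a cycle of six edges, and the section `sec` consists of the four triangles obtained
by joining the vertex `inl 0` to the other vertices of `Γ`.

*Return map.* On each region the velocity is constant, the orbit leaves through one of at most two
facets, and once the exits through the section are removed the graph of transitions is acyclic. Hence
there are finitely many itineraries between successive hits of the section, and on each of them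
hitting time and hitting point are restrictions of linear maps (`IsCyclic.hasPieces`). This gives
existence, continuity and piecewise affinity of the return map, and its extension by the identity on
`Γ`, where the hitting times vanish. Each step from facet to facet preserves the symplectic form
(`IsCyclic.symp_stepMap`), whence the preservation of area.

*Horseshoe.* On a parallelogram in the third triangle, the second iterate of the return map along two
itineraries is an affine saddle that maps a thin strip across the whole parallelogram. In cross form,
expressing the new contracted and the old expanded coordinate by the old contracted and the new
expanded one, the two branches have small coefficients. Orbits with a prescribed itinerary are then
fixed points of a contraction, which gives the horseshoe (`CrossForm.IsHorseshoe.hasHorseshoe`); the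
constant itinerary gives the saddle, and the itinerary that differs from it in one place the
transverse homoclinic point (`CrossForm.IsHorseshoe.exists_saddle`). The required strict inequalities
are open in `M`, and for `matB σ` they are checked in exact arithmetic in `ℤ[σ]` (`hasBox_golden`).
-/

open Set Filter Topology MeasureTheory

noncomputable section

namespace PWHam

/-! ### Differential inclusions with locally decreasing right-hand side -/

section Inclusion

variable {E : Type*} [NormedAddCommGroup E] [NormedSpace ℝ E]

/-- The increment of `γ` over `[s₁, s₂]` is `s₂ - s₁` times an element of `C`. -/
def IncrIn (C : Set E) (γ : ℝ → E) (s₁ s₂ : ℝ) : Prop :=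
  ∃ w ∈ C, γ s₂ - γ s₁ = (s₂ - s₁) • w

/-- Solutions of the inclusion `γ' ∈ F γ` on the whole line, in derivative-free form: near every
time `t`, all mean velocities of `γ` belong to `F (γ t)`. For the fields considered here this is
equivalent to being a Carathéodory solution, and it passes to pointwise limits. -/
def IsTraj (F : E → Set E) (γ : ℝ → E) : Prop :=
  ∀ t, ∃ δ > 0, ∀ s₁ s₂, t - δ < s₁ → s₁ ≤ s₂ → s₂ < t + δ → IncrIn (F (γ t)) γ s₁ s₂

/-- Set-valued fields with nonempty, compact, convex, uniformly bounded values, such that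
`F y ⊆ F x` for all `y` near `x`. -/
structure IsTameField (F : E → Set E) (K : ℝ) : Prop where
  nonempty : ∀ x, (F x).Nonempty
  convex : ∀ x, Convex ℝ (F x)
  compact : ∀ x, IsCompact (F x)
  bound : ∀ x, ∀ w ∈ F x, ‖w‖ ≤ K
  usc : ∀ x, ∀ᶠ y in 𝓝 x, F y ⊆ F x

lemma IncrIn.mono {C D : Set E} {γ : ℝ → E} {a b : ℝ} (h : IncrIn C γ a b) (hCD : C ⊆ D) :
    IncrIn D γ a b := by
  obtain ⟨w, hw, h⟩ := h
  exact ⟨w, hCD hw, h⟩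

lemma incrIn_self {C : Set E} (hC : C.Nonempty) (γ : ℝ → E) (a : ℝ) : IncrIn C γ a a := by
  obtain ⟨w, hw⟩ := hC
  exact ⟨w, hw, by simp⟩

lemma IncrIn.trans {C : Set E} (hC : Convex ℝ C) {γ : ℝ → E} {a b c : ℝ} (hab : a ≤ b)
    (hbc : b ≤ c) (h₁ : IncrIn C γ a b) (h₂ : IncrIn C γ b c) : IncrIn C γ a c := by
  obtain ⟨w₁, hw₁, h₁⟩ := h₁
  obtain ⟨w₂, hw₂, h₂⟩ := h₂
  rcases (hab.trans hbc).eq_or_lt with h | h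
  · have hb : b = a := le_antisymm (h ▸ hbc) hab
    subst hb
    exact ⟨w₂, hw₂, h₂⟩
  · have hne : c - a ≠ 0 := (sub_pos.2 h).ne'
    refine ⟨((b - a) / (c - a)) • w₁ + ((c - b) / (c - a)) • w₂,
      hC hw₁ hw₂ (div_nonneg (by linarith) (by linarith))
        (div_nonneg (by linarith) (by linarith)) (by field_simp; ring), ?_⟩
    rw [smul_add, smul_smul, smul_smul, mul_div_cancel₀ _ hne, mul_div_cancel₀ _ hne, ← h₁, ← h₂]
    abel

/-- Mean velocities that lie locally in a convex set do so globally. -/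
lemma incrIn_of_local {C : Set E} (hC : Convex ℝ C) (hne : C.Nonempty) {γ : ℝ → E} {a b : ℝ}
    (hab : a ≤ b)
    (h : ∀ t ∈ Icc a b, ∃ δ > 0, ∀ s₁ s₂, a ≤ s₁ → s₁ ≤ s₂ → s₂ ≤ b → t - δ < s₁ → s₂ < t + δ →
      IncrIn C γ s₁ s₂) : IncrIn C γ a b := by
  choose! δ hδ h using h
  obtain ⟨t, ht0, htm, ⟨m, hm⟩, hc⟩ := exists_monotone_Icc_subset_open_cover_Icc hab
    (c := fun t : Icc a b => {s : Icc a b | t.1 - δ t < s.1 ∧ s.1 < t.1 + δ t})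
    (fun t => (isOpen_lt continuous_const continuous_subtype_val).inter
      (isOpen_lt continuous_subtype_val continuous_const))
    (fun t _ => mem_iUnion.2 ⟨t, by
      have := hδ t t.2
      constructor <;> linarith⟩)
  have key : ∀ n, IncrIn C γ a (t n) := by
    intro n
    induction n with
    | zero => rw [ht0]; exact incrIn_self hne γ a
    | succ n ih =>
      refine ih.trans hC (t n).2.1 (htm n.le_succ) ?_
      obtain ⟨i, hi⟩ := hc n
      have h1 := hi (left_mem_Icc.2 (htm n.le_succ))
      have h2 := hi (right_mem_Icc.2 (htm n.le_succ))
      exact h i.1 i.2 _ _ (t n).2.1 (htm n.le_succ) (t (n + 1)).2.2 h1.1 h2.2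
  have := key m
  rwa [hm m le_rfl] at this

variable {F : E → Set E} {K : ℝ}

lemma IsTameField.K_nonneg (hF : IsTameField F K) : 0 ≤ K := by
  obtain ⟨w, hw⟩ := hF.nonempty 0
  exact (norm_nonneg w).trans (hF.bound 0 w hw)

lemma IncrIn.dist_le {C : Set E} (hC : ∀ w ∈ C, ‖w‖ ≤ K) {γ : ℝ → E} {a b : ℝ} (hab : a ≤ b)
    (h : IncrIn C γ a b) : dist (γ a) (γ b) ≤ K * (b - a) := by
  obtain ⟨w, hw, h⟩ := h
  rw [dist_comm, dist_eq_norm, h, norm_smul, Real.norm_eq_abs, abs_of_nonneg (by linarith),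
    mul_comm]
  exact mul_le_mul_of_nonneg_right (hC w hw) (by linarith)

lemma IsTraj.dist_le (hF : IsTameField F K) {γ : ℝ → E} (hγ : IsTraj F γ) (a b : ℝ) :
    dist (γ a) (γ b) ≤ K * |b - a| := by
  wlog hab : a ≤ b generalizing a b
  · rw [dist_comm, abs_sub_comm]
    exact this b a (le_of_not_ge hab)
  rw [abs_of_nonneg (by linarith)]
  have : IncrIn (Metric.closedBall (0 : E) K) γ a b := by
    refine incrIn_of_local (convex_closedBall _ _) ⟨0, by simpa using hF.K_nonneg⟩ hab
      fun t _ => ?_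
    obtain ⟨δ, hδ, h⟩ := hγ t
    exact ⟨δ, hδ, fun s₁ s₂ _ h2 _ h4 h5 => (h s₁ s₂ h4 h2 h5).mono
      fun w hw => by simpa using hF.bound _ w hw⟩
  exact this.dist_le (fun w hw => by simpa using hw) hab

lemma IsTraj.lipschitz (hF : IsTameField F K) {γ : ℝ → E} (hγ : IsTraj F γ) :
    LipschitzWith K.toNNReal γ := by
  refine LipschitzWith.of_dist_le_mul fun a b => ?_
  rw [Real.coe_toNNReal _ hF.K_nonneg, Real.dist_eq, abs_sub_comm]
  exact hγ.dist_le hF a b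

lemma IsTraj.continuous (hF : IsTameField F K) {γ : ℝ → E} (hγ : IsTraj F γ) : Continuous γ :=
  (hγ.lipschitz hF).continuous

lemma IsTraj.shift {γ : ℝ → E} (hγ : IsTraj F γ) (c : ℝ) : IsTraj F (fun t => γ (t + c)) := by
  intro t
  obtain ⟨δ, hδ, h⟩ := hγ (t + c)
  refine ⟨δ, hδ, fun s₁ s₂ h1 h2 h3 => ?_⟩
  obtain ⟨w, hw, e⟩ := h (s₁ + c) (s₂ + c) (by linarith) (by linarith) (by linarith)
  exact ⟨w, hw, by rw [e]; ring_nf⟩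

/-- It suffices to control the mean velocities on the two sides of each time separately. -/
lemma isTraj_of_sides {F : E → Set E} (hconv : ∀ x, Convex ℝ (F x)) {γ : ℝ → E}
    (hr : ∀ t, ∃ δ > 0, ∀ s₁ s₂, t ≤ s₁ → s₁ ≤ s₂ → s₂ < t + δ → IncrIn (F (γ t)) γ s₁ s₂)
    (hl : ∀ t, ∃ δ > 0, ∀ s₁ s₂, t - δ < s₁ → s₁ ≤ s₂ → s₂ ≤ t → IncrIn (F (γ t)) γ s₁ s₂) :
    IsTraj F γ := by
  intro t
  obtain ⟨δ, hδ, h⟩ := hr t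
  obtain ⟨δ', hδ', h'⟩ := hl t
  refine ⟨min δ δ', lt_min hδ hδ', fun s₁ s₂ h1 h2 h3 => ?_⟩
  have h4 := min_le_left δ δ'
  have h5 := min_le_right δ δ'
  rcases le_total t s₁ with a | a
  · exact h s₁ s₂ a h2 (by linarith)
  rcases le_total t s₂ with b | b
  · exact (h' s₁ t (by linarith) a le_rfl).trans (hconv _) a b (h t s₂ le_rfl b (by linarith))
  · exact h' s₁ s₂ (by linarith) h2 b

/-- Pointwise limits of trajectories are trajectories. -/
lemma isTraj_of_tendsto (hF : IsTameField F K) {ι : Type*} (l : Filter ι) [l.NeBot]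
    {γ : ι → ℝ → E} (hγ : ∀ i, IsTraj F (γ i)) {η : ℝ → E}
    (hlim : ∀ s, Tendsto (fun i => γ i s) l (𝓝 (η s))) : IsTraj F η := by
  intro t
  obtain ⟨r, hr, hball⟩ := Metric.eventually_nhds_iff.1 (hF.usc (η t))
  have hK := hF.K_nonneg
  refine ⟨r / (2 * (K + 1)), by positivity, fun s₁ s₂ h1 h2 h3 => ?_⟩
  have hcl : IsClosed ((fun w => (s₂ - s₁) • w) '' F (η t)) :=
    ((hF.compact (η t)).image (by fun_prop)).isClosed
  have hmem : η s₂ - η s₁ ∈ (fun w => (s₂ - s₁) • w) '' F (η t) := by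
    refine hcl.mem_of_tendsto ((hlim s₂).sub (hlim s₁)) ?_
    filter_upwards [(hlim t).eventually (Metric.ball_mem_nhds (η t) (half_pos hr))] with i hi
    have : IncrIn (F (η t)) (γ i) s₁ s₂ := by
      refine incrIn_of_local (hF.convex _) (hF.nonempty _) h2 fun u hu => ?_
      obtain ⟨δ, hδ, h⟩ := hγ i u
      refine ⟨δ, hδ, fun a b _ hab _ ha hb => (h a b ha hab hb).mono (hball ?_)⟩
      have hd := (hγ i).dist_le hF u t
      have : |t - u| ≤ r / (2 * (K + 1)) :=
        abs_le.2 ⟨by linarith [hu.2], by linarith [hu.1]⟩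
      have h6 : K * |t - u| < r / 2 := by
        calc K * |t - u| ≤ K * (r / (2 * (K + 1))) := by gcongr
          _ < (K + 1) * (r / (2 * (K + 1))) := by gcongr; linarith
          _ = r / 2 := by field_simp
      have h7 := dist_triangle (γ i u) (γ i t) (η t)
      have h8 : dist (γ i t) (η t) < r / 2 := hi
      linarith
    obtain ⟨w, hw, e⟩ := this
    exact ⟨w, hw, e.symm⟩
  obtain ⟨w, hw, e⟩ := hmem
  exact ⟨w, hw, e.symm⟩

/-- The explicit Euler scheme with step `h` for a selection `v` of the field. -/
def eulerSeq (v : E → E) (h : ℝ) (x : E) : ℕ → E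
  | 0 => x
  | n + 1 => eulerSeq v h x n + h • v (eulerSeq v h x n)

lemma eulerSeq_incr {v : E → E} {h : ℝ} {x : E} {C : Set E} (hC : Convex ℝ C) (hne : C.Nonempty)
    {k l : ℕ} (hkl : k ≤ l) (hv : ∀ n, k ≤ n → n < l → v (eulerSeq v h x n) ∈ C) :
    ∃ w ∈ C, eulerSeq v h x l - eulerSeq v h x k = (h * (l - k)) • w := by
  induction l, hkl using Nat.le_induction with
  | base => obtain ⟨w, hw⟩ := hne; exact ⟨w, hw, by simp⟩
  | succ l hkl ih =>
    obtain ⟨w, hw, e⟩ := ih fun n h1 h2 => hv n h1 (by omega)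
    have hv' := hv l hkl (by omega)
    have hp : (0 : ℝ) < (l : ℝ) + 1 - k := by
      have : (k : ℝ) ≤ l := by exact_mod_cast hkl
      linarith
    have hq : (0 : ℝ) ≤ (l : ℝ) - k := by
      have : (k : ℝ) ≤ l := by exact_mod_cast hkl
      linarith
    refine ⟨(((l : ℝ) - k) / (l + 1 - k)) • w + (1 / ((l : ℝ) + 1 - k)) • v (eulerSeq v h x l),
      hC hw hv' (by positivity) (by positivity) (by field_simp; ring), ?_⟩
    have : eulerSeq v h x (l + 1) - eulerSeq v h x k
        = (eulerSeq v h x l - eulerSeq v h x k) + h • v (eulerSeq v h x l) := by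
      simp only [eulerSeq]; abel
    rw [this, e, smul_add, smul_smul, smul_smul]
    push_cast
    congr 2 <;> field_simp

lemma IsTameField.neg (hF : IsTameField F K) : IsTameField (fun x => -F x) K where
  nonempty x := (hF.nonempty x).neg
  convex x := (hF.convex x).neg
  compact x := (hF.compact x).neg
  bound x w hw := by simpa using hF.bound x (-w) hw
  usc x := (hF.usc x).mono fun y hy => Set.neg_subset_neg.2 hy

variable [FiniteDimensional ℝ E]

/-- Forward solutions exist: they are pointwise limits of Euler polygons along an ultrafilter. -/
lemma exists_forward (hF : IsTameField F K) (x : E) : ∃ γ : ℝ → E, γ 0 = x ∧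
    ∀ t, 0 ≤ t → ∃ δ > 0, ∀ s₁ s₂, 0 ≤ s₁ → t - δ < s₁ → s₁ ≤ s₂ → s₂ < t + δ →
      IncrIn (F (γ t)) γ s₁ s₂ := by
  choose v hv using hF.nonempty
  have hK := hF.K_nonneg
  set X : ℕ → ℕ → E := fun n k => eulerSeq v (1 / (n + 1 : ℝ)) x k with hX
  have hdist : ∀ n k l, dist (X n k) (X n l) ≤ K * |(k : ℝ) - l| / (n + 1) := by
    intro n k l
    wlog hkl : k ≤ l generalizing k l
    · rw [dist_comm, abs_sub_comm]; exact this l k (le_of_not_ge hkl)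
    obtain ⟨w, hw, e⟩ := eulerSeq_incr (v := v) (h := 1 / (n + 1 : ℝ)) (x := x)
      (C := Metric.closedBall (0 : E) K) (convex_closedBall _ _) ⟨0, by simpa using hK⟩ hkl
      (fun m _ _ => by simpa using hF.bound _ _ (hv _))
    have hw' : ‖w‖ ≤ K := by simpa using hw
    have h1 : (k : ℝ) ≤ l := by exact_mod_cast hkl
    rw [dist_comm, dist_eq_norm, e, norm_smul, Real.norm_eq_abs, abs_mul,
      abs_of_nonneg (by positivity : (0 : ℝ) ≤ 1 / (n + 1)), abs_sub_comm (k : ℝ)]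
    calc 1 / ((n : ℝ) + 1) * |(l : ℝ) - k| * ‖w‖ ≤ 1 / ((n : ℝ) + 1) * |(l : ℝ) - k| * K := by
          gcongr
      _ = K * |(l : ℝ) - k| / (n + 1) := by ring
  -- the index of the last Euler step before time `t`
  set fl : ℕ → ℝ → ℕ := fun n t => ⌊t * (n + 1)⌋₊ with hfl
  have hfl1 : ∀ n t, 0 ≤ t → |(fl n t : ℝ) - t * (n + 1)| ≤ 1 := by
    intro n t ht
    have h1 := Nat.floor_le (by positivity : 0 ≤ t * ((n : ℝ) + 1))
    have h2 := Nat.lt_floor_add_one (t * ((n : ℝ) + 1))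
    rw [abs_le]; constructor <;> simp only [hfl] <;> linarith
  have hinv : Tendsto (fun n : ℕ => 1 / ((n : ℝ) + 1)) (hyperfilter ℕ : Filter ℕ) (𝓝 0) :=
    tendsto_one_div_add_atTop_nhds_zero_nat.mono_left Nat.hyperfilter_le_atTop
  have hlim : ∀ t, ∃ y, 0 ≤ t → Tendsto (fun n => X n (fl n t)) (hyperfilter ℕ : Filter ℕ)
      (𝓝 y) := by
    intro t
    by_cases ht : 0 ≤ t
    · have hb : ∀ n, X n (fl n t) ∈ Metric.closedBall x (K * (t + 1)) := by
        intro n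
        have h1 := hdist n (fl n t) 0
        have h2 := hfl1 n t ht
        have h3 : X n 0 = x := rfl
        rw [h3] at h1
        refine Metric.mem_closedBall.2 (h1.trans ?_)
        rw [mul_div_assoc]
        refine mul_le_mul_of_nonneg_left ?_ hK
        rw [div_le_iff₀ (by positivity)]
        rw [abs_le] at h2
        have h0 : (0 : ℝ) ≤ fl n t := by positivity
        have hn : (0 : ℝ) ≤ n := by positivity
        rw [Nat.cast_zero, sub_zero, abs_of_nonneg h0]
        nlinarith
      have hu : ((hyperfilter ℕ).map fun n => X n (fl n t) : Filter E)
          ≤ 𝓟 (Metric.closedBall x (K * (t + 1))) := by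
        rw [le_principal_iff]
        exact Filter.mem_map.2 (Filter.univ_mem' hb)
      obtain ⟨y, _, hy⟩ := (isCompact_closedBall x (K * (t + 1))).ultrafilter_le_nhds
        ((hyperfilter ℕ).map fun n => X n (fl n t)) hu
      exact ⟨y, fun _ => hy⟩
    · exact ⟨x, fun h => absurd h ht⟩
  choose γ hγ using hlim
  refine ⟨γ, ?_, fun t ht => ?_⟩
  · refine tendsto_nhds_unique (hγ 0 le_rfl) ?_
    have : ∀ n, X n (fl n 0) = x := by intro n; simp [hfl, hX, eulerSeq]
    simp only [this]
    exact tendsto_const_nhds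
  obtain ⟨r, hr, hball⟩ := Metric.eventually_nhds_iff.1 (hF.usc (γ t))
  refine ⟨r / (4 * (K + 1)), by positivity, fun s₁ s₂ h0 h1 h2 h3 => ?_⟩
  have hs₂ : 0 ≤ s₂ := h0.trans h2
  -- for most `n`, the Euler increment is a multiple of an element of `F (γ t)`
  have hev : ∀ᶠ n in (hyperfilter ℕ : Filter ℕ), ∃ w ∈ F (γ t), X n (fl n s₂) - X n (fl n s₁)
      = (1 / ((n : ℝ) + 1) * (fl n s₂ - fl n s₁)) • w := by
    filter_upwards [(hγ t ht).eventually (Metric.ball_mem_nhds (γ t) (half_pos hr)),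
      hinv.eventually (gt_mem_nhds (by positivity : (0 : ℝ) < r / (8 * (K + 1))))] with n hn hn'
    refine eulerSeq_incr (hF.convex _) (hF.nonempty _) (Nat.floor_mono (by gcongr))
      fun k hk1 hk2 => hball ?_ (hv _)
    have hd := hdist n k (fl n t)
    have e1 := abs_le.1 (hfl1 n s₁ h0)
    have e2 := abs_le.1 (hfl1 n s₂ hs₂)
    have e3 := abs_le.1 (hfl1 n t ht)
    have hk1' : (fl n s₁ : ℝ) ≤ k := by exact_mod_cast hk1
    have hk2' : (k : ℝ) ≤ fl n s₂ := by exact_mod_cast hk2.le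
    have hN : (0 : ℝ) < (n : ℝ) + 1 := by positivity
    set ρ := r / (4 * (K + 1)) with hρ
    have hm1 : (t - ρ) * ((n : ℝ) + 1) ≤ s₁ * (n + 1) := by gcongr
    have hm2 : s₂ * ((n : ℝ) + 1) ≤ (t + ρ) * (n + 1) := by gcongr
    have hab : |(k : ℝ) - fl n t| ≤ ρ * (n + 1) + 2 := by
      rw [abs_le]; constructor <;> linarith
    have h6 : K * |(k : ℝ) - fl n t| / (n + 1) < r / 2 := by
      calc K * |(k : ℝ) - fl n t| / (n + 1) ≤ K * (ρ * (n + 1) + 2) / (n + 1) := by gcongr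
        _ = K * (ρ + 2 * (1 / ((n : ℝ) + 1))) := by field_simp
        _ ≤ K * (ρ + 2 * (r / (8 * (K + 1)))) := by gcongr
        _ = K * (r / (2 * (K + 1))) := by rw [hρ]; field_simp; ring
        _ < (K + 1) * (r / (2 * (K + 1))) := by gcongr; linarith
        _ = r / 2 := by field_simp
    have h7 := dist_triangle (X n k) (X n (fl n t)) (γ t)
    have h8 : dist (X n (fl n t)) (γ t) < r / 2 := hn
    change dist (X n k) (γ t) < r
    linarith
  -- choose these elements for all `n`; by compactness they converge along the ultrafilter
  have hsel : ∀ n, ∃ w, w ∈ F (γ t) ∧ ((∃ w ∈ F (γ t), X n (fl n s₂) - X n (fl n s₁)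
      = (1 / ((n : ℝ) + 1) * (fl n s₂ - fl n s₁)) • w) → X n (fl n s₂) - X n (fl n s₁)
      = (1 / ((n : ℝ) + 1) * (fl n s₂ - fl n s₁)) • w) := by
    intro n
    by_cases h : ∃ w ∈ F (γ t), X n (fl n s₂) - X n (fl n s₁)
      = (1 / ((n : ℝ) + 1) * (fl n s₂ - fl n s₁)) • w
    · obtain ⟨w, hw, e⟩ := h
      exact ⟨w, hw, fun _ => e⟩
    · obtain ⟨w, hw⟩ := hF.nonempty (γ t)
      exact ⟨w, hw, fun h' => absurd h' h⟩
  choose w hw hwe using hsel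
  have hu : ((hyperfilter ℕ).map w : Filter E) ≤ 𝓟 (F (γ t)) := by
    rw [le_principal_iff]
    exact Filter.mem_map.2 (Filter.univ_mem' hw)
  obtain ⟨y, hy, hwy⟩ := (hF.compact (γ t)).ultrafilter_le_nhds ((hyperfilter ℕ).map w) hu
  have hwy' : Tendsto w (hyperfilter ℕ : Filter ℕ) (𝓝 y) := hwy
  have hflim : ∀ s, 0 ≤ s → Tendsto (fun n : ℕ => 1 / ((n : ℝ) + 1) * (fl n s : ℝ))
      (hyperfilter ℕ : Filter ℕ) (𝓝 s) := by
    intro s hs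
    rw [tendsto_iff_norm_sub_tendsto_zero]
    refine squeeze_zero (fun _ => norm_nonneg _) (fun n => ?_) hinv
    have h1 := hfl1 n s hs
    have : 1 / ((n : ℝ) + 1) * (fl n s : ℝ) - s = 1 / ((n : ℝ) + 1) * (fl n s - s * (n + 1)) := by
      field_simp
    rw [this, norm_mul, Real.norm_eq_abs, Real.norm_eq_abs, abs_of_nonneg (by positivity)]
    exact mul_le_of_le_one_right (by positivity) h1
  refine ⟨y, hy, tendsto_nhds_unique ((hγ s₂ hs₂).sub (hγ s₁ h0)) ?_⟩
  refine Tendsto.congr' ?_ (((hflim s₂ hs₂).sub (hflim s₁ h0)).smul hwy')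
  filter_upwards [hev] with n hn
  rw [hwe n hn, mul_sub]

/-- Solutions on the whole line exist through every point. -/
theorem exists_isTraj (hF : IsTameField F K) (x : E) : ∃ γ : ℝ → E, γ 0 = x ∧ IsTraj F γ := by
  obtain ⟨γ, hγ0, hγ⟩ := exists_forward hF x
  obtain ⟨η, hη0, hη⟩ := exists_forward hF.neg x
  have hp : ∀ t, 0 ≤ t → (if 0 ≤ t then γ t else η (-t)) = γ t := fun t ht => if_pos ht
  have hn : ∀ t, t ≤ 0 → (if 0 ≤ t then γ t else η (-t)) = η (-t) := by
    intro t ht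
    rcases ht.eq_or_lt with rfl | ht
    · simp [hγ0, hη0]
    · exact if_neg (not_le.2 ht)
  refine ⟨fun t => if 0 ≤ t then γ t else η (-t), by simpa using hγ0,
    isTraj_of_sides hF.convex (fun t => ?_) (fun t => ?_)⟩
  · rcases le_or_gt 0 t with ht | ht
    · obtain ⟨δ, hδ, h⟩ := hγ t ht
      refine ⟨δ, hδ, fun s₁ s₂ h1 h2 h3 => ?_⟩
      have := h s₁ s₂ (by linarith) (by linarith) h2 h3
      simp only [IncrIn, hp t ht, hp s₁ (by linarith), hp s₂ (by linarith)]
      exact this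
    · obtain ⟨δ, hδ, h⟩ := hη (-t) (by linarith)
      refine ⟨min δ (-t), lt_min hδ (by linarith), fun s₁ s₂ h1 h2 h3 => ?_⟩
      have h4 := min_le_left δ (-t)
      have h5 := min_le_right δ (-t)
      obtain ⟨w, hw, e⟩ := h (-s₂) (-s₁) (by linarith) (by linarith) (by linarith) (by linarith)
      simp only [IncrIn, hn t ht.le, hn s₁ (by linarith), hn s₂ (by linarith)]
      refine ⟨-w, hw, ?_⟩
      rw [smul_neg, ← neg_sub (η (-s₁)), e]
      congr 2; ring
  · rcases le_or_gt t 0 with ht | ht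
    · obtain ⟨δ, hδ, h⟩ := hη (-t) (by linarith)
      refine ⟨δ, hδ, fun s₁ s₂ h1 h2 h3 => ?_⟩
      obtain ⟨w, hw, e⟩ := h (-s₂) (-s₁) (by linarith) (by linarith) (by linarith) (by linarith)
      simp only [IncrIn, hn t ht, hn s₁ (by linarith), hn s₂ (by linarith)]
      refine ⟨-w, hw, ?_⟩
      rw [smul_neg, ← neg_sub (η (-s₁)), e]
      congr 2; ring
    · obtain ⟨δ, hδ, h⟩ := hγ t ht.le
      refine ⟨min δ t, lt_min hδ ht, fun s₁ s₂ h1 h2 h3 => ?_⟩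
      have h4 := min_le_left δ t
      have h5 := min_le_right δ t
      have := h s₁ s₂ (by linarith) (by linarith) h2 (by linarith)
      simp only [IncrIn, hp t ht.le, hp s₁ (by linarith), hp s₂ (by linarith)]
      exact this

end Inclusion

section Flow

variable {E : Type*} [NormedAddCommGroup E] [NormedSpace ℝ E]

/-- `φ` is a continuous flow on `X` whose orbits are the unique solutions of the inclusion. -/
structure IsUniqueFlow (F : E → Set E) (X : Set E) (φ : ℝ → E → E) : Prop where
  zero : ∀ x, φ 0 x = x
  traj : ∀ x, IsTraj F (fun t => φ t x)
  mem : ∀ x ∈ X, ∀ t, φ t x ∈ X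
  unique : ∀ γ, IsTraj F γ → γ 0 ∈ X → ∀ t, γ t = φ t (γ 0)
  cont : ContinuousOn (fun z : ℝ × E => φ z.1 z.2) (univ ×ˢ X)

variable {F : E → Set E} {K : ℝ} {X : Set E}

/-- Local uniqueness of solutions implies global uniqueness. -/
lemma IsTraj.eq_of_local (hF : IsTameField F K)
    (hinv : ∀ γ, IsTraj F γ → γ 0 ∈ X → ∀ t, γ t ∈ X)
    (hloc : ∀ γ η, IsTraj F γ → IsTraj F η → γ 0 = η 0 → γ 0 ∈ X → ∀ᶠ t in 𝓝 0, γ t = η t)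
    {γ η : ℝ → E} (hγ : IsTraj F γ) (hη : IsTraj F η) (h0 : γ 0 = η 0) (hX : γ 0 ∈ X) :
    γ = η := by
  have hcl : IsClosed {t | γ t = η t} := isClosed_eq (hγ.continuous hF) (hη.continuous hF)
  have hop : IsOpen {t | γ t = η t} := by
    rw [isOpen_iff_mem_nhds]
    intro t ht
    have ht' : γ t = η t := ht
    have h1 := hloc _ _ (hγ.shift t) (hη.shift t) (by simpa using ht')
      (by simpa using hinv γ hγ hX t)
    have h2 : Tendsto (fun s => s - t) (𝓝 t) (𝓝 0) := by
      have : Continuous fun s : ℝ => s - t := by fun_prop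
      simpa using this.tendsto t
    filter_upwards [h2.eventually h1] with s hs
    simpa using hs
  have := IsClopen.eq_univ ⟨hcl, hop⟩ ⟨0, h0⟩
  funext t
  exact this.symm.subset (mem_univ t)

/-- A field with unique solutions through the points of an invariant set generates a continuous
flow there: limits of solutions are solutions, so uniqueness implies continuous dependence. -/
theorem exists_isUniqueFlow [FiniteDimensional ℝ E] (hF : IsTameField F K)
    (hinv : ∀ γ, IsTraj F γ → γ 0 ∈ X → ∀ t, γ t ∈ X)
    (hloc : ∀ γ η, IsTraj F γ → IsTraj F η → γ 0 = η 0 → γ 0 ∈ X → ∀ᶠ t in 𝓝 0, γ t = η t) :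
    ∃ φ, IsUniqueFlow F X φ := by
  choose Φ hΦ0 hΦ using fun x => exists_isTraj hF x
  have huniq : ∀ γ, IsTraj F γ → γ 0 ∈ X → ∀ t, γ t = Φ (γ 0) t := fun γ hγ h0 t =>
    congrFun (IsTraj.eq_of_local hF hinv hloc hγ (hΦ (γ 0)) (hΦ0 _).symm h0) t
  refine ⟨fun t x => Φ x t, hΦ0, hΦ, fun x hx => hinv _ (hΦ x) (by rwa [hΦ0]), huniq, ?_⟩
  rintro ⟨t, x⟩ ⟨-, hx⟩
  rw [ContinuousWithinAt, tendsto_iff_ultrafilter]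
  intro u hu
  have hu1 : Tendsto (fun z : ℝ × E => z.1) u (𝓝 t) :=
    (continuous_fst.tendsto (t, x)).mono_left (hu.trans nhdsWithin_le_nhds)
  have hu2 : Tendsto (fun z : ℝ × E => z.2) u (𝓝 x) :=
    (continuous_snd.tendsto (t, x)).mono_left (hu.trans nhdsWithin_le_nhds)
  have hlim : ∀ s, ∃ y, Tendsto (fun z : ℝ × E => Φ z.2 s) u (𝓝 y) := by
    intro s
    have hmem : ∀ᶠ z in (u : Filter (ℝ × E)), Φ z.2 s ∈ Metric.closedBall x (1 + K * |s|) := by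
      filter_upwards [hu2.eventually (Metric.ball_mem_nhds x one_pos)] with z hz
      have h1 := (hΦ z.2).dist_le hF s 0
      rw [hΦ0, zero_sub, abs_neg] at h1
      have h2 : dist z.2 x < 1 := hz
      exact Metric.mem_closedBall.2 ((dist_triangle _ z.2 _).trans (by linarith))
    have hle : (u.map (fun z : ℝ × E => Φ z.2 s) : Filter E)
        ≤ 𝓟 (Metric.closedBall x (1 + K * |s|)) :=
      le_principal_iff.2 (Filter.mem_map.2 hmem)
    obtain ⟨y, _, hy⟩ := (isCompact_closedBall x (1 + K * |s|)).ultrafilter_le_nhds _ hle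
    exact ⟨y, hy⟩
  choose η hη using hlim
  have hηt : IsTraj F η := isTraj_of_tendsto hF (u : Filter (ℝ × E)) (fun z => hΦ z.2) hη
  have hη0 : η 0 = x := by
    refine tendsto_nhds_unique (hη 0) ?_
    simpa only [hΦ0] using hu2
  have hηeq : η t = Φ x t := by rw [huniq η hηt (by rwa [hη0]) t, hη0]
  change Tendsto (fun z : ℝ × E => Φ z.2 z.1) u (𝓝 (Φ x t))
  rw [← hηeq]
  refine (hη t).congr_dist ?_
  have hz : Tendsto (fun z : ℝ × E => K * |z.1 - t|) u (𝓝 0) := by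
    have : Tendsto (fun z : ℝ × E => K * |z.1 - t|) u (𝓝 (K * |t - t|)) :=
      ((hu1.sub_const t).abs).const_mul K
    simpa using this
  exact squeeze_zero (fun _ => dist_nonneg) (fun z => (hΦ z.2).dist_le hF t z.1) hz

variable {φ : ℝ → E → E}

lemma IsUniqueFlow.add (hφ : IsUniqueFlow F X φ) {x : E} (hx : x ∈ X) (s t : ℝ) :
    φ (s + t) x = φ s (φ t x) := by
  have := hφ.unique _ ((hφ.traj x).shift t) (by simpa using hφ.mem x hx t) s
  simpa using this

/-- Orbits follow straight lines as long as these satisfy the inclusion. -/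
lemma IsUniqueFlow.straight (hφ : IsUniqueFlow F X φ) (hF : IsTameField F K) {x w : E} {t : ℝ}
    (hx : x ∈ X) (hw : ∀ s, 0 ≤ s → s ≤ t → w ∈ F (x + s • w)) {s : ℝ} (hs : 0 ≤ s)
    (hst : s ≤ t) : φ s x = x + s • w := by
  rcases (hs.trans hst).eq_or_lt with rfl | ht
  · have : s = 0 := le_antisymm hst hs
    subst this
    simp [hφ.zero]
  set γ : ℝ → E := fun s => if s ≤ 0 then φ s x else if s ≤ t then x + s • w
    else φ (s - t) (x + t • w) with hγ
  have h1 : ∀ s, s ≤ 0 → γ s = φ s x := fun s hs => if_pos hs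
  have h2 : ∀ s, 0 ≤ s → s ≤ t → γ s = x + s • w := by
    intro s hs hst
    rcases hs.eq_or_lt with rfl | hs
    · rw [h1 0 le_rfl, hφ.zero]; simp
    · simp only [hγ, if_neg (not_le.2 hs), if_pos hst]
  have h3 : ∀ s, t ≤ s → γ s = φ (s - t) (x + t • w) := by
    intro s hs
    rcases hs.eq_or_lt with rfl | hs
    · rw [h2 t ht.le le_rfl, sub_self, hφ.zero]
    · simp only [hγ, if_neg (not_le.2 (ht.trans hs)), if_neg (not_le.2 hs)]
  have hA := hφ.traj x
  have hB := (hφ.traj (x + t • w)).shift (-t)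
  simp only [← sub_eq_add_neg] at hB
  have hline : ∀ u, 0 ≤ u → u ≤ t → ∀ s₁ s₂, 0 ≤ s₁ → s₁ ≤ s₂ → s₂ ≤ t →
      IncrIn (F (γ u)) γ s₁ s₂ := by
    intro u hu hut s₁ s₂ a b c
    refine ⟨w, by rw [h2 u hu hut]; exact hw u hu hut, ?_⟩
    rw [h2 s₁ a (by linarith), h2 s₂ (by linarith) c, sub_smul]
    abel
  have htraj : IsTraj F γ := by
    refine isTraj_of_sides hF.convex (fun u => ?_) (fun u => ?_)
    · rcases lt_or_ge u 0 with hu | hu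
      · obtain ⟨δ, hδ, h⟩ := hA u
        refine ⟨min δ (-u), lt_min hδ (by linarith), fun s₁ s₂ a b c => ?_⟩
        have h4 := min_le_left δ (-u)
        have h5 := min_le_right δ (-u)
        simp only [IncrIn, h1 u hu.le, h1 s₁ (by linarith), h1 s₂ (by linarith)]
        exact h s₁ s₂ (by linarith) b (by linarith)
      · rcases lt_or_ge u t with hut | hut
        · exact ⟨t - u, by linarith, fun s₁ s₂ a b c => hline u hu hut.le s₁ s₂ (by linarith) b
            (by linarith)⟩
        · obtain ⟨δ, hδ, h⟩ := hB u
          refine ⟨δ, hδ, fun s₁ s₂ a b c => ?_⟩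
          simp only [IncrIn, h3 u hut, h3 s₁ (by linarith), h3 s₂ (by linarith)]
          exact h s₁ s₂ (by linarith) b (by linarith)
    · rcases le_or_gt u 0 with hu | hu
      · obtain ⟨δ, hδ, h⟩ := hA u
        refine ⟨δ, hδ, fun s₁ s₂ a b c => ?_⟩
        simp only [IncrIn, h1 u hu, h1 s₁ (by linarith), h1 s₂ (by linarith)]
        exact h s₁ s₂ (by linarith) b (by linarith)
      · rcases le_or_gt u t with hut | hut
        · exact ⟨u, hu, fun s₁ s₂ a b c => hline u hu.le hut s₁ s₂ (by linarith) b
            (by linarith)⟩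
        · obtain ⟨δ, hδ, h⟩ := hB u
          refine ⟨min δ (u - t), lt_min hδ (by linarith), fun s₁ s₂ a b c => ?_⟩
          have h4 := min_le_left δ (u - t)
          have h5 := min_le_right δ (u - t)
          simp only [IncrIn, h3 u hut.le, h3 s₁ (by linarith), h3 s₂ (by linarith)]
          exact h s₁ s₂ (by linarith) b (by linarith)
  have h0 : γ 0 = x := by rw [h1 0 le_rfl, hφ.zero]
  have := hφ.unique γ htraj (by rwa [h0]) s
  rw [h0] at this
  rw [← this, h2 s hs hst]

/-- If near `a` the mean velocities on `(a, b)` can only be `w`, a solution is a straight line on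
`[a, b]`. -/
lemma eq_line_of_local_const {γ : ℝ → E} (hγ : Continuous γ) {a b : ℝ} {w : E}
    (h : ∀ t, a < t → t < b → ∃ δ > 0, ∀ s₁ s₂, t - δ < s₁ → s₁ ≤ s₂ → s₂ < t + δ →
      γ s₂ - γ s₁ = (s₂ - s₁) • w) {t : ℝ} (hat : a ≤ t) (htb : t ≤ b) :
    γ t = γ a + (t - a) • w := by
  have hmain : ∀ s₁ s₂, a < s₁ → s₁ ≤ s₂ → s₂ < b → γ s₂ - γ s₁ = (s₂ - s₁) • w := by
    intro s₁ s₂ h1 h2 h3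
    have : IncrIn {w} γ s₁ s₂ := incrIn_of_local (convex_singleton w) ⟨w, rfl⟩ h2 fun u hu => by
      obtain ⟨δ, hδ, h⟩ := h u (by linarith [hu.1]) (by linarith [hu.2])
      exact ⟨δ, hδ, fun p q _ hpq _ hp hq => ⟨w, rfl, h p q hp hpq hq⟩⟩
    obtain ⟨_, rfl, e⟩ := this
    exact e
  rcases hat.eq_or_lt with rfl | hat
  · simp
  -- the identity extends from the open to the closed interval by continuity
  set f : ℝ → E := fun s => γ s - s • w with hf
  have hfc : Continuous f := by fun_prop
  have hab : a < b := hat.trans_le htb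
  obtain ⟨c, hc1, hc2⟩ := exists_between hab
  have hconst : ∀ s ∈ Ioo a b, f s = f c := by
    intro s hs
    rcases le_total s c with hsc | hsc
    · have := hmain s c hs.1 hsc hc2
      simp only [hf]
      rw [sub_smul, sub_eq_iff_eq_add] at this
      rw [this]; abel
    · have := hmain c s hc1 hsc hs.2
      simp only [hf]
      rw [sub_smul, sub_eq_iff_eq_add] at this
      rw [this]; abel
  have hcl : Icc a b ⊆ {s | f s = f c} := by
    rw [← closure_Ioo hab.ne]
    exact closure_minimal hconst (isClosed_eq hfc continuous_const)
  have e1 : f a = f c := hcl ⟨le_rfl, hab.le⟩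
  have e2 : f t = f c := hcl ⟨hat.le, htb⟩
  have e3 : γ t - t • w = γ a - a • w := e2.trans e1.symm
  rw [sub_smul, eq_add_of_sub_eq e3]
  abel

/-- Solutions in the sense of `IsTraj` are Carathéodory solutions. -/
lemma IsTraj.caratheodory [FiniteDimensional ℝ E] (hF : IsTameField F K) {γ : ℝ → E}
    (hγ : IsTraj F γ) : (∀ a b : ℝ, AbsolutelyContinuousOnInterval γ a b) ∧
      ∀ᵐ t : ℝ, ∃ w ∈ F (γ t), HasDerivAt γ w t := by
  refine ⟨fun a b => ((hγ.lipschitz hF).lipschitzOnWith).absolutelyContinuousOnInterval, ?_⟩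
  filter_upwards [(hγ.lipschitz hF).ae_differentiableAt_real] with t ht
  refine ⟨deriv γ t, ?_, ht.hasDerivAt⟩
  obtain ⟨δ, hδ, h⟩ := hγ t
  refine (hF.compact (γ t)).isClosed.mem_of_tendsto ht.hasDerivAt.tendsto_slope ?_
  have hnear : ∀ᶠ s in 𝓝[≠] t, s ∈ Ioo (t - δ) (t + δ) :=
    nhdsWithin_le_nhds (Ioo_mem_nhds (by linarith) (by linarith))
  filter_upwards [hnear, self_mem_nhdsWithin] with s hs hne
  have hne' : s - t ≠ 0 := sub_ne_zero.2 hne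
  rw [slope_def_module]
  rcases le_total t s with hts | hts
  · obtain ⟨w, hw, e⟩ := h t s (by linarith) hts hs.2
    rwa [e, smul_smul, inv_mul_cancel₀ hne', one_smul]
  · obtain ⟨w, hw, e⟩ := h s t hs.1 hts (by linarith)
    have e' : γ s - γ t = (s - t) • w := by
      rw [← neg_sub, e, ← neg_smul, neg_sub]
    rwa [e', smul_smul, inv_mul_cancel₀ hne', one_smul]

lemma absolutelyContinuous_clm_comp {γ : ℝ → E} {a b : ℝ}
    (h : AbsolutelyContinuousOnInterval γ a b) (f : E →L[ℝ] ℝ) :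
    AbsolutelyContinuousOnInterval (fun t => f (γ t)) a b := by
  unfold AbsolutelyContinuousOnInterval at *
  refine squeeze_zero (fun _ => Finset.sum_nonneg fun _ _ => dist_nonneg) (fun p => ?_)
    (by simpa using h.const_mul ‖f‖)
  rw [Finset.mul_sum]
  refine Finset.sum_le_sum fun i _ => ?_
  rw [dist_eq_norm, dist_eq_norm, ← map_sub]
  exact f.le_opNorm _

/-- Carathéodory solutions are solutions in the sense of `IsTraj`. -/
lemma isTraj_of_caratheodory (hF : IsTameField F K) {γ : ℝ → E}
    (hac : ∀ a b : ℝ, AbsolutelyContinuousOnInterval γ a b)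
    (hae : ∀ᵐ t : ℝ, ∃ w ∈ F (γ t), HasDerivAt γ w t) : IsTraj F γ := by
  have hc : Continuous γ := continuous_iff_continuousAt.2 fun t =>
    (hac (t - 1) (t + 1)).continuousOn.continuousAt
      (by rw [uIcc_of_le (by linarith)]; exact Icc_mem_nhds (by linarith) (by linarith))
  intro t
  obtain ⟨δ, hδ, hball⟩ := Metric.eventually_nhds_iff.1
    ((hc.tendsto t).eventually (hF.usc (γ t)))
  refine ⟨δ, hδ, fun s₁ s₂ h1 h2 h3 => ?_⟩
  rcases h2.eq_or_lt with rfl | h2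
  · exact incrIn_self (hF.nonempty _) γ s₁
  have hpos : 0 < s₂ - s₁ := by linarith
  set p : E := (s₂ - s₁)⁻¹ • (γ s₂ - γ s₁) with hp
  by_cases hpC : p ∈ F (γ t)
  · exact ⟨p, hpC, by rw [hp, smul_smul, mul_inv_cancel₀ hpos.ne', one_smul]⟩
  exfalso
  obtain ⟨f, u, hfu, hup⟩ := geometric_hahn_banach_closed_point (hF.convex (γ t))
    (hF.compact (γ t)).isClosed hpC
  have hfac := absolutelyContinuous_clm_comp (hac s₁ s₂) f
  have hint := hfac.integral_deriv_eq_sub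
  have hle : ∫ x in s₁..s₂, deriv (fun t => f (γ t)) x ≤ ∫ _x in s₁..s₂, u := by
    refine intervalIntegral.integral_mono_ae_restrict h2.le hfac.intervalIntegrable_deriv
      intervalIntegrable_const ?_
    filter_upwards [ae_restrict_of_ae hae, ae_restrict_mem measurableSet_Icc] with s hs hs'
    obtain ⟨w, hw, hd⟩ := hs
    have hs2 : dist s t < δ := by
      rw [Real.dist_eq, abs_lt]; constructor <;> linarith [hs'.1, hs'.2]
    have hd' : HasDerivAt (fun t => f (γ t)) (f w) s := f.hasFDerivAt.comp_hasDerivAt s hd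
    rw [hd'.deriv]
    exact (hfu w (hball hs2 hw)).le
  rw [hint, intervalIntegral.integral_const, smul_eq_mul, ← map_sub] at hle
  have : f p = (s₂ - s₁)⁻¹ * f (γ s₂ - γ s₁) := by rw [hp, map_smul, smul_eq_mul]
  rw [this] at hup
  have h4 : (s₂ - s₁)⁻¹ * f (γ s₂ - γ s₁) ≤ u := by
    rw [inv_mul_le_iff₀ hpos]; exact hle
  linarith

end Flow

/-! ### The game of a matrix near `matB β` -/

/-- The sum of the entries of the adjugate matrix. -/
def adjSum (M : Matrix (Fin 3) (Fin 3) ℝ) : ℝ := ∑ i, ∑ j, M.adjugate i j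

/-- The equilibrium strategy of the row player: the row vector of sum one that is equalised by `M`,
normalised from the adjugate so that it is visibly continuous in `M`. -/
def pStar (M : Matrix (Fin 3) (Fin 3) ℝ) (j : Fin 3) : ℝ := (∑ i, M.adjugate i j) / adjSum M

/-- The equilibrium strategy of the column player. -/
def qStar (M : Matrix (Fin 3) (Fin 3) ℝ) (i : Fin 3) : ℝ := (∑ j, M.adjugate i j) / adjSum M

/-- The value of the game. -/
def val (M : Matrix (Fin 3) (Fin 3) ℝ) : ℝ := M.det / adjSum M

/-- The qualitative hypotheses on the matrix: the equilibrium is completely mixed, and the entries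
are ordered like those of `matB β` with `0 < β < 1`, by the class of `i - j` modulo `3`. -/
structure IsCyclic (M : Matrix (Fin 3) (Fin 3) ℝ) : Prop where
  order : ∀ i j k l : Fin 3, i - j < k - l → M k l < M i j
  det_ne : M.det ≠ 0
  p_pos : ∀ i, 0 < pStar M i
  q_pos : ∀ i, 0 < qStar M i

variable {M : Matrix (Fin 3) (Fin 3) ℝ}

namespace IsCyclic

lemma adjSum_ne (hM : IsCyclic M) : adjSum M ≠ 0 := by
  intro h
  have := hM.p_pos 0
  simp [pStar, h] at this

lemma p_sum (hM : IsCyclic M) : ∑ i, pStar M i = 1 := by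
  simp only [pStar, ← Finset.sum_div]
  rw [Finset.sum_comm]
  exact div_self hM.adjSum_ne

lemma q_sum (hM : IsCyclic M) : ∑ i, qStar M i = 1 := by
  simp only [qStar, ← Finset.sum_div]
  exact div_self hM.adjSum_ne

lemma mulVec_q (_ : IsCyclic M) (i : Fin 3) : ∑ j, M i j * qStar M j = val M := by
  have h := M.mul_adjugate
  have h1 : ∀ k, ∑ j, M i j * M.adjugate j k = if i = k then M.det else 0 := by
    intro k
    have := congrFun (congrFun h i) k
    simpa [Matrix.mul_apply, Matrix.one_apply] using this
  simp only [qStar, val, mul_div_assoc', ← Finset.sum_div, Finset.mul_sum]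
  rw [Finset.sum_comm]
  simp [h1]

lemma vecMul_p (_ : IsCyclic M) (j : Fin 3) : ∑ i, pStar M i * M i j = val M := by
  have h := M.adjugate_mul
  have h1 : ∀ k, ∑ i, M.adjugate k i * M i j = if k = j then M.det else 0 := by
    intro k
    have := congrFun (congrFun h k) j
    simpa [Matrix.mul_apply, Matrix.one_apply] using this
  simp only [pStar, val, div_mul_eq_mul_div, ← Finset.sum_div, Finset.sum_mul]
  rw [Finset.sum_comm]
  simp [h1]

end IsCyclic

/-- The payoff `(M q)ᵢ` of row `i`, as a linear functional on phase space. -/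
def pay (M : Matrix (Fin 3) (Fin 3) ℝ) (i : Fin 3) : Phase →ₗ[ℝ] ℝ :=
  ∑ j, M i j • (LinearMap.proj j ∘ₗ LinearMap.snd ℝ (Fin 3 → ℝ) (Fin 3 → ℝ))

/-- The cost `(p' M)ⱼ` of column `j`, as a linear functional on phase space. -/
def cost (M : Matrix (Fin 3) (Fin 3) ℝ) (j : Fin 3) : Phase →ₗ[ℝ] ℝ :=
  ∑ i, M i j • (LinearMap.proj i ∘ₗ LinearMap.fst ℝ (Fin 3 → ℝ) (Fin 3 → ℝ))

lemma pay_apply (i : Fin 3) (x : Phase) : pay M i x = ∑ j, M i j * x.2 j := by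
  simp [pay]

lemma cost_apply (j : Fin 3) (x : Phase) : cost M j x = ∑ i, M i j * x.1 i := by
  simp [cost]

lemma pay_eq (i : Fin 3) (x : Phase) : Matrix.mulVec M x.2 i = pay M i x := by
  rw [pay_apply]; rfl

lemma cost_eq (j : Fin 3) (x : Phase) : Matrix.vecMul x.1 M j = cost M j x := by
  rw [cost_apply]; simp [Matrix.vecMul, dotProduct, mul_comm]

@[fun_prop]
lemma continuous_pay (i : Fin 3) : Continuous (pay M i) :=
  LinearMap.continuous_of_finiteDimensional _

@[fun_prop]
lemma continuous_cost (j : Fin 3) : Continuous (cost M j) :=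
  LinearMap.continuous_of_finiteDimensional _

lemma ham_eq (x : Phase) : ham M x = (⨆ i, pay M i x) - ⨅ j, cost M j x := by
  simp only [ham, pay_eq, cost_eq]

lemma pay_le_iSup (x : Phase) (i : Fin 3) : pay M i x ≤ ⨆ i, pay M i x :=
  le_ciSup (f := fun i => pay M i x) (finite_range _).bddAbove i

lemma iInf_le_cost (x : Phase) (j : Fin 3) : ⨅ j, cost M j x ≤ cost M j x :=
  ciInf_le (f := fun j => cost M j x) (finite_range _).bddBelow j

lemma iSup_pay_eq {x : Phase} {i : Fin 3} (h : ∀ k, pay M k x ≤ pay M i x) :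
    ⨆ i, pay M i x = pay M i x :=
  le_antisymm (ciSup_le h) (pay_le_iSup x i)

lemma iInf_cost_eq {x : Phase} {j : Fin 3} (h : ∀ l, cost M j x ≤ cost M l x) :
    ⨅ j, cost M j x = cost M j x :=
  le_antisymm (iInf_le_cost x j) (le_ciInf h)

lemma mem_bestRespP_iff {a : Fin 3 → ℝ} {x : Phase} : a ∈ bestRespP M x.2 ↔
    a ∈ stdSimplex ℝ (Fin 3) ∧ ∀ i, a i ≠ 0 → ∀ k, pay M k x ≤ pay M i x := by
  simp only [bestRespP, dotProduct, pay_eq]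
  constructor
  · rintro ⟨ha, h⟩
    refine ⟨ha, fun i hi k => ?_⟩
    by_contra! hlt
    have hai : 0 < a i := lt_of_le_of_ne (ha.1 i) (Ne.symm hi)
    -- moving the weight of `i` to the better reply `k` raises the payoff
    have hne : i ≠ k := by rintro rfl; exact lt_irrefl _ hlt
    have h1 := h (a + a i • (Pi.single k 1 - Pi.single i 1)) ⟨fun l => by
        have := ha.1 l
        by_cases hlk : l = k <;> by_cases hli : l = i <;> simp_all
        positivity, by
        simp [Finset.sum_add_distrib, ← Finset.mul_sum, ha.2]⟩
    simp only [Pi.add_apply, Pi.smul_apply, Pi.sub_apply, smul_eq_mul, add_mul, sub_mul,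
      mul_sub, Finset.sum_add_distrib, Finset.sum_sub_distrib, Pi.single_apply] at h1
    simp only [mul_ite, mul_one, mul_zero, ite_mul, zero_mul, Finset.sum_ite_eq',
      Finset.mem_univ, if_true] at h1
    nlinarith
  · rintro ⟨ha, h⟩
    refine ⟨ha, fun a' ha' => ?_⟩
    obtain ⟨i, hi⟩ : ∃ i, a i ≠ 0 := by
      by_contra! h0
      have := ha.2
      simp [h0] at this
    calc ∑ l, a' l * pay M l x ≤ ∑ l, a' l * pay M i x :=
          Finset.sum_le_sum fun l _ => mul_le_mul_of_nonneg_left (h i hi l) (ha'.1 l)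
      _ = ∑ l, a l * pay M i x := by rw [← Finset.sum_mul, ← Finset.sum_mul, ha.2, ha'.2]
      _ = ∑ l, a l * pay M l x := by
          refine Finset.sum_congr rfl fun l _ => ?_
          by_cases hl : a l = 0
          · simp [hl]
          · rw [le_antisymm (h l hl i) (h i hi l)]

lemma mem_bestRespQ_iff {b : Fin 3 → ℝ} {x : Phase} : b ∈ bestRespQ M x.1 ↔
    b ∈ stdSimplex ℝ (Fin 3) ∧ ∀ j, b j ≠ 0 → ∀ l, cost M j x ≤ cost M l x := by
  simp only [bestRespQ, Matrix.dotProduct_mulVec]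
  simp only [dotProduct, cost_eq]
  constructor
  · rintro ⟨ha, h⟩
    refine ⟨ha, fun i hi k => ?_⟩
    by_contra! hlt
    have hai : 0 < b i := lt_of_le_of_ne (ha.1 i) (Ne.symm hi)
    have hne : i ≠ k := by rintro rfl; exact lt_irrefl _ hlt
    have h1 := h (b + b i • (Pi.single k 1 - Pi.single i 1)) ⟨fun l => by
        have := ha.1 l
        by_cases hlk : l = k <;> by_cases hli : l = i <;> simp_all
        positivity, by
        simp [Finset.sum_add_distrib, ← Finset.mul_sum, ha.2]⟩
    simp only [Pi.add_apply, Pi.smul_apply, Pi.sub_apply, smul_eq_mul, mul_add, mul_sub,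
      Finset.sum_add_distrib, Finset.sum_sub_distrib, Pi.single_apply] at h1
    simp only [mul_ite, mul_one, mul_zero, Finset.sum_ite_eq',
      Finset.mem_univ, if_true] at h1
    nlinarith
  · rintro ⟨ha, h⟩
    refine ⟨ha, fun a' ha' => ?_⟩
    obtain ⟨i, hi⟩ : ∃ i, b i ≠ 0 := by
      by_contra! h0
      have := ha.2
      simp [h0] at this
    calc ∑ l, cost M l x * b l = ∑ l, cost M i x * b l := by
          refine Finset.sum_congr rfl fun l _ => ?_
          by_cases hl : b l = 0
          · simp [hl]
          · rw [le_antisymm (h l hl i) (h i hi l)]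
      _ = ∑ l, cost M i x * a' l := by rw [← Finset.mul_sum, ← Finset.mul_sum, ha.2, ha'.2]
      _ ≤ ∑ l, cost M l x * a' l :=
          Finset.sum_le_sum fun l _ => mul_le_mul_of_nonneg_right (h i hi l) (ha'.1 l)

/-- If `v` has sum zero and `v' M` is constant, then `v = 0`. -/
lemma IsCyclic.eq_zero_of_vecMul (hM : IsCyclic M) {v : Fin 3 → ℝ} (hv : ∑ i, v i = 0) {t : ℝ}
    (h : ∀ j, ∑ i, v i * M i j = t) : v = 0 := by
  have h1 : t = 0 := by
    have e : ∑ j, (∑ i, v i * M i j) * qStar M j = t := by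
      simp only [h, ← Finset.mul_sum, hM.q_sum, mul_one]
    have e' : ∑ j, (∑ i, v i * M i j) * qStar M j = 0 := by
      simp only [Finset.sum_mul, mul_assoc]
      rw [Finset.sum_comm]
      simp only [← Finset.mul_sum, hM.mulVec_q, ← Finset.sum_mul, hv, zero_mul]
    exact e.symm.trans e'
  refine Matrix.eq_zero_of_vecMul_eq_zero hM.det_ne ?_
  funext j
  simpa [Matrix.vecMul, dotProduct, h1] using h j

lemma IsCyclic.eq_zero_of_mulVec (hM : IsCyclic M) {v : Fin 3 → ℝ} (hv : ∑ i, v i = 0) {t : ℝ}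
    (h : ∀ i, ∑ j, M i j * v j = t) : v = 0 := by
  have h1 : t = 0 := by
    have e : ∑ i, pStar M i * (∑ j, M i j * v j) = t := by
      simp only [h, ← Finset.sum_mul, hM.p_sum, one_mul]
    have e' : ∑ i, pStar M i * (∑ j, M i j * v j) = 0 := by
      simp only [Finset.mul_sum, ← mul_assoc]
      rw [Finset.sum_comm]
      simp only [← Finset.sum_mul, hM.vecMul_p, ← Finset.mul_sum, hv, mul_zero]
    exact e.symm.trans e'
  refine Matrix.eq_zero_of_mulVec_eq_zero hM.det_ne ?_
  funext j
  simpa [Matrix.mulVec, dotProduct, h1] using h j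

/-- The inclusion is best-response dynamics recentred at the equilibrium. -/
lemma IsCyclic.mem_hamField_iff (hM : IsCyclic M) {x w : Phase} : w ∈ hamField M M x ↔
    ∃ a ∈ bestRespP M x.2, ∃ b ∈ bestRespQ M x.1, w = (a - pStar M, b - qStar M) := by
  have hp := hM.p_sum
  have hq := hM.q_sum
  have hMq := hM.mulVec_q
  have hpM := hM.vecMul_p
  simp only [Fin.sum_univ_three] at hp hq hMq hpM
  constructor
  · rintro ⟨⟨hw1, hw2⟩, a, ha, b, hb, h⟩
    refine ⟨a, ha, b, hb, ?_⟩
    have ha1 := ha.1.2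
    have hb1 := hb.1.2
    rw [Fin.sum_univ_three] at ha1 hb1 hw1 hw2
    have e1 : w.1 - (a - pStar M) = 0 := by
      refine hM.eq_zero_of_vecMul (t := ∑ i, (w.1 - (a - pStar M)) i * M i 0)
        (by simp [Fin.sum_univ_three]; linarith) fun j => ?_
      have hY := h (0, Pi.single j 1 - Pi.single 0 1) ⟨by simp, by simp⟩
      have := hpM j
      have := hpM 0
      simp [symp, Matrix.mulVec_sub, Matrix.mulVec_single, dotProduct, Fin.sum_univ_three] at hY
      simp [Fin.sum_univ_three]
      linarith
    have e2 : w.2 - (b - qStar M) = 0 := by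
      refine hM.eq_zero_of_mulVec (t := ∑ j, M 0 j * (w.2 - (b - qStar M)) j)
        (by simp [Fin.sum_univ_three]; linarith) fun i => ?_
      have hY := h (Pi.single i 1 - Pi.single 0 1, 0) ⟨by simp, by simp⟩
      have := hMq i
      have := hMq 0
      simp [symp, sub_dotProduct] at hY
      simp only [Matrix.mulVec, dotProduct, Fin.sum_univ_three] at hY
      simp [Fin.sum_univ_three]
      linarith
    exact Prod.ext (sub_eq_zero.1 e1) (sub_eq_zero.1 e2)
  · rintro ⟨a, ha, b, hb, rfl⟩
    have ha1 := ha.1.2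
    have hb1 := hb.1.2
    rw [Fin.sum_univ_three] at ha1 hb1
    refine ⟨⟨by simp [Fin.sum_univ_three]; linarith, by simp [Fin.sum_univ_three]; linarith⟩,
      a, ha, b, hb, ?_⟩
    rintro Y ⟨hY1, hY2⟩
    rw [Fin.sum_univ_three] at hY1 hY2
    simp only [symp, dotProduct, Matrix.mulVec, Fin.sum_univ_three, Pi.sub_apply]
    linear_combination (-Y.2 0) * hpM 0 - Y.2 1 * hpM 1 - Y.2 2 * hpM 2 + Y.1 0 * hMq 0
      + Y.1 1 * hMq 1 + Y.1 2 * hMq 2 + (-val M) * hY2 + val M * hY1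

lemma IsCyclic.pay_vel (hM : IsCyclic M) (i : Fin 3) (a b : Fin 3 → ℝ) :
    pay M i (a - pStar M, b - qStar M) = ∑ j, M i j * b j - val M := by
  rw [pay_apply, ← hM.mulVec_q i, ← Finset.sum_sub_distrib]
  exact Finset.sum_congr rfl fun j _ => by simp [mul_sub]

lemma IsCyclic.cost_vel (hM : IsCyclic M) (j : Fin 3) (a b : Fin 3 → ℝ) :
    cost M j (a - pStar M, b - qStar M) = ∑ i, M i j * a i - val M := by
  rw [cost_apply, ← hM.vecMul_p j, ← Finset.sum_sub_distrib]
  exact Finset.sum_congr rfl fun j _ => by simp [mul_sub, mul_comm]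

lemma stdSimplex_le_one {a : Fin 3 → ℝ} (ha : a ∈ stdSimplex ℝ (Fin 3)) (i : Fin 3) : a i ≤ 1 :=
  ha.2 ▸ Finset.single_le_sum (fun j _ => ha.1 j) (Finset.mem_univ i)

lemma IsCyclic.pStar_mem (hM : IsCyclic M) : pStar M ∈ stdSimplex ℝ (Fin 3) :=
  ⟨fun i => (hM.p_pos i).le, hM.p_sum⟩

lemma IsCyclic.qStar_mem (hM : IsCyclic M) : qStar M ∈ stdSimplex ℝ (Fin 3) :=
  ⟨fun i => (hM.q_pos i).le, hM.q_sum⟩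

/-- Near `x`, only best responses at `x` are best responses. -/
lemma eventually_lt (x : Phase) : ∀ᶠ y in 𝓝 x,
    (∀ i k, pay M i x < pay M k x → pay M i y < pay M k y) ∧
      ∀ j l, cost M j x < cost M l x → cost M j y < cost M l y := by
  refine (eventually_all.2 fun i => eventually_all.2 fun k => ?_).and
    (eventually_all.2 fun j => eventually_all.2 fun l => ?_)
  · by_cases h : pay M i x < pay M k x
    · filter_upwards [((continuous_pay i).tendsto x).eventually_lt
        ((continuous_pay k).tendsto x) h] with y hy _ using hy
    · exact Eventually.of_forall fun y h' => absurd h' h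
  · by_cases h : cost M j x < cost M l x
    · filter_upwards [((continuous_cost j).tendsto x).eventually_lt
        ((continuous_cost l).tendsto x) h] with y hy _ using hy
    · exact Eventually.of_forall fun y h' => absurd h' h

lemma bestRespP_mono {x y : Phase}
    (h : ∀ i k, pay M i x < pay M k x → pay M i y < pay M k y) :
    bestRespP M y.2 ⊆ bestRespP M x.2 := by
  intro a ha
  rw [mem_bestRespP_iff] at ha ⊢
  refine ⟨ha.1, fun i hi k => ?_⟩
  by_contra! hlt
  exact absurd (ha.2 i hi k) (not_le.2 (h i k hlt))

lemma bestRespQ_mono {x y : Phase}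
    (h : ∀ j l, cost M j x < cost M l x → cost M j y < cost M l y) :
    bestRespQ M y.1 ⊆ bestRespQ M x.1 := by
  intro b hb
  rw [mem_bestRespQ_iff] at hb ⊢
  refine ⟨hb.1, fun j hj l => ?_⟩
  by_contra! hlt
  exact absurd (hb.2 j hj l) (not_le.2 (h l j hlt))

lemma exists_max_pay (M : Matrix (Fin 3) (Fin 3) ℝ) (x : Phase) :
    ∃ i, ∀ k, pay M k x ≤ pay M i x := by
  obtain ⟨i, _, hi⟩ := Finset.univ.exists_max_image (fun i => pay M i x) Finset.univ_nonempty
  exact ⟨i, fun k => hi k (Finset.mem_univ k)⟩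

lemma exists_min_cost (M : Matrix (Fin 3) (Fin 3) ℝ) (x : Phase) :
    ∃ j, ∀ l, cost M j x ≤ cost M l x := by
  obtain ⟨i, _, hi⟩ := Finset.univ.exists_min_image (fun i => cost M i x) Finset.univ_nonempty
  exact ⟨i, fun k => hi k (Finset.mem_univ k)⟩

lemma single_mem_bestRespP {x : Phase} {i : Fin 3} (h : ∀ k, pay M k x ≤ pay M i x) :
    Pi.single i 1 ∈ bestRespP M x.2 := by
  refine mem_bestRespP_iff.2 ⟨single_mem_stdSimplex ℝ i, fun l hl => ?_⟩
  by_cases hli : l = i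
  · subst hli; exact h
  · simp [hli] at hl

lemma single_mem_bestRespQ {x : Phase} {j : Fin 3} (h : ∀ l, cost M j x ≤ cost M l x) :
    Pi.single j 1 ∈ bestRespQ M x.1 := by
  refine mem_bestRespQ_iff.2 ⟨single_mem_stdSimplex ℝ j, fun l hl => ?_⟩
  by_cases hli : l = j
  · subst hli; exact h
  · simp [hli] at hl

lemma isCompact_convex_bestRespP (x : Phase) :
    IsCompact (bestRespP M x.2) ∧ Convex ℝ (bestRespP M x.2) := by
  constructor
  · have : bestRespP M x.2 = stdSimplex ℝ (Fin 3) ∩ ⋂ a' ∈ stdSimplex ℝ (Fin 3),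
        {a | a' ⬝ᵥ Matrix.mulVec M x.2 ≤ a ⬝ᵥ Matrix.mulVec M x.2} := by
      ext a; simp [bestRespP]
    rw [this]
    refine (isCompact_stdSimplex ℝ (Fin 3)).inter_right (isClosed_biInter fun a' _ => ?_)
    exact isClosed_le continuous_const (by unfold dotProduct; fun_prop)
  · rintro a ⟨ha, ha'⟩ b ⟨hb, hb'⟩ s t hs ht hst
    refine ⟨convex_stdSimplex ℝ (Fin 3) ha hb hs ht hst, fun c hc => ?_⟩
    rw [add_dotProduct, smul_dotProduct, smul_dotProduct, smul_eq_mul, smul_eq_mul]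
    have h1 := mul_le_mul_of_nonneg_left (ha' c hc) hs
    have h2 := mul_le_mul_of_nonneg_left (hb' c hc) ht
    have : c ⬝ᵥ M.mulVec x.2 = s * (c ⬝ᵥ M.mulVec x.2) + t * (c ⬝ᵥ M.mulVec x.2) := by
      rw [← add_mul, hst, one_mul]
    linarith

lemma isCompact_convex_bestRespQ (x : Phase) :
    IsCompact (bestRespQ M x.1) ∧ Convex ℝ (bestRespQ M x.1) := by
  constructor
  · have : bestRespQ M x.1 = stdSimplex ℝ (Fin 3) ∩ ⋂ a' ∈ stdSimplex ℝ (Fin 3),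
        {a | x.1 ⬝ᵥ Matrix.mulVec M a ≤ x.1 ⬝ᵥ Matrix.mulVec M a'} := by
      ext a; simp [bestRespQ]
    rw [this]
    refine (isCompact_stdSimplex ℝ (Fin 3)).inter_right (isClosed_biInter fun a' _ => ?_)
    exact isClosed_le (by unfold dotProduct Matrix.mulVec dotProduct; fun_prop) continuous_const
  · rintro a ⟨ha, ha'⟩ b ⟨hb, hb'⟩ s t hs ht hst
    refine ⟨convex_stdSimplex ℝ (Fin 3) ha hb hs ht hst, fun c hc => ?_⟩
    rw [Matrix.mulVec_add, Matrix.mulVec_smul, Matrix.mulVec_smul, dotProduct_add,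
      dotProduct_smul, dotProduct_smul, smul_eq_mul, smul_eq_mul]
    have h1 := mul_le_mul_of_nonneg_left (ha' c hc) hs
    have h2 := mul_le_mul_of_nonneg_left (hb' c hc) ht
    have : x.1 ⬝ᵥ M.mulVec c = s * (x.1 ⬝ᵥ M.mulVec c) + t * (x.1 ⬝ᵥ M.mulVec c) := by
      rw [← add_mul, hst, one_mul]
    linarith

/-- Near a point the best responses can only become fewer. -/
lemma IsCyclic.isTameField (hM : IsCyclic M) : IsTameField (hamField M M) 1 := by
  have himg : ∀ x, hamField M M x
      = (fun z : Phase => z + (-pStar M, -qStar M)) '' (bestRespP M x.2 ×ˢ bestRespQ M x.1) := by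
    intro x
    ext w
    rw [hM.mem_hamField_iff]
    constructor
    · rintro ⟨a, ha, b, hb, rfl⟩
      exact ⟨(a, b), ⟨ha, hb⟩, by simp [sub_eq_add_neg]⟩
    · rintro ⟨⟨a, b⟩, ⟨ha, hb⟩, rfl⟩
      exact ⟨a, ha, b, hb, by simp [sub_eq_add_neg]⟩
  refine ⟨fun x => ?_, fun x => ?_, fun x => ?_, fun x w hw => ?_, fun x => ?_⟩
  · obtain ⟨i, hi⟩ := exists_max_pay M x
    obtain ⟨j, hj⟩ := exists_min_cost M x
    exact ⟨_, hM.mem_hamField_iff.2 ⟨_, single_mem_bestRespP hi, _, single_mem_bestRespQ hj, rfl⟩⟩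
  · rw [himg]
    have := ((isCompact_convex_bestRespP (M := M) x).2.prod
      (isCompact_convex_bestRespQ (M := M) x).2).translate (-pStar M, -qStar M)
    simpa [add_comm] using this
  · rw [himg]
    exact ((isCompact_convex_bestRespP x).1.prod (isCompact_convex_bestRespQ x).1).image
      (by fun_prop)
  · obtain ⟨a, ha, b, hb, rfl⟩ := hM.mem_hamField_iff.1 hw
    refine max_le ?_ ?_
    · refine (pi_norm_le_iff_of_nonneg zero_le_one).2 fun i => ?_
      have h1 := ha.1.1 i
      have h2 := stdSimplex_le_one ha.1 i
      have h3 := hM.pStar_mem.1 i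
      have h4 := stdSimplex_le_one hM.pStar_mem i
      simp only [Pi.sub_apply, Real.norm_eq_abs, abs_le]
      constructor <;> linarith
    · refine (pi_norm_le_iff_of_nonneg zero_le_one).2 fun i => ?_
      have h1 := hb.1.1 i
      have h2 := stdSimplex_le_one hb.1 i
      have h3 := hM.qStar_mem.1 i
      have h4 := stdSimplex_le_one hM.qStar_mem i
      simp only [Pi.sub_apply, Real.norm_eq_abs, abs_le]
      constructor <;> linarith
  · filter_upwards [eventually_lt (M := M) x] with y hy w hw
    obtain ⟨a, ha, b, hb, rfl⟩ := hM.mem_hamField_iff.1 hw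
    exact hM.mem_hamField_iff.2 ⟨a, bestRespP_mono hy.1 ha, b, bestRespQ_mono hy.2 hb, rfl⟩

lemma continuous_ham : Continuous (ham M) := by
  have : ham M = fun x => Finset.univ.sup' Finset.univ_nonempty (fun i => pay M i x)
      - Finset.univ.inf' Finset.univ_nonempty (fun j => cost M j x) := by
    funext x
    obtain ⟨i, hi⟩ := exists_max_pay M x
    obtain ⟨j, hj⟩ := exists_min_cost M x
    rw [ham_eq, iSup_pay_eq hi, iInf_cost_eq hj]
    congr 1
    · exact le_antisymm (Finset.le_sup' (fun i => pay M i x) (Finset.mem_univ i))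
        (Finset.sup'_le _ _ fun k _ => hi k)
    · exact le_antisymm (Finset.le_inf' _ _ fun k _ => hj k)
        (Finset.inf'_le (fun i => cost M i x) (Finset.mem_univ j))
  rw [this]
  refine Continuous.sub ?_ ?_
  · exact Continuous.finset_sup'_apply _ fun i _ => continuous_pay i
  · exact Continuous.finset_inf'_apply _ fun j _ => continuous_cost j

/-- A continuous function on the line all of whose points are local minima is constant. -/
lemma eq_of_forall_isLocalMin {f : ℝ → ℝ} (hf : Continuous f) (h : ∀ t, ∀ᶠ s in 𝓝 t, f t ≤ f s)
    (a b : ℝ) : f a = f b := by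
  have key : ∀ a b, f a ≤ f b := by
    intro a b
    have hcl : IsClosed {t | f a ≤ f t} := isClosed_le continuous_const hf
    have hop : IsOpen {t | f a ≤ f t} := isOpen_iff_mem_nhds.2 fun t ht =>
      (h t).mono fun s hs => le_trans ht hs
    exact (IsClopen.eq_univ ⟨hcl, hop⟩ ⟨a, le_refl (f a)⟩).symm.subset (mem_univ b)
  exact le_antisymm (key a b) (key b a)

lemma average_pay_le {a : Fin 3 → ℝ} (ha : a ∈ stdSimplex ℝ (Fin 3)) (x : Phase) :
    ∑ i, a i * pay M i x ≤ ⨆ i, pay M i x := by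
  calc ∑ i, a i * pay M i x ≤ ∑ i, a i * ⨆ i, pay M i x :=
        Finset.sum_le_sum fun i _ => mul_le_mul_of_nonneg_left (pay_le_iSup x i) (ha.1 i)
    _ = _ := by rw [← Finset.sum_mul, ha.2, one_mul]

lemma le_average_cost {b : Fin 3 → ℝ} (hb : b ∈ stdSimplex ℝ (Fin 3)) (x : Phase) :
    ⨅ j, cost M j x ≤ ∑ j, b j * cost M j x := by
  calc _ = ∑ j, b j * ⨅ j, cost M j x := by rw [← Finset.sum_mul, hb.2, one_mul]
    _ ≤ _ := Finset.sum_le_sum fun j _ => mul_le_mul_of_nonneg_left (iInf_le_cost x j) (hb.1 j)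

lemma average_pay_eq {a : Fin 3 → ℝ} {x : Phase} (ha : a ∈ bestRespP M x.2) :
    ∑ i, a i * pay M i x = ⨆ i, pay M i x := by
  rw [mem_bestRespP_iff] at ha
  rw [← one_mul (⨆ i, pay M i x), ← ha.1.2, Finset.sum_mul]
  refine Finset.sum_congr rfl fun i _ => ?_
  by_cases hi : a i = 0
  · simp [hi]
  · rw [iSup_pay_eq (ha.2 i hi)]

lemma average_cost_eq {b : Fin 3 → ℝ} {x : Phase} (hb : b ∈ bestRespQ M x.1) :
    ∑ j, b j * cost M j x = ⨅ j, cost M j x := by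
  rw [mem_bestRespQ_iff] at hb
  rw [← one_mul (⨅ j, cost M j x), ← hb.1.2, Finset.sum_mul]
  refine Finset.sum_congr rfl fun i _ => ?_
  by_cases hi : b i = 0
  · simp [hi]
  · rw [iInf_cost_eq (hb.2 i hi)]

/-- The Hamiltonian is constant along solutions. A mean velocity near time `t` is given by best
responses `(a, b)` at time `t`; evaluating the subgradient of the convex function `ham M` at
`(a, b)` shows that `ham M` along the solution has a local minimum at `t`. -/
lemma IsCyclic.ham_const (hM : IsCyclic M) {γ : ℝ → Phase} (hγ : IsTraj (hamField M M) γ)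
    (s t : ℝ) : ham M (γ s) = ham M (γ t) := by
  refine eq_of_forall_isLocalMin (f := fun t => ham M (γ t))
    (continuous_ham.comp (hγ.continuous hM.isTameField)) (fun t => ?_) s t
  obtain ⟨δ, hδ, h⟩ := hγ t
  filter_upwards [Ioo_mem_nhds (by linarith : t - δ < t) (by linarith : t < t + δ)] with s hs
  obtain ⟨w, hw, e⟩ : ∃ w ∈ hamField M M (γ t), γ s = γ t + (s - t) • w := by
    rcases le_total t s with hts | hts
    · obtain ⟨w, hw, e⟩ := h t s (by linarith) hts hs.2
      exact ⟨w, hw, by rw [← e]; abel⟩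
    · obtain ⟨w, hw, e⟩ := h s t hs.1 hts (by linarith)
      refine ⟨w, hw, ?_⟩
      rw [← neg_sub t s, neg_smul, ← e]; abel
  obtain ⟨a, ha, b, hb, rfl⟩ := hM.mem_hamField_iff.1 hw
  have h1 := average_pay_le (M := M) ha.1 (γ s)
  have h2 := le_average_cost (M := M) hb.1 (γ s)
  rw [ham_eq, ham_eq, ← average_pay_eq ha, ← average_cost_eq hb]
  have h3 : ∑ i, a i * pay M i (γ s) - ∑ j, b j * cost M j (γ s)
      = ∑ i, a i * pay M i (γ t) - ∑ j, b j * cost M j (γ t) := by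
    have ha1 := ha.1.2
    have hb1 := hb.1.2
    rw [Fin.sum_univ_three] at ha1 hb1
    simp only [e, map_add, map_smul, hM.pay_vel, hM.cost_vel, Fin.sum_univ_three, smul_eq_mul]
    linear_combination (-(s - t) * val M) * ha1 + ((s - t) * val M) * hb1
  linarith

lemma IsCyclic.mem_levelSet (hM : IsCyclic M) {γ : ℝ → Phase} (hγ : IsTraj (hamField M M) γ)
    (h0 : γ 0 ∈ levelSet M) (t : ℝ) : γ t ∈ levelSet M := by
  refine ⟨?_, (hM.ham_const hγ t 0).trans h0.2⟩
  have hconv : Convex ℝ tangentVectors := by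
    rintro x ⟨hx1, hx2⟩ y ⟨hy1, hy2⟩ s t _ _ _
    constructor <;> simp [Finset.sum_add_distrib, ← Finset.mul_sum, *]
  have hne : tangentVectors.Nonempty := ⟨0, by simp [tangentVectors]⟩
  have key : ∀ a b, a ≤ b → IncrIn tangentVectors γ a b := fun a b hab =>
    incrIn_of_local hconv hne hab fun u _ => by
      obtain ⟨δ, hδ, h⟩ := hγ u
      exact ⟨δ, hδ, fun s₁ s₂ _ h2 _ h4 h5 => (h s₁ s₂ h4 h2 h5).mono fun w hw => hw.1⟩
  obtain ⟨r, w, hw, e⟩ : ∃ r : ℝ, ∃ w ∈ tangentVectors, γ t = γ 0 + r • w := by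
    rcases le_total 0 t with ht | ht
    · obtain ⟨w, hw, e⟩ := key 0 t ht
      exact ⟨t - 0, w, hw, by rw [← e]; abel⟩
    · obtain ⟨w, hw, e⟩ := key t 0 ht
      exact ⟨-(0 - t), w, hw, by rw [neg_smul, ← e]; abel⟩
  obtain ⟨⟨h1, h2⟩, -⟩ := h0
  rw [e]
  constructor
  · simp [Finset.sum_add_distrib, ← Finset.mul_sum, h1, hw.1]
  · simp [Finset.sum_add_distrib, ← Finset.mul_sum, h2, hw.2]

variable {M : Matrix (Fin 3) (Fin 3) ℝ}

/-! ### Uniqueness of solutions on the level set -/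

lemma eq_line_sgn {γ : ℝ → Phase} (hγ : Continuous γ) {sgn : ℝ} (hsgn : sgn = 1 ∨ sgn = -1)
    {δ : ℝ} {w : Phase} (h : ∀ t, 0 < t → t < δ → ∃ ε > 0, ∀ s₁ s₂, sgn * t - ε < s₁ → s₁ ≤ s₂ →
      s₂ < sgn * t + ε → γ s₂ - γ s₁ = (s₂ - s₁) • w) {t : ℝ} (ht0 : 0 ≤ t) (ht : t ≤ δ) :
    γ (sgn * t) = γ 0 + (sgn * t) • w := by
  rcases hsgn with rfl | rfl
  · have := eq_line_of_local_const hγ (a := 0) (b := δ) (w := w)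
      (fun s h1 h2 => by simpa using h s h1 h2) ht0 ht
    simpa using this
  · have key := fun s => eq_line_of_local_const hγ (a := -δ) (b := 0) (w := w)
      (fun s h1 h2 => by simpa using h (-s) (by linarith) (by linarith)) (t := s)
    have h1 := key (-t) (by linarith) (by linarith)
    have h0 := key 0 (by linarith) le_rfl
    rw [neg_one_mul, h1, h0, add_assoc, ← add_smul]
    congr 2; ring

/-- The velocity in the region where row `r.1` and column `r.2` are the best responses. -/
def vel (M : Matrix (Fin 3) (Fin 3) ℝ) (r : Fin 3 × Fin 3) : Phase :=
  (Pi.single r.1 1 - pStar M, Pi.single r.2 1 - qStar M)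

lemma single_of_support {a : Fin 3 → ℝ} (ha : a ∈ stdSimplex ℝ (Fin 3)) {i : Fin 3}
    (h : ∀ k, k ≠ i → a k = 0) : a = Pi.single i 1 := by
  have h1 := ha.2
  rw [Finset.sum_eq_single i (fun k _ hk => h k hk) (by simp)] at h1
  funext k
  by_cases hk : k = i
  · subst hk; simpa using h1
  · simp [hk, h k hk]

lemma IsCyclic.hamField_subset_singleton (hM : IsCyclic M) {x : Phase} {r : Fin 3 × Fin 3}
    (h1 : ∀ k, k ≠ r.1 → pay M k x < pay M r.1 x)
    (h2 : ∀ l, l ≠ r.2 → cost M r.2 x < cost M l x) : hamField M M x ⊆ {vel M r} := by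
  intro w hw
  obtain ⟨a, ha, b, hb, rfl⟩ := hM.mem_hamField_iff.1 hw
  rw [mem_bestRespP_iff] at ha
  rw [mem_bestRespQ_iff] at hb
  have ea := single_of_support ha.1 (i := r.1) fun k hk => by
    by_contra h0
    exact absurd (ha.2 k h0 r.1) (not_le.2 (h1 k hk))
  have eb := single_of_support hb.1 (i := r.2) fun k hk => by
    by_contra h0
    exact absurd (hb.2 k h0 r.2) (not_le.2 (h2 k hk))
  simp [vel, ea, eb]

/-- The mean velocities of a solution near a time, seen from that time in either direction. -/
lemma IsTraj.exists_incr {F : Phase → Set Phase} {γ : ℝ → Phase} (hγ : IsTraj F γ) (t : ℝ) :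
    ∀ᶠ s in 𝓝 t, ∃ w ∈ F (γ t), γ s = γ t + (s - t) • w := by
  obtain ⟨δ, hδ, h⟩ := hγ t
  filter_upwards [Ioo_mem_nhds (by linarith : t - δ < t) (by linarith : t < t + δ)] with s hs
  rcases le_total t s with hts | hts
  · obtain ⟨w, hw, e⟩ := h t s (by linarith) hts hs.2
    exact ⟨w, hw, by rw [← e]; abel⟩
  · obtain ⟨w, hw, e⟩ := h s t hs.1 hts (by linarith)
    refine ⟨w, hw, ?_⟩
    rw [← neg_sub t s, neg_smul, ← e]; abel

lemma eventually_sgn {sgn : ℝ} {P : ℝ → Prop} (h : ∀ᶠ s in 𝓝 (0 : ℝ), P s) :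
    ∃ δ > 0, ∀ t, 0 ≤ t → t ≤ δ → P (sgn * t) := by
  have h2 : Tendsto (fun t : ℝ => sgn * t) (𝓝 0) (𝓝 0) := by
    have : Continuous fun t : ℝ => sgn * t := by fun_prop
    simpa using this.tendsto 0
  obtain ⟨δ, hδ, hb⟩ := Metric.eventually_nhds_iff.1 (h2.eventually h)
  refine ⟨δ / 2, by positivity, fun t h0 h1 => hb ?_⟩
  rw [Real.dist_eq, sub_zero, abs_of_nonneg h0]
  linarith

lemma sum_mul_pos_of_support {b c : Fin 3 → ℝ} (hb : b ∈ stdSimplex ℝ (Fin 3))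
    (h : ∀ l, b l ≠ 0 → 0 < c l) : 0 < ∑ l, c l * b l := by
  obtain ⟨i, hi⟩ : ∃ i, b i ≠ 0 := by
    by_contra! h0
    have := hb.2
    simp [h0] at this
  refine Finset.sum_pos' (fun l _ => ?_) ⟨i, Finset.mem_univ i, ?_⟩
  · by_cases hl : b l = 0
    · simp [hl]
    · exact mul_nonneg (h l hl).le (hb.1 l)
  · exact mul_pos (h i hi) (lt_of_le_of_ne (hb.1 i) (Ne.symm hi))

/-- If row `r.1` and column `r.2` are strictly dominant among the tied best responses at `γ 0`
(for the game run in time direction `sgn`), the solution enters the region `r` at once. -/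
lemma IsCyclic.eq_line_of_dominant (hM : IsCyclic M) {γ : ℝ → Phase}
    (hγ : IsTraj (hamField M M) γ) {sgn : ℝ} (hsgn : sgn = 1 ∨ sgn = -1) {r : Fin 3 × Fin 3}
    (h1 : ∀ k, pay M k (γ 0) ≤ pay M r.1 (γ 0)) (h2 : ∀ l, cost M r.2 (γ 0) ≤ cost M l (γ 0))
    (d1 : ∀ k, pay M k (γ 0) = pay M r.1 (γ 0) → k ≠ r.1 → ∀ l,
      cost M l (γ 0) = cost M r.2 (γ 0) → 0 < sgn * (M r.1 l - M k l))
    (d2 : ∀ l, cost M l (γ 0) = cost M r.2 (γ 0) → l ≠ r.2 → ∀ k,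
      pay M k (γ 0) = pay M r.1 (γ 0) → 0 < sgn * (M k l - M k r.2)) :
    ∃ δ > 0, ∀ t, 0 ≤ t → t ≤ δ → γ (sgn * t) = γ 0 + (sgn * t) • vel M r := by
  have hF := hM.isTameField
  obtain ⟨δ, hδ, h⟩ := eventually_sgn (sgn := sgn) ((hγ.exists_incr 0).and
    (((hγ.continuous hF).tendsto 0).eventually (eventually_lt (M := M) (γ 0))))
  refine ⟨δ, hδ, fun t ht0 ht => eq_line_sgn (hγ.continuous hF) hsgn (fun s hs0 hs => ?_) ht0 ht⟩
  obtain ⟨⟨w, hw, e⟩, hlt1, hlt2⟩ := h s hs0.le hs.le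
  have hwF := hw
  obtain ⟨a, ha, b, hb, rfl⟩ := hM.mem_hamField_iff.1 hw
  rw [mem_bestRespP_iff] at ha
  rw [mem_bestRespQ_iff] at hb
  have hsub : hamField M M (γ (sgn * s)) ⊆ {vel M r} := by
    refine hM.hamField_subset_singleton (fun k hk => ?_) (fun l hl => ?_)
    · rcases (h1 k).lt_or_eq with hlt | heq
      · exact hlt1 _ _ hlt
      · have hp := sum_mul_pos_of_support hb.1 (c := fun l => sgn * (M r.1 l - M k l))
          fun l hl => d1 k heq hk l (le_antisymm (hb.2 l hl _) (h2 l))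
        simp only [Fin.sum_univ_three] at hp
        simp only [e, map_add, map_smul, hM.pay_vel, Fin.sum_univ_three, smul_eq_mul, heq]
        nlinarith
    · rcases (h2 l).lt_or_eq with hlt | heq
      · exact hlt2 _ _ hlt
      · have hp := sum_mul_pos_of_support ha.1 (c := fun k => sgn * (M k l - M k r.2))
          fun k hk => d2 l heq.symm hl k (le_antisymm (h1 k) (ha.2 k hk _))
        simp only [Fin.sum_univ_three] at hp
        simp only [e, map_add, map_smul, hM.cost_vel, Fin.sum_univ_three, smul_eq_mul, ← heq]
        nlinarith
  obtain ⟨ε, hε, hi⟩ := hγ (sgn * s)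
  refine ⟨ε, hε, fun s₁ s₂ a1 a2 a3 => ?_⟩
  obtain ⟨w, hw', e'⟩ := hi s₁ s₂ a1 a2 a3
  rw [e', hsub hw']

/-- A `2 × 2` subgame on rows `i₁, i₂` and columns `j₁, j₂` without dominated strategies; `θ` and
`κ` are its equilibrium strategies. -/
structure IsSubgame (M : Matrix (Fin 3) (Fin 3) ℝ) (i₁ i₂ i₃ j₁ j₂ j₃ : Fin 3)
    (θ₁ θ₂ κ₁ κ₂ : ℝ) : Prop where
  rows : ∀ f : Fin 3 → ℝ, ∑ i, f i = f i₁ + f i₂ + f i₃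
  cols : ∀ f : Fin 3 → ℝ, ∑ j, f j = f j₁ + f j₂ + f j₃
  rows_ne : i₁ ≠ i₂ ∧ i₁ ≠ i₃ ∧ i₂ ≠ i₃
  cols_ne : j₁ ≠ j₂ ∧ j₁ ≠ j₃ ∧ j₂ ≠ j₃
  θ₁_pos : 0 < θ₁
  θ₂_pos : 0 < θ₂
  κ₁_pos : 0 < κ₁
  κ₂_pos : 0 < κ₂
  θ_sum : θ₁ + θ₂ = 1
  κ_sum : κ₁ + κ₂ = 1
  θ_eq : θ₁ * M i₁ j₁ + θ₂ * M i₂ j₁ = θ₁ * M i₁ j₂ + θ₂ * M i₂ j₂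
  κ_eq : κ₁ * M i₁ j₁ + κ₂ * M i₁ j₂ = κ₁ * M i₂ j₁ + κ₂ * M i₂ j₂
  nondeg : M i₁ j₁ - M i₁ j₂ - M i₂ j₁ + M i₂ j₂ ≠ 0

/-- The velocity along the edge of the level set on which a `2 × 2` subgame is tied. -/
def edgeVel (M : Matrix (Fin 3) (Fin 3) ℝ) (i₁ i₂ j₁ j₂ : Fin 3) (θ₁ θ₂ κ₁ κ₂ : ℝ) : Phase :=
  (Pi.single i₁ θ₁ + Pi.single i₂ θ₂ - pStar M, Pi.single j₁ κ₁ + Pi.single j₂ κ₂ - qStar M)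

lemma IsSubgame.idx {i₁ i₂ i₃ j₁ j₂ j₃ : Fin 3} {θ₁ θ₂ κ₁ κ₂ : ℝ}
    (h : IsSubgame M i₁ i₂ i₃ j₁ j₂ j₃ θ₁ θ₂ κ₁ κ₂) (k : Fin 3) :
    (k = i₁ ∨ k = i₂ ∨ k = i₃) ∧ (k = j₁ ∨ k = j₂ ∨ k = j₃) := by
  have h1 := h.rows_ne
  have h2 := h.cols_ne
  omega

/-- The linear functional `θ · u - κ · v` attached to a tied subgame is at most `1` on the level
set, with equality only where the subgame is tied. Its derivative along the flow vanishes near the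
interior of that edge, and has a sign at the end points, in the time direction in which the third
row or column is not favourable. Hence solutions starting on the edge stay on it. -/
lemma IsCyclic.eq_line_of_subgame (hM : IsCyclic M) {i₁ i₂ i₃ j₁ j₂ j₃ : Fin 3}
    {θ₁ θ₂ κ₁ κ₂ : ℝ} (h : IsSubgame M i₁ i₂ i₃ j₁ j₂ j₃ θ₁ θ₂ κ₁ κ₂) {γ : ℝ → Phase}
    (hγ : IsTraj (hamField M M) γ) (hx : γ 0 ∈ levelSet M) {sgn : ℝ} (hsgn : sgn = 1 ∨ sgn = -1)
    (h1 : ∀ k, pay M k (γ 0) ≤ pay M i₁ (γ 0)) (h2 : pay M i₂ (γ 0) = pay M i₁ (γ 0))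
    (h3 : ∀ l, cost M j₁ (γ 0) ≤ cost M l (γ 0)) (h4 : cost M j₂ (γ 0) = cost M j₁ (γ 0))
    (hrow : pay M i₃ (γ 0) < pay M i₁ (γ 0) ∨
      0 < sgn * (κ₁ * M i₁ j₁ + κ₂ * M i₁ j₂ - (κ₁ * M i₃ j₁ + κ₂ * M i₃ j₂)))
    (hcol : cost M j₁ (γ 0) < cost M j₃ (γ 0) ∨
      0 < sgn * (θ₁ * M i₁ j₃ + θ₂ * M i₂ j₃ - (θ₁ * M i₁ j₁ + θ₂ * M i₂ j₁))) :
    ∃ δ > 0, ∀ t, 0 ≤ t → t ≤ δ →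
      γ (sgn * t) = γ 0 + (sgn * t) • edgeVel M i₁ i₂ j₁ j₂ θ₁ θ₂ κ₁ κ₂ := by
  have hF := hM.isTameField
  have hsq : sgn * sgn = 1 := by rcases hsgn with rfl | rfl <;> norm_num
  obtain ⟨δ, hδ, hev⟩ := eventually_sgn (sgn := sgn) ((hγ.exists_incr 0).and
    (((hγ.continuous hF).tendsto 0).eventually (eventually_lt (M := M) (γ 0))))
  have hθ1 := h.θ₁_pos
  have hθ2 := h.θ₂_pos
  have hκ1 := h.κ₁_pos
  have hκ2 := h.κ₂_pos
  have pv : ∀ (i : Fin 3) (a b : Fin 3 → ℝ), pay M i (a - pStar M, b - qStar M)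
      = M i j₁ * b j₁ + M i j₂ * b j₂ + M i j₃ * b j₃ - val M := fun i a b => by
    rw [hM.pay_vel, h.cols]
  have cv : ∀ (j : Fin 3) (a b : Fin 3 → ℝ), cost M j (a - pStar M, b - qStar M)
      = M i₁ j * a i₁ + M i₂ j * a i₂ + M i₃ j * a i₃ - val M := fun j a b => by
    rw [hM.cost_vel, h.rows]
  -- the subgame stays tied
  have htie : ∀ t, 0 ≤ t → t ≤ δ → pay M i₁ (γ (sgn * t)) = pay M i₂ (γ (sgn * t)) ∧
      cost M j₁ (γ (sgn * t)) = cost M j₂ (γ (sgn * t)) := by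
    intro t ht0 ht
    obtain ⟨⟨w, hw, e⟩, hlt1, hlt2⟩ := hev t ht0 ht
    obtain ⟨a, ha, b, hb, rfl⟩ := hM.mem_hamField_iff.1 hw
    rw [mem_bestRespP_iff] at ha
    rw [mem_bestRespQ_iff] at hb
    have hlev := hM.mem_levelSet hγ hx (sgn * t)
    have hham := hlev.2
    have hham0 := hx.2
    rw [ham_eq] at hham hham0
    rw [iSup_pay_eq h1, iInf_cost_eq h3] at hham0
    have m1 := pay_le_iSup (M := M) (γ (sgn * t)) i₁
    have m2 := pay_le_iSup (M := M) (γ (sgn * t)) i₂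
    have m3 := iInf_le_cost (M := M) (γ (sgn * t)) j₁
    have m4 := iInf_le_cost (M := M) (γ (sgn * t)) j₂
    have hA : 0 ≤ sgn * (a i₃ * (κ₁ * M i₁ j₁ + κ₂ * M i₁ j₂ - (κ₁ * M i₃ j₁ + κ₂ * M i₃ j₂))) := by
      rcases hrow with hr | hr
      · have : a i₃ = 0 := by
          by_contra h0
          exact absurd (ha.2 _ h0 i₁) (not_le.2 hr)
        simp [this]
      · have := mul_nonneg (ha.1.1 i₃) hr.le
        linarith
    have hB : 0 ≤ sgn * (b j₃ * (θ₁ * M i₁ j₃ + θ₂ * M i₂ j₃ - (θ₁ * M i₁ j₁ + θ₂ * M i₂ j₁))) := by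
      rcases hcol with hr | hr
      · have : b j₃ = 0 := by
          by_contra h0
          exact absurd (hb.2 _ h0 j₁) (not_le.2 hr)
        simp [this]
      · have := mul_nonneg (hb.1.1 j₃) hr.le
        linarith
    have ha1 := ha.1.2
    have hb1 := hb.1.2
    rw [h.rows] at ha1
    rw [h.cols] at hb1
    -- the derivative of `θ · u - κ · v`
    have hL : θ₁ * pay M i₁ (a - pStar M, b - qStar M) + θ₂ * pay M i₂ (a - pStar M, b - qStar M)
        - κ₁ * cost M j₁ (a - pStar M, b - qStar M) - κ₂ * cost M j₂ (a - pStar M, b - qStar M)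
        = a i₃ * (κ₁ * M i₁ j₁ + κ₂ * M i₁ j₂ - (κ₁ * M i₃ j₁ + κ₂ * M i₃ j₂))
        + b j₃ * (θ₁ * M i₁ j₃ + θ₂ * M i₂ j₃ - (θ₁ * M i₁ j₁ + θ₂ * M i₂ j₁)) := by
      simp only [pv, cv]
      have e1 := h.θ_eq
      have e2 := h.κ_eq
      have e3 := h.θ_sum
      have e4 := h.κ_sum
      have ea : a i₁ = 1 - a i₂ - a i₃ := by linarith
      have eb : b j₁ = 1 - b j₂ - b j₃ := by linarith
      have et : θ₁ = 1 - θ₂ := by linarith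
      have ek : κ₁ = 1 - κ₂ := by linarith
      rw [ea, eb]
      subst et ek
      linear_combination (-b j₂ + κ₂) * e1 + (a i₂ - θ₂) * e2
    -- conservation of the Hamiltonian gives the opposite inequality, so equality holds throughout
    have hLt : 1 ≤ θ₁ * pay M i₁ (γ (sgn * t)) + θ₂ * pay M i₂ (γ (sgn * t))
        - κ₁ * cost M j₁ (γ (sgn * t)) - κ₂ * cost M j₂ (γ (sgn * t)) := by
      simp only [e, map_add, map_smul, smul_eq_mul, sub_zero, h2, h4]
      have : 0 ≤ (sgn * t) * (θ₁ * pay M i₁ (a - pStar M, b - qStar M)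
          + θ₂ * pay M i₂ (a - pStar M, b - qStar M)
          - κ₁ * cost M j₁ (a - pStar M, b - qStar M)
          - κ₂ * cost M j₂ (a - pStar M, b - qStar M)) := by
        rw [hL]
        have := mul_nonneg ht0 (add_nonneg hA hB)
        linarith
      have e3 := h.θ_sum
      have e4 := h.κ_sum
      have et : θ₁ = 1 - θ₂ := by linarith
      have ek : κ₁ = 1 - κ₂ := by linarith
      subst et ek
      linarith
    set P := ⨆ i, pay M i (γ (sgn * t))
    set Q := ⨅ j, cost M j (γ (sgn * t))
    have e3 := h.θ_sum
    have e4 := h.κ_sum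
    have s1 : 0 ≤ θ₁ * (P - pay M i₁ (γ (sgn * t))) := mul_nonneg hθ1.le (by linarith)
    have s2 : 0 ≤ θ₂ * (P - pay M i₂ (γ (sgn * t))) := mul_nonneg hθ2.le (by linarith)
    have s3 : 0 ≤ κ₁ * (cost M j₁ (γ (sgn * t)) - Q) := mul_nonneg hκ1.le (by linarith)
    have s4 : 0 ≤ κ₂ * (cost M j₂ (γ (sgn * t)) - Q) := mul_nonneg hκ2.le (by linarith)
    have hP : θ₁ * P + θ₂ * P = P := by rw [← add_mul, e3, one_mul]
    have hQ : κ₁ * Q + κ₂ * Q = Q := by rw [← add_mul, e4, one_mul]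
    have z1 : θ₁ * (P - pay M i₁ (γ (sgn * t))) = 0 := by linarith
    have z2 : θ₂ * (P - pay M i₂ (γ (sgn * t))) = 0 := by linarith
    have z3 : κ₁ * (cost M j₁ (γ (sgn * t)) - Q) = 0 := by linarith
    have z4 : κ₂ * (cost M j₂ (γ (sgn * t)) - Q) = 0 := by linarith
    have y1 := (mul_eq_zero.1 z1).resolve_left hθ1.ne'
    have y2 := (mul_eq_zero.1 z2).resolve_left hθ2.ne'
    have y3 := (mul_eq_zero.1 z3).resolve_left hκ1.ne'
    have y4 := (mul_eq_zero.1 z4).resolve_left hκ2.ne'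
    constructor <;> linarith
  -- a mean velocity that keeps the rows tied uses the equilibrium weights of the columns
  have hκeq : ∀ b : Fin 3 → ℝ, b j₁ + b j₂ = 1 → M i₁ j₁ * b j₁ + M i₁ j₂ * b j₂
      = M i₂ j₁ * b j₁ + M i₂ j₂ * b j₂ → b j₁ = κ₁ ∧ b j₂ = κ₂ := by
    intro b hb1 hb2
    have e4 := h.κ_sum
    have : (b j₁ - κ₁) * (M i₁ j₁ - M i₁ j₂ - M i₂ j₁ + M i₂ j₂) = 0 := by
      have eb : b j₂ = 1 - b j₁ := by linarith
      have ek : κ₂ = 1 - κ₁ := by linarith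
      have e2 := h.κ_eq
      rw [eb] at hb2
      rw [ek] at e2
      linear_combination hb2 - e2
    have := (mul_eq_zero.1 this).resolve_right h.nondeg
    constructor <;> linarith
  have hθeq : ∀ a : Fin 3 → ℝ, a i₁ + a i₂ = 1 → M i₁ j₁ * a i₁ + M i₂ j₁ * a i₂
      = M i₁ j₂ * a i₁ + M i₂ j₂ * a i₂ → a i₁ = θ₁ ∧ a i₂ = θ₂ := by
    intro a ha1 ha2
    have e4 := h.θ_sum
    have : (a i₁ - θ₁) * (M i₁ j₁ - M i₁ j₂ - M i₂ j₁ + M i₂ j₂) = 0 := by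
      have ea : a i₂ = 1 - a i₁ := by linarith
      have ek : θ₂ = 1 - θ₁ := by linarith
      have e2 := h.θ_eq
      rw [ea] at ha2
      rw [ek] at e2
      linear_combination ha2 - e2
    have := (mul_eq_zero.1 this).resolve_right h.nondeg
    constructor <;> linarith
  obtain ⟨hr1, hr2, hr3⟩ := h.rows_ne
  obtain ⟨hc1, hc2, hc3⟩ := h.cols_ne
  -- the third row and the third column are strictly worse at later times
  have hstrict : ∀ t, 0 < t → t ≤ δ → pay M i₃ (γ (sgn * t)) < pay M i₁ (γ (sgn * t)) ∧
      cost M j₁ (γ (sgn * t)) < cost M j₃ (γ (sgn * t)) := by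
    intro t ht0 ht
    obtain ⟨t1, t2⟩ := htie t ht0.le ht
    obtain ⟨⟨w, hw, e⟩, hlt1, hlt2⟩ := hev t ht0.le ht
    obtain ⟨a, ha, b, hb, rfl⟩ := hM.mem_hamField_iff.1 hw
    rw [mem_bestRespP_iff] at ha
    rw [mem_bestRespQ_iff] at hb
    have hst : sgn * t ≠ 0 := by
      rcases hsgn with rfl | rfl <;> simp [ht0.ne']
    have ha1 := ha.1.2
    have hb1 := hb.1.2
    rw [h.rows] at ha1
    rw [h.cols] at hb1
    simp only [e, map_add, map_smul, smul_eq_mul, sub_zero, h2, h4, add_right_inj,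
      mul_eq_mul_left_iff, hst, or_false, pv, cv, sub_left_inj] at t1 t2
    -- if both third strategies were tied at time zero the Hamiltonian would vanish
    have hnot : pay M i₃ (γ 0) < pay M i₁ (γ 0) ∨ cost M j₁ (γ 0) < cost M j₃ (γ 0) := by
      by_contra! hcon
      have p3 : pay M i₃ (γ 0) = pay M i₁ (γ 0) := le_antisymm (h1 _) hcon.1
      have c3 : cost M j₃ (γ 0) = cost M j₁ (γ 0) := le_antisymm hcon.2 (h3 _)
      have hham0 := hx.2
      rw [ham_eq, iSup_pay_eq h1, iInf_cost_eq h3] at hham0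
      have hs1 : ∑ i, pStar M i * pay M i (γ 0) = val M := by
        simp only [pay_apply, Finset.mul_sum, ← mul_assoc]
        rw [Finset.sum_comm]
        simp only [← Finset.sum_mul, hM.vecMul_p, ← Finset.mul_sum, hx.1.2, mul_one]
      have hs2 : ∑ j, cost M j (γ 0) * qStar M j = val M := by
        simp only [cost_apply, Finset.sum_mul]
        rw [Finset.sum_comm]
        have : ∀ i, ∑ j, M i j * (γ 0).1 i * qStar M j = val M * (γ 0).1 i := by
          intro i
          rw [← hM.mulVec_q i, Finset.sum_mul]
          exact Finset.sum_congr rfl fun j _ => by ring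
        simp only [this, ← Finset.mul_sum, hx.1.1, mul_one]
      have hp := hM.p_sum
      have hq := hM.q_sum
      rw [h.rows] at hs1 hp
      rw [h.cols] at hs2 hq
      rw [h2, p3, ← add_mul, ← add_mul, hp, one_mul] at hs1
      rw [h4, c3, ← mul_add, ← mul_add, hq, mul_one] at hs2
      linarith
    constructor
    · by_cases hp3 : pay M i₃ (γ 0) < pay M i₁ (γ 0)
      · exact hlt1 _ _ hp3
      have hr := hrow.resolve_left hp3
      have hc := hnot.resolve_left hp3
      have hb3 : b j₃ = 0 := by
        by_contra h0
        exact absurd (hb.2 _ h0 j₁) (not_le.2 hc)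
      obtain ⟨k1, k2⟩ := hκeq b (by linarith) (by simpa [hb3] using t1)
      have p3 : pay M i₃ (γ 0) = pay M i₁ (γ 0) := le_antisymm (h1 _) (not_lt.1 hp3)
      simp only [e, map_add, map_smul, smul_eq_mul, sub_zero, pv, hb3, k1, k2, p3]
      have := mul_pos ht0 hr
      nlinarith
    · by_cases hp3 : cost M j₁ (γ 0) < cost M j₃ (γ 0)
      · exact hlt2 _ _ hp3
      have hr := hcol.resolve_left hp3
      have hc := hnot.resolve_right hp3
      have ha3 : a i₃ = 0 := by
        by_contra h0
        exact absurd (ha.2 _ h0 i₁) (not_le.2 hc)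
      obtain ⟨k1, k2⟩ := hθeq a (by linarith) (by simpa [ha3] using t2)
      have p3 : cost M j₃ (γ 0) = cost M j₁ (γ 0) := le_antisymm (not_lt.1 hp3) (h3 _)
      simp only [e, map_add, map_smul, smul_eq_mul, sub_zero, cv, ha3, k1, k2, p3]
      have := mul_pos ht0 hr
      nlinarith
  refine ⟨δ, hδ, fun t ht0 ht => eq_line_sgn (hγ.continuous hF) hsgn (fun s hs0 hs => ?_) ht0 ht⟩
  obtain ⟨q1, q2⟩ := hstrict s hs0 hs.le
  obtain ⟨ε, hε, hi⟩ := hγ (sgn * s)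
  refine ⟨min ε (min s (δ - s)), lt_min hε (lt_min hs0 (by linarith)), fun s₁ s₂ a1 a2 a3 => ?_⟩
  have g1 := min_le_left ε (min s (δ - s))
  have g2 := (min_le_right ε (min s (δ - s))).trans (min_le_left _ _)
  have g3 := (min_le_right ε (min s (δ - s))).trans (min_le_right _ _)
  have htie' : ∀ u, sgn * s - min ε (min s (δ - s)) < u → u < sgn * s + min ε (min s (δ - s)) →
      pay M i₁ (γ u) = pay M i₂ (γ u) ∧ cost M j₁ (γ u) = cost M j₂ (γ u) := by
    intro u hu1 hu2
    have hu : u = sgn * (sgn * u) := by rw [← mul_assoc, hsq, one_mul]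
    rw [hu]
    rcases hsgn with rfl | rfl <;> exact htie _ (by linarith) (by linarith)
  -- near later times only the four tied strategies are used, and keeping both players tied forces
  -- the equilibrium weights
  obtain ⟨w, hw, e⟩ := hi s₁ s₂ (by linarith) a2 (by linarith)
  rcases a2.eq_or_lt with rfl | hlt
  · simp
  obtain ⟨a, ha, b, hb, rfl⟩ := hM.mem_hamField_iff.1 hw
  rw [mem_bestRespP_iff] at ha
  rw [mem_bestRespQ_iff] at hb
  have ha3 : a i₃ = 0 := by
    by_contra h0
    exact absurd (ha.2 _ h0 i₁) (not_le.2 q1)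
  have hb3 : b j₃ = 0 := by
    by_contra h0
    exact absurd (hb.2 _ h0 j₁) (not_le.2 q2)
  have ha1 := ha.1.2
  have hb1 := hb.1.2
  rw [h.rows] at ha1
  rw [h.cols] at hb1
  obtain ⟨u1, u2⟩ := htie' s₁ (by linarith) (by linarith)
  obtain ⟨v1, v2⟩ := htie' s₂ (by linarith) (by linarith)
  have e' : γ s₂ = γ s₁ + (s₂ - s₁) • (a - pStar M, b - qStar M) := by rw [← e]; abel
  have hne : s₂ - s₁ ≠ 0 := by linarith
  simp only [e', map_add, map_smul, smul_eq_mul, u1, u2, add_right_inj, mul_eq_mul_left_iff, hne,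
    or_false, pv, cv, sub_left_inj, ha3, hb3] at v1 v2
  obtain ⟨k1, k2⟩ := hκeq b (by linarith) (by simpa using v1)
  obtain ⟨k3, k4⟩ := hθeq a (by linarith) (by simpa using v2)
  rw [e]
  congr 1
  have ea : a = Pi.single i₁ θ₁ + Pi.single i₂ θ₂ := by
    funext k
    rcases (h.idx k).1 with rfl | rfl | rfl <;> simp [*, Ne.symm hr2, Ne.symm hr3]
  have eb : b = Pi.single j₁ κ₁ + Pi.single j₂ κ₂ := by
    funext k
    rcases (h.idx k).2 with rfl | rfl | rfl <;> simp [*, Ne.symm hc2, Ne.symm hc3]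
  rw [ea, eb, edgeVel]

variable {M : Matrix (Fin 3) (Fin 3) ℝ}

lemma exists_isSubgame {i₁ i₂ i₃ j₁ j₂ j₃ : Fin 3} (hr : i₁ ≠ i₂ ∧ i₁ ≠ i₃ ∧ i₂ ≠ i₃)
    (hc : j₁ ≠ j₂ ∧ j₁ ≠ j₃ ∧ j₂ ≠ j₃) (h1 : M i₂ j₁ < M i₁ j₁) (h2 : M i₁ j₂ < M i₂ j₂)
    (h3 : M i₁ j₂ < M i₁ j₁) (h4 : M i₂ j₁ < M i₂ j₂) :
    ∃ θ₁ θ₂ κ₁ κ₂, IsSubgame M i₁ i₂ i₃ j₁ j₂ j₃ θ₁ θ₂ κ₁ κ₂ := by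
  have sums : ∀ i₁ i₂ i₃ : Fin 3, (i₁ ≠ i₂ ∧ i₁ ≠ i₃ ∧ i₂ ≠ i₃) → ∀ f : Fin 3 → ℝ,
      ∑ i, f i = f i₁ + f i₂ + f i₃ := by
    rintro a b c ⟨h1, h2, h3⟩ f
    have : (Finset.univ : Finset (Fin 3)) = {a, b, c} := by
      clear f; revert a b c; decide
    rw [this, Finset.sum_insert (by simp [h1, h2]), Finset.sum_pair h3, add_assoc]
  have p1 : 0 < M i₁ j₁ - M i₂ j₁ := by linarith
  have p2 : 0 < M i₂ j₂ - M i₁ j₂ := by linarith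
  have p3 : 0 < M i₁ j₁ - M i₁ j₂ := by linarith
  have p4 : 0 < M i₂ j₂ - M i₂ j₁ := by linarith
  have q1 := add_pos p1 p2
  have q2 := add_pos p3 p4
  refine ⟨(M i₂ j₂ - M i₂ j₁) / ((M i₁ j₁ - M i₁ j₂) + (M i₂ j₂ - M i₂ j₁)),
    (M i₁ j₁ - M i₁ j₂) / ((M i₁ j₁ - M i₁ j₂) + (M i₂ j₂ - M i₂ j₁)),
    (M i₂ j₂ - M i₁ j₂) / ((M i₁ j₁ - M i₂ j₁) + (M i₂ j₂ - M i₁ j₂)),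
    (M i₁ j₁ - M i₂ j₁) / ((M i₁ j₁ - M i₂ j₁) + (M i₂ j₂ - M i₁ j₂)),
    ⟨sums _ _ _ hr, sums _ _ _ hc, hr, hc, by positivity, by positivity, by positivity,
      by positivity, ?_, ?_, ?_, ?_, ?_⟩⟩
  · field_simp; ring
  · field_simp; ring
  · field_simp; ring
  · field_simp; ring
  · intro h0; linarith

/-- The subgame without row `k` and column `k`, tied along an edge whose flow leads away from the
point where all rows are tied, towards the point where all columns are tied. -/
lemma IsCyclic.exists_subgame₀ (hM : IsCyclic M) (k : Fin 3) : ∃ θ₁ θ₂ κ₁ κ₂,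
    IsSubgame M (k + 1) (k + 2) k (k + 1) (k + 2) k θ₁ θ₂ κ₁ κ₂ ∧
    κ₁ * M k (k + 1) + κ₂ * M k (k + 2) < κ₁ * M (k + 1) (k + 1) + κ₂ * M (k + 1) (k + 2) ∧
    θ₁ * M (k + 1) k + θ₂ * M (k + 2) k < θ₁ * M (k + 1) (k + 1) + θ₂ * M (k + 2) (k + 1) := by
  obtain ⟨θ₁, θ₂, κ₁, κ₂, h⟩ := exists_isSubgame (M := M) (i₁ := k + 1) (i₂ := k + 2) (i₃ := k)
    (j₁ := k + 1) (j₂ := k + 2) (j₃ := k) (by clear * -; revert k; decide) (by clear * -; revert k; decide)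
    (hM.order _ _ _ _ (by clear * -; revert k; decide)) (hM.order _ _ _ _ (by clear * -; revert k; decide))
    (hM.order _ _ _ _ (by clear * -; revert k; decide)) (hM.order _ _ _ _ (by clear * -; revert k; decide))
  refine ⟨θ₁, θ₂, κ₁, κ₂, h, ?_, ?_⟩
  · rw [h.κ_eq]
    exact add_lt_add (mul_lt_mul_of_pos_left (hM.order _ _ _ _ (by clear * -; revert k; decide)) h.κ₁_pos)
      (mul_lt_mul_of_pos_left (hM.order _ _ _ _ (by clear * -; revert k; decide)) h.κ₂_pos)
  · exact add_lt_add (mul_lt_mul_of_pos_left (hM.order _ _ _ _ (by clear * -; revert k; decide)) h.θ₁_pos)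
      (mul_lt_mul_of_pos_left (hM.order _ _ _ _ (by clear * -; revert k; decide)) h.θ₂_pos)

/-- The subgame without row `k` and column `k + 1`, tied along an edge whose flow leads away from
the point where all columns are tied, towards the point where all rows are tied. -/
lemma IsCyclic.exists_subgame₁ (hM : IsCyclic M) (k : Fin 3) : ∃ θ₁ θ₂ κ₁ κ₂,
    IsSubgame M (k + 1) (k + 2) k k (k + 2) (k + 1) θ₁ θ₂ κ₁ κ₂ ∧
    κ₁ * M (k + 1) k + κ₂ * M (k + 1) (k + 2) < κ₁ * M k k + κ₂ * M k (k + 2) ∧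
    θ₁ * M (k + 1) k + θ₂ * M (k + 2) k < θ₁ * M (k + 1) (k + 1) + θ₂ * M (k + 2) (k + 1) := by
  obtain ⟨θ₁, θ₂, κ₁, κ₂, h⟩ := exists_isSubgame (M := M) (i₁ := k + 1) (i₂ := k + 2) (i₃ := k)
    (j₁ := k) (j₂ := k + 2) (j₃ := k + 1) (by clear * -; revert k; decide) (by clear * -; revert k; decide)
    (hM.order _ _ _ _ (by clear * -; revert k; decide)) (hM.order _ _ _ _ (by clear * -; revert k; decide))
    (hM.order _ _ _ _ (by clear * -; revert k; decide)) (hM.order _ _ _ _ (by clear * -; revert k; decide))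
  refine ⟨θ₁, θ₂, κ₁, κ₂, h, ?_, ?_⟩
  · exact add_lt_add (mul_lt_mul_of_pos_left (hM.order _ _ _ _ (by clear * -; revert k; decide)) h.κ₁_pos)
      (mul_lt_mul_of_pos_left (hM.order _ _ _ _ (by clear * -; revert k; decide)) h.κ₂_pos)
  · exact add_lt_add (mul_lt_mul_of_pos_left (hM.order _ _ _ _ (by clear * -; revert k; decide)) h.θ₁_pos)
      (mul_lt_mul_of_pos_left (hM.order _ _ _ _ (by clear * -; revert k; decide)) h.θ₂_pos)

/-- All rows other than `k` are best responses, and all columns other than `l`. -/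
def TiedAt (M : Matrix (Fin 3) (Fin 3) ℝ) (k l : Fin 3) (x : Phase) : Prop :=
  (∀ i, i ≠ k → ∀ m, pay M m x ≤ pay M i x) ∧ ∀ j, j ≠ l → ∀ m, cost M j x ≤ cost M m x

/-- The hexagon: the points of the level set at which a `2 × 2` subgame without dominated
strategies is tied. -/
def hexagon (M : Matrix (Fin 3) (Fin 3) ℝ) : Set Phase :=
  {x | x ∈ levelSet M ∧ ∃ k l, (l = k ∨ l = k + 1) ∧ TiedAt M k l x}

/-- On the level set not all rows and all columns are tied. -/
lemma IsCyclic.not_all_tied (hM : IsCyclic M) {x : Phase} (hx : x ∈ levelSet M)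
    (h1 : ∀ i m, pay M m x ≤ pay M i x) (h2 : ∀ j m, cost M j x ≤ cost M m x) : False := by
  have hham := hx.2
  rw [ham_eq, iSup_pay_eq (h1 0), iInf_cost_eq (h2 0)] at hham
  have e1 : ∀ i, pay M i x = pay M 0 x := fun i => le_antisymm (h1 _ _) (h1 _ _)
  have e2 : ∀ i, cost M i x = cost M 0 x := fun i => le_antisymm (h2 _ _) (h2 _ _)
  have hs1 : ∑ i, pStar M i * pay M i x = val M := by
    simp only [pay_apply, Finset.mul_sum, ← mul_assoc]
    rw [Finset.sum_comm]
    simp only [← Finset.sum_mul, hM.vecMul_p, ← Finset.mul_sum, hx.1.2, mul_one]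
  have hs2 : ∑ j, cost M j x * qStar M j = val M := by
    simp only [cost_apply, Finset.sum_mul]
    rw [Finset.sum_comm]
    have : ∀ i, ∑ j, M i j * x.1 i * qStar M j = val M * x.1 i := by
      intro i
      rw [← hM.mulVec_q i, Finset.sum_mul]
      exact Finset.sum_congr rfl fun j _ => by ring
    simp only [this, ← Finset.mul_sum, hx.1.1, mul_one]
  simp only [e1, ← Finset.sum_mul, hM.p_sum, one_mul] at hs1
  simp only [e2, ← Finset.mul_sum, hM.q_sum, mul_one] at hs2
  linarith

lemma IsCyclic.third_strict (hM : IsCyclic M) {x : Phase} (hx : x ∈ levelSet M) {k l : Fin 3}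
    (h : TiedAt M k l x) : pay M k x < pay M (k + 1) x ∨
      ∃ j, j ≠ l ∧ cost M j x < cost M l x := by
  by_contra! hcon
  refine hM.not_all_tied hx (fun i m => ?_) (fun j m => ?_)
  · by_cases hi : i = k
    · subst hi
      exact (h.1 _ (by clear * -; revert i; decide) m).trans hcon.1
    · exact h.1 i hi m
  · by_cases hj : j = l
    · subst hj
      exact (hcon.2 (j + 1) (by clear * -; revert j; decide)).trans (h.2 _ (by clear * -; revert j; decide) m)
    · exact h.2 j hj m

/-- On the hexagon solutions are determined locally, in both time directions. -/
lemma IsCyclic.exists_line_of_mem_hexagon (hM : IsCyclic M) {x : Phase} (hx : x ∈ hexagon M)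
    {sgn : ℝ} (hsgn : sgn = 1 ∨ sgn = -1) : ∃ w : Phase, ∀ γ : ℝ → Phase,
      IsTraj (hamField M M) γ → γ 0 = x →
      ∃ δ > 0, ∀ t, 0 ≤ t → t ≤ δ → γ (sgn * t) = x + (sgn * t) • w := by
  obtain ⟨hlev, k, l, hkl, ht⟩ := hx
  -- the two kinds of edges, each used in the time direction in which the edge is not left
  have edge0 : ∀ k, TiedAt M k k x → (sgn = 1 ∧ cost M (k + 1) x < cost M k x ∨
      sgn = -1 ∧ pay M k x < pay M (k + 1) x) → ∃ w : Phase, ∀ γ : ℝ → Phase,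
      IsTraj (hamField M M) γ → γ 0 = x →
      ∃ δ > 0, ∀ t, 0 ≤ t → t ≤ δ → γ (sgn * t) = x + (sgn * t) • w := by
    intro k ht hs
    obtain ⟨θ₁, θ₂, κ₁, κ₂, h, hr, hc⟩ := hM.exists_subgame₀ k
    have n1 : k + 1 ≠ k := by clear * -; revert k; decide
    have n2 : k + 2 ≠ k := by clear * -; revert k; decide
    refine ⟨edgeVel M (k + 1) (k + 2) (k + 1) (k + 2) θ₁ θ₂ κ₁ κ₂, fun γ hγ h0 => ?_⟩
    subst h0
    refine hM.eq_line_of_subgame h hγ hlev hsgn (ht.1 _ n1)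
      (le_antisymm (ht.1 _ n1 _) (ht.1 _ n2 _)) (ht.2 _ n1)
      (le_antisymm (ht.2 _ n2 _) (ht.2 _ n1 _)) ?_ ?_
    · rcases hs with ⟨rfl, hs⟩ | ⟨rfl, hs⟩
      · right; linarith
      · exact Or.inl hs
    · rcases hs with ⟨rfl, hs⟩ | ⟨rfl, hs⟩
      · exact Or.inl hs
      · right; linarith
  have edge1 : ∀ k, TiedAt M k (k + 1) x → (sgn = -1 ∧ cost M k x < cost M (k + 1) x ∨
      sgn = 1 ∧ pay M k x < pay M (k + 1) x) → ∃ w : Phase, ∀ γ : ℝ → Phase,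
      IsTraj (hamField M M) γ → γ 0 = x →
      ∃ δ > 0, ∀ t, 0 ≤ t → t ≤ δ → γ (sgn * t) = x + (sgn * t) • w := by
    intro k ht hs
    obtain ⟨θ₁, θ₂, κ₁, κ₂, h, hr, hc⟩ := hM.exists_subgame₁ k
    have n1 : k + 1 ≠ k := by clear * -; revert k; decide
    have n2 : k + 2 ≠ k := by clear * -; revert k; decide
    have n3 : k ≠ k + 1 := n1.symm
    have n4 : k + 2 ≠ k + 1 := by clear * -; revert k; decide
    refine ⟨edgeVel M (k + 1) (k + 2) k (k + 2) θ₁ θ₂ κ₁ κ₂, fun γ hγ h0 => ?_⟩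
    subst h0
    have hth := h.θ_eq
    refine hM.eq_line_of_subgame h hγ hlev hsgn (ht.1 _ n1)
      (le_antisymm (ht.1 _ n1 _) (ht.1 _ n2 _)) (ht.2 _ n3)
      (le_antisymm (ht.2 _ n4 _) (ht.2 _ n3 _)) ?_ ?_
    · rcases hs with ⟨rfl, hs⟩ | ⟨rfl, hs⟩
      · right; linarith
      · exact Or.inl hs
    · rcases hs with ⟨rfl, hs⟩ | ⟨rfl, hs⟩
      · exact Or.inl hs
      · right; linarith
  -- at a vertex of the hexagon the adjacent edge is used on which the given time direction points
  -- into the edge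
  rcases hkl with rfl | rfl
  · by_cases hp : pay M l x < pay M (l + 1) x
    · by_cases hc : cost M (l + 1) x < cost M l x
      · exact edge0 l ht (by rcases hsgn with rfl | rfl <;> simp [hp, hc])
      · rcases hsgn with rfl | rfl
        · refine edge1 l ⟨ht.1, fun j hj m => ?_⟩ (Or.inr ⟨rfl, hp⟩)
          by_cases hjl : j = l
          · rw [hjl]
            exact (not_lt.1 hc).trans (ht.2 _ (by clear * -; revert l; decide) m)
          · exact ht.2 j hjl m
        · exact edge0 l ht (Or.inr ⟨rfl, hp⟩)
    · obtain ⟨j, hj, hc⟩ := (hM.third_strict hlev ht).resolve_left hp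
      have hc' : ∀ m, m ≠ l → cost M m x < cost M l x := fun m hm =>
        lt_of_le_of_lt (ht.2 m hm j) hc
      rcases hsgn with rfl | rfl
      · exact edge0 l ht (Or.inl ⟨rfl, hc' _ (by clear * -; revert l; decide)⟩)
      · have e : l + 2 + 1 = l := by clear * -; revert l; decide
        have h1 : TiedAt M (l + 2) (l + 2 + 1) x := by
          refine ⟨fun i hi m => ?_, by rw [e]; exact ht.2⟩
          by_cases hil : i = l
          · rw [hil]
            exact (ht.1 _ (by clear * -; revert l; decide) m).trans (not_lt.1 hp)
          · exact ht.1 i hil m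
        refine edge1 (l + 2) h1 (Or.inl ⟨rfl, ?_⟩)
        rw [e]
        exact hc' _ (by clear * -; revert l; decide)
  · by_cases hp : pay M k x < pay M (k + 1) x
    · by_cases hc : cost M k x < cost M (k + 1) x
      · exact edge1 k ht (by rcases hsgn with rfl | rfl <;> simp [hp, hc])
      · rcases hsgn with rfl | rfl
        · exact edge1 k ht (Or.inr ⟨rfl, hp⟩)
        · refine edge0 k ⟨ht.1, fun j hj m => ?_⟩ (Or.inr ⟨rfl, hp⟩)
          by_cases hjl : j = k + 1
          · rw [hjl]
            exact (not_lt.1 hc).trans (ht.2 _ (by clear * -; revert k; decide) m)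
          · exact ht.2 j hjl m
    · obtain ⟨j, hj, hc⟩ := (hM.third_strict hlev ht).resolve_left hp
      have hc' : ∀ m, m ≠ k + 1 → cost M m x < cost M (k + 1) x := fun m hm =>
        lt_of_le_of_lt (ht.2 m hm j) hc
      rcases hsgn with rfl | rfl
      · have h1 : TiedAt M (k + 1) (k + 1) x := by
          refine ⟨fun i hi m => ?_, ht.2⟩
          by_cases hil : i = k
          · rw [hil]
            exact (ht.1 _ (by clear * -; revert k; decide) m).trans (not_lt.1 hp)
          · exact ht.1 i hil m
        exact edge0 (k + 1) h1 (Or.inl ⟨rfl, hc' _ (by clear * -; revert k; decide)⟩)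
      · exact edge1 k ht (Or.inl ⟨rfl, hc' _ (by clear * -; revert k; decide)⟩)

lemma IsCyclic.row_injective (hM : IsCyclic M) {i j l : Fin 3} (h : j ≠ l) : M i j ≠ M i l := by
  have : i - j ≠ i - l := fun h' => h (sub_right_injective h')
  rcases lt_or_gt_of_ne this with h | h
  · exact (hM.order _ _ _ _ h).ne'
  · exact (hM.order _ _ _ _ h).ne

lemma IsCyclic.col_injective (hM : IsCyclic M) {i k j : Fin 3} (h : i ≠ k) : M i j ≠ M k j := by
  have : i - j ≠ k - j := fun h' => h (sub_left_injective h')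
  rcases lt_or_gt_of_ne this with h | h
  · exact (hM.order _ _ _ _ h).ne'
  · exact (hM.order _ _ _ _ h).ne

/-- Off the hexagon one region is strictly dominant in each time direction: either one player has a
single best response, or the tied `2 × 2` subgame has dominated strategies. -/
lemma IsCyclic.exists_dominant (hM : IsCyclic M) {x : Phase} (hx : x ∈ levelSet M)
    (hΓ : x ∉ hexagon M) {sgn : ℝ} (hsgn : sgn = 1 ∨ sgn = -1) : ∃ r : Fin 3 × Fin 3,
    (∀ k, pay M k x ≤ pay M r.1 x) ∧ (∀ l, cost M r.2 x ≤ cost M l x) ∧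
    (∀ k, pay M k x = pay M r.1 x → k ≠ r.1 → ∀ l, cost M l x = cost M r.2 x →
      0 < sgn * (M r.1 l - M k l)) ∧
    (∀ l, cost M l x = cost M r.2 x → l ≠ r.2 → ∀ k, pay M k x = pay M r.1 x →
      0 < sgn * (M k l - M k r.2)) := by
  classical
  have hs0 : sgn ≠ 0 := by rcases hsgn with rfl | rfl <;> norm_num
  obtain ⟨i, hi⟩ := exists_max_pay M x
  obtain ⟨j, hj⟩ := exists_min_cost M x
  -- a single best row: the other player has a strictly best reply to it
  by_cases hA : ∀ k, k ≠ i → pay M k x ≠ pay M i x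
  · obtain ⟨l, hl, hmin⟩ := (Finset.univ.filter fun l => cost M l x = cost M j x).exists_min_image
      (fun l => sgn * M i l) ⟨j, by simp⟩
    simp only [Finset.mem_filter, Finset.mem_univ, true_and] at hl hmin
    refine ⟨(i, l), hi, fun m => by rw [hl]; exact hj m, fun k hk hki => absurd hk (hA k hki),
      fun m hm hml k hk => ?_⟩
    have hki : k = i := by
      by_contra h
      exact hA k h hk
    subst hki
    have h1 := hmin m (hm.trans hl)
    have h2 : sgn * M k m ≠ sgn * M k l := fun h => hM.row_injective hml (mul_left_cancel₀ hs0 h)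
    rw [mul_sub]
    exact sub_pos.2 (lt_of_le_of_ne h1 h2.symm)
  -- a single best column
  by_cases hB : ∀ l, l ≠ j → cost M l x ≠ cost M j x
  · obtain ⟨k, hk, hmax⟩ := (Finset.univ.filter fun k => pay M k x = pay M i x).exists_max_image
      (fun k => sgn * M k j) ⟨i, by simp⟩
    simp only [Finset.mem_filter, Finset.mem_univ, true_and] at hk hmax
    refine ⟨(k, j), fun m => by rw [hk]; exact hi m, hj, fun m hm hmk l hl => ?_,
      fun l hl hlj => absurd hl (hB l hlj)⟩
    have hlj : l = j := by
      by_contra h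
      exact hB l h hl
    subst hlj
    have h1 := hmax m (hm.trans hk)
    have h2 : sgn * M m l ≠ sgn * M k l := fun h => hM.col_injective hmk (mul_left_cancel₀ hs0 h)
    rw [mul_sub]
    exact sub_pos.2 (lt_of_le_of_ne h1 h2)
  -- both players have ties; `m` and `n` are the remaining row and column
  push Not at hA hB
  obtain ⟨i', hi', hie⟩ := hA
  obtain ⟨j', hj', hje⟩ := hB
  obtain ⟨m, hm⟩ : ∃ m : Fin 3, ∀ k, k = i ∨ k = i' ∨ k = m :=
    (by decide : ∀ i i' : Fin 3, i' ≠ i → ∃ m, ∀ k, k = i ∨ k = i' ∨ k = m) i i' hi'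
  obtain ⟨n, hn⟩ : ∃ n : Fin 3, ∀ k, k = j ∨ k = j' ∨ k = n :=
    (by decide : ∀ i i' : Fin 3, i' ≠ i → ∃ m, ∀ k, k = i ∨ k = i' ∨ k = m) j j' hj'
  have hI : ∀ k, k ≠ m → ∀ a, pay M a x ≤ pay M k x := by
    intro k hk a
    rcases hm k with rfl | rfl | rfl
    · exact hi a
    · rw [hie]; exact hi a
    · exact absurd rfl hk
  have hJ : ∀ l, l ≠ n → ∀ a, cost M l x ≤ cost M a x := by
    intro k hk a
    rcases hn k with rfl | rfl | rfl
    · exact hj a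
    · rw [hje]; exact hj a
    · exact absurd rfl hk
  have hG : ∀ k l, (l = k ∨ l = k + 1) → ¬ TiedAt M k l x := fun k l hkl ht =>
    hΓ ⟨hx, k, l, hkl, ht⟩
  have hmI : ∀ k, k ≠ m → pay M m x ≠ pay M k x := by
    intro k hk h
    refine hG n n (Or.inl rfl) ⟨fun a ha b => ?_, hJ⟩
    by_cases ham : a = m
    · rw [ham, h]; exact hI k hk b
    · exact hI a ham b
  have hnJ : ∀ l, l ≠ n → cost M n x ≠ cost M l x := by
    intro k hk h
    refine hG m m (Or.inl rfl) ⟨hI, fun a ha b => ?_⟩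
    by_cases ham : a = n
    · rw [ham, h]; exact hJ k hk b
    · exact hJ a ham b
  -- the tied rows and columns are those of the only edge outside the hexagon
  have hnm : n = m + 2 := by
    have h1 : ¬ (n = m ∨ n = m + 1) := fun h => hG m n h ⟨hI, hJ⟩
    exact (by decide : ∀ n m : Fin 3, ¬ (n = m ∨ n = m + 1) → n = m + 2) n m h1
  subst hnm
  have a1 : m + 1 ≠ m := by clear * -; revert m; decide
  have a2 : m + 2 ≠ m := by clear * -; revert m; decide
  have a3 : m + 1 ≠ m + 2 := by clear * -; revert m; decide
  have tri : ∀ k, k = m ∨ k = m + 1 ∨ k = m + 2 := by clear * -; revert m; decide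
  rcases hsgn with rfl | rfl
  · refine ⟨(m + 1, m), hI _ a1, hJ _ a2.symm, fun k hk hk1 l hl => ?_, fun l hl hl1 k hk => ?_⟩
    · obtain rfl : k = m + 2 := by
        rcases tri k with rfl | rfl | rfl
        · exact absurd hk (hmI _ a1)
        · exact absurd rfl hk1
        · rfl
      rw [one_mul, sub_pos]
      refine hM.order _ _ _ _ ?_
      rcases tri l with rfl | rfl | rfl
      · clear * -; revert l; decide
      · clear * -; revert m; decide
      · exact absurd hl (hnJ _ a2.symm)
    · obtain rfl : l = m + 1 := by
        rcases tri l with rfl | rfl | rfl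
        · exact absurd rfl hl1
        · rfl
        · exact absurd hl (hnJ _ a2.symm)
      rw [one_mul, sub_pos]
      refine hM.order _ _ _ _ ?_
      rcases tri k with rfl | rfl | rfl
      · exact absurd hk (hmI _ a1)
      · clear * -; revert m; decide
      · clear * -; revert m; decide
  · refine ⟨(m + 2, m + 1), hI _ a2, hJ _ a3, fun k hk hk1 l hl => ?_, fun l hl hl1 k hk => ?_⟩
    · obtain rfl : k = m + 1 := by
        rcases tri k with rfl | rfl | rfl
        · exact absurd hk (hmI _ a2)
        · rfl
        · exact absurd rfl hk1
      rw [neg_one_mul, neg_sub, sub_pos]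
      refine hM.order _ _ _ _ ?_
      rcases tri l with rfl | rfl | rfl
      · clear * -; revert l; decide
      · clear * -; revert m; decide
      · exact absurd hl (hnJ _ a3)
    · obtain rfl : l = m := by
        rcases tri l with rfl | rfl | rfl
        · rfl
        · exact absurd rfl hl1
        · exact absurd hl (hnJ _ a3)
      rw [neg_one_mul, neg_sub, sub_pos]
      refine hM.order _ _ _ _ ?_
      rcases tri k with rfl | rfl | rfl
      · exact absurd hk (hmI _ a2)
      · clear * -; revert l; decide
      · clear * -; revert l; decide

/-- Solutions on the level set are determined locally, in both time directions. -/
lemma IsCyclic.exists_line (hM : IsCyclic M) {x : Phase} (hx : x ∈ levelSet M)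
    {sgn : ℝ} (hsgn : sgn = 1 ∨ sgn = -1) : ∃ w : Phase, ∀ γ : ℝ → Phase,
      IsTraj (hamField M M) γ → γ 0 = x →
      ∃ δ > 0, ∀ t, 0 ≤ t → t ≤ δ → γ (sgn * t) = x + (sgn * t) • w := by
  by_cases hΓ : x ∈ hexagon M
  · exact hM.exists_line_of_mem_hexagon hΓ hsgn
  · obtain ⟨r, h1, h2, d1, d2⟩ := hM.exists_dominant hx hΓ hsgn
    refine ⟨vel M r, fun γ hγ h0 => ?_⟩
    subst h0
    exact hM.eq_line_of_dominant hγ hsgn h1 h2 d1 d2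

/-- The Hamiltonian inclusion generates a continuous flow on the level set. -/
theorem IsCyclic.exists_flow (hM : IsCyclic M) :
    ∃ φ, IsUniqueFlow (hamField M M) (levelSet M) φ := by
  refine exists_isUniqueFlow hM.isTameField (fun γ hγ h0 => hM.mem_levelSet hγ h0)
    fun γ η hγ hη h0 hX => ?_
  obtain ⟨w₁, h₁⟩ := hM.exists_line hX (Or.inl rfl)
  obtain ⟨w₂, h₂⟩ := hM.exists_line hX (Or.inr rfl)
  obtain ⟨δ₁, hδ₁, a₁⟩ := h₁ γ hγ rfl
  obtain ⟨δ₂, hδ₂, a₂⟩ := h₁ η hη h0.symm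
  obtain ⟨δ₃, hδ₃, a₃⟩ := h₂ γ hγ rfl
  obtain ⟨δ₄, hδ₄, a₄⟩ := h₂ η hη h0.symm
  have hpos : 0 < min (min δ₁ δ₂) (min δ₃ δ₄) := by positivity
  filter_upwards [Ioo_mem_nhds (neg_lt_zero.2 hpos) hpos] with t ht
  obtain ⟨ht1, ht2⟩ := ht
  simp only [lt_min_iff, neg_lt, ] at ht1 ht2
  rcases le_total 0 t with h | h
  · have b₁ := a₁ t h (by linarith)
    have b₂ := a₂ t h (by linarith)
    simp only [one_mul] at b₁ b₂
    rw [b₁, b₂]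
  · have b₁ := a₃ (-t) (by linarith) (by linarith)
    have b₂ := a₄ (-t) (by linarith) (by linarith)
    simp only [neg_mul_neg, one_mul] at b₁ b₂
    rw [b₁, b₂]

/-- The flow of the inclusion solves it in the sense of the definition. -/
lemma IsCyclic.isFlow (hM : IsCyclic M) {φ : ℝ → Phase → Phase}
    (hφ : IsUniqueFlow (hamField M M) (levelSet M) φ) : IsFlow M M φ := by
  refine ⟨fun x hx => ⟨hφ.zero x, hφ.mem x hx, (hφ.traj x).caratheodory hM.isTameField,
    fun γ hγ h0 t => ?_⟩, hφ.cont⟩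
  have := hφ.unique γ (isTraj_of_caratheodory hM.isTameField hγ.1 hγ.2) (by rwa [h0]) t
  rwa [h0] at this

/-! ### The level set as a simplicial sphere -/

/-- The six vertices of the level set: `inl k` is the point where all columns and all rows except
`k` are tied, `inr l` the point where all rows and all columns except `l` are tied. -/
abbrev Vtx : Type := Fin 3 ⊕ Fin 3

variable {M : Matrix (Fin 3) (Fin 3) ℝ}

/-- The barycentric coordinates on the region where row `r.1` and column `r.2` are best responses,
as linear functionals: the weighted disadvantages of the other rows and columns. -/
def gap (M : Matrix (Fin 3) (Fin 3) ℝ) (r : Fin 3 × Fin 3) : Vtx → Phase →ₗ[ℝ] ℝ :=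
  Sum.elim (fun k => pStar M k • (pay M r.1 - pay M k)) (fun l => qStar M l • (cost M l - cost M r.2))

/-- The rate of change of `gap M r v` along the flow in the region `r`. -/
def rate (M : Matrix (Fin 3) (Fin 3) ℝ) (r : Fin 3 × Fin 3) : Vtx → ℝ :=
  Sum.elim (fun k => pStar M k * (M r.1 r.2 - M k r.2)) (fun l => qStar M l * (M r.1 l - M r.1 r.2))

lemma gap_inl (r : Fin 3 × Fin 3) (k : Fin 3) (x : Phase) :
    gap M r (Sum.inl k) x = pStar M k * (pay M r.1 x - pay M k x) := rfl

lemma gap_inr (r : Fin 3 × Fin 3) (l : Fin 3) (x : Phase) :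
    gap M r (Sum.inr l) x = qStar M l * (cost M l x - cost M r.2 x) := rfl

@[fun_prop]
lemma continuous_gap (r : Fin 3 × Fin 3) (v : Vtx) : Continuous (gap M r v) :=
  LinearMap.continuous_of_finiteDimensional _

lemma IsCyclic.gap_vel (hM : IsCyclic M) (r : Fin 3 × Fin 3) (v : Vtx) :
    gap M r v (vel M r) = rate M r v := by
  rcases v with k | l
  · rw [gap_inl, vel, hM.pay_vel, hM.pay_vel]
    simp [rate, Pi.single_apply]
  · rw [gap_inr, vel, hM.cost_vel, hM.cost_vel]
    simp [rate, Pi.single_apply]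

/-- The vertices of the level set. -/
def vert (M : Matrix (Fin 3) (Fin 3) ℝ) : Vtx → Phase :=
  Sum.elim (fun k => (pStar M, fun j => qStar M j * (1 + 1 / val M) -
      M.adjugate j k / (M.det * pStar M k)))
    (fun l => (fun i => pStar M i * (1 - 1 / val M) + M.adjugate l i / (M.det * qStar M l), qStar M))

lemma IsCyclic.val_ne (hM : IsCyclic M) : val M ≠ 0 := div_ne_zero hM.det_ne hM.adjSum_ne

lemma IsCyclic.pay_vert (hM : IsCyclic M) (i : Fin 3) (v : Vtx) : pay M i (vert M v) =
    val M + Sum.elim (fun k => 1 - if i = k then 1 / pStar M k else 0) (fun _ => 0) v := by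
  rcases v with k | l
  · have h1 : ∑ j, M i j * M.adjugate j k = if i = k then M.det else 0 := by
      have := congrFun (congrFun M.mul_adjugate i) k
      simpa [Matrix.mul_apply, Matrix.one_apply] using this
    have h2 := hM.mulVec_q i
    have hv := hM.val_ne
    have hp := (hM.p_pos k).ne'
    have hd := hM.det_ne
    rw [pay_apply]
    simp only [vert, Sum.elim_inl, mul_sub, Finset.sum_sub_distrib, ← mul_assoc, ← Finset.sum_mul,
      h2, mul_div_assoc', ← Finset.sum_div, h1]
    split_ifs <;> field_simp <;> ring
  · rw [pay_apply]
    simpa [vert] using hM.mulVec_q i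

lemma IsCyclic.cost_vert (hM : IsCyclic M) (j : Fin 3) (v : Vtx) : cost M j (vert M v) =
    val M + Sum.elim (fun _ => 0) (fun l => (if j = l then 1 / qStar M l else 0) - 1) v := by
  rcases v with k | l
  · rw [cost_apply]
    simpa [vert, mul_comm] using hM.vecMul_p j
  · have h1 : ∑ i, M.adjugate l i * M i j = if j = l then M.det else 0 := by
      have := congrFun (congrFun M.adjugate_mul l) j
      simpa [Matrix.mul_apply, Matrix.one_apply, eq_comm] using this
    have h2 := hM.vecMul_p j
    have hv := hM.val_ne
    have hp := (hM.q_pos l).ne'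
    have hd := hM.det_ne
    rw [cost_apply]
    have : ∀ i, M i j * (pStar M i * (1 - 1 / val M) + M.adjugate l i / (M.det * qStar M l))
        = pStar M i * M i j * (1 - 1 / val M) + M.adjugate l i * M i j / (M.det * qStar M l) := by
      intro i; ring
    simp only [vert, Sum.elim_inr, this, Finset.sum_add_distrib, ← Finset.sum_mul,
      h2, ← Finset.sum_div, h1]
    split_ifs <;> field_simp <;> ring

lemma IsCyclic.vert_mem (hM : IsCyclic M) (v : Vtx) : vert M v ∈ hyperplanes := by
  have ha := hM.adjSum_ne
  have hd := hM.det_ne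
  rcases v with k | l
  · refine ⟨hM.p_sum, ?_⟩
    have hp := (hM.p_pos k).ne'
    have h : ∑ j, M.adjugate j k = pStar M k * adjSum M := by rw [pStar]; field_simp
    simp only [vert, Sum.elim_inl, Finset.sum_sub_distrib, ← Finset.sum_mul, hM.q_sum,
      ← Finset.sum_div, h, val]
    field_simp
    ring
  · refine ⟨?_, hM.q_sum⟩
    have hp := (hM.q_pos l).ne'
    have h : ∑ j, M.adjugate l j = qStar M l * adjSum M := by rw [qStar]; field_simp
    simp only [vert, Sum.elim_inr, Finset.sum_add_distrib, ← Finset.sum_mul, hM.p_sum,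
      ← Finset.sum_div, h, val]
    field_simp
    ring

lemma IsCyclic.p_ne (hM : IsCyclic M) (k : Fin 3) : pStar M k ≠ 0 := (hM.p_pos k).ne'

lemma IsCyclic.q_ne (hM : IsCyclic M) (k : Fin 3) : qStar M k ≠ 0 := (hM.q_pos k).ne'

/-- The coordinates of the vertices: `gap` and `vert` are dual to each other. -/
lemma IsCyclic.gap_vert (hM : IsCyclic M) {r : Fin 3 × Fin 3} {u : Vtx} (h1 : u ≠ Sum.inl r.1)
    (h2 : u ≠ Sum.inr r.2) (v : Vtx) : gap M r v (vert M u) = if u = v then 1 else 0 := by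
  rcases v with k | l
  · rw [gap_inl, hM.pay_vert, hM.pay_vert]
    rcases u with m | m
    · have hm : r.1 ≠ m := fun h => h1 (by rw [h])
      by_cases hk : k = m
      · subst hk
        simp [hm, hM.p_ne]
      · simp [hm, hk, Ne.symm hk]
    · simp
  · rw [gap_inr, hM.cost_vert, hM.cost_vert]
    rcases u with m | m
    · simp
    · have hm : r.2 ≠ m := fun h => h2 (by rw [h])
      by_cases hk : l = m
      · subst hk
        simp [hm, hM.q_ne]
      · simp [hm, hk, Ne.symm hk]

/-- The point with given barycentric coordinates. -/
def bary (M : Matrix (Fin 3) (Fin 3) ℝ) : (Vtx → ℝ) →ₗ[ℝ] Phase :=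
  ∑ v, (LinearMap.proj v : (Vtx → ℝ) →ₗ[ℝ] ℝ).smulRight (vert M v)

lemma bary_apply (w : Vtx → ℝ) : bary M w = ∑ v, w v • vert M v := by
  simp [bary]

lemma bary_single (v : Vtx) : bary M (Pi.single v 1) = vert M v := by
  rw [bary_apply, Finset.sum_eq_single v] <;> simp +contextual

lemma continuous_bary : Continuous (bary M) := LinearMap.continuous_of_finiteDimensional _

lemma IsCyclic.gap_bary (hM : IsCyclic M) {r : Fin 3 × Fin 3} {w : Vtx → ℝ}
    (h1 : w (Sum.inl r.1) = 0) (h2 : w (Sum.inr r.2) = 0) (v : Vtx) :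
    gap M r v (bary M w) = w v := by
  rw [bary_apply, map_sum, Finset.sum_eq_single v]
  · by_cases e1 : v = Sum.inl r.1
    · rw [e1, h1]; simp
    by_cases e2 : v = Sum.inr r.2
    · rw [e2, h2]; simp
    rw [map_smul, hM.gap_vert e1 e2]; simp
  · intro u _ hu
    by_cases e1 : u = Sum.inl r.1
    · rw [e1, h1]; simp
    by_cases e2 : u = Sum.inr r.2
    · rw [e2, h2]; simp
    rw [map_smul, hM.gap_vert e1 e2, if_neg hu, smul_zero]
  · simp

/-- The affine hull of the region `r` of the level set. -/
def regionSpan (M : Matrix (Fin 3) (Fin 3) ℝ) (r : Fin 3 × Fin 3) : Set Phase :=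
  {x | x ∈ hyperplanes ∧ pay M r.1 x - cost M r.2 x = 1}

lemma IsCyclic.average_pay (hM : IsCyclic M) (x : Phase) :
    ∑ i, pStar M i * pay M i x = val M * ∑ j, x.2 j := by
  simp only [pay_apply, Finset.mul_sum, ← mul_assoc]
  rw [Finset.sum_comm]
  simp only [← Finset.sum_mul, hM.vecMul_p]

lemma IsCyclic.average_cost (hM : IsCyclic M) (x : Phase) :
    ∑ j, qStar M j * cost M j x = val M * ∑ i, x.1 i := by
  simp only [cost_apply, Finset.mul_sum]
  rw [Finset.sum_comm]
  refine Finset.sum_congr rfl fun i _ => ?_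
  rw [← hM.mulVec_q i, Finset.sum_mul]
  exact Finset.sum_congr rfl fun j _ => by ring

lemma IsCyclic.sum_gap_inl (hM : IsCyclic M) (r : Fin 3 × Fin 3) (x : Phase) :
    ∑ k, gap M r (Sum.inl k) x = pay M r.1 x - val M * ∑ j, x.2 j := by
  simp only [gap_inl, mul_sub, Finset.sum_sub_distrib, ← Finset.sum_mul, hM.p_sum, one_mul,
    hM.average_pay]

lemma IsCyclic.sum_gap_inr (hM : IsCyclic M) (r : Fin 3 × Fin 3) (x : Phase) :
    ∑ k, gap M r (Sum.inr k) x = val M * ∑ i, x.1 i - cost M r.2 x := by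
  simp only [gap_inr, mul_sub, Finset.sum_sub_distrib, ← Finset.sum_mul, hM.q_sum, one_mul,
    hM.average_cost]

lemma IsCyclic.sum_gap (hM : IsCyclic M) {r : Fin 3 × Fin 3} {x : Phase}
    (hx : x ∈ regionSpan M r) : ∑ v, gap M r v x = 1 := by
  rw [Fintype.sum_sum_type, hM.sum_gap_inl, hM.sum_gap_inr, hx.1.1, hx.1.2, ← hx.2]
  ring

/-- Points with equal sums are determined by the payoffs of the rows and columns. -/
lemma IsCyclic.ext_pay_cost (hM : IsCyclic M) {x y : Phase} (h1 : ∑ i, x.1 i = ∑ i, y.1 i)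
    (h2 : ∑ i, x.2 i = ∑ i, y.2 i) (hp : ∀ i, pay M i x = pay M i y)
    (hc : ∀ j, cost M j x = cost M j y) : x = y := by
  have e2 : x.2 - y.2 = 0 := by
    refine hM.eq_zero_of_mulVec (t := 0) (by simp [h2]) fun i => ?_
    have := hp i
    rw [pay_apply, pay_apply] at this
    simp [mul_sub, this]
  have e1 : x.1 - y.1 = 0 := by
    refine hM.eq_zero_of_vecMul (t := 0) (by simp [h1]) fun i => ?_
    have := hc i
    rw [cost_apply, cost_apply] at this
    simp only [mul_comm _ (M _ _)]
    simp [mul_sub, this]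
  exact Prod.ext (sub_eq_zero.1 e1) (sub_eq_zero.1 e2)

lemma IsCyclic.bary_fst (hM : IsCyclic M) (w : Vtx → ℝ) : ∑ i, (bary M w).1 i = ∑ v, w v := by
  simp only [bary_apply, Prod.fst_sum, Finset.sum_apply, Prod.smul_fst, Pi.smul_apply, smul_eq_mul]
  rw [Finset.sum_comm]
  simp only [← Finset.mul_sum, (hM.vert_mem _).1, mul_one]

lemma IsCyclic.bary_snd (hM : IsCyclic M) (w : Vtx → ℝ) : ∑ i, (bary M w).2 i = ∑ v, w v := by
  simp only [bary_apply, Prod.snd_sum, Finset.sum_apply, Prod.smul_snd, Pi.smul_apply, smul_eq_mul]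
  rw [Finset.sum_comm]
  simp only [← Finset.mul_sum, (hM.vert_mem _).2, mul_one]

lemma IsCyclic.pay_bary (hM : IsCyclic M) (w : Vtx → ℝ) (i : Fin 3) : pay M i (bary M w) =
    val M * ∑ v, w v + ∑ k, w (Sum.inl k) - w (Sum.inl i) / pStar M i := by
  rw [bary_apply, map_sum, Fintype.sum_sum_type, Fintype.sum_sum_type]
  simp only [map_smul, hM.pay_vert, smul_eq_mul, Sum.elim_inl, Sum.elim_inr, mul_add, mul_sub,
    Finset.sum_add_distrib, Finset.sum_sub_distrib, mul_ite, mul_zero, Finset.sum_ite_eq,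
    Finset.mem_univ, if_true, ← Finset.sum_mul, Finset.sum_const_zero]
  ring

lemma IsCyclic.cost_bary (hM : IsCyclic M) (w : Vtx → ℝ) (j : Fin 3) : cost M j (bary M w) =
    val M * ∑ v, w v - ∑ k, w (Sum.inr k) + w (Sum.inr j) / qStar M j := by
  rw [bary_apply, map_sum, Fintype.sum_sum_type, Fintype.sum_sum_type]
  simp only [map_smul, hM.cost_vert, smul_eq_mul, Sum.elim_inl, Sum.elim_inr, mul_add, mul_sub,
    Finset.sum_add_distrib, Finset.sum_sub_distrib, mul_ite, mul_zero, Finset.sum_ite_eq,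
    Finset.mem_univ, if_true, ← Finset.sum_mul, Finset.sum_const_zero]
  ring

lemma IsCyclic.bary_gap (hM : IsCyclic M) {r : Fin 3 × Fin 3} {x : Phase} (hx : x ∈ regionSpan M r) :
    bary M (fun v => gap M r v x) = x := by
  have hs := hM.sum_gap hx
  refine hM.ext_pay_cost ?_ ?_ (fun i => ?_) fun j => ?_
  · rw [hM.bary_fst, hs, hx.1.1]
  · rw [hM.bary_snd, hs, hx.1.2]
  · rw [hM.pay_bary, hs, hM.sum_gap_inl, hx.1.2, gap_inl, mul_div_cancel_left₀ _ (hM.p_ne i)]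
    ring
  · rw [hM.cost_bary, hs, hM.sum_gap_inr, hx.1.1, gap_inr, mul_div_cancel_left₀ _ (hM.q_ne j)]
    ring

lemma IsCyclic.bary_mem_regionSpan (hM : IsCyclic M) {r : Fin 3 × Fin 3} {w : Vtx → ℝ}
    (h1 : w (Sum.inl r.1) = 0) (h2 : w (Sum.inr r.2) = 0) (hs : ∑ v, w v = 1) :
    bary M w ∈ regionSpan M r := by
  refine ⟨⟨by rw [hM.bary_fst, hs], by rw [hM.bary_snd, hs]⟩, ?_⟩
  rw [hM.pay_bary, hM.cost_bary, h1, h2, ← hs, Fintype.sum_sum_type]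
  simp

lemma gap_own₁ (r : Fin 3 × Fin 3) (x : Phase) : gap M r (Sum.inl r.1) x = 0 := by
  simp [gap_inl]

lemma gap_own₂ (r : Fin 3 × Fin 3) (x : Phase) : gap M r (Sum.inr r.2) x = 0 := by
  simp [gap_inr]

/-- The region of the level set on which row `r.1` and column `r.2` are best responses. -/
def region (M : Matrix (Fin 3) (Fin 3) ℝ) (r : Fin 3 × Fin 3) : Set Phase :=
  {x | x ∈ regionSpan M r ∧ ∀ v, 0 ≤ gap M r v x}

lemma IsCyclic.mem_region_iff (hM : IsCyclic M) {r : Fin 3 × Fin 3} {x : Phase} :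
    x ∈ region M r ↔ x ∈ levelSet M ∧ (∀ k, pay M k x ≤ pay M r.1 x) ∧
      ∀ l, cost M r.2 x ≤ cost M l x := by
  have key : (∀ v, 0 ≤ gap M r v x) ↔ (∀ k, pay M k x ≤ pay M r.1 x) ∧
      ∀ l, cost M r.2 x ≤ cost M l x := by
    simp only [Sum.forall, gap_inl, gap_inr, mul_nonneg_iff_of_pos_left (hM.p_pos _),
      mul_nonneg_iff_of_pos_left (hM.q_pos _), sub_nonneg]
  have e : (x ∈ region M r) = (x ∈ regionSpan M r ∧ ∀ v, 0 ≤ gap M r v x) := rfl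
  rw [e, key]
  refine and_congr_left fun h => ?_
  have e' : (x ∈ levelSet M) = (x ∈ hyperplanes ∧ ham M x = 1) := rfl
  rw [e', ham_eq, iSup_pay_eq h.1, iInf_cost_eq h.2]
  rfl

lemma IsCyclic.exists_region (hM : IsCyclic M) {x : Phase} (hx : x ∈ levelSet M) :
    ∃ r, x ∈ region M r := by
  obtain ⟨i, hi⟩ := exists_max_pay M x
  obtain ⟨j, hj⟩ := exists_min_cost M x
  exact ⟨(i, j), hM.mem_region_iff.2 ⟨hx, hi, hj⟩⟩

lemma isClosed_region (r : Fin 3 × Fin 3) : IsClosed (region M r) := by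
  have : region M r = ({x | ∑ i, x.1 i = 1} ∩ {x | ∑ i, x.2 i = 1} ∩
      {x | pay M r.1 x - cost M r.2 x = 1}) ∩ ⋂ v, {x | 0 ≤ gap M r v x} := by
    ext x; simp [region, regionSpan, hyperplanes]
  rw [this]
  refine (((isClosed_eq (by fun_prop) (by fun_prop)).inter
    (isClosed_eq (by fun_prop) (by fun_prop))).inter
    (isClosed_eq (by fun_prop) (by fun_prop))).inter
    (isClosed_iInter fun v => isClosed_le (by fun_prop) (by fun_prop))

/-- The barycentric coordinates of a point of the level set. -/
def coord (M : Matrix (Fin 3) (Fin 3) ℝ) (x : Phase) : Vtx → ℝ :=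
  Sum.elim (fun k => pStar M k * ((⨆ i, pay M i x) - pay M k x))
    (fun l => qStar M l * (cost M l x - ⨅ j, cost M j x))

lemma IsCyclic.coord_eq (hM : IsCyclic M) {r : Fin 3 × Fin 3} {x : Phase} (hx : x ∈ region M r) :
    coord M x = fun v => gap M r v x := by
  obtain ⟨-, h1, h2⟩ := hM.mem_region_iff.1 hx
  funext v
  rcases v with k | l
  · simp [coord, gap_inl, iSup_pay_eq h1]
  · simp [coord, gap_inr, iInf_cost_eq h2]

lemma IsCyclic.coord_nonneg (hM : IsCyclic M) (x : Phase) (v : Vtx) : 0 ≤ coord M x v := by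
  rcases v with k | l
  · exact mul_nonneg (hM.p_pos k).le (sub_nonneg.2 (pay_le_iSup x k))
  · exact mul_nonneg (hM.q_pos l).le (sub_nonneg.2 (iInf_le_cost x l))

lemma IsCyclic.sum_coord (hM : IsCyclic M) {x : Phase} (hx : x ∈ levelSet M) :
    ∑ v, coord M x v = 1 := by
  obtain ⟨r, hr⟩ := hM.exists_region hx
  rw [hM.coord_eq hr, hM.sum_gap hr.1]

lemma IsCyclic.bary_coord (hM : IsCyclic M) {x : Phase} (hx : x ∈ levelSet M) :
    bary M (coord M x) = x := by
  obtain ⟨r, hr⟩ := hM.exists_region hx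
  rw [hM.coord_eq hr, hM.bary_gap hr.1]

/-- A point lies in a region iff the two corresponding coordinates vanish. -/
lemma IsCyclic.mem_region_iff_coord (hM : IsCyclic M) {r : Fin 3 × Fin 3} {x : Phase}
    (hx : x ∈ levelSet M) :
    x ∈ region M r ↔ coord M x (Sum.inl r.1) = 0 ∧ coord M x (Sum.inr r.2) = 0 := by
  rw [hM.mem_region_iff]
  simp only [coord, Sum.elim_inl, Sum.elim_inr, mul_eq_zero, hM.p_ne, hM.q_ne, false_or,
    sub_eq_zero]
  refine ⟨fun h => ⟨iSup_pay_eq h.2.1, (iInf_cost_eq h.2.2).symm⟩, fun h => ⟨hx, fun k => ?_,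
    fun l => ?_⟩⟩
  · rw [← h.1]; exact pay_le_iSup x k
  · rw [h.2]; exact iInf_le_cost x l

lemma IsCyclic.bary_mem_region (hM : IsCyclic M) {r : Fin 3 × Fin 3} {w : Vtx → ℝ}
    (h1 : w (Sum.inl r.1) = 0) (h2 : w (Sum.inr r.2) = 0) (hs : ∑ v, w v = 1) (h0 : ∀ v, 0 ≤ w v) :
    bary M w ∈ region M r :=
  ⟨hM.bary_mem_regionSpan h1 h2 hs, fun v => by rw [hM.gap_bary h1 h2]; exact h0 v⟩

lemma IsCyclic.coord_bary (hM : IsCyclic M) {r : Fin 3 × Fin 3} {w : Vtx → ℝ}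
    (h1 : w (Sum.inl r.1) = 0) (h2 : w (Sum.inr r.2) = 0) (hs : ∑ v, w v = 1) (h0 : ∀ v, 0 ≤ w v) :
    coord M (bary M w) = w := by
  rw [hM.coord_eq (hM.bary_mem_region h1 h2 hs h0)]
  exact funext fun v => hM.gap_bary h1 h2 v

lemma region_subset (hM : IsCyclic M) {r : Fin 3 × Fin 3} : region M r ⊆ levelSet M :=
  fun _ hx => (hM.mem_region_iff.1 hx).1

lemma isClosed_levelSet : IsClosed (levelSet M) := by
  have : levelSet M = {x | ∑ i, x.1 i = 1} ∩ {x | ∑ i, x.2 i = 1} ∩ {x | ham M x = 1} := by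
    ext x; simp [levelSet, hyperplanes]
  rw [this]
  exact ((isClosed_eq (by fun_prop) (by fun_prop)).inter
    (isClosed_eq (by fun_prop) (by fun_prop))).inter (isClosed_eq continuous_ham (by fun_prop))

/-- The face of the level set with vertex set `F`. -/
def face (M : Matrix (Fin 3) (Fin 3) ℝ) (F : Finset Vtx) : Set Phase :=
  {x | x ∈ levelSet M ∧ ∀ v, v ∉ F → coord M x v = 0}

/-- `F` is the vertex set of a face: it misses a row and a column. -/
def IsFace (F : Finset Vtx) : Prop := ∃ r : Fin 3 × Fin 3, Sum.inl r.1 ∉ F ∧ Sum.inr r.2 ∉ F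

instance (F : Finset Vtx) : Decidable (IsFace F) := by unfold IsFace; infer_instance

lemma sum_single_apply (v : Vtx) : ∑ u, (Pi.single v 1 : Vtx → ℝ) u = 1 := by
  simp

lemma IsCyclic.vert_mem_region (hM : IsCyclic M) {r : Fin 3 × Fin 3} {v : Vtx}
    (h1 : v ≠ Sum.inl r.1) (h2 : v ≠ Sum.inr r.2) : vert M v ∈ region M r := by
  rw [← bary_single]
  refine hM.bary_mem_region ?_ ?_ (sum_single_apply v) fun u => ?_
  · exact Pi.single_eq_of_ne (Ne.symm h1) _
  · exact Pi.single_eq_of_ne (Ne.symm h2) _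
  · by_cases h : u = v
    · subst h; simp
    · simp [h]

lemma IsCyclic.coord_vert (hM : IsCyclic M) (v : Vtx) : coord M (vert M v) = Pi.single v 1 := by
  obtain ⟨r, h1, h2⟩ : ∃ r : Fin 3 × Fin 3, v ≠ Sum.inl r.1 ∧ v ≠ Sum.inr r.2 := by
    revert v; decide
  rw [hM.coord_eq (hM.vert_mem_region h1 h2)]
  funext u
  rw [hM.gap_vert h1 h2, Pi.single_apply]
  simp [eq_comm]

lemma IsCyclic.vert_injective (hM : IsCyclic M) : Function.Injective (vert M) := by
  intro u v h
  have := congrArg (coord M) h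
  rw [hM.coord_vert, hM.coord_vert] at this
  by_contra hne
  have h2 := congrFun this u
  simp [hne] at h2

lemma IsCyclic.vert_mem_levelSet (hM : IsCyclic M) (v : Vtx) : vert M v ∈ levelSet M := by
  obtain ⟨r, h1, h2⟩ : ∃ r : Fin 3 × Fin 3, v ≠ Sum.inl r.1 ∧ v ≠ Sum.inr r.2 := by
    revert v; decide
  exact region_subset hM (hM.vert_mem_region h1 h2)

lemma convex_region (r : Fin 3 × Fin 3) : Convex ℝ (region M r) := by
  rintro x ⟨⟨⟨hx1, hx2⟩, hx3⟩, hx4⟩ y ⟨⟨⟨hy1, hy2⟩, hy3⟩, hy4⟩ a b ha hb hab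
  refine ⟨⟨⟨?_, ?_⟩, ?_⟩, fun v => ?_⟩
  · simp [Finset.sum_add_distrib, ← Finset.mul_sum, hx1, hy1, hab]
  · simp [Finset.sum_add_distrib, ← Finset.mul_sum, hx2, hy2, hab]
  · simp only [map_add, map_smul, smul_eq_mul]
    linear_combination a * hx3 + b * hy3 + hab
  · simp only [map_add, map_smul, smul_eq_mul]
    exact add_nonneg (mul_nonneg ha (hx4 v)) (mul_nonneg hb (hy4 v))

/-- The faces are the simplices spanned by their vertices. -/
lemma IsCyclic.convexHull_vert (hM : IsCyclic M) {F : Finset Vtx} (hF : IsFace F) :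
    convexHull ℝ (vert M '' F) = face M F := by
  obtain ⟨r, h1, h2⟩ := hF
  apply subset_antisymm
  · have hface : face M F = region M r ∩ {x | ∀ v, v ∉ F → gap M r v x = 0} := by
      ext x
      constructor
      · rintro ⟨hx, h⟩
        have hr := (hM.mem_region_iff_coord (r := r) hx).2 ⟨h _ h1, h _ h2⟩
        exact ⟨hr, fun v hv => by rw [← congrFun (hM.coord_eq hr) v]; exact h v hv⟩
      · rintro ⟨hr, h⟩
        exact ⟨region_subset hM hr, fun v hv => by rw [hM.coord_eq hr]; exact h v hv⟩
    refine convexHull_min ?_ ?_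
    · rintro _ ⟨v, hv, rfl⟩
      refine ⟨hM.vert_mem_levelSet v, fun u hu => ?_⟩
      rw [hM.coord_vert, Pi.single_eq_of_ne]
      rintro rfl
      exact hu hv
    · rw [hface]
      refine (convex_region r).inter ?_
      intro x hx y hy a b _ _ _ v hv
      simp [hx v hv, hy v hv]
  · rintro x ⟨hx, h⟩
    rw [← hM.bary_coord hx, bary_apply, ← Finset.sum_subset (Finset.subset_univ F)]
    · refine (convex_convexHull ℝ _).sum_mem (fun v _ => hM.coord_nonneg x v) ?_
        fun v hv => subset_convexHull ℝ _ (mem_image_of_mem _ hv)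
      rw [← hM.sum_coord hx]
      exact Finset.sum_subset (Finset.subset_univ F) fun v _ hv => h v hv
    · intro v _ hv
      rw [h v hv, zero_smul]

lemma IsFace.mono {F G : Finset Vtx} (hF : IsFace F) (h : G ⊆ F) : IsFace G := by
  obtain ⟨r, h1, h2⟩ := hF
  exact ⟨r, fun hh => h1 (h hh), fun hh => h2 (h hh)⟩

/-- Two faces meet in the face spanned by their common vertices. -/
lemma face_inter (F G : Finset Vtx) : face M F ∩ face M G = face M (F ∩ G) := by
  ext x
  constructor
  · rintro ⟨⟨hx, h1⟩, -, h2⟩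
    refine ⟨hx, fun v hv => ?_⟩
    by_cases hF : v ∈ F
    · exact h2 v fun hG => hv (Finset.mem_inter.2 ⟨hF, hG⟩)
    · exact h1 v hF
  · rintro ⟨hx, h⟩
    exact ⟨⟨hx, fun v hv => h v fun hh => hv (Finset.mem_inter.1 hh).1⟩,
      hx, fun v hv => h v fun hh => hv (Finset.mem_inter.1 hh).2⟩

lemma continuous_coord (v : Vtx) : Continuous fun x => coord M x v := by
  have hs : Continuous fun x => ⨆ i, pay M i x := by
    have : (fun x => ⨆ i, pay M i x)
        = fun x => Finset.univ.sup' Finset.univ_nonempty (fun i => pay M i x) := by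
      funext x; rw [Finset.sup'_univ_eq_ciSup]
    rw [this]
    exact Continuous.finset_sup'_apply _ fun i _ => continuous_pay i
  have hi : Continuous fun x => ⨅ i, cost M i x := by
    have : (fun x => ⨅ i, cost M i x)
        = fun x => Finset.univ.inf' Finset.univ_nonempty (fun i => cost M i x) := by
      funext x; rw [Finset.inf'_univ_eq_ciInf]
    rw [this]
    exact Continuous.finset_inf'_apply _ fun i _ => continuous_cost i
  rcases v with k | l
  · simp only [coord, Sum.elim_inl]; fun_prop
  · simp only [coord, Sum.elim_inr]; fun_prop

lemma isClosed_face (F : Finset Vtx) : IsClosed (face M F) := by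
  have : face M F = levelSet M ∩ ⋂ v, ⋂ (_ : v ∉ F), {x | coord M x v = 0} := by
    ext x; simp only [face, mem_inter_iff, mem_iInter]; rfl
  rw [this]
  exact isClosed_levelSet.inter (isClosed_iInter fun v => isClosed_iInter fun _ =>
    isClosed_eq (continuous_coord v) continuous_const)

lemma IsCyclic.isCompact_levelSet (hM : IsCyclic M) : IsCompact (levelSet M) := by
  refine IsCompact.of_isClosed_subset ((isCompact_Icc (a := (0 : Vtx → ℝ)) (b := 1)).image
    continuous_bary) isClosed_levelSet fun x hx => ⟨coord M x, ⟨hM.coord_nonneg x, fun v => ?_⟩,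
    hM.bary_coord hx⟩
  rw [Pi.one_apply, ← hM.sum_coord hx]
  exact Finset.single_le_sum (f := coord M x) (fun u _ => hM.coord_nonneg x u) (Finset.mem_univ v)

variable {M : Matrix (Fin 3) (Fin 3) ℝ}

/-! ### The hexagonal periodic orbit -/

lemma IsCyclic.pay_center (hM : IsCyclic M) (i : Fin 3) :
    pay M i (pStar M, qStar M) = val M := by
  rw [pay_apply]; exact hM.mulVec_q i

lemma IsCyclic.cost_center (hM : IsCyclic M) (j : Fin 3) :
    cost M j (pStar M, qStar M) = val M := by
  rw [cost_apply, ← hM.vecMul_p j]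
  exact Finset.sum_congr rfl fun i _ => mul_comm _ _

/-- The barycentric representation off the level set. -/
lemma IsCyclic.bary_gap_eq (hM : IsCyclic M) (r : Fin 3 × Fin 3) {x : Phase}
    (hx : ∑ i, x.1 i = ∑ j, x.2 j) : bary M (fun v => gap M r v x) =
      x + (pay M r.1 x - cost M r.2 x - ∑ i, x.1 i) • ((pStar M, qStar M) : Phase) := by
  have hs : ∑ v, gap M r v x = pay M r.1 x - cost M r.2 x := by
    rw [Fintype.sum_sum_type, hM.sum_gap_inl, hM.sum_gap_inr, hx]; ring
  refine hM.ext_pay_cost ?_ ?_ (fun i => ?_) fun j => ?_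
  · rw [hM.bary_fst, hs]
    simp [Finset.sum_add_distrib, ← Finset.mul_sum, hM.p_sum]
  · rw [hM.bary_snd, hs]
    simp [Finset.sum_add_distrib, ← Finset.mul_sum, hM.q_sum, hx]
  · rw [hM.pay_bary, hs, hM.sum_gap_inl, ← hx, gap_inl, mul_div_cancel_left₀ _ (hM.p_ne i), map_add,
      map_smul, hM.pay_center, smul_eq_mul]
    ring
  · rw [hM.cost_bary, hs, hM.sum_gap_inr, gap_inr, mul_div_cancel_left₀ _ (hM.q_ne j), map_add,
      map_smul, hM.cost_center, smul_eq_mul]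
    ring

lemma IsSubgame.mem_stdSimplex {i₁ i₂ i₃ j₁ j₂ j₃ : Fin 3} {θ₁ θ₂ κ₁ κ₂ : ℝ}
    (h : IsSubgame M i₁ i₂ i₃ j₁ j₂ j₃ θ₁ θ₂ κ₁ κ₂) :
    (Pi.single i₁ θ₁ + Pi.single i₂ θ₂ : Fin 3 → ℝ) ∈ stdSimplex ℝ (Fin 3) ∧
    (Pi.single j₁ κ₁ + Pi.single j₂ κ₂ : Fin 3 → ℝ) ∈ stdSimplex ℝ (Fin 3) := by
  have h1 := h.θ₁_pos.le
  have h2 := h.θ₂_pos.le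
  have h3 := h.κ₁_pos.le
  have h4 := h.κ₂_pos.le
  refine ⟨⟨fun i => ?_, ?_⟩, ⟨fun i => ?_, ?_⟩⟩
  · simp only [Pi.add_apply, Pi.single_apply]
    split_ifs <;> positivity
  · simp [Finset.sum_add_distrib, h.θ_sum]
  · simp only [Pi.add_apply, Pi.single_apply]
    split_ifs <;> positivity
  · simp [Finset.sum_add_distrib, h.κ_sum]

lemma IsCyclic.pay_edgeVel (hM : IsCyclic M) {i₁ i₂ j₁ j₂ : Fin 3} {θ₁ θ₂ κ₁ κ₂ : ℝ} (i : Fin 3) :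
    pay M i (edgeVel M i₁ i₂ j₁ j₂ θ₁ θ₂ κ₁ κ₂) = κ₁ * M i j₁ + κ₂ * M i j₂ - val M := by
  rw [edgeVel, hM.pay_vel]
  simp [mul_add, Finset.sum_add_distrib, Pi.single_apply, mul_comm]

lemma IsCyclic.cost_edgeVel (hM : IsCyclic M) {i₁ i₂ j₁ j₂ : Fin 3} {θ₁ θ₂ κ₁ κ₂ : ℝ} (j : Fin 3) :
    cost M j (edgeVel M i₁ i₂ j₁ j₂ θ₁ θ₂ κ₁ κ₂) = θ₁ * M i₁ j + θ₂ * M i₂ j - val M := by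
  rw [edgeVel, hM.cost_vel]
  simp [mul_add, Finset.sum_add_distrib, Pi.single_apply, mul_comm]

/-- The velocity on an edge is directed along the edge. -/
lemma IsCyclic.edgeVel_eq (hM : IsCyclic M) {i₁ i₂ i₃ j₁ j₂ j₃ : Fin 3} {θ₁ θ₂ κ₁ κ₂ : ℝ}
    (h : IsSubgame M i₁ i₂ i₃ j₁ j₂ j₃ θ₁ θ₂ κ₁ κ₂) : edgeVel M i₁ i₂ j₁ j₂ θ₁ θ₂ κ₁ κ₂ =
      (pStar M i₃ * (κ₁ * M i₁ j₁ + κ₂ * M i₁ j₂ - (κ₁ * M i₃ j₁ + κ₂ * M i₃ j₂))) •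
        (vert M (Sum.inl i₃) - vert M (Sum.inr j₃)) := by
  obtain ⟨hs1, hs2⟩ := h.mem_stdSimplex
  set u := edgeVel M i₁ i₂ j₁ j₂ θ₁ θ₂ κ₁ κ₂ with hu
  set c := pStar M i₃ * (κ₁ * M i₁ j₁ + κ₂ * M i₁ j₂ - (κ₁ * M i₃ j₁ + κ₂ * M i₃ j₂)) with hc
  have e1 : ∑ i, u.1 i = 0 := by
    have := hs1.2
    simp only [hu, edgeVel, Pi.sub_apply, Finset.sum_sub_distrib, hM.p_sum, this, sub_self]
  have e2 : ∑ i, u.2 i = 0 := by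
    have := hs2.2
    simp only [hu, edgeVel, Pi.sub_apply, Finset.sum_sub_distrib, hM.q_sum, this, sub_self]
  have e3 : pay M i₁ u - cost M j₁ u = 0 := by
    rw [hu, hM.pay_edgeVel, hM.cost_edgeVel]
    linear_combination θ₂ * h.κ_eq - κ₂ * h.θ_eq - (κ₁ * M i₁ j₁ + κ₂ * M i₁ j₂) * h.θ_sum
      + (θ₁ * M i₁ j₁ + θ₂ * M i₂ j₁) * h.κ_sum
  have hb := hM.bary_gap_eq (i₁, j₁) (x := u) (by rw [e1, e2])
  simp only [e1, e3, sub_zero, zero_smul, add_zero] at hb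
  have g1 : gap M (i₁, j₁) (Sum.inl i₃) u = c := by
    rw [gap_inl, hu, hM.pay_edgeVel, hM.pay_edgeVel, hc]; ring
  have g2 : gap M (i₁, j₁) (Sum.inl i₁) u = 0 := gap_own₁ (i₁, j₁) u
  have g3 : gap M (i₁, j₁) (Sum.inr j₁) u = 0 := gap_own₂ (i₁, j₁) u
  have g4 : gap M (i₁, j₁) (Sum.inl i₂) u = 0 := by
    rw [gap_inl, hu, hM.pay_edgeVel, hM.pay_edgeVel, h.κ_eq]; ring
  have g5 : gap M (i₁, j₁) (Sum.inr j₂) u = 0 := by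
    rw [gap_inr, hu, hM.cost_edgeVel, hM.cost_edgeVel, h.θ_eq]; ring
  have g6 : gap M (i₁, j₁) (Sum.inr j₃) u = -c := by
    have := hM.sum_gap_inl (i₁, j₁) u
    have h2 := hM.sum_gap_inr (i₁, j₁) u
    rw [h.rows, e2, g1, g2, g4] at this
    rw [h.cols, e1, g3, g5] at h2
    simp only at this h2
    linarith
  have hrows : (Finset.univ : Finset (Fin 3)) = {i₁, i₂, i₃} := by
    ext k; simpa using (h.idx k).1
  have hcols : (Finset.univ : Finset (Fin 3)) = {j₁, j₂, j₃} := by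
    ext k; simpa using (h.idx k).2
  rw [← hb, bary_apply, Fintype.sum_sum_type, hrows,
    Finset.sum_insert (by simp [h.rows_ne]), Finset.sum_pair h.rows_ne.2.2, ← hrows, hcols,
    Finset.sum_insert (by simp [h.cols_ne]), Finset.sum_pair h.cols_ne.2.2, g1, g2, g3, g4, g5, g6]
  module

/-- The vertices of the hexagon in the order in which the flow visits them. -/
def hexVtx : Fin 6 → Vtx :=
  ![Sum.inl 0, Sum.inr 1, Sum.inl 1, Sum.inr 2, Sum.inl 2, Sum.inr 0]

/-- The vertex sets of the edges of the hexagon. -/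
def hexEdge (i : Fin 6) : Finset Vtx := {hexVtx i, hexVtx (i + 1)}

lemma hexVtx_injective : Function.Injective hexVtx := by decide

lemma isFace_hexEdge (i : Fin 6) : IsFace (hexEdge i) := by revert i; decide

lemma IsCyclic.segment_hex (hM : IsCyclic M) (i : Fin 6) :
    segment ℝ (vert M (hexVtx i)) (vert M (hexVtx (i + 1))) = face M (hexEdge i) := by
  rw [← hM.convexHull_vert (isFace_hexEdge i), ← convexHull_pair]
  simp [hexEdge, image_pair]

lemma IsCyclic.tiedAt_iff (hM : IsCyclic M) {x : Phase} {k l : Fin 3} :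
    TiedAt M k l x ↔ ∀ v, v ∉ ({Sum.inl k, Sum.inr l} : Finset Vtx) → coord M x v = 0 := by
  simp only [Sum.forall, Finset.mem_insert, Finset.mem_singleton, Sum.inl.injEq, Sum.inr.injEq,
    reduceCtorEq, or_false, false_or, coord, Sum.elim_inl, Sum.elim_inr, mul_eq_zero, hM.p_ne,
    hM.q_ne, sub_eq_zero]
  refine ⟨fun h => ⟨fun i hi => iSup_pay_eq (h.1 i hi), fun j hj => (iInf_cost_eq (h.2 j hj)).symm⟩,
    fun h => ⟨fun i hi m => ?_, fun j hj m => ?_⟩⟩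
  · rw [← h.1 i hi]; exact pay_le_iSup x m
  · rw [h.2 j hj]; exact iInf_le_cost x m

lemma hexEdge_eq (k l : Fin 3) (h : l = k ∨ l = k + 1) :
    ∃ i, hexEdge i = {Sum.inl k, Sum.inr l} := by
  revert k l; decide

lemma exists_hexEdge (i : Fin 6) :
    ∃ k l : Fin 3, (l = k ∨ l = k + 1) ∧ hexEdge i = {Sum.inl k, Sum.inr l} := by
  revert i; decide

lemma IsCyclic.mem_hexagon_iff (hM : IsCyclic M) {x : Phase} :
    x ∈ hexagon M ↔ ∃ i, x ∈ face M (hexEdge i) := by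
  constructor
  · rintro ⟨hx, k, l, hkl, ht⟩
    obtain ⟨i, hi⟩ := hexEdge_eq k l hkl
    exact ⟨i, hx, by rw [hi]; exact hM.tiedAt_iff.1 ht⟩
  · rintro ⟨i, hx, h⟩
    obtain ⟨k, l, hkl, hi⟩ := exists_hexEdge i
    exact ⟨hx, k, l, hkl, hM.tiedAt_iff.2 (by rw [← hi]; exact h)⟩

lemma IsCyclic.hexagon_eq (hM : IsCyclic M) :
    hexagon M = ⋃ i, segment ℝ (vert M (hexVtx i)) (vert M (hexVtx (i + 1))) := by
  ext x
  simp only [mem_iUnion, hM.segment_hex, hM.mem_hexagon_iff]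

/-- Vertices that do not include all of a row set or a column set are affinely independent. -/
lemma IsCyclic.affineIndependent_vert (hM : IsCyclic M) {ι : Type*} [Fintype ι] {f : ι → Vtx}
    (hf : Function.Injective f) {r : Fin 3 × Fin 3} (h1 : ∀ i, f i ≠ Sum.inl r.1)
    (h2 : ∀ i, f i ≠ Sum.inr r.2) : AffineIndependent ℝ (fun i => vert M (f i)) := by
  rw [affineIndependent_iff]
  intro s w _ hw i hi
  have := congrArg (gap M r (f i)) hw
  rw [map_sum, map_zero, Finset.sum_eq_single i] at this
  · simpa [hM.gap_vert (h1 i) (h2 i)] using this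
  · intro j _ hj
    rw [map_smul, hM.gap_vert (h1 j) (h2 j), if_neg (fun h => hj (hf h)), smul_zero]
  · exact fun h => absurd hi h

lemma IsCyclic.isHexagon (hM : IsCyclic M) : IsHexagon (hexagon M) := by
  refine ⟨fun i => vert M (hexVtx i), hM.vert_injective.comp hexVtx_injective, fun i => ?_,
    fun i j hij => ?_, hM.hexagon_eq⟩
  · obtain ⟨r, h⟩ : ∃ r : Fin 3 × Fin 3, ∀ j : Fin 3, (![hexVtx i, hexVtx (i + 1), hexVtx (i + 2)] j)
        ≠ Sum.inl r.1 ∧ (![hexVtx i, hexVtx (i + 1), hexVtx (i + 2)] j) ≠ Sum.inr r.2 := by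
      revert i; decide
    have := hM.affineIndependent_vert (f := ![hexVtx i, hexVtx (i + 1), hexVtx (i + 2)])
      (by clear h; revert i; decide) (fun j => (h j).1) fun j => (h j).2
    have e : (fun j => vert M (![hexVtx i, hexVtx (i + 1), hexVtx (i + 2)] j)) =
        ![vert M (hexVtx i), vert M (hexVtx (i + 1)), vert M (hexVtx (i + 2))] := by
      funext j; fin_cases j <;> rfl
    rw [e] at this
    exact affineIndependent_iff_not_collinear_set.1 this
  · have e2 : ∀ i, ({vert M (hexVtx i), vert M (hexVtx (i + 1))} : Set Phase)
        = vert M '' {hexVtx i, hexVtx (i + 1)} := fun i => by rw [image_pair]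
    rw [hM.segment_hex, hM.segment_hex, face_inter, e2, e2, ← image_inter hM.vert_injective]
    have e : (({hexVtx i, hexVtx (i + 1)} : Set Vtx) ∩ {hexVtx j, hexVtx (j + 1)})
        = ((hexEdge i ∩ hexEdge j : Finset Vtx) : Set Vtx) := by
      simp [hexEdge]
    rw [e, ← hM.convexHull_vert ((isFace_hexEdge i).mono Finset.inter_subset_left)]
    refine Convex.convexHull_eq (Set.Subsingleton.convex ?_)
    refine Set.Subsingleton.image ?_ _
    have : (hexEdge i ∩ hexEdge j).card ≤ 1 := by clear e; revert i j; decide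
    exact fun a ha b hb => Finset.card_le_one.1 this a ha b hb

lemma hexagon_nontrivial {x : Phase} (hx : x ∈ hexagon M) :
    (bestRespP M x.2).Nontrivial ∧ (bestRespQ M x.1).Nontrivial := by
  obtain ⟨-, k, l, -, h1, h2⟩ := hx
  have hs : ∀ k : Fin 3, k + 1 ≠ k ∧ k + 2 ≠ k ∧ k + 1 ≠ k + 2 := by decide
  have hne : ∀ {i j : Fin 3}, i ≠ j → (Pi.single i 1 : Fin 3 → ℝ) ≠ Pi.single j 1 := by
    intro i j hij h
    have := congrFun h i
    simp [hij] at this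
  exact ⟨⟨_, single_mem_bestRespP (h1 _ (hs k).1), _, single_mem_bestRespP (h1 _ (hs k).2.1),
    hne (hs k).2.2⟩, ⟨_, single_mem_bestRespQ (h2 _ (hs l).1), _,
    single_mem_bestRespQ (h2 _ (hs l).2.1), hne (hs l).2.2⟩⟩

lemma IsCyclic.edgeVel_mem (hM : IsCyclic M) {i₁ i₂ i₃ j₁ j₂ j₃ : Fin 3} {θ₁ θ₂ κ₁ κ₂ : ℝ}
    (h : IsSubgame M i₁ i₂ i₃ j₁ j₂ j₃ θ₁ θ₂ κ₁ κ₂) {x : Phase} (hx : TiedAt M i₃ j₃ x) :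
    edgeVel M i₁ i₂ j₁ j₂ θ₁ θ₂ κ₁ κ₂ ∈ hamField M M x := by
  refine hM.mem_hamField_iff.2 ⟨_, mem_bestRespP_iff.2 ⟨h.mem_stdSimplex.1, fun i hi => ?_⟩, _,
    mem_bestRespQ_iff.2 ⟨h.mem_stdSimplex.2, fun j hj => ?_⟩, rfl⟩
  · refine hx.1 i ?_
    rintro rfl
    simp [h.rows_ne.2.1.symm, h.rows_ne.2.2.symm] at hi
  · refine hx.2 j ?_
    rintro rfl
    simp [h.cols_ne.2.1.symm, h.cols_ne.2.2.symm] at hj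

variable {φ : ℝ → Phase → Phase}

lemma IsCyclic.flow_edge (hM : IsCyclic M) (hφ : IsUniqueFlow (hamField M M) (levelSet M) φ)
    {k l : Fin 3} (hkl : l = k ∨ l = k + 1) {u : Phase}
    (hu : ∀ x, TiedAt M k l x → u ∈ hamField M M x) {v v' : Vtx}
    (hv : ({v, v'} : Finset Vtx) = {Sum.inl k, Sum.inr l})
    {c : ℝ} (hc : 0 < c) (he : u = c • (vert M v' - vert M v)) :
    ∀ s, 0 ≤ s → s ≤ 1 / c → φ s (vert M v) = vert M v + (s * c) • (vert M v' - vert M v) := by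
  intro s h0 h1
  rw [mul_smul, ← he]
  refine hφ.straight hM.isTameField (t := 1 / c) (hM.vert_mem_levelSet v) (fun s h0 h1 => hu _ ?_)
    h0 h1
  obtain ⟨i, hi⟩ := hexEdge_eq k l hkl
  have hmem : vert M v + s • u ∈ face M {v, v'} := by
    rw [hv, ← hi, ← hM.convexHull_vert (isFace_hexEdge i), hi, ← hv, Finset.coe_pair, image_pair,
      convexHull_pair, segment_eq_image']
    refine ⟨s * c, ⟨by positivity, ?_⟩, by simp only [he, mul_smul]⟩
    rwa [le_div_iff₀ hc] at h1
  rw [hv] at hmem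
  exact hM.tiedAt_iff.2 hmem.2

/-- The flow moves along the edges of the hexagon. -/
lemma IsCyclic.flow_hex (hM : IsCyclic M) (hφ : IsUniqueFlow (hamField M M) (levelSet M) φ)
    (i : Fin 6) : ∃ c > 0, ∀ s, 0 ≤ s → s ≤ 1 / c → φ s (vert M (hexVtx i)) =
      vert M (hexVtx i) + (s * c) • (vert M (hexVtx (i + 1)) - vert M (hexVtx i)) := by
  have hcase : (∃ k : Fin 3, hexVtx i = Sum.inl k ∧ hexVtx (i + 1) = Sum.inr (k + 1)) ∨
      ∃ k : Fin 3, hexVtx i = Sum.inr k ∧ hexVtx (i + 1) = Sum.inl k := by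
    revert i; decide
  rcases hcase with ⟨k, e1, e2⟩ | ⟨k, e1, e2⟩
  · obtain ⟨θ₁, θ₂, κ₁, κ₂, h, hr, -⟩ := hM.exists_subgame₁ k
    rw [e1, e2]
    refine ⟨_, mul_pos (hM.p_pos k) (sub_pos.2 hr), hM.flow_edge hφ (Or.inr rfl)
      (fun x => hM.edgeVel_mem h) rfl (mul_pos (hM.p_pos k) (sub_pos.2 hr)) ?_⟩
    rw [hM.edgeVel_eq h]
    module
  · obtain ⟨θ₁, θ₂, κ₁, κ₂, h, hr, -⟩ := hM.exists_subgame₀ k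
    rw [e1, e2]
    refine ⟨_, mul_pos (hM.p_pos k) (sub_pos.2 hr), hM.flow_edge hφ (Or.inl rfl)
      (fun x => hM.edgeVel_mem h) (Finset.pair_comm _ _) (mul_pos (hM.p_pos k) (sub_pos.2 hr)) ?_⟩
    rw [hM.edgeVel_eq h]

/-- The flow traverses the edges of the hexagon one after the other, each at constant speed. -/
lemma IsCyclic.isPeriodicOrbit_hexagon (hM : IsCyclic M)
    (hφ : IsUniqueFlow (hamField M M) (levelSet M) φ) :
    IsPeriodicOrbit φ (levelSet M) (hexagon M) := by
  choose c hc hflow using hM.flow_hex hφ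
  set w : Fin 6 → Phase := fun i => vert M (hexVtx i) with hw
  have hwX : ∀ i, w i ∈ levelSet M := fun i => hM.vert_mem_levelSet _
  have hnext : ∀ i, φ (1 / c i) (w i) = w (i + 1) := by
    intro i
    have := hflow i (1 / c i) (one_div_pos.2 (hc i)).le le_rfl
    rw [this, div_mul_cancel₀ _ (hc i).ne']
    simp [hw]
  -- the time at which the flow has passed `n` edges
  set ι : ℕ → Fin 6 := fun n => (fun i => i + 1)^[n] 0 with hι
  have hιs : ∀ n, ι (n + 1) = ι n + 1 := fun n => Function.iterate_succ_apply' _ _ _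
  set τ : ℕ → ℝ := fun n => ∑ m ∈ Finset.range n, 1 / c (ι m) with hτ
  have hpass : ∀ n : ℕ, φ (τ n) (w 0) = w (ι n) := by
    intro n
    induction n with
    | zero => simp [hτ, hφ.zero, hι]
    | succ n ih =>
      have e : τ (n + 1) = 1 / c (ι n) + τ n := by
        simp only [hτ, Finset.sum_range_succ]; ring
      rw [e, hφ.add (hwX 0), ih, hnext, hιs]
  have hT : φ (τ 6) (w 0) = w 0 := hpass 6
  have hTpos : 0 < τ 6 := Finset.sum_pos (fun m _ => one_div_pos.2 (hc _)) (by simp)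
  -- a lower bound for the time spent on an edge, for the induction that follows the orbit
  obtain ⟨b, hb0, hb⟩ : ∃ b > 0, ∀ i, b ≤ 1 / c i := by
    obtain ⟨i, -, hi⟩ := Finset.univ.exists_min_image (fun i => 1 / c i) Finset.univ_nonempty
    exact ⟨1 / c i, one_div_pos.2 (hc i), fun j => hi j (Finset.mem_univ j)⟩
  have hseg : ∀ i s, 0 ≤ s → s ≤ 1 / c i → φ s (w i) ∈ hexagon M := by
    intro i s h0 h1
    rw [hM.hexagon_eq, mem_iUnion]
    refine ⟨i, ?_⟩
    rw [hflow i s h0 h1, segment_eq_image']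
    refine ⟨s * c i, ⟨mul_nonneg h0 (hc i).le, ?_⟩, rfl⟩
    rwa [le_div_iff₀ (hc i)] at h1
  have hpos : ∀ (n : ℕ) i (t : ℝ), 0 ≤ t → t ≤ n * b → φ t (w i) ∈ hexagon M := by
    intro n
    induction n with
    | zero =>
      intro i t h0 h1
      exact hseg i t h0 (h1.trans (by simpa using (hc i).le))
    | succ n ih =>
      intro i t h0 h1
      by_cases h : t ≤ 1 / c i
      · exact hseg i t h0 h
      · have e : t = (t - 1 / c i) + 1 / c i := by ring
        rw [e, hφ.add (hwX i), hnext]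
        push_cast at h1
        exact ih _ _ (by linarith) (by linarith [hb i])
  -- negative times are reduced to positive ones by periodicity
  have hper : ∀ (n : ℕ) (t : ℝ), φ (t + n * τ 6) (w 0) = φ t (w 0) := by
    intro n
    induction n with
    | zero => simp
    | succ n ih =>
      intro t
      have e : t + ((n + 1 : ℕ) : ℝ) * τ 6 = (t + n * τ 6) + τ 6 := by push_cast; ring
      rw [e, hφ.add (hwX 0), hT, ih]
  refine ⟨w 0, hwX 0, τ 6, hTpos, hT, subset_antisymm ?_ ?_⟩
  · intro x hx
    rw [hM.hexagon_eq, mem_iUnion] at hx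
    obtain ⟨i, hi⟩ := hx
    rw [segment_eq_image'] at hi
    obtain ⟨θ, ⟨h0, h1⟩, rfl⟩ := hi
    refine ⟨θ / c i + τ i, ?_⟩
    have hpi : φ (τ i) (w 0) = w i := by
      have := hpass (i : ℕ)
      rwa [show ι (i : ℕ) = i by simp only [hι]; clear * -; revert i; decide] at this
    simp only
    rw [hφ.add (hwX 0), hpi, hflow i (θ / c i) (div_nonneg h0 (hc i).le)
      (div_le_div_of_nonneg_right h1 (hc i).le), div_mul_cancel₀ _ (hc i).ne']
  · rintro _ ⟨t, rfl⟩
    obtain ⟨n, hn⟩ := exists_nat_gt (-t / τ 6)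
    rw [div_lt_iff₀ hTpos] at hn
    simp only
    rw [← hper n t]
    obtain ⟨m, hm⟩ := exists_nat_gt ((t + n * τ 6) / b)
    rw [div_lt_iff₀ hb0] at hm
    exact hpos m 0 _ (by linarith) hm.le

/-- Orbits do not enter or leave a periodic orbit. -/
lemma IsPeriodicOrbit.mem_iff {F : Phase → Set Phase} {X Γ : Set Phase}
    (hφ : IsUniqueFlow F X φ) (hΓ : IsPeriodicOrbit φ X Γ) {x : Phase} (hx : x ∈ X) (t : ℝ) :
    φ t x ∈ Γ ↔ x ∈ Γ := by
  obtain ⟨x₀, hx₀, T, -, -, rfl⟩ := hΓ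
  constructor
  · rintro ⟨s, hs⟩
    refine ⟨-t + s, ?_⟩
    simp only at hs ⊢
    rw [hφ.add hx₀, hs, ← hφ.add hx, neg_add_cancel, hφ.zero]
  · rintro ⟨s, rfl⟩
    exact ⟨t + s, hφ.add hx₀ t s⟩

/-! ### The level set is a three-sphere -/

/-- A bounded sublevel set of a continuous convex function is a topological ball, with the level
set as its boundary sphere. -/
lemma exists_homeomorph_sublevel {E : Type*} [NormedAddCommGroup E] [NormedSpace ℝ E]
    {g : E → ℝ} (hg : ConvexOn ℝ univ g) (hc : Continuous g) {x₀ : E} (h0 : g x₀ < 1)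
    (hb : Bornology.IsBounded {x | g x ≤ 1}) : ∃ h : E ≃ₜ E,
      h '' {x | g x ≤ 1} = Metric.closedBall 0 1 ∧ h '' {x | g x = 1} = Metric.sphere 0 1 := by
  have hcl : IsClosed {x | g x ≤ 1} := isClosed_le hc continuous_const
  have hop : IsOpen {x | g x < 1} := isOpen_lt hc continuous_const
  have hint : interior {x | g x ≤ 1} = {x | g x < 1} := by
    apply subset_antisymm
    · intro y hy
      have hy1 : y ∈ {x | g x ≤ 1} := interior_subset hy
      replace hy1 : g y ≤ 1 := hy1
      -- beyond `y` on the ray from `x₀` a convex function exceeds the value at `y`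
      have ht : Tendsto (fun t : ℝ => y + t • (y - x₀)) (𝓝[>] 0) (𝓝 y) := by
        have : Continuous fun t : ℝ => y + t • (y - x₀) := by fun_prop
        simpa using (this.tendsto 0).mono_left nhdsWithin_le_nhds
      obtain ⟨t, ht1, ht0⟩ := ((ht.eventually (mem_interior_iff_mem_nhds.1 hy)).and
        self_mem_nhdsWithin).exists
      have ht0' : (0 : ℝ) < t := ht0
      have hz : g (y + t • (y - x₀)) ≤ 1 := ht1
      have e1 : t / (1 + t) + 1 / (1 + t) = 1 := by field_simp; ring
      have p1 : 0 < t / (1 + t) := by positivity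
      have p2 : 0 < 1 / (1 + t) := by positivity
      have hcomb := hg.2 (mem_univ x₀) (mem_univ (y + t • (y - x₀))) p1.le p2.le e1
      have e : (t / (1 + t)) • x₀ + (1 / (1 + t)) • (y + t • (y - x₀)) = y := by
        have : (1 + t) ≠ 0 := by positivity
        rw [show y + t • (y - x₀) = (1 + t) • y - t • x₀ by module, smul_sub, smul_smul, smul_smul,
          one_div_mul_cancel this, one_smul, one_div_mul_eq_div]
        abel
      rw [e, smul_eq_mul, smul_eq_mul] at hcomb
      show g y < 1
      nlinarith
    · exact hop.subset_interior_iff.2 fun x (hx : g x < 1) => hx.le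
  have hconv : Convex ℝ {x | g x ≤ 1} := by
    have := hg.convex_le 1
    simpa using this
  obtain ⟨h, -, h2, h3⟩ := exists_homeomorph_image_interior_closure_frontier_eq_unitBall hconv
    (by rw [hint]; exact ⟨x₀, h0⟩) hb
  rw [hcl.closure_eq] at h2
  have hfr : frontier {x | g x ≤ 1} = {x | g x = 1} := by
    rw [hcl.frontier_eq, hint]
    ext x
    simp [le_antisymm_iff]
  rw [hfr] at h3
  exact ⟨h, h2, h3⟩

variable {M : Matrix (Fin 3) (Fin 3) ℝ}

lemma convexOn_ham : ConvexOn ℝ univ (ham M) := by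
  refine ⟨convex_univ, fun x _ y _ a b ha hb hab => ?_⟩
  obtain ⟨i, hi⟩ := exists_max_pay M (a • x + b • y)
  obtain ⟨j, hj⟩ := exists_min_cost M (a • x + b • y)
  have h1 := pay_le_iSup (M := M) x i
  have h2 := pay_le_iSup (M := M) y i
  have h3 := iInf_le_cost (M := M) x j
  have h4 := iInf_le_cost (M := M) y j
  rw [ham_eq, ham_eq, ham_eq, iSup_pay_eq hi, iInf_cost_eq hj]
  simp only [map_add, map_smul, smul_eq_mul]
  nlinarith [mul_le_mul_of_nonneg_left h1 ha, mul_le_mul_of_nonneg_left h2 hb,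
    mul_le_mul_of_nonneg_left h3 ha, mul_le_mul_of_nonneg_left h4 hb]

lemma IsCyclic.ham_center (hM : IsCyclic M) : ham M (pStar M, qStar M) = 0 := by
  rw [ham_eq]
  simp [hM.pay_center, hM.cost_center]

lemma IsCyclic.isBounded_sublevel (hM : IsCyclic M) :
    Bornology.IsBounded {x | x ∈ hyperplanes ∧ ham M x ≤ 1} := by
  have hK : IsCompact ((fun z : (Vtx → ℝ) × ℝ => bary M z.1 - z.2 • ((pStar M, qStar M) : Phase)) ''
      (Icc 0 1 ×ˢ Icc (-1) 0)) := by
    refine (isCompact_Icc.prod isCompact_Icc).image ?_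
    have := continuous_bary (M := M)
    fun_prop
  refine hK.isBounded.subset ?_
  rintro x ⟨hx, h1⟩
  obtain ⟨i, hi⟩ := exists_max_pay M x
  obtain ⟨j, hj⟩ := exists_min_cost M x
  have hh : ham M x = pay M i x - cost M j x := by rw [ham_eq, iSup_pay_eq hi, iInf_cost_eq hj]
  have hg0 : ∀ v, 0 ≤ gap M (i, j) v x := by
    rintro (k | l)
    · exact mul_nonneg (hM.p_pos k).le (sub_nonneg.2 (hi k))
    · exact mul_nonneg (hM.q_pos l).le (sub_nonneg.2 (hj l))
  have hs : ∑ v, gap M (i, j) v x = ham M x := by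
    rw [Fintype.sum_sum_type, hM.sum_gap_inl, hM.sum_gap_inr, hx.1, hx.2, hh]; ring
  have h0 : 0 ≤ ham M x := hs ▸ Finset.sum_nonneg fun v _ => hg0 v
  refine ⟨(fun v => gap M (i, j) v x, ham M x - 1), ⟨⟨hg0, fun v => ?_⟩, by linarith, by linarith⟩,
    ?_⟩
  · exact (Finset.single_le_sum (fun u _ => hg0 u) (Finset.mem_univ v)).trans (hs.trans_le h1)
  · simp only
    rw [hM.bary_gap_eq (i, j) (hx.1.trans hx.2.symm), ← hh, hx.1]
    abel

/-- Linear coordinates on the tangent space of the phase space. -/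
def tangentMap : EuclideanSpace ℝ (Fin 4) →ₗ[ℝ] Phase where
  toFun z := (![z 0, z 1, -z 0 - z 1], ![z 2, z 3, -z 2 - z 3])
  map_add' x y := by
    ext i <;> fin_cases i <;> simp <;> ring
  map_smul' a x := by
    ext i <;> fin_cases i <;> simp <;> ring

lemma continuous_tangentMap : Continuous tangentMap :=
  LinearMap.continuous_of_finiteDimensional _

/-- The level set is homeomorphic to the three-sphere. -/
theorem IsCyclic.nonempty_homeomorph_sphere (hM : IsCyclic M) :
    Nonempty (levelSet M ≃ₜ Metric.sphere (0 : EuclideanSpace ℝ (Fin 4)) 1) := by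
  have hp := hM.p_sum
  have hq := hM.q_sum
  rw [Fin.sum_univ_three] at hp hq
  set c : Phase := (pStar M, qStar M) with hc
  set f : EuclideanSpace ℝ (Fin 4) → Phase := fun z => c + tangentMap z with hf
  have hfc : Continuous f := continuous_const.add continuous_tangentMap
  -- the affine chart `f` of the phase space centred at the equilibrium, with inverse `inv`
  set inv : Phase → EuclideanSpace ℝ (Fin 4) := fun x =>
    WithLp.toLp 2 ![x.1 0 - pStar M 0, x.1 1 - pStar M 1, x.2 0 - qStar M 0, x.2 1 - qStar M 1]
    with hinv
  have hinvc : Continuous inv := by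
    refine (PiLp.continuous_toLp 2 _).comp (continuous_pi fun i => ?_)
    fin_cases i <;> simp <;> fun_prop
  have f1 : ∀ z, (f z).1 0 = pStar M 0 + z 0 ∧ (f z).1 1 = pStar M 1 + z 1 ∧
      (f z).1 2 = pStar M 2 + (-z 0 - z 1) := fun z => ⟨rfl, rfl, rfl⟩
  have f2 : ∀ z, (f z).2 0 = qStar M 0 + z 2 ∧ (f z).2 1 = qStar M 1 + z 3 ∧
      (f z).2 2 = qStar M 2 + (-z 2 - z 3) := fun z => ⟨rfl, rfl, rfl⟩
  have hfm : ∀ z, f z ∈ hyperplanes := fun z => by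
    constructor
    · rw [Fin.sum_univ_three, (f1 z).1, (f1 z).2.1, (f1 z).2.2]; linarith
    · rw [Fin.sum_univ_three, (f2 z).1, (f2 z).2.1, (f2 z).2.2]; linarith
  have h1 : ∀ z, inv (f z) = z := fun z => by
    ext i; fin_cases i <;> simp [hinv, f1, f2]
  have h2 : ∀ x ∈ hyperplanes, f (inv x) = x := by
    rintro x ⟨hx1, hx2⟩
    rw [Fin.sum_univ_three] at hx1 hx2
    ext i
    · fin_cases i <;> simp [hinv, f1]; linarith
    · fin_cases i <;> simp [hinv, f2]; linarith
  have hconv : ConvexOn ℝ univ (fun z => ham M (f z)) := by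
    refine ⟨convex_univ, fun x _ y _ a b ha hb hab => ?_⟩
    have e : f (a • x + b • y) = a • f x + b • f y := by
      simp only [hf, map_add, map_smul]
      have : c = (a + b) • c := by rw [hab, one_smul]
      nth_rw 1 [this]
      module
    simp only [e]
    exact convexOn_ham.2 (mem_univ _) (mem_univ _) ha hb hab
  obtain ⟨h, -, hs⟩ := exists_homeomorph_sublevel hconv (continuous_ham.comp hfc) (x₀ := 0)
    (by simp only [hf, map_zero, add_zero, hc, hM.ham_center]; norm_num) (by
      have hK : IsCompact (closure {x | x ∈ hyperplanes ∧ ham M x ≤ 1}) :=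
        hM.isBounded_sublevel.isCompact_closure
      refine (hK.image hinvc).isBounded.subset fun z hz => ⟨f z, subset_closure ⟨hfm z, hz⟩, h1 z⟩)
  have hs1 : ∀ x ∈ levelSet M, h (inv x) ∈ Metric.sphere (0 : EuclideanSpace ℝ (Fin 4)) 1 := by
    intro x hx
    rw [← hs]
    refine mem_image_of_mem _ ?_
    show ham M (f (inv x)) = 1
    rw [h2 x hx.1, hx.2]
  have hs2 : ∀ y ∈ Metric.sphere (0 : EuclideanSpace ℝ (Fin 4)) 1, f (h.symm y) ∈ levelSet M := by
    intro y hy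
    rw [← hs] at hy
    obtain ⟨z, hz, rfl⟩ := hy
    rw [h.symm_apply_apply]
    exact ⟨hfm z, hz⟩
  refine ⟨⟨⟨fun x => ⟨h (inv x), hs1 x x.2⟩, fun y => ⟨f (h.symm y), hs2 y y.2⟩, fun x => ?_,
    fun y => ?_⟩, ?_, ?_⟩⟩
  · simp [h2 x.1 x.2.1]
  · simp [h1]
  · exact (h.continuous.comp (hinvc.comp continuous_subtype_val)).subtype_mk _
  · exact (hfc.comp (h.symm.continuous.comp continuous_subtype_val)).subtype_mk _

/-! ### The disc spanned by the hexagon -/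

/-- The vertices of the four triangles of the section. They all contain the vertex `inl 0`, and the
opposite sides form a path along the other vertices of the hexagon. -/
def secVtx : Fin 4 → Fin 3 → Vtx :=
  ![![Sum.inl 0, Sum.inr 0, Sum.inl 2], ![Sum.inl 0, Sum.inl 2, Sum.inr 2],
    ![Sum.inl 0, Sum.inr 2, Sum.inl 1], ![Sum.inl 0, Sum.inl 1, Sum.inr 1]]

/-- The vertex sets of the four triangles. -/
def secFace (k : Fin 4) : Finset Vtx := Finset.univ.image (secVtx k)

/-- The four triangles. -/
def secTri (M : Matrix (Fin 3) (Fin 3) ℝ) (k : Fin 4) (i : Fin 3) : Phase := vert M (secVtx k i)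

/-- The section. -/
def sec (M : Matrix (Fin 3) (Fin 3) ℝ) : Set Phase := ⋃ k, face M (secFace k)

lemma isFace_secFace (k : Fin 4) : IsFace (secFace k) := by revert k; decide

lemma range_secTri (k : Fin 4) : range (secTri M k) = vert M '' secFace k := by
  rw [secFace, Finset.coe_image, Finset.coe_univ, image_univ, ← range_comp]
  rfl

lemma IsCyclic.tri_secTri (hM : IsCyclic M) (k : Fin 4) :
    tri (secTri M k) = face M (secFace k) := by
  rw [tri, range_secTri, hM.convexHull_vert (isFace_secFace k)]

lemma IsCyclic.isTriangulation (hM : IsCyclic M) : IsTriangulation (secTri M) (sec M) := by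
  refine ⟨fun k => ?_, fun k l _ => ?_, ?_⟩
  · obtain ⟨r, h⟩ : ∃ r : Fin 3 × Fin 3, ∀ i, secVtx k i ≠ Sum.inl r.1 ∧
        secVtx k i ≠ Sum.inr r.2 := by
      revert k; decide
    exact hM.affineIndependent_vert (by clear h; revert k; decide) (fun i => (h i).1)
      fun i => (h i).2
  · rw [hM.tri_secTri, hM.tri_secTri, face_inter, range_secTri, range_secTri,
      ← image_inter hM.vert_injective, ← Finset.coe_inter,
      hM.convexHull_vert ((isFace_secFace k).mono Finset.inter_subset_left)]
  · simp only [hM.tri_secTri, sec]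

lemma sec_subset : sec M ⊆ levelSet M := by
  intro x hx
  obtain ⟨k, hk⟩ := mem_iUnion.1 hx
  exact hk.1

/-- Barycentric coordinates on the section, as functions on the triangle `X, Y ≥ 0`, `X + Y ≤ 4`.
The vertex `inl 0` is sent to the origin, the others to the lattice points on the opposite side, and
each coordinate is the piecewise linear hat function at its vertex. -/
def hat (X Y : ℝ) : Vtx → ℝ :=
  Sum.elim ![1 - (X + Y) / 4, max 0 (min X ((Y - X) / 2)), max 0 (min Y ((X - Y) / 2))]
    ![max 0 ((X - 3 * Y) / 4), max 0 ((Y - 3 * X) / 4),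
      max 0 (min ((3 * Y - X) / 4) ((3 * X - Y) / 4))]

/-- The first planar coordinate of a point of the section with given barycentric coordinates. -/
def planeX (w : Vtx → ℝ) : ℝ :=
  4 * w (Sum.inr 0) + 3 * w (Sum.inl 2) + 2 * w (Sum.inr 2) + w (Sum.inl 1)

/-- The second planar coordinate of a point of the section with given barycentric coordinates. -/
def planeY (w : Vtx → ℝ) : ℝ :=
  w (Sum.inl 2) + 2 * w (Sum.inr 2) + 3 * w (Sum.inl 1) + 4 * w (Sum.inr 1)

lemma sum_vtx (w : Vtx → ℝ) : ∑ v, w v = w (Sum.inl 0) + w (Sum.inl 1) + w (Sum.inl 2) +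
    (w (Sum.inr 0) + w (Sum.inr 1) + w (Sum.inr 2)) := by
  rw [Fintype.sum_sum_type, Fin.sum_univ_three, Fin.sum_univ_three]

lemma hat_inl_zero (X Y : ℝ) : hat X Y (Sum.inl 0) = 1 - (X + Y) / 4 := rfl

/-- The values of the hat functions on each of the four sectors. -/
lemma hat_cases {X Y : ℝ} (hX : 0 ≤ X) (hY : 0 ≤ Y) :
    (3 * Y ≤ X ∧ hat X Y (Sum.inl 1) = 0 ∧ hat X Y (Sum.inr 1) = 0 ∧ hat X Y (Sum.inr 2) = 0 ∧
      hat X Y (Sum.inr 0) = (X - 3 * Y) / 4 ∧ hat X Y (Sum.inl 2) = Y) ∨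
    (Y ≤ X ∧ X ≤ 3 * Y ∧ hat X Y (Sum.inl 1) = 0 ∧ hat X Y (Sum.inr 1) = 0 ∧
      hat X Y (Sum.inr 0) = 0 ∧ hat X Y (Sum.inr 2) = (3 * Y - X) / 4 ∧
      hat X Y (Sum.inl 2) = (X - Y) / 2) ∨
    (X ≤ Y ∧ Y ≤ 3 * X ∧ hat X Y (Sum.inl 2) = 0 ∧ hat X Y (Sum.inr 1) = 0 ∧
      hat X Y (Sum.inr 0) = 0 ∧ hat X Y (Sum.inr 2) = (3 * X - Y) / 4 ∧
      hat X Y (Sum.inl 1) = (Y - X) / 2) ∨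
    (3 * X ≤ Y ∧ hat X Y (Sum.inl 2) = 0 ∧ hat X Y (Sum.inr 2) = 0 ∧ hat X Y (Sum.inr 0) = 0 ∧
      hat X Y (Sum.inr 1) = (Y - 3 * X) / 4 ∧ hat X Y (Sum.inl 1) = X) := by
  have e1 : hat X Y (Sum.inl 1) = max 0 (min X ((Y - X) / 2)) := rfl
  have e2 : hat X Y (Sum.inl 2) = max 0 (min Y ((X - Y) / 2)) := rfl
  have e3 : hat X Y (Sum.inr 0) = max 0 ((X - 3 * Y) / 4) := rfl
  have e4 : hat X Y (Sum.inr 1) = max 0 ((Y - 3 * X) / 4) := rfl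
  have e5 : hat X Y (Sum.inr 2) = max 0 (min ((3 * Y - X) / 4) ((3 * X - Y) / 4)) := rfl
  rw [e1, e2, e3, e4, e5]
  have m1 : ∀ a : ℝ, a ≤ 0 → max 0 a = 0 := fun a => max_eq_left
  have m2 : ∀ a b : ℝ, 0 ≤ a → a ≤ b → max 0 (min a b) = a := fun a b h h' => by
    rw [min_eq_left h', max_eq_right h]
  have m3 : ∀ a b : ℝ, 0 ≤ b → b ≤ a → max 0 (min a b) = b := fun a b h h' => by
    rw [min_eq_right h', max_eq_right h]
  have m4 : ∀ a b : ℝ, a ≤ 0 → max 0 (min a b) = 0 := fun a b h =>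
    max_eq_left ((min_le_left _ _).trans h)
  have m5 : ∀ a b : ℝ, b ≤ 0 → max 0 (min a b) = 0 := fun a b h =>
    max_eq_left ((min_le_right _ _).trans h)
  have m6 : ∀ a : ℝ, 0 ≤ a → max 0 a = a := fun a => max_eq_right
  by_cases h1 : 3 * Y ≤ X
  · exact Or.inl ⟨h1, m5 _ _ (by linarith), m1 _ (by linarith), m4 _ _ (by linarith),
      m6 _ (by linarith), m2 _ _ (by linarith) (by linarith)⟩
  by_cases h2 : Y ≤ X
  · exact Or.inr (Or.inl ⟨h2, by linarith, m5 _ _ (by linarith), m1 _ (by linarith),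
      m1 _ (by linarith), m2 _ _ (by linarith) (by linarith), m3 _ _ (by linarith) (by linarith)⟩)
  by_cases h3 : Y ≤ 3 * X
  · exact Or.inr (Or.inr (Or.inl ⟨by linarith, h3, m5 _ _ (by linarith), m1 _ (by linarith),
      m1 _ (by linarith), m3 _ _ (by linarith) (by linarith), m3 _ _ (by linarith) (by linarith)⟩))
  · exact Or.inr (Or.inr (Or.inr ⟨by linarith, m5 _ _ (by linarith), m5 _ _ (by linarith),
      m1 _ (by linarith), m6 _ (by linarith), m2 _ _ (by linarith) (by linarith)⟩))

lemma not_mem_secFace_iff {w : Vtx → ℝ} (k : Fin 4) : (∀ v, v ∉ secFace k → w v = 0) ↔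
    (k = 0 → w (Sum.inl 1) = 0 ∧ w (Sum.inr 1) = 0 ∧ w (Sum.inr 2) = 0) ∧
    (k = 1 → w (Sum.inl 1) = 0 ∧ w (Sum.inr 1) = 0 ∧ w (Sum.inr 0) = 0) ∧
    (k = 2 → w (Sum.inl 2) = 0 ∧ w (Sum.inr 1) = 0 ∧ w (Sum.inr 0) = 0) ∧
    (k = 3 → w (Sum.inl 2) = 0 ∧ w (Sum.inr 2) = 0 ∧ w (Sum.inr 0) = 0) := by
  have key : ∀ (v : Vtx) (k : Fin 4), v ∈ secFace k ∨ (k = 0 ∧ (v = Sum.inl 1 ∨ v = Sum.inr 1 ∨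
      v = Sum.inr 2)) ∨ (k = 1 ∧ (v = Sum.inl 1 ∨ v = Sum.inr 1 ∨ v = Sum.inr 0)) ∨
      (k = 2 ∧ (v = Sum.inl 2 ∨ v = Sum.inr 1 ∨ v = Sum.inr 0)) ∨
      (k = 3 ∧ (v = Sum.inl 2 ∨ v = Sum.inr 2 ∨ v = Sum.inr 0)) := by decide
  refine ⟨fun h => ⟨?_, ?_, ?_, ?_⟩, fun h v hv => ?_⟩
  · rintro rfl; exact ⟨h _ (by decide), h _ (by decide), h _ (by decide)⟩
  · rintro rfl; exact ⟨h _ (by decide), h _ (by decide), h _ (by decide)⟩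
  · rintro rfl; exact ⟨h _ (by decide), h _ (by decide), h _ (by decide)⟩
  · rintro rfl; exact ⟨h _ (by decide), h _ (by decide), h _ (by decide)⟩
  · obtain ⟨h0, h1, h2, h3⟩ := h
    rcases (key v k).resolve_left hv with ⟨hk, hv⟩ | ⟨hk, hv⟩ | ⟨hk, hv⟩ | ⟨hk, hv⟩
    · rcases hv with rfl | rfl | rfl <;> simp [h0 hk]
    · rcases hv with rfl | rfl | rfl <;> simp [h1 hk]
    · rcases hv with rfl | rfl | rfl <;> simp [h2 hk]
    · rcases hv with rfl | rfl | rfl <;> simp [h3 hk]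

lemma hat_spec {X Y : ℝ} (hX : 0 ≤ X) (hY : 0 ≤ Y) (hXY : X + Y ≤ 4) :
    (∀ v, 0 ≤ hat X Y v) ∧ ∑ v, hat X Y v = 1 ∧ planeX (hat X Y) = X ∧ planeY (hat X Y) = Y ∧
      ∃ k, ∀ v, v ∉ secFace k → hat X Y v = 0 := by
  refine ⟨?_, ?_, ?_, ?_, ?_⟩
  · rintro (v | v) <;> fin_cases v <;> simp [hat]
    linarith
  · rw [sum_vtx, hat_inl_zero]
    rcases hat_cases hX hY with ⟨_, h1, h2, h3, h4, h5⟩ | ⟨_, _, h1, h2, h3, h4, h5⟩ |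
      ⟨_, _, h1, h2, h3, h4, h5⟩ | ⟨_, h1, h2, h3, h4, h5⟩ <;> rw [h1, h2, h3, h4, h5] <;> ring
  · rw [planeX]
    rcases hat_cases hX hY with ⟨_, h1, h2, h3, h4, h5⟩ | ⟨_, _, h1, h2, h3, h4, h5⟩ |
      ⟨_, _, h1, h2, h3, h4, h5⟩ | ⟨_, h1, h2, h3, h4, h5⟩ <;> simp only [h1, h2, h3, h4, h5] <;>
      ring
  · rw [planeY]
    rcases hat_cases hX hY with ⟨_, h1, h2, h3, h4, h5⟩ | ⟨_, _, h1, h2, h3, h4, h5⟩ |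
      ⟨_, _, h1, h2, h3, h4, h5⟩ | ⟨_, h1, h2, h3, h4, h5⟩ <;> simp only [h1, h2, h3, h4, h5] <;>
      ring
  · simp only [not_mem_secFace_iff]
    rcases hat_cases hX hY with ⟨_, h1, h2, h3, h4, h5⟩ | ⟨_, _, h1, h2, h3, h4, h5⟩ |
      ⟨_, _, h1, h2, h3, h4, h5⟩ | ⟨_, h1, h2, h3, h4, h5⟩
    · exact ⟨0, by simp [h1, h2, h3]⟩
    · exact ⟨1, by simp [h1, h2, h3]⟩
    · exact ⟨2, by simp [h1, h2, h3]⟩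
    · exact ⟨3, by simp [h1, h2, h3]⟩

lemma plane_nonneg {w : Vtx → ℝ} (h0 : ∀ v, 0 ≤ w v) :
    0 ≤ planeX w ∧ 0 ≤ planeY w := by
  have a1 := h0 (Sum.inl 1)
  have a2 := h0 (Sum.inl 2)
  have b0 := h0 (Sum.inr 0)
  have b1 := h0 (Sum.inr 1)
  have b2 := h0 (Sum.inr 2)
  constructor
  · rw [planeX]; linarith
  · rw [planeY]; linarith

lemma plane_add {w : Vtx → ℝ} (hs : ∑ v, w v = 1) :
    planeX w + planeY w = 4 * (1 - w (Sum.inl 0)) := by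
  rw [sum_vtx] at hs
  rw [planeX, planeY]; linarith

/-- The hat functions recover the barycentric coordinates from the planar ones. -/
lemma hat_plane {w : Vtx → ℝ} (h0 : ∀ v, 0 ≤ w v) (hs : ∑ v, w v = 1) {k : Fin 4}
    (hk : ∀ v, v ∉ secFace k → w v = 0) : hat (planeX w) (planeY w) = w := by
  have hpl := plane_nonneg h0
  have hadd := plane_add hs
  have a1 := h0 (Sum.inl 1)
  have a2 := h0 (Sum.inl 2)
  have b0 := h0 (Sum.inr 0)
  have b1 := h0 (Sum.inr 1)
  have b2 := h0 (Sum.inr 2)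
  rw [not_mem_secFace_iff] at hk
  have hc := hat_cases hpl.1 hpl.2
  have key : hat (planeX w) (planeY w) (Sum.inl 1) = w (Sum.inl 1) ∧
      hat (planeX w) (planeY w) (Sum.inl 2) = w (Sum.inl 2) ∧
      hat (planeX w) (planeY w) (Sum.inr 0) = w (Sum.inr 0) ∧
      hat (planeX w) (planeY w) (Sum.inr 1) = w (Sum.inr 1) ∧
      hat (planeX w) (planeY w) (Sum.inr 2) = w (Sum.inr 2) := by
    obtain ⟨k0, k1, k2, k3⟩ := hk
    have hX : planeX w = 4 * w (Sum.inr 0) + 3 * w (Sum.inl 2) + 2 * w (Sum.inr 2) +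
      w (Sum.inl 1) := rfl
    have hY : planeY w = w (Sum.inl 2) + 2 * w (Sum.inr 2) + 3 * w (Sum.inl 1) +
      4 * w (Sum.inr 1) := rfl
    have hkk : k = 0 ∨ k = 1 ∨ k = 2 ∨ k = 3 := by clear * -; revert k; decide
    rcases hkk with h | h | h | h
    · obtain ⟨z1, z2, z3⟩ := k0 h
      rcases hc with ⟨_, h1, h2, h3, h4, h5⟩ | ⟨_, _, h1, h2, h3, h4, h5⟩ |
        ⟨_, _, h1, h2, h3, h4, h5⟩ | ⟨_, h1, h2, h3, h4, h5⟩ <;> rw [h1, h2, h3, h4, h5] <;>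
        refine ⟨?_, ?_, ?_, ?_, ?_⟩ <;> linarith
    · obtain ⟨z1, z2, z3⟩ := k1 h
      rcases hc with ⟨_, h1, h2, h3, h4, h5⟩ | ⟨_, _, h1, h2, h3, h4, h5⟩ |
        ⟨_, _, h1, h2, h3, h4, h5⟩ | ⟨_, h1, h2, h3, h4, h5⟩ <;> rw [h1, h2, h3, h4, h5] <;>
        refine ⟨?_, ?_, ?_, ?_, ?_⟩ <;> linarith
    · obtain ⟨z1, z2, z3⟩ := k2 h
      rcases hc with ⟨_, h1, h2, h3, h4, h5⟩ | ⟨_, _, h1, h2, h3, h4, h5⟩ |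
        ⟨_, _, h1, h2, h3, h4, h5⟩ | ⟨_, h1, h2, h3, h4, h5⟩ <;> rw [h1, h2, h3, h4, h5] <;>
        refine ⟨?_, ?_, ?_, ?_, ?_⟩ <;> linarith
    · obtain ⟨z1, z2, z3⟩ := k3 h
      rcases hc with ⟨_, h1, h2, h3, h4, h5⟩ | ⟨_, _, h1, h2, h3, h4, h5⟩ |
        ⟨_, _, h1, h2, h3, h4, h5⟩ | ⟨_, h1, h2, h3, h4, h5⟩ <;> rw [h1, h2, h3, h4, h5] <;>
        refine ⟨?_, ?_, ?_, ?_, ?_⟩ <;> linarith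
  obtain ⟨k1, k2, k3, k4, k5⟩ := key
  funext v
  rcases v with v | v
  · fin_cases v
    · show 1 - (planeX w + planeY w) / 4 = w (Sum.inl 0)
      rw [hadd]; ring
    · exact k1
    · exact k2
  · fin_cases v
    · exact k3
    · exact k4
    · exact k5

/-- The points of the hexagon are those on the boundary of the planar triangle. -/
lemma hat_boundary {X Y : ℝ} (hX : 0 ≤ X) (hY : 0 ≤ Y) (hXY : X + Y ≤ 4) :
    (X = 0 ∨ Y = 0 ∨ X + Y = 4) ↔ ∃ i, ∀ v, v ∉ hexEdge i → hat X Y v = 0 := by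
  have key : ∀ i : Fin 6, (∀ v, v ∉ hexEdge i → hat X Y v = 0) →
      (hat X Y (Sum.inl 0) = 0) ∨
      (hat X Y (Sum.inl 1) = 0 ∧ hat X Y (Sum.inl 2) = 0 ∧ hat X Y (Sum.inr 2) = 0 ∧
        hat X Y (Sum.inr 0) = 0) ∨
      (hat X Y (Sum.inl 1) = 0 ∧ hat X Y (Sum.inl 2) = 0 ∧ hat X Y (Sum.inr 2) = 0 ∧
        hat X Y (Sum.inr 1) = 0) := by
    intro i h
    have hi : Sum.inl 0 ∉ hexEdge i ∨ (Sum.inl 1 ∉ hexEdge i ∧ Sum.inl 2 ∉ hexEdge i ∧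
        Sum.inr 2 ∉ hexEdge i ∧ Sum.inr 0 ∉ hexEdge i) ∨ (Sum.inl 1 ∉ hexEdge i ∧
        Sum.inl 2 ∉ hexEdge i ∧ Sum.inr 2 ∉ hexEdge i ∧ Sum.inr 1 ∉ hexEdge i) := by
      clear h; revert i; decide
    rcases hi with hi | ⟨i1, i2, i3, i4⟩ | ⟨i1, i2, i3, i4⟩
    · exact Or.inl (h _ hi)
    · exact Or.inr (Or.inl ⟨h _ i1, h _ i2, h _ i3, h _ i4⟩)
    · exact Or.inr (Or.inr ⟨h _ i1, h _ i2, h _ i3, h _ i4⟩)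
  have hspec := hat_spec hX hY hXY
  constructor
  · intro hb
    have edge : ∀ (u v : Vtx), (∃ i, hexEdge i = {u, v}) → (∀ x, x ≠ u → x ≠ v → hat X Y x = 0) →
        ∃ i, ∀ v, v ∉ hexEdge i → hat X Y v = 0 := by
      rintro u v ⟨i, hi⟩ h
      refine ⟨i, fun x hx => ?_⟩
      rw [hi] at hx
      simp only [Finset.mem_insert, Finset.mem_singleton, not_or] at hx
      exact h x hx.1 hx.2
    have h0 := hat_inl_zero X Y
    have all : ∀ u v : Vtx, (∀ x, x ≠ u → x ≠ v → hat X Y x = 0) ↔ ∀ x ∈ ({Sum.inl 0, Sum.inl 1,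
        Sum.inl 2, Sum.inr 0, Sum.inr 1, Sum.inr 2} : Finset Vtx), x ≠ u → x ≠ v →
        hat X Y x = 0 := by
      intro u v
      refine ⟨fun h x _ => h x, fun h x => h x ?_⟩
      revert x; decide
    simp only [all, Finset.forall_mem_insert, Finset.mem_singleton, forall_eq] at edge
    rcases hat_cases hX hY with ⟨_, h1, h2, h3, h4, h5⟩ | ⟨_, _, h1, h2, h3, h4, h5⟩ |
        ⟨_, _, h1, h2, h3, h4, h5⟩ | ⟨_, h1, h2, h3, h4, h5⟩
    · by_cases hs : X + Y = 4
      · refine edge (Sum.inr 0) (Sum.inl 2) (by decide) ?_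
        simp [h1, h2, h3, h0]; linarith
      · have hY0 : Y = 0 := by rcases hb with h | h | h <;> [linarith; exact h; exact absurd h hs]
        refine edge (Sum.inl 0) (Sum.inr 0) (by decide) ?_
        simp [h1, h2, h3, h5]; linarith
    · by_cases hs : X + Y = 4
      · refine edge (Sum.inr 2) (Sum.inl 2) (by decide) ?_
        simp [h1, h2, h3, h0]; linarith
      · have hY0 : Y = 0 := by rcases hb with h | h | h <;> [linarith; exact h; exact absurd h hs]
        have hX0 : X = 0 := by linarith
        refine edge (Sum.inl 0) (Sum.inr 0) (by decide) ?_
        simp [h1, h2, h5, h4]; constructor <;> linarith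
    · by_cases hs : X + Y = 4
      · refine edge (Sum.inr 2) (Sum.inl 1) (by decide) ?_
        simp [h1, h2, h3, h0]; linarith
      · have hX0 : X = 0 := by rcases hb with h | h | h <;> [exact h; linarith; exact absurd h hs]
        have hY0 : Y = 0 := by linarith
        refine edge (Sum.inl 0) (Sum.inr 0) (by decide) ?_
        simp [h1, h2, h5, h4]; constructor <;> linarith
    · by_cases hs : X + Y = 4
      · refine edge (Sum.inr 1) (Sum.inl 1) (by decide) ?_
        simp [h1, h2, h3, h0]; linarith
      · have hX0 : X = 0 := by rcases hb with h | h | h <;> [exact h; linarith; exact absurd h hs]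
        refine edge (Sum.inl 0) (Sum.inr 1) (by decide) ?_
        simp [h1, h2, h3, h5]; linarith
  · rintro ⟨i, hi⟩
    obtain ⟨-, -, hx, hy, -⟩ := hspec
    rw [planeX] at hx
    rw [planeY] at hy
    rcases key i hi with h | ⟨h1, h2, h3, h4⟩ | ⟨h1, h2, h3, h4⟩
    · rw [hat_inl_zero] at h
      right; right; linarith
    · left; rw [← hx, h1, h2, h3, h4]; ring
    · right; left; rw [← hy, h1, h2, h3, h4]; ring

lemma continuous_hat : Continuous fun z : ℝ × ℝ => hat z.1 z.2 := by
  refine continuous_pi fun v => ?_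
  rcases v with v | v <;> fin_cases v <;> simp [hat] <;> fun_prop

/-- The section is a topological disc bounded by the hexagon. -/
theorem IsCyclic.isDiscWithBoundary (hM : IsCyclic M) :
    IsDiscWithBoundary (sec M) (hexagon M) := by
  -- `g ≤ 1` is the triangle `X, Y ≥ 0`, `X + Y ≤ 4`
  set g : EuclideanSpace ℝ (Fin 2) → ℝ := fun z => max (max (1 - z 0) (1 - z 1)) (z 0 + z 1 - 3)
    with hg
  have hgc : Continuous g := by simp only [hg]; fun_prop
  have hgconv : ConvexOn ℝ univ g := by
    refine ⟨convex_univ, fun x _ y _ a b ha hb hab => ?_⟩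
    have h1 : 1 - x 0 ≤ g x := (le_max_left _ _).trans (le_max_left _ _)
    have h2 : 1 - x 1 ≤ g x := (le_max_right _ _).trans (le_max_left _ _)
    have h3 : x 0 + x 1 - 3 ≤ g x := le_max_right _ _
    have h4 : 1 - y 0 ≤ g y := (le_max_left _ _).trans (le_max_left _ _)
    have h5 : 1 - y 1 ≤ g y := (le_max_right _ _).trans (le_max_left _ _)
    have h6 : y 0 + y 1 - 3 ≤ g y := le_max_right _ _
    refine max_le (max_le ?_ ?_) ?_ <;> simp only [PiLp.add_apply, PiLp.smul_apply, smul_eq_mul] <;>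
      nlinarith
  have hle : ∀ z, g z ≤ 1 ↔ 0 ≤ z 0 ∧ 0 ≤ z 1 ∧ z 0 + z 1 ≤ 4 := by
    intro z
    simp only [hg, max_le_iff]
    constructor
    · rintro ⟨⟨h1, h2⟩, h3⟩; exact ⟨by linarith, by linarith, by linarith⟩
    · rintro ⟨h1, h2, h3⟩; exact ⟨⟨by linarith, by linarith⟩, by linarith⟩
  have heq : ∀ z, g z ≤ 1 → (g z = 1 ↔ z 0 = 0 ∨ z 1 = 0 ∨ z 0 + z 1 = 4) := by
    intro z hz
    have hz' := (hle z).1 hz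
    constructor
    · intro h
      by_contra! hne
      have : g z < 1 := by
        refine max_lt (max_lt ?_ ?_) ?_
        · linarith [lt_of_le_of_ne hz'.1 (Ne.symm hne.1)]
        · linarith [lt_of_le_of_ne hz'.2.1 (Ne.symm hne.2.1)]
        · linarith [lt_of_le_of_ne hz'.2.2 hne.2.2]
      linarith
    · intro h
      refine le_antisymm hz ?_
      simp only [hg, le_max_iff]
      rcases h with h | h | h
      · left; left; linarith
      · left; right; linarith
      · right; linarith
  obtain ⟨h, hball, hsph⟩ := exists_homeomorph_sublevel hgconv hgc
    (x₀ := WithLp.toLp 2 ![1, 1]) (by norm_num [hg]) (by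
      have hK : IsCompact ((fun x : Fin 2 → ℝ => (WithLp.toLp 2 x : EuclideanSpace ℝ (Fin 2))) ''
          Icc 0 (fun _ => 4)) := isCompact_Icc.image (PiLp.continuous_toLp 2 _)
      refine hK.isBounded.subset fun z hz => ⟨z.ofLp, ⟨fun i => ?_, fun i => ?_⟩, rfl⟩
      all_goals
        obtain ⟨h1, h2, h3⟩ := (hle z).1 hz
        fin_cases i <;> simp <;> linarith)
  have hin : ∀ y ∈ Metric.closedBall (0 : EuclideanSpace ℝ (Fin 2)) 1, g (h.symm y) ≤ 1 := by
    intro y hy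
    rw [← hball] at hy
    obtain ⟨z, hz, rfl⟩ := hy
    rw [h.symm_apply_apply]; exact hz
  -- every point of the planar triangle yields a point of the section, with the hat functions as
  -- coordinates
  have hcoord : ∀ z, g z ≤ 1 → bary M (hat (z 0) (z 1)) ∈ sec M ∧
      coord M (bary M (hat (z 0) (z 1))) = hat (z 0) (z 1) := by
    intro z hz
    obtain ⟨h1, h2, h3⟩ := (hle z).1 hz
    obtain ⟨p0, ps, -, -, k, hk⟩ := hat_spec h1 h2 h3
    obtain ⟨r, hr1, hr2⟩ := isFace_secFace k
    have hc := hM.coord_bary (hk _ hr1) (hk _ hr2) ps p0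
    refine ⟨mem_iUnion.2 ⟨k, region_subset hM (hM.bary_mem_region (hk _ hr1) (hk _ hr2) ps p0),
      fun v hv => ?_⟩, hc⟩
    rw [hc]; exact hk v hv
  have hsurj : ∀ x ∈ sec M, ∃ z, g z ≤ 1 ∧ bary M (hat (z 0) (z 1)) = x := by
    intro x hx
    obtain ⟨k, hxl, hk⟩ := mem_iUnion.1 hx
    have h0 := hM.coord_nonneg x
    have hs := hM.sum_coord hxl
    have hpl := plane_nonneg h0
    refine ⟨WithLp.toLp 2 ![planeX (coord M x), planeY (coord M x)], (hle _).2 ⟨?_, ?_, ?_⟩, ?_⟩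
    · simpa using hpl.1
    · simpa using hpl.2
    · have := plane_add hs
      simp
      linarith [h0 (Sum.inl 0)]
    · simp only [Matrix.cons_val_zero, Matrix.cons_val_one]
      rw [hat_plane h0 hs hk, hM.bary_coord hxl]
  have hinj : ∀ z z', g z ≤ 1 → g z' ≤ 1 →
      bary M (hat (z 0) (z 1)) = bary M (hat (z' 0) (z' 1)) → z = z' := by
    intro z z' hz hz' he
    have := congrArg (coord M) he
    rw [(hcoord z hz).2, (hcoord z' hz').2] at this
    obtain ⟨h1, h2, h3⟩ := (hle z).1 hz
    obtain ⟨h1', h2', h3'⟩ := (hle z').1 hz'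
    obtain ⟨-, -, a1, a2, -⟩ := hat_spec h1 h2 h3
    obtain ⟨-, -, b1, b2, -⟩ := hat_spec h1' h2' h3'
    ext i
    fin_cases i
    · simp; rw [← a1, ← b1, this]
    · simp; rw [← a2, ← b2, this]
  have hbd : ∀ z, g z ≤ 1 → (g z = 1 ↔ bary M (hat (z 0) (z 1)) ∈ hexagon M) := by
    intro z hz
    obtain ⟨h1, h2, h3⟩ := (hle z).1 hz
    rw [heq z hz, hat_boundary h1 h2 h3, hM.mem_hexagon_iff]
    have e : (coord M (bary M (hat (z 0) (z 1)))) = hat (z 0) (z 1) := (hcoord z hz).2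
    refine exists_congr fun i => ?_
    rw [face, Set.mem_ofPred_eq, e]
    exact (and_iff_right (sec_subset (hcoord z hz).1)).symm
  have hhex : hexagon M ⊆ sec M := by
    intro x hx
    obtain ⟨i, hxl, hi⟩ := hM.mem_hexagon_iff.1 hx
    obtain ⟨k, hk⟩ : ∃ k, hexEdge i ⊆ secFace k := by clear hi hx; revert i; decide
    exact mem_iUnion.2 ⟨k, hxl, fun v hv => hi v fun hh => hv (hk hh)⟩
  refine ⟨fun y => bary M (hat (h.symm y 0) (h.symm y 1)), ?_, ?_, ?_, ?_⟩
  · refine Continuous.continuousOn ?_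
    have h1 := continuous_bary (M := M)
    have h2 := continuous_hat
    have h3 : Continuous fun y => (h.symm y 0, h.symm y 1) := by
      have := h.symm.continuous
      fun_prop
    exact h1.comp (h2.comp h3)
  · intro y hy y' hy' he
    exact h.symm.injective (hinj _ _ (hin y hy) (hin y' hy') he)
  · ext x
    constructor
    · rintro ⟨y, hy, rfl⟩
      exact (hcoord _ (hin y hy)).1
    · intro hx
      obtain ⟨z, hz, rfl⟩ := hsurj x hx
      refine ⟨h z, ?_, by simp⟩
      rw [← hball]; exact mem_image_of_mem _ hz
  · ext x
    constructor
    · rintro ⟨y, hy, rfl⟩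
      rw [← hsph] at hy
      obtain ⟨z, hz, rfl⟩ := hy
      simp only [h.symm_apply_apply]
      exact (hbd z (le_of_eq hz)).1 hz
    · intro hx
      obtain ⟨z, hz, rfl⟩ := hsurj x (hhex hx)
      refine ⟨h z, ?_, by simp⟩
      rw [← hsph]
      exact mem_image_of_mem _ ((hbd z hz).2 hx)

variable {M : Matrix (Fin 3) (Fin 3) ℝ} {φ : ℝ → Phase → Phase}

/-! ### The itinerary of an orbit through the regions -/

/-- The orbits leave the region `r` where the coordinate `v` vanishes. -/
def IsExit (r : Fin 3 × Fin 3) : Vtx → Prop :=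
  Sum.elim (fun k => k - r.2 < r.1 - r.2) (fun l => r.1 - r.2 < r.1 - l)

instance (r : Fin 3 × Fin 3) (v : Vtx) : Decidable (IsExit r v) := by
  unfold IsExit
  cases v <;> simp only [Sum.elim_inl, Sum.elim_inr] <;> infer_instance

/-- The region on the other side of the face of `r` opposite to `v`. -/
def next (r : Fin 3 × Fin 3) : Vtx → Fin 3 × Fin 3 :=
  Sum.elim (fun k => (k, r.2)) (fun l => (r.1, l))

/-- The triangle of the section through which orbits leave the region `r` at the exit `v`. -/
def secExit (r : Fin 3 × Fin 3) (v : Vtx) : Option (Fin 4) :=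
  if r = (1, 1) ∧ v = Sum.inr 2 then some 0 else if r = (1, 1) ∧ v = Sum.inr 0 then some 1
  else if r = (2, 1) ∧ v = Sum.inr 0 then some 2 else if r = (2, 2) ∧ v = Sum.inr 0 then some 3
  else none

/-- The regions that orbits enter through the section. -/
def After (r : Fin 3 × Fin 3) : Prop := r = (1, 2) ∨ r = (1, 0) ∨ r = (2, 0)

/-- The regions that orbits leave through the section. -/
def Before (r : Fin 3 × Fin 3) : Prop := r = (1, 1) ∨ r = (2, 1) ∨ r = (2, 2)

/-- The points with support `P` lie in the section. -/
def InSec (P : Finset Vtx) : Prop := ∃ k, P ⊆ secFace k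

/-- The points with support `P` lie on the hexagon. -/
def InHex (P : Finset Vtx) : Prop := ∃ i, P ⊆ hexEdge i

instance (r : Fin 3 × Fin 3) : Decidable (After r) := by unfold After; infer_instance
instance (r : Fin 3 × Fin 3) : Decidable (Before r) := by unfold Before; infer_instance
instance (P : Finset Vtx) : Decidable (InSec P) := by unfold InSec; infer_instance
instance (P : Finset Vtx) : Decidable (InHex P) := by unfold InHex; infer_instance

/-- The order in which orbits that avoid the section pass through the regions. -/
def exitRank (r : Fin 3 × Fin 3) : ℕ :=
  if r = (2, 0) then 8 else if r = (1, 0) then 7 else if r = (1, 2) then 6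
  else if r = (0, 0) then 5 else if r = (0, 2) then 4 else if r = (0, 1) then 3
  else if r = (2, 2) then 2 else if r = (2, 1) then 1 else 0

lemma exitRank_next (r : Fin 3 × Fin 3) (e : Vtx) (he : IsExit r e) (hs : secExit r e = none) :
    exitRank (next r e) < exitRank r := by
  revert r e; decide

lemma exists_isExit (r : Fin 3 × Fin 3) : ∃ e, IsExit r e := by revert r; decide

/-- On the hexagon every region is left at once. -/
lemma exists_exit_of_inHex (r : Fin 3 × Fin 3) (P : Finset Vtx) (h : InHex P) :
    ∃ e, IsExit r e ∧ e ∉ P := by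
  obtain ⟨i, hi⟩ := h
  obtain ⟨e, he, h⟩ : ∃ e, IsExit r e ∧ e ∉ hexEdge i := by clear hi; revert r i; decide
  exact ⟨e, he, fun h' => h (hi h')⟩

set_option synthInstance.maxHeartbeats 200000 in
set_option synthInstance.maxSize 1000 in
/-- An orbit that reaches a new region other than through the section meets the section off the
hexagon only if the new region is left at once. -/
lemma inHex_of_landing : ∀ (r : Fin 3 × Fin 3) (e : Vtx) (P : Finset Vtx), IsExit r e →
    secExit r e = none → ¬ Before (next r e) → Sum.inl r.1 ∉ P → Sum.inr r.2 ∉ P → e ∉ P →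
    (∀ v, v ≠ Sum.inl r.1 → v ≠ Sum.inr r.2 → ¬ IsExit r v → v ∈ P) → InSec P → InHex P := by
  decide +kernel

set_option synthInstance.maxHeartbeats 200000 in
set_option synthInstance.maxSize 1000 in
lemma after_next : ∀ (r : Fin 3 × Fin 3) (e : Vtx) (P : Finset Vtx), IsExit r e → After r →
    Sum.inl r.1 ∉ P → Sum.inr r.2 ∉ P → e ∉ P → InSec P → ¬ InHex P → After (next r e) := by
  decide +kernel

set_option synthInstance.maxHeartbeats 200000 in
set_option synthInstance.maxSize 1000 in
lemma exists_exit_of_before : ∀ (r : Fin 3 × Fin 3) (P : Finset Vtx), Before r →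
    Sum.inl r.1 ∉ P → Sum.inr r.2 ∉ P → InSec P → ¬ InHex P → ∃ e, IsExit r e ∧ e ∉ P := by
  decide +kernel

set_option synthInstance.maxHeartbeats 200000 in
set_option synthInstance.maxSize 1000 in
lemma before_next : ∀ (r : Fin 3 × Fin 3) (e : Vtx) (P : Finset Vtx), IsExit r e → Before r →
    secExit r e = none → Sum.inl r.1 ∉ P → Sum.inr r.2 ∉ P → e ∉ P → InSec P → ¬ InHex P →
    Before (next r e) := by
  decide +kernel

lemma secExit_of_after (r : Fin 3 × Fin 3) (e : Vtx) (h : After r) : secExit r e = none := by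
  revert r e; decide

lemma mem_secFace_of_secExit (r : Fin 3 × Fin 3) (e : Vtx) (l : Fin 4) (h : secExit r e = some l)
    (v : Vtx) : v ∈ secFace l ↔ v ≠ Sum.inl r.1 ∧ v ≠ Sum.inr r.2 ∧ v ≠ e := by
  revert r e l v; decide

lemma exists_not_mem_secFace (r : Fin 3 × Fin 3) (k : Fin 4) :
    ∃ v, v ≠ Sum.inl r.1 ∧ v ≠ Sum.inr r.2 ∧ v ∉ secFace k := by
  revert r k; decide

/-- The set of nonzero barycentric coordinates. -/
def supp (M : Matrix (Fin 3) (Fin 3) ℝ) (x : Phase) : Finset Vtx :=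
  Finset.univ.filter fun v => coord M x v ≠ 0

lemma mem_supp {x : Phase} {v : Vtx} : v ∈ supp M x ↔ coord M x v ≠ 0 := by simp [supp]

lemma mem_face_iff_supp {x : Phase} (hx : x ∈ levelSet M) (F : Finset Vtx) :
    x ∈ face M F ↔ supp M x ⊆ F := by
  have : (x ∈ face M F) = (x ∈ levelSet M ∧ ∀ v, v ∉ F → coord M x v = 0) := rfl
  rw [this, and_iff_right hx]
  refine forall_congr' fun v => ?_
  rw [mem_supp, not_imp_comm]

lemma mem_sec_iff_supp {x : Phase} (hx : x ∈ levelSet M) : x ∈ sec M ↔ InSec (supp M x) := by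
  simp only [sec, mem_iUnion, mem_face_iff_supp hx, InSec]

lemma IsCyclic.mem_hexagon_iff_supp (hM : IsCyclic M) {x : Phase} (hx : x ∈ levelSet M) :
    x ∈ hexagon M ↔ InHex (supp M x) := by
  simp only [hM.mem_hexagon_iff, mem_face_iff_supp hx, InHex]

lemma IsCyclic.rate_neg (hM : IsCyclic M) {r : Fin 3 × Fin 3} {v : Vtx} (h : IsExit r v) :
    rate M r v < 0 := by
  rcases v with k | l
  · exact mul_neg_of_pos_of_neg (hM.p_pos k) (sub_neg.2 (hM.order _ _ _ _ h))
  · exact mul_neg_of_pos_of_neg (hM.q_pos l) (sub_neg.2 (hM.order _ _ _ _ h))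

lemma IsCyclic.rate_pos (hM : IsCyclic M) {r : Fin 3 × Fin 3} {v : Vtx} (h1 : v ≠ Sum.inl r.1)
    (h2 : v ≠ Sum.inr r.2) (h : ¬ IsExit r v) : 0 < rate M r v := by
  rcases v with k | l
  · refine mul_pos (hM.p_pos k) (sub_pos.2 (hM.order _ _ _ _ ?_))
    refine lt_of_le_of_ne (not_lt.1 h) fun h' => h1 ?_
    rw [sub_left_injective h']
  · refine mul_pos (hM.q_pos l) (sub_pos.2 (hM.order _ _ _ _ ?_))
    refine lt_of_le_of_ne (not_lt.1 h) fun h' => h2 ?_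
    rw [sub_right_injective h']

lemma rate_own (r : Fin 3 × Fin 3) :
    rate M r (Sum.inl r.1) = 0 ∧ rate M r (Sum.inr r.2) = 0 := by
  simp [rate]

lemma IsCyclic.rate_nonneg (hM : IsCyclic M) {r : Fin 3 × Fin 3} {v : Vtx} (h : ¬ IsExit r v) :
    0 ≤ rate M r v := by
  by_cases h1 : v = Sum.inl r.1
  · rw [h1, (rate_own r).1]
  by_cases h2 : v = Sum.inr r.2
  · rw [h2, (rate_own r).2]
  exact (hM.rate_pos h1 h2 h).le

lemma IsCyclic.vel_sum (hM : IsCyclic M) (r : Fin 3 × Fin 3) :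
    ∑ i, (vel M r).1 i = 0 ∧ ∑ i, (vel M r).2 i = 0 := by
  simp [vel, hM.p_sum, hM.q_sum]

lemma IsCyclic.ham_vel (hM : IsCyclic M) (r : Fin 3 × Fin 3) :
    pay M r.1 (vel M r) = cost M r.2 (vel M r) := by
  rw [vel, hM.pay_vel, hM.cost_vel]
  simp [Pi.single_apply]

lemma IsCyclic.add_vel_mem_regionSpan (hM : IsCyclic M) {r : Fin 3 × Fin 3} {x : Phase}
    (hx : x ∈ regionSpan M r) (t : ℝ) : x + t • vel M r ∈ regionSpan M r := by
  obtain ⟨⟨h1, h2⟩, h3⟩ := hx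
  refine ⟨⟨?_, ?_⟩, ?_⟩
  · simp [Finset.sum_add_distrib, ← Finset.mul_sum, hM.vel_sum, h1]
  · simp [Finset.sum_add_distrib, ← Finset.mul_sum, hM.vel_sum, h2]
  · rw [map_add, map_add, map_smul, map_smul, hM.ham_vel]
    linarith

lemma IsCyclic.gap_add_vel (hM : IsCyclic M) (r : Fin 3 × Fin 3) (x : Phase) (t : ℝ) (v : Vtx) :
    gap M r v (x + t • vel M r) = gap M r v x + t * rate M r v := by
  rw [map_add, map_smul, hM.gap_vel, smul_eq_mul]

/-- The time after which the coordinate `e` of a point of the region `r` vanishes. -/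
def exitTime (M : Matrix (Fin 3) (Fin 3) ℝ) (r : Fin 3 × Fin 3) (e : Vtx) : Phase →ₗ[ℝ] ℝ :=
  (1 / (-rate M r e)) • gap M r e

/-- The flow through the region `r` up to the exit `e`. -/
def stepMap (M : Matrix (Fin 3) (Fin 3) ℝ) (r : Fin 3 × Fin 3) (e : Vtx) : Phase →ₗ[ℝ] Phase :=
  LinearMap.id + (exitTime M r e).smulRight (vel M r)

lemma exitTime_apply (r : Fin 3 × Fin 3) (e : Vtx) (x : Phase) :
    exitTime M r e x = gap M r e x / (-rate M r e) := by
  simp [exitTime]; ring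

lemma stepMap_apply (r : Fin 3 × Fin 3) (e : Vtx) (x : Phase) :
    stepMap M r e x = x + exitTime M r e x • vel M r := rfl

lemma IsCyclic.gap_stepMap (hM : IsCyclic M) {r : Fin 3 × Fin 3} {e : Vtx} (he : IsExit r e)
    (x : Phase) : gap M r e (stepMap M r e x) = 0 := by
  have := (hM.rate_neg he).ne
  rw [stepMap_apply, hM.gap_add_vel, exitTime_apply]
  field_simp
  ring

/-- Neighbouring regions have the same coordinates on their common face. -/
lemma IsCyclic.gap_next (hM : IsCyclic M) {r : Fin 3 × Fin 3} {e : Vtx} {x : Phase}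
    (h : gap M r e x = 0) : (∀ v, gap M (next r e) v x = gap M r v x) ∧
      (x ∈ regionSpan M r → x ∈ regionSpan M (next r e)) := by
  rcases e with k | l
  · rw [gap_inl, mul_eq_zero, or_iff_right (hM.p_ne k), sub_eq_zero] at h
    refine ⟨fun v => ?_, fun hx => ⟨hx.1, ?_⟩⟩
    · rcases v with v | v
      · rw [gap_inl, gap_inl, h]; rfl
      · rfl
    · rw [← hx.2, h]; rfl
  · rw [gap_inr, mul_eq_zero, or_iff_right (hM.q_ne l), sub_eq_zero] at h
    refine ⟨fun v => ?_, fun hx => ⟨hx.1, ?_⟩⟩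
    · rcases v with v | v
      · rfl
      · rw [gap_inr, gap_inr, ← h]; rfl
    · rw [← hx.2, ← h]; rfl

lemma IsCyclic.stepMap_mem_regionSpan (hM : IsCyclic M) {r : Fin 3 × Fin 3} {e : Vtx}
    (he : IsExit r e) {x : Phase} (hx : x ∈ regionSpan M r) :
    stepMap M r e x ∈ regionSpan M (next r e) :=
  (hM.gap_next (hM.gap_stepMap he x)).2 (hM.add_vel_mem_regionSpan hx _)

/-- The flow in a region up to its first exit. -/
structure FirstExit (M : Matrix (Fin 3) (Fin 3) ℝ) (r : Fin 3 × Fin 3) (e : Vtx) (x : Phase) :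
    Prop where
  mem : x ∈ region M r
  isExit : IsExit r e
  le : ∀ e', IsExit r e' → exitTime M r e x ≤ exitTime M r e' x

namespace FirstExit

variable {r : Fin 3 × Fin 3} {e : Vtx} {x : Phase}

lemma nonneg (h : FirstExit M r e x) (hM : IsCyclic M) : 0 ≤ exitTime M r e x := by
  rw [exitTime_apply]
  exact div_nonneg (h.mem.2 e) (neg_pos.2 (hM.rate_neg h.isExit)).le

lemma gap_nonneg (h : FirstExit M r e x) (hM : IsCyclic M) {t : ℝ} (h0 : 0 ≤ t)
    (ht : t ≤ exitTime M r e x) (v : Vtx) : 0 ≤ gap M r v (x + t • vel M r) := by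
  rw [hM.gap_add_vel]
  have hg := h.mem.2 v
  by_cases hv : IsExit r v
  · have hr := hM.rate_neg hv
    have h1 := ht.trans (h.le v hv)
    rw [exitTime_apply, le_div_iff₀ (neg_pos.2 hr)] at h1
    linarith
  · exact add_nonneg hg (mul_nonneg h0 (hM.rate_nonneg hv))

lemma mem_region (h : FirstExit M r e x) (hM : IsCyclic M) {t : ℝ} (h0 : 0 ≤ t)
    (ht : t ≤ exitTime M r e x) : x + t • vel M r ∈ region M r :=
  ⟨hM.add_vel_mem_regionSpan h.mem.1 t, h.gap_nonneg hM h0 ht⟩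

lemma gap_pos (h : FirstExit M r e x) (hM : IsCyclic M) {t : ℝ} (h0 : 0 < t)
    (ht : t < exitTime M r e x) {v : Vtx} (h1 : v ≠ Sum.inl r.1) (h2 : v ≠ Sum.inr r.2) :
    0 < gap M r v (x + t • vel M r) := by
  rw [hM.gap_add_vel]
  have hg := h.mem.2 v
  by_cases hv : IsExit r v
  · have hr := hM.rate_neg hv
    have h1 := ht.trans_le (h.le v hv)
    rw [exitTime_apply, lt_div_iff₀ (neg_pos.2 hr)] at h1
    linarith
  · exact add_pos_of_nonneg_of_pos hg (mul_pos h0 (hM.rate_pos h1 h2 hv))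

lemma vel_mem {y : Phase} (hM : IsCyclic M) (hy : y ∈ region M r) : vel M r ∈ hamField M M y := by
  obtain ⟨-, h1, h2⟩ := hM.mem_region_iff.1 hy
  exact hM.mem_hamField_iff.2 ⟨_, single_mem_bestRespP h1, _, single_mem_bestRespQ h2, rfl⟩

lemma flow_eq (h : FirstExit M r e x) (hM : IsCyclic M)
    (hφ : IsUniqueFlow (hamField M M) (levelSet M) φ) {t : ℝ} (h0 : 0 ≤ t)
    (ht : t ≤ exitTime M r e x) : φ t x = x + t • vel M r :=
  hφ.straight hM.isTameField (region_subset hM h.mem)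
    (fun _ h0 hs => vel_mem hM (h.mem_region hM h0 hs)) h0 ht

lemma flow_exitTime (h : FirstExit M r e x) (hM : IsCyclic M)
    (hφ : IsUniqueFlow (hamField M M) (levelSet M) φ) :
    φ (exitTime M r e x) x = stepMap M r e x :=
  h.flow_eq hM hφ (h.nonneg hM) le_rfl

lemma flow_not_mem_sec (h : FirstExit M r e x) (hM : IsCyclic M)
    (hφ : IsUniqueFlow (hamField M M) (levelSet M) φ) {t : ℝ} (h0 : 0 < t)
    (ht : t < exitTime M r e x) : φ t x ∉ sec M := by
  rw [h.flow_eq hM hφ h0.le ht.le]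
  intro hs
  obtain ⟨k, -, hk⟩ := mem_iUnion.1 hs
  obtain ⟨v, h1, h2, h3⟩ := exists_not_mem_secFace r k
  have := hk v h3
  rw [hM.coord_eq (h.mem_region hM h0.le ht.le)] at this
  exact (h.gap_pos hM h0 ht h1 h2).ne' this

lemma stepMap_mem (h : FirstExit M r e x) (hM : IsCyclic M) :
    stepMap M r e x ∈ region M r ∧ stepMap M r e x ∈ region M (next r e) := by
  have h1 := h.mem_region hM (h.nonneg hM) le_rfl
  have h2 := hM.gap_next (hM.gap_stepMap h.isExit x)
  exact ⟨h1, h2.2 h1.1, fun v => by rw [h2.1]; exact h1.2 v⟩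

lemma eq_zero_of (h : FirstExit M r e x) (hM : IsCyclic M) {e' : Vtx} (he : IsExit r e')
    (h0 : e' ∉ supp M x) : exitTime M r e x = 0 ∧ stepMap M r e x = x ∧ e ∉ supp M x := by
  have h1 := h.le e' he
  rw [mem_supp, not_not, hM.coord_eq h.mem] at h0
  simp only at h0
  rw [exitTime_apply r e', h0, zero_div] at h1
  have h2 := le_antisymm h1 (h.nonneg hM)
  refine ⟨h2, by rw [stepMap_apply, h2, zero_smul, add_zero], ?_⟩
  rw [mem_supp, not_not, hM.coord_eq h.mem]
  rw [exitTime_apply] at h2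
  exact (div_eq_zero_iff.1 h2).resolve_right (neg_pos.2 (hM.rate_neg h.isExit)).ne'

lemma own_not_mem {x : Phase} (hM : IsCyclic M) (hx : x ∈ region M r) :
    Sum.inl r.1 ∉ supp M x ∧ Sum.inr r.2 ∉ supp M x := by
  rw [mem_supp, mem_supp, not_not, not_not]
  exact (hM.mem_region_iff_coord (region_subset hM hx)).1 hx

end FirstExit

/-- The affine plane of the triangle `l` of the section. -/
def secPlane (M : Matrix (Fin 3) (Fin 3) ℝ) (l : Fin 4) : Set Phase :=
  range fun s : ℝ × ℝ => secTri M l 0 + s.1 • (secTri M l 1 - secTri M l 0) +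
    s.2 • (secTri M l 2 - secTri M l 0)

lemma sum_eq_secFace (l : Fin 4) {E : Type*} [AddCommMonoid E] (f : Vtx → E)
    (h : ∀ v, v ∉ secFace l → f v = 0) :
    ∑ v, f v = f (secVtx l 0) + f (secVtx l 1) + f (secVtx l 2) := by
  have hinj : Function.Injective (secVtx l) := by clear h; revert l; decide
  rw [← Finset.sum_subset (Finset.subset_univ (secFace l)) fun v _ hv => h v hv, secFace,
    Finset.sum_image fun a _ b _ hab => hinj hab, Fin.sum_univ_three]

lemma IsCyclic.mem_secPlane (hM : IsCyclic M) {r : Fin 3 × Fin 3} {l : Fin 4} {x : Phase}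
    (hx : x ∈ regionSpan M r) (h : ∀ v, v ∉ secFace l → gap M r v x = 0) : x ∈ secPlane M l := by
  have h1 := hM.bary_gap hx
  have h2 := hM.sum_gap hx
  rw [bary_apply, sum_eq_secFace l _ fun v hv => by rw [h v hv, zero_smul]] at h1
  rw [sum_eq_secFace l _ h] at h2
  refine ⟨(gap M r (secVtx l 1) x, gap M r (secVtx l 2) x), ?_⟩
  simp only [secTri]
  have : gap M r (secVtx l 0) x = 1 - gap M r (secVtx l 1) x - gap M r (secVtx l 2) x := by
    linarith
  rw [this] at h1
  refine Eq.trans ?_ h1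
  module

/-! ### The pieces of the hitting map of the section -/

lemma symp_add_left (x y z : Phase) : symp M (x + y) z = symp M x z + symp M y z := by
  simp [symp, add_dotProduct, Matrix.mulVec_add, dotProduct_add]; ring

lemma symp_smul_left (a : ℝ) (x z : Phase) : symp M (a • x) z = a * symp M x z := by
  simp [symp, Matrix.mulVec_smul, mul_sub]

lemma symp_swap (x y : Phase) : symp M x y = -symp M y x := by
  simp [symp]

lemma symp_add_right (x y z : Phase) : symp M x (y + z) = symp M x y + symp M x z := by
  rw [symp_swap, symp_add_left, symp_swap y, symp_swap z]; ring

lemma symp_smul_right (a : ℝ) (x z : Phase) : symp M x (a • z) = a * symp M x z := by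
  rw [symp_swap, symp_smul_left, symp_swap z]; ring

lemma symp_self (x : Phase) : symp M x x = 0 := by
  have := symp_swap (M := M) x x
  linarith

/-- The velocity of the region `r` represents the differential of the Hamiltonian there. -/
lemma IsCyclic.symp_vel (hM : IsCyclic M) (r : Fin 3 × Fin 3) (y : Phase) : symp M (vel M r) y =
    (pay M r.1 y - val M * ∑ j, y.2 j) - (cost M r.2 y - val M * ∑ i, y.1 i) := by
  have h1 : (vel M r).1 ⬝ᵥ Matrix.mulVec M y.2 = pay M r.1 y - val M * ∑ j, y.2 j := by
    rw [← hM.average_pay]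
    simp [vel, dotProduct, pay_eq, Pi.single_apply, sub_mul, Finset.sum_sub_distrib]
  have h2 : y.1 ⬝ᵥ Matrix.mulVec M (vel M r).2 = cost M r.2 y - val M * ∑ i, y.1 i := by
    have : ∀ i, Matrix.mulVec M (vel M r).2 i = M i r.2 - val M := by
      intro i
      rw [pay_eq, vel, hM.pay_vel]; simp [Pi.single_apply]
    simp only [dotProduct, this, cost_apply, Finset.mul_sum, ← Finset.sum_sub_distrib]
    exact Finset.sum_congr rfl fun i _ => by ring
  rw [symp, h1, h2]

lemma IsCyclic.symp_vel_sub (hM : IsCyclic M) {r : Fin 3 × Fin 3} {x y : Phase}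
    (hx : x ∈ regionSpan M r) (hy : y ∈ regionSpan M r) : symp M (vel M r) (y - x) = 0 := by
  obtain ⟨⟨a1, a2⟩, a3⟩ := hx
  obtain ⟨⟨b1, b2⟩, b3⟩ := hy
  rw [hM.symp_vel]
  simp only [map_sub, Prod.fst_sub, Prod.snd_sub, Pi.sub_apply, Finset.sum_sub_distrib, a1, a2, b1,
    b2]
  linarith

lemma IsCyclic.symp_stepMap (hM : IsCyclic M) {r : Fin 3 × Fin 3} (e : Vtx) {x y z : Phase}
    (hx : x ∈ regionSpan M r) (hy : y ∈ regionSpan M r) (hz : z ∈ regionSpan M r) :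
    symp M (stepMap M r e y - stepMap M r e x) (stepMap M r e z - stepMap M r e x) =
      symp M (y - x) (z - x) := by
  have e1 : ∀ y, stepMap M r e y - stepMap M r e x =
      (y - x) + (exitTime M r e y - exitTime M r e x) • vel M r := fun y => by
    rw [stepMap_apply, stepMap_apply]; module
  rw [e1, e1]
  simp only [symp_add_left, symp_add_right, symp_smul_left, symp_smul_right, symp_self,
    symp_swap _ (vel M r), hM.symp_vel_sub hx hy, hM.symp_vel_sub hx hz]
  ring

/-- A branch of the map that sends the points of a region to their first hit of the section: a
polyhedral cone given by linear inequalities, on which hitting time and hitting point are linear. -/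
structure Piece where
  /-- The linear forms that are nonnegative on the branch. -/
  cons : List (Phase →ₗ[ℝ] ℝ)
  /-- The hitting time. -/
  time : Phase →ₗ[ℝ] ℝ
  /-- The hitting point. -/
  map : Phase →ₗ[ℝ] Phase
  /-- The triangle that is hit. -/
  tgt : Fin 4

/-- The domain of a branch. -/
def Piece.dom (P : Piece) : Set Phase := {x | ∀ c ∈ P.cons, 0 ≤ c x}

/-- The branch `P` describes the hitting map on the region `r`. -/
structure Piece.Valid (M : Matrix (Fin 3) (Fin 3) ℝ) (φ : ℝ → Phase → Phase) (r : Fin 3 × Fin 3)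
    (P : Piece) : Prop where
  span : ∀ x ∈ regionSpan M r, P.map x ∈ secPlane M P.tgt
  symp : ∀ x ∈ regionSpan M r, ∀ y ∈ regionSpan M r, ∀ z ∈ regionSpan M r,
    symp M (P.map y - P.map x) (P.map z - P.map x) = symp M (y - x) (z - x)
  nonneg : ∀ x ∈ region M r, x ∈ P.dom → 0 ≤ P.time x
  flow : ∀ x ∈ region M r, x ∈ P.dom → φ (P.time x) x = P.map x
  mem : ∀ x ∈ region M r, x ∈ P.dom → P.map x ∈ face M (secFace P.tgt)
  hex : ∀ x ∈ region M r, x ∈ P.dom → x ∈ hexagon M → P.time x = 0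
  nohit : ∀ x ∈ region M r, x ∈ P.dom → x ∉ hexagon M → ∀ t, 0 < t → t < P.time x → φ t x ∉ sec M
  after : ∀ x ∈ region M r, x ∈ P.dom → x ∈ sec M → x ∉ hexagon M → After r → 0 < P.time x
  before : ∀ x ∈ region M r, x ∈ P.dom → x ∈ sec M → x ∉ hexagon M → Before r → P.time x = 0

/-- Finitely many branches describe the hitting map on the region `r`. -/
def HasPieces (M : Matrix (Fin 3) (Fin 3) ℝ) (φ : ℝ → Phase → Phase) (r : Fin 3 × Fin 3) : Prop :=
  ∃ Ps : List Piece, (∀ P ∈ Ps, P.Valid M φ r) ∧ ∀ x ∈ region M r, ∃ P ∈ Ps, x ∈ P.dom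

/-- The inequalities that express that `e` is the first exit. -/
def exitCons (M : Matrix (Fin 3) (Fin 3) ℝ) (r : Fin 3 × Fin 3) (e : Vtx) :
    List (Phase →ₗ[ℝ] ℝ) :=
  ((Finset.univ.filter (IsExit r)).toList).map fun e' => exitTime M r e' - exitTime M r e

lemma exitCons_iff {r : Fin 3 × Fin 3} {e : Vtx} {x : Phase} : (∀ c ∈ exitCons M r e, 0 ≤ c x) ↔
    ∀ e', IsExit r e' → exitTime M r e x ≤ exitTime M r e' x := by
  simp only [exitCons, List.forall_mem_map, Finset.mem_toList, Finset.mem_filter, Finset.mem_univ,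
    true_and, LinearMap.sub_apply, sub_nonneg]

/-- The branch of an exit that lands on the section. -/
lemma IsCyclic.valid_secExit (hM : IsCyclic M) (hφ : IsUniqueFlow (hamField M M) (levelSet M) φ)
    {r : Fin 3 × Fin 3} {e : Vtx} (he : IsExit r e) {l : Fin 4} (hl : secExit r e = some l) :
    Piece.Valid M φ r ⟨exitCons M r e, exitTime M r e, stepMap M r e, l⟩ := by
  have hF : ∀ x ∈ region M r, x ∈ Piece.dom ⟨exitCons M r e, exitTime M r e, stepMap M r e, l⟩ →
      FirstExit M r e x := fun x hx hd => ⟨hx, he, exitCons_iff.1 hd⟩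
  have hz : ∀ x ∈ regionSpan M r, ∀ v, v ∉ secFace l → gap M r v (stepMap M r e x) = 0 := by
    intro x hx v hv
    by_cases h1 : v = Sum.inl r.1
    · rw [h1, gap_own₁]
    by_cases h2 : v = Sum.inr r.2
    · rw [h2, gap_own₂]
    have h3 : v = e := by
      by_contra h3
      exact hv ((mem_secFace_of_secExit r e l hl v).2 ⟨h1, h2, h3⟩)
    rw [h3, hM.gap_stepMap he]
  refine ⟨fun x hx => ?_, fun x hx y hy z hz => hM.symp_stepMap e hx hy hz,
    fun x hx hd => (hF x hx hd).nonneg hM, fun x hx hd => (hF x hx hd).flow_exitTime hM hφ,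
    fun x hx hd => ?_, fun x hx hd hh => ?_, fun x hx hd hh t h0 ht => ?_,
    fun x hx hd hs hh ha => ?_, fun x hx hd hs hh hb => ?_⟩
  · exact hM.mem_secPlane (hM.add_vel_mem_regionSpan hx _) (hz x hx)
  · have h := (hF x hx hd).stepMap_mem hM
    refine ⟨region_subset hM h.1, fun v hv => ?_⟩
    rw [hM.coord_eq h.1]
    exact hz x hx.1 v hv
  · rw [hM.mem_hexagon_iff_supp (region_subset hM hx)] at hh
    obtain ⟨e', he', hn⟩ := exists_exit_of_inHex r _ hh
    exact ((hF x hx hd).eq_zero_of hM he' hn).1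
  · exact (hF x hx hd).flow_not_mem_sec hM hφ h0 ht
  · rw [secExit_of_after r e ha] at hl
    exact absurd hl (by simp)
  · rw [mem_sec_iff_supp (region_subset hM hx)] at hs
    rw [hM.mem_hexagon_iff_supp (region_subset hM hx)] at hh
    obtain ⟨o1, o2⟩ := FirstExit.own_not_mem hM hx
    obtain ⟨e', he', hn⟩ := exists_exit_of_before r _ hb o1 o2 hs hh
    exact ((hF x hx hd).eq_zero_of hM he' hn).1

/-- The branch of an exit that does not land on the section, followed by a branch for the next region. -/
lemma IsCyclic.valid_comp (hM : IsCyclic M) (hφ : IsUniqueFlow (hamField M M) (levelSet M) φ)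
    {r : Fin 3 × Fin 3} {e : Vtx} (he : IsExit r e) (hl : secExit r e = none) {P : Piece}
    (hP : P.Valid M φ (next r e)) : Piece.Valid M φ r
      ⟨exitCons M r e ++ P.cons.map fun c => c ∘ₗ stepMap M r e,
        P.time ∘ₗ stepMap M r e + exitTime M r e, P.map ∘ₗ stepMap M r e, P.tgt⟩ := by
  set Q : Piece := ⟨exitCons M r e ++ P.cons.map fun c => c ∘ₗ stepMap M r e,
        P.time ∘ₗ stepMap M r e + exitTime M r e, P.map ∘ₗ stepMap M r e, P.tgt⟩ with hQ
  have hF : ∀ x ∈ region M r, x ∈ Q.dom → FirstExit M r e x := fun x hx hd =>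
    ⟨hx, he, exitCons_iff.1 fun c hc => hd c (List.mem_append_left _ hc)⟩
  have hd' : ∀ x, x ∈ Q.dom → stepMap M r e x ∈ P.dom := fun x hd c hc =>
    hd (c ∘ₗ stepMap M r e) (List.mem_append_right _ (List.mem_map_of_mem hc))
  have hr' : ∀ x ∈ region M r, x ∈ Q.dom → stepMap M r e x ∈ region M (next r e) :=
    fun x hx hd => ((hF x hx hd).stepMap_mem hM).2
  have hper := hM.isPeriodicOrbit_hexagon hφ
  have hhex : ∀ x ∈ region M r, x ∈ Q.dom → (stepMap M r e x ∈ hexagon M ↔ x ∈ hexagon M) := by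
    intro x hx hd
    rw [← (hF x hx hd).flow_exitTime hM hφ]
    exact hper.mem_iff hφ (region_subset hM hx) _
  have htime : ∀ x, Q.time x = P.time (stepMap M r e x) + exitTime M r e x := fun x => rfl
  have h0' : ∀ x ∈ region M r, x ∈ Q.dom → 0 ≤ P.time (stepMap M r e x) := fun x hx hd =>
    hP.nonneg _ (hr' x hx hd) (hd' x hd)
  have hflow : ∀ x ∈ region M r, x ∈ Q.dom → ∀ t,
      φ (t + exitTime M r e x) x = φ t (stepMap M r e x) := fun x hx hd t => by
    rw [hφ.add (region_subset hM hx), (hF x hx hd).flow_exitTime hM hφ]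
  refine ⟨fun x hx => hP.span _ (hM.stepMap_mem_regionSpan he hx), fun x hx y hy z hz => ?_,
    fun x hx hd => add_nonneg (h0' x hx hd) ((hF x hx hd).nonneg hM), fun x hx hd => ?_,
    fun x hx hd => hP.mem _ (hr' x hx hd) (hd' x hd), fun x hx hd hh => ?_,
    fun x hx hd hh t h0 ht => ?_, fun x hx hd hs hh ha => ?_, fun x hx hd hs hh hb => ?_⟩
  · rw [← hM.symp_stepMap e hx hy hz]
    exact hP.symp _ (hM.stepMap_mem_regionSpan he hx) _ (hM.stepMap_mem_regionSpan he hy) _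
      (hM.stepMap_mem_regionSpan he hz)
  · rw [htime, hflow x hx hd]
    exact hP.flow _ (hr' x hx hd) (hd' x hd)
  · have hh' := hh
    rw [hM.mem_hexagon_iff_supp (region_subset hM hx)] at hh'
    obtain ⟨e', he', hn⟩ := exists_exit_of_inHex r _ hh'
    rw [htime, ((hF x hx hd).eq_zero_of hM he' hn).1,
      hP.hex _ (hr' x hx hd) (hd' x hd) ((hhex x hx hd).2 hh), add_zero]
  · have hh' : stepMap M r e x ∉ hexagon M := fun h => hh ((hhex x hx hd).1 h)
    rcases lt_trichotomy t (exitTime M r e x) with h | h | h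
    · exact (hF x hx hd).flow_not_mem_sec hM hφ h0 h
    · -- landing on the section at the exit would be at a point from which `P` has hitting time zero
      rw [h, (hF x hx hd).flow_exitTime hM hφ]
      intro hsec
      have hm := (hF x hx hd).stepMap_mem hM
      have ht' : 0 < P.time (stepMap M r e x) := by rw [htime] at ht; linarith
      have hnb : ¬ Before (next r e) := fun hb =>
        ht'.ne' (hP.before _ hm.2 (hd' x hd) hsec hh' hb)
      obtain ⟨o1, o2⟩ := FirstExit.own_not_mem hM hm.1
      refine hh' ((hM.mem_hexagon_iff_supp (region_subset hM hm.1)).2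
        (inHex_of_landing r e _ he hl hnb o1 o2 ?_ ?_
          ((mem_sec_iff_supp (region_subset hM hm.1)).1 hsec)))
      · rw [mem_supp, not_not, hM.coord_eq hm.1]
        exact hM.gap_stepMap he x
      · intro v h1 h2 hv
        rw [mem_supp, hM.coord_eq hm.1]
        simp only
        rw [stepMap_apply, hM.gap_add_vel, ← h]
        exact (add_pos_of_nonneg_of_pos (hx.2 v) (mul_pos h0 (hM.rate_pos h1 h2 hv))).ne'
    · have := hflow x hx hd (t - exitTime M r e x)
      rw [sub_add_cancel] at this
      rw [this]
      exact hP.nohit _ (hr' x hx hd) (hd' x hd) hh' _ (by linarith) (by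
        rw [htime] at ht; linarith)
  · rw [htime]
    rcases ((hF x hx hd).nonneg hM).eq_or_lt with h | h
    · have hx' : stepMap M r e x = x := by rw [stepMap_apply, ← h, zero_smul, add_zero]
      rw [← h, add_zero, hx']
      have h1 := hr' x hx hd
      have h2 := hd' x hd
      rw [hx'] at h1 h2
      refine hP.after x h1 h2 hs hh ?_
      obtain ⟨o1, o2⟩ := FirstExit.own_not_mem hM hx
      refine after_next r e (supp M x) he ha o1 o2 ?_
        ((mem_sec_iff_supp (region_subset hM hx)).1 hs)
        fun h' => hh ((hM.mem_hexagon_iff_supp (region_subset hM hx)).2 h')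
      rw [mem_supp, not_not, hM.coord_eq hx]
      have := hM.gap_stepMap he x
      rwa [hx'] at this
    · exact add_pos_of_nonneg_of_pos (h0' x hx hd) h
  · have hs' := hs
    have hh' := hh
    rw [mem_sec_iff_supp (region_subset hM hx)] at hs'
    rw [hM.mem_hexagon_iff_supp (region_subset hM hx)] at hh'
    obtain ⟨o1, o2⟩ := FirstExit.own_not_mem hM hx
    obtain ⟨e', he', hn⟩ := exists_exit_of_before r _ hb o1 o2 hs' hh'
    obtain ⟨z1, z2, z3⟩ := (hF x hx hd).eq_zero_of hM he' hn
    have h1 := hr' x hx hd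
    have h2 := hd' x hd
    rw [z2] at h1 h2
    rw [htime, z1, z2, add_zero]
    exact hP.before x h1 h2 hs hh (before_next r e _ he hb hl o1 o2 z3 hs' hh')

/-- Every region is covered by finitely many branches of the hitting map: the itineraries that
avoid the section are finite. -/
theorem IsCyclic.hasPieces (hM : IsCyclic M) (hφ : IsUniqueFlow (hamField M M) (levelSet M) φ)
    (r : Fin 3 × Fin 3) : HasPieces M φ r := by
  induction hn : exitRank r using Nat.strong_induction_on generalizing r with
  | _ n ih =>
  have hex : ∀ e, ∃ Q : List Piece, IsExit r e → (∀ P ∈ Q, P.Valid M φ r) ∧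
      ∀ x, FirstExit M r e x → ∃ P ∈ Q, x ∈ P.dom := by
    intro e
    by_cases he : IsExit r e
    · rcases hl : secExit r e with _ | l
      · obtain ⟨Ps, hPs, hcov⟩ := ih _ (hn ▸ exitRank_next r e he hl) (next r e) rfl
        refine ⟨Ps.map fun P => ⟨exitCons M r e ++ P.cons.map fun c => c ∘ₗ stepMap M r e,
          P.time ∘ₗ stepMap M r e + exitTime M r e, P.map ∘ₗ stepMap M r e, P.tgt⟩,
          fun _ => ⟨fun Q hQ => ?_, fun x hx => ?_⟩⟩
        · obtain ⟨P, hP, rfl⟩ := List.mem_map.1 hQ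
          exact hM.valid_comp hφ he hl (hPs P hP)
        · obtain ⟨P, hP, hd⟩ := hcov _ (hx.stepMap_mem hM).2
          refine ⟨_, List.mem_map_of_mem hP, fun c hc => ?_⟩
          rcases List.mem_append.1 hc with hc | hc
          · exact exitCons_iff.2 hx.le c hc
          · obtain ⟨c', hc', rfl⟩ := List.mem_map.1 hc
            exact hd c' hc'
      · refine ⟨[⟨exitCons M r e, exitTime M r e, stepMap M r e, l⟩], fun _ => ⟨fun Q hQ => ?_,
          fun x hx => ⟨_, List.mem_singleton.2 rfl, exitCons_iff.2 hx.le⟩⟩⟩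
        rw [List.mem_singleton] at hQ
        subst hQ
        exact hM.valid_secExit hφ he hl
    · exact ⟨[], fun h => absurd h he⟩
  choose Q hQ using hex
  refine ⟨((Finset.univ.filter (IsExit r)).toList).flatMap Q, fun P hP => ?_, fun x hx => ?_⟩
  · obtain ⟨e, he, hP⟩ := List.mem_flatMap.1 hP
    exact (hQ e (by simpa using he)).1 P hP
  · obtain ⟨e₀, he₀⟩ := exists_isExit r
    obtain ⟨e, he, hmin⟩ := (Finset.univ.filter (IsExit r)).exists_min_image
      (fun e => exitTime M r e x) ⟨e₀, by simpa using he₀⟩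
    simp only [Finset.mem_filter, Finset.mem_univ, true_and] at he hmin
    obtain ⟨P, hP, hd⟩ := (hQ e he).2 x ⟨hx, he, hmin⟩
    exact ⟨P, List.mem_flatMap.2 ⟨e, by simpa using he, hP⟩, hd⟩

variable {M : Matrix (Fin 3) (Fin 3) ℝ} {φ : ℝ → Phase → Phase}

/-! ### The first return map -/

lemma IsUniqueFlow.continuousOn_left {F : Phase → Set Phase} {X : Set Phase}
    (hφ : IsUniqueFlow F X φ) (t : ℝ) : ContinuousOn (φ t) X :=
  hφ.cont.comp (f := fun x => (t, x)) (by fun_prop) fun x hx => ⟨mem_univ _, hx⟩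

lemma IsUniqueFlow.continuous_right {F : Phase → Set Phase} {X : Set Phase}
    (hφ : IsUniqueFlow F X φ) {x : Phase} (hx : x ∈ X) : Continuous fun t => φ t x := by
  rw [← continuousOn_univ]
  exact hφ.cont.comp (f := fun t => (t, x)) (by fun_prop) fun t ht => ⟨ht, hx⟩

lemma IsUniqueFlow.neg_apply {F : Phase → Set Phase} {X : Set Phase}
    (hφ : IsUniqueFlow F X φ) {x : Phase} (hx : x ∈ X) (t : ℝ) : φ (-t) (φ t x) = x := by
  rw [← hφ.add hx, neg_add_cancel, hφ.zero]

/-- A function is continuous if it is continuous on each of finitely many closed sets. -/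
lemma continuousOn_of_finite_closed_cover {α β ι : Type*} [TopologicalSpace α] [TopologicalSpace β]
    [Finite ι] {f : α → β} {Y : Set α} {K : ι → Set α} (hK : ∀ i, IsClosed (K i))
    (hcov : Y ⊆ ⋃ i, K i) (hf : ∀ i, ContinuousOn f (Y ∩ K i)) : ContinuousOn f Y := by
  intro x hx
  have e : Y = ⋃ i, Y ∩ K i := by rw [← inter_iUnion, inter_eq_left.2 hcov]
  rw [ContinuousWithinAt, e, nhdsWithin_iUnion, tendsto_iSup]
  intro i
  by_cases hi : x ∈ K i
  · exact hf i x ⟨hx, hi⟩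
  · have : 𝓝[Y ∩ K i] x = ⊥ := by
      rw [← notMem_closure_iff_nhdsWithin_eq_bot]
      exact fun h => hi ((hK i).closure_subset (closure_mono inter_subset_right h))
    rw [this]
    exact tendsto_bot

lemma IsCyclic.exists_pieces (hM : IsCyclic M) (hφ : IsUniqueFlow (hamField M M) (levelSet M) φ) :
    ∃ (n : ℕ) (P : Fin n → Piece) (s : Fin n → Fin 3 × Fin 3), (∀ i, (P i).Valid M φ (s i)) ∧
      ∀ r, ∀ x ∈ region M r, ∃ i, s i = r ∧ x ∈ (P i).dom := by
  choose Ps hv hc using hM.hasPieces hφ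
  let e := Fintype.equivFin (Σ r, Fin (Ps r).length)
  refine ⟨_, fun i => (Ps (e.symm i).1).get (e.symm i).2, fun i => (e.symm i).1,
    fun i => hv _ _ (List.get_mem _ _), fun r x hx => ?_⟩
  obtain ⟨P, hP, hd⟩ := hc r x hx
  obtain ⟨j, hj⟩ := List.get_of_mem hP
  refine ⟨e ⟨r, j⟩, by simp, ?_⟩
  dsimp only
  rw [Equiv.symm_apply_apply, hj]
  exact hd

lemma isClosed_dom (P : Piece) : IsClosed P.dom := by
  have : P.dom = ⋂ c ∈ P.cons, {x | 0 ≤ c x} := by ext x; simp [Piece.dom]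
  rw [this]
  exact isClosed_biInter fun c _ => isClosed_le continuous_const
    (LinearMap.continuous_of_finiteDimensional c)

/-- The region that orbits enter through the triangle `k`. -/
def afterRegion : Fin 4 → Fin 3 × Fin 3 := ![(1, 2), (1, 0), (2, 0), (2, 0)]

lemma after_afterRegion (k : Fin 4) : After (afterRegion k) := by revert k; decide

lemma IsCyclic.secFace_subset (hM : IsCyclic M) (k : Fin 4) :
    face M (secFace k) ⊆ region M (afterRegion k) := by
  intro x hx
  have h : Sum.inl (afterRegion k).1 ∉ secFace k ∧ Sum.inr (afterRegion k).2 ∉ secFace k := by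
    clear hx; revert k; decide
  exact (hM.mem_region_iff_coord hx.1).2 ⟨hx.2 _ h.1, hx.2 _ h.2⟩

lemma isClosed_sec : IsClosed (sec M) := isClosed_iUnion_of_finite fun _ => isClosed_face _

lemma IsCyclic.hexagon_subset (hM : IsCyclic M) : hexagon M ⊆ sec M := by
  intro x hx
  obtain ⟨i, hxl, hi⟩ := hM.mem_hexagon_iff.1 hx
  obtain ⟨k, hk⟩ : ∃ k, hexEdge i ⊆ secFace k := by clear hi hx; revert i; decide
  exact mem_iUnion.2 ⟨k, hxl, fun v hv => hi v fun hh => hv (hk hh)⟩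

/-- The first return time to the section, extended by zero to the hexagon. -/
def retTime (M : Matrix (Fin 3) (Fin 3) ℝ) (φ : ℝ → Phase → Phase) (z : Phase) : ℝ :=
  open Classical in if z ∈ hexagon M then 0 else sInf {t | 0 < t ∧ φ t z ∈ sec M}

/-- The first return map of the section. -/
def retMap (M : Matrix (Fin 3) (Fin 3) ℝ) (φ : ℝ → Phase → Phase) (z : Phase) : Phase :=
  φ (retTime M φ z) z

/-- The first hitting time of the section. -/
def hitTime (M : Matrix (Fin 3) (Fin 3) ℝ) (φ : ℝ → Phase → Phase) (z : Phase) : ℝ :=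
  sInf {t | 0 ≤ t ∧ φ t z ∈ sec M}

lemma retTime_of_isLeast {z : Phase} (hz : z ∉ hexagon M) {t : ℝ}
    (h : IsLeast {t | 0 < t ∧ φ t z ∈ sec M} t) : retTime M φ z = t := by
  rw [retTime, if_neg hz, h.csInf_eq]

lemma retTime_of_mem_hexagon {z : Phase} (hz : z ∈ hexagon M) : retTime M φ z = 0 := if_pos hz

section pieces

variable (hM : IsCyclic M) (hφ : IsUniqueFlow (hamField M M) (levelSet M) φ)
include hM hφ

omit hφ in
lemma IsCyclic.isLeast_piece {k : Fin 4} {z : Phase} (hz : z ∈ face M (secFace k))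
    (hz' : z ∉ hexagon M) {P : Piece} (hP : P.Valid M φ (afterRegion k)) (hd : z ∈ P.dom) :
    IsLeast {t | 0 < t ∧ φ t z ∈ sec M} (P.time z) := by
  have hr := hM.secFace_subset k hz
  have hs : z ∈ sec M := mem_iUnion.2 ⟨k, hz⟩
  refine ⟨⟨hP.after z hr hd hs hz' (after_afterRegion k), ?_⟩, fun t ht => ?_⟩
  · rw [hP.flow z hr hd]
    exact mem_iUnion.2 ⟨_, hP.mem z hr hd⟩
  · by_contra! hlt
    exact hP.nohit z hr hd hz' t ht.1 hlt ht.2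

lemma IsCyclic.isLeast_retTime {z : Phase} (hz : z ∈ sec M) (hz' : z ∉ hexagon M) :
    IsLeast {t | 0 < t ∧ φ t z ∈ sec M} (retTime M φ z) := by
  obtain ⟨n, P, s, hv, hc⟩ := hM.exists_pieces hφ
  obtain ⟨k, hk⟩ := mem_iUnion.1 hz
  obtain ⟨i, hi, hd⟩ := hc _ z (hM.secFace_subset k hk)
  have := hM.isLeast_piece hk hz' (hi ▸ hv i) hd
  rwa [retTime_of_isLeast hz' this]

omit hφ in
lemma IsCyclic.retTime_piece {k : Fin 4} {z : Phase} (hz : z ∈ face M (secFace k))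
    {P : Piece} (hP : P.Valid M φ (afterRegion k)) (hd : z ∈ P.dom) :
    retTime M φ z = P.time z := by
  by_cases hz' : z ∈ hexagon M
  · rw [retTime_of_mem_hexagon hz', hP.hex z (hM.secFace_subset k hz) hd hz']
  · exact retTime_of_isLeast hz' (hM.isLeast_piece hz hz' hP hd)

omit hφ in
lemma IsCyclic.retMap_piece {k : Fin 4} {z : Phase} (hz : z ∈ face M (secFace k))
    {P : Piece} (hP : P.Valid M φ (afterRegion k)) (hd : z ∈ P.dom) :
    retMap M φ z = P.map z := by
  rw [retMap, hM.retTime_piece hz hP hd, hP.flow z (hM.secFace_subset k hz) hd]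

omit hM in
lemma retMap_of_mem_hexagon {z : Phase} (hz : z ∈ hexagon M) : retMap M φ z = z := by
  rw [retMap, retTime_of_mem_hexagon hz, hφ.zero]

lemma IsCyclic.continuousOn_ret : ContinuousOn (retTime M φ) (sec M) ∧
    ContinuousOn (retMap M φ) (sec M) := by
  obtain ⟨n, P, s, hv, hc⟩ := hM.exists_pieces hφ
  have hcov : sec M ⊆ ⋃ j : {j : Fin 4 × Fin n // s j.2 = afterRegion j.1},
      face M (secFace j.1.1) ∩ (P j.1.2).dom := by
    intro z hz
    obtain ⟨k, hk⟩ := mem_iUnion.1 hz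
    obtain ⟨i, hi, hd⟩ := hc _ z (hM.secFace_subset k hk)
    exact mem_iUnion.2 ⟨⟨(k, i), hi⟩, hk, hd⟩
  constructor
  · refine continuousOn_of_finite_closed_cover (fun j => (isClosed_face _).inter (isClosed_dom _))
      hcov ?_
    rintro ⟨⟨k, i⟩, hi⟩
    refine (LinearMap.continuous_of_finiteDimensional (P i).time).continuousOn.congr ?_
    rintro z ⟨-, hz, hd⟩
    exact hM.retTime_piece hz (hi ▸ hv i) hd
  · refine continuousOn_of_finite_closed_cover (fun j => (isClosed_face _).inter (isClosed_dom _))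
      hcov ?_
    rintro ⟨⟨k, i⟩, hi⟩
    refine (LinearMap.continuous_of_finiteDimensional (P i).map).continuousOn.congr ?_
    rintro z ⟨-, hz, hd⟩
    exact hM.retMap_piece hz (hi ▸ hv i) hd

lemma IsCyclic.tendsto_retTime {z' : Phase} (hz' : z' ∈ hexagon M) :
    Tendsto (retTime M φ) (𝓝[sec M \ hexagon M] z') (𝓝 0) := by
  have := (hM.continuousOn_ret hφ).1 z' (hM.hexagon_subset hz')
  rw [ContinuousWithinAt, retTime_of_mem_hexagon hz'] at this
  exact this.mono_left (nhdsWithin_mono _ sdiff_subset)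

lemma IsCyclic.retMap_mem {z : Phase} (hz : z ∈ sec M) : retMap M φ z ∈ sec M := by
  by_cases hz' : z ∈ hexagon M
  · rwa [retMap_of_mem_hexagon hφ hz']
  · exact (hM.isLeast_retTime hφ hz hz').1.2

lemma IsCyclic.retMap_mem_hexagon_iff {z : Phase} (hz : z ∈ sec M) :
    retMap M φ z ∈ hexagon M ↔ z ∈ hexagon M :=
  (hM.isPeriodicOrbit_hexagon hφ).mem_iff hφ (sec_subset hz) _

omit hM hφ in
/-- The return map is recognised by its defining property. -/
lemma retMap_eq {z : Phase} (hz' : z ∉ hexagon M) {t : ℝ}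
    (ht : 0 < t) (h : φ t z ∈ sec M) (hn : ∀ s, 0 < s → s < t → φ s z ∉ sec M) :
    retMap M φ z = φ t z := by
  rw [retMap, retTime_of_isLeast (t := t) hz' ⟨⟨ht, h⟩, fun s hs => ?_⟩]
  by_contra! hlt
  exact hn s hs.1 hlt hs.2

lemma IsCyclic.injOn_retMap : InjOn (retMap M φ) (sec M) := by
  have key : ∀ z ∈ sec M, z ∉ hexagon M → ∀ z' ∈ sec M, z' ∉ hexagon M →
      retMap M φ z = retMap M φ z' → retTime M φ z ≤ retTime M φ z' → z = z' := by
    intro z hz h z' hz' h' e hle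
    have hl := hM.isLeast_retTime hφ hz h
    have hl' := hM.isLeast_retTime hφ hz' h'
    have e2 : z = φ (retTime M φ z' - retTime M φ z) z' := by
      have := congrArg (φ (-retTime M φ z)) e
      rw [retMap, retMap, hφ.neg_apply (sec_subset hz), ← hφ.add (sec_subset hz')] at this
      rw [← sub_eq_neg_add] at this
      exact this
    rcases hle.eq_or_lt with heq | hlt
    · rw [heq, sub_self, hφ.zero] at e2
      exact e2
    · have := hl'.2 ⟨sub_pos.2 hlt, by rw [← e2]; exact hz⟩
      linarith [hl.1.1]
  intro z hz z' hz' e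
  by_cases h : z ∈ hexagon M
  · have h' : z' ∈ hexagon M := by
      rw [← hM.retMap_mem_hexagon_iff hφ hz', ← e, hM.retMap_mem_hexagon_iff hφ hz]; exact h
    rwa [retMap_of_mem_hexagon hφ h, retMap_of_mem_hexagon hφ h'] at e
  · have h' : z' ∉ hexagon M := by
      rw [← hM.retMap_mem_hexagon_iff hφ hz', ← e, hM.retMap_mem_hexagon_iff hφ hz]; exact h
    rcases le_total (retTime M φ z) (retTime M φ z') with hle | hle
    · exact key z hz h z' hz' h' e hle
    · exact (key z' hz' h' z hz h e.symm hle).symm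

/-- Every orbit off the hexagon hits the section after a bounded time. -/
lemma IsCyclic.exists_hit : ∃ C : ℝ, ∀ x ∈ levelSet M, ∃ t, 0 ≤ t ∧ t ≤ C ∧ φ t x ∈ sec M := by
  obtain ⟨n, P, s, hv, hc⟩ := hM.exists_pieces hφ
  have hb : ∀ i, ∃ C, ∀ x ∈ levelSet M, ‖(P i).time x‖ ≤ C := fun i =>
    hM.isCompact_levelSet.exists_bound_of_continuousOn
      (LinearMap.continuous_of_finiteDimensional (P i).time).continuousOn
  choose C hC using hb
  refine ⟨∑ i, |C i|, fun x hx => ?_⟩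
  obtain ⟨r, hr⟩ := hM.exists_region hx
  obtain ⟨i, rfl, hd⟩ := hc r x hr
  refine ⟨(P i).time x, (hv i).nonneg x hr hd, ?_, ?_⟩
  · exact (le_abs_self _).trans ((hC i x hx).trans ((le_abs_self _).trans
      (Finset.single_le_sum (f := fun i => |C i|) (fun j _ => abs_nonneg _) (Finset.mem_univ i))))
  · rw [(hv i).flow x hr hd]
    exact mem_iUnion.2 ⟨_, (hv i).mem x hr hd⟩

lemma IsCyclic.exists_hit_large {x : Phase} (hx : x ∈ levelSet M) (t₀ : ℝ) :
    (∃ t, t₀ < t ∧ φ t x ∈ sec M) ∧ ∃ t, t < t₀ ∧ φ t x ∈ sec M := by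
  obtain ⟨C, hC⟩ := hM.exists_hit hφ
  constructor
  · obtain ⟨t, h0, -, ht⟩ := hC _ (hφ.mem x hx (t₀ + 1))
    exact ⟨t + (t₀ + 1), by linarith, by rwa [hφ.add hx]⟩
  · obtain ⟨t, h0, h1, ht⟩ := hC _ (hφ.mem x hx (t₀ - 1 - C))
    exact ⟨t + (t₀ - 1 - C), by linarith, by rwa [hφ.add hx]⟩

lemma IsCyclic.hitTime_piece {r : Fin 3 × Fin 3} {x : Phase} (hx : x ∈ region M r)
    (hs : x ∉ sec M) {P : Piece} (hP : P.Valid M φ r) (hd : x ∈ P.dom) :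
    hitTime M φ x = P.time x := by
  refine IsLeast.csInf_eq ⟨⟨hP.nonneg x hx hd, ?_⟩, fun t ht => ?_⟩
  · rw [hP.flow x hx hd]
    exact mem_iUnion.2 ⟨_, hP.mem x hx hd⟩
  · by_contra! hlt
    refine hP.nohit x hx hd (fun h => hs (hM.hexagon_subset h)) t (lt_of_le_of_ne ht.1 ?_) hlt ht.2
    rintro rfl
    exact hs (by simpa [hφ.zero] using ht.2)

lemma IsCyclic.continuousOn_hitTime : ContinuousOn (hitTime M φ) (levelSet M \ sec M) := by
  obtain ⟨n, P, s, hv, hc⟩ := hM.exists_pieces hφ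
  refine continuousOn_of_finite_closed_cover (K := fun i : Fin n => region M (s i) ∩ (P i).dom)
    (fun i => (isClosed_region _).inter (isClosed_dom _)) (fun x hx => ?_) fun i => ?_
  · obtain ⟨r, hr⟩ := hM.exists_region hx.1
    obtain ⟨i, rfl, hd⟩ := hc r x hr
    exact mem_iUnion.2 ⟨i, hr, hd⟩
  · refine (LinearMap.continuous_of_finiteDimensional (P i).time).continuousOn.congr ?_
    rintro x ⟨⟨-, hs⟩, hr, hd⟩
    exact hM.hitTime_piece hφ hr hs (hv i) hd

lemma IsCyclic.flow_hitTime {x : Phase} (hx : x ∈ levelSet M) (hs : x ∉ sec M) :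
    φ (hitTime M φ x) x ∈ sec M := by
  obtain ⟨n, P, s, hv, hc⟩ := hM.exists_pieces hφ
  obtain ⟨r, hr⟩ := hM.exists_region hx
  obtain ⟨i, rfl, hd⟩ := hc r x hr
  rw [hM.hitTime_piece hφ hr hs (hv i) hd, (hv i).flow x hr hd]
  exact mem_iUnion.2 ⟨_, (hv i).mem x hr hd⟩

/-! ### Transversality of the flow to the section -/

omit hφ in
/-- On each triangle of the section two columns are tied. -/
lemma IsCyclic.exists_tied (k : Fin 4) : ∃ a b : Fin 3, a ≠ b ∧
    (∀ u ∈ triDir (secTri M k), cost M a u = cost M b u) ∧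
    ∀ x ∈ face M (secFace k), cost M a x = cost M b x := by
  obtain ⟨a, b, hab, ha, hb⟩ : ∃ a b : Fin 3, a ≠ b ∧ Sum.inr a ∉ secFace k ∧
      Sum.inr b ∉ secFace k := by
    revert k; decide
  have hv : ∀ v ∈ secFace k, cost M a (vert M v) = cost M b (vert M v) := by
    intro v hv
    rw [hM.cost_vert, hM.cost_vert]
    rcases v with v | l
    · rfl
    · have h1 : a ≠ l := fun h => ha (h ▸ hv)
      have h2 : b ≠ l := fun h => hb (h ▸ hv)
      simp [h1, h2]
  refine ⟨a, b, hab, fun u hu => ?_, fun x hx => ?_⟩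
  · have : triDir (secTri M k) ≤ LinearMap.ker (cost M a - cost M b) := by
      rw [triDir, vectorSpan, Submodule.span_le]
      rintro _ ⟨x, ⟨i, rfl⟩, y, ⟨j, rfl⟩, rfl⟩
      have h1 := hv (secVtx k i) (Finset.mem_image_of_mem _ (Finset.mem_univ _))
      have h2 := hv (secVtx k j) (Finset.mem_image_of_mem _ (Finset.mem_univ _))
      simp [secTri, h1, h2]
    have := this hu
    rwa [LinearMap.mem_ker, LinearMap.sub_apply, sub_eq_zero] at this
  · rw [← hM.convexHull_vert (isFace_secFace k)] at hx
    have : convexHull ℝ (vert M '' secFace k) ⊆ {x | (cost M a - cost M b) x = 0} := by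
      refine convexHull_min ?_ ?_
      · rintro _ ⟨v, hv', rfl⟩
        simp [hv v hv']
      · exact convex_hyperplane (cost M a - cost M b).isLinear 0
    have := this hx
    rwa [Set.mem_ofPred_eq, LinearMap.sub_apply, sub_eq_zero] at this

omit hφ in
lemma IsCyclic.cost_vel_ne {a b : Fin 3} (hab : a ≠ b) (r : Fin 3 × Fin 3) :
    cost M a (vel M r) ≠ cost M b (vel M r) := by
  rw [vel, hM.cost_vel, hM.cost_vel]
  simpa [Pi.single_apply] using hM.row_injective (i := r.1) hab

omit hφ in
lemma IsCyclic.vel_not_mem_triDir (r : Fin 3 × Fin 3) (k : Fin 4) :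
    vel M r ∉ triDir (secTri M k) := by
  obtain ⟨a, b, hab, h, -⟩ := hM.exists_tied k
  exact fun hm => hM.cost_vel_ne hab r (h _ hm)

lemma IsCyclic.flow_line {y : Phase} (hy : y ∈ levelSet M) (hy' : y ∉ hexagon M) {sgn : ℝ}
    (hsgn : sgn = 1 ∨ sgn = -1) : ∃ r, ∃ δ > 0, ∀ t, 0 ≤ t → t ≤ δ →
      φ (sgn * t) y = y + (sgn * t) • vel M r := by
  obtain ⟨r, h1, h2, d1, d2⟩ := hM.exists_dominant hy hy' hsgn
  refine ⟨r, ?_⟩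
  have := hM.eq_line_of_dominant (hφ.traj y) (r := r) hsgn
  simp only [hφ.zero] at this
  exact this h1 h2 d1 d2

/-- Orbits leave the section at once, in both time directions. -/
lemma IsCyclic.eventually_not_mem_sec {y : Phase} (hy : y ∈ levelSet M) (hy' : y ∉ hexagon M) :
    ∃ δ > 0, ∀ s, s ≠ 0 → |s| < δ → φ s y ∉ sec M := by
  have hk : ∀ k, ∃ δ > 0, ∀ s, s ≠ 0 → |s| < δ → φ s y ∉ face M (secFace k) := by
    intro k
    by_cases hmem : y ∈ face M (secFace k)
    · obtain ⟨r₁, δ₁, hδ₁, h₁⟩ := hM.flow_line hφ hy hy' (Or.inl rfl)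
      obtain ⟨r₂, δ₂, hδ₂, h₂⟩ := hM.flow_line hφ hy hy' (Or.inr rfl)
      obtain ⟨a, b, hab, -, hf⟩ := hM.exists_tied k
      have key : ∀ s r, s ≠ 0 → φ s y = y + s • vel M r → φ s y ∉ face M (secFace k) := by
        intro s r hs e hm
        have := hf _ hm
        rw [e, map_add, map_add, map_smul, map_smul, hf y hmem, add_right_inj] at this
        exact hM.cost_vel_ne hab r (smul_right_injective ℝ hs this)
      refine ⟨min δ₁ δ₂, lt_min hδ₁ hδ₂, fun s hs hlt => ?_⟩
      rw [lt_min_iff] at hlt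
      rcases le_total 0 s with h | h
      · rw [abs_of_nonneg h] at hlt
        exact key s r₁ hs (by simpa using h₁ s h hlt.1.le)
      · rw [abs_of_nonpos h] at hlt
        exact key s r₂ hs (by simpa using h₂ (-s) (by linarith) hlt.2.le)
    · have hc := (hφ.continuous_right hy).tendsto 0
      simp only [hφ.zero] at hc
      obtain ⟨δ, hδ, h⟩ := Metric.eventually_nhds_iff.1
        (hc.eventually ((isClosed_face (M := M) (secFace k)).isOpen_compl.mem_nhds hmem))
      exact ⟨δ, hδ, fun s _ hs => h (by simpa using hs)⟩
  choose δ hδ h using hk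
  refine ⟨Finset.univ.inf' Finset.univ_nonempty δ, by simpa using hδ, fun s hs hlt hm => ?_⟩
  obtain ⟨k, hk⟩ := mem_iUnion.1 hm
  exact h k s hs (hlt.trans_le (Finset.inf'_le _ (Finset.mem_univ k))) hk

lemma IsCyclic.surjOn_retMap : SurjOn (retMap M φ) (sec M) (sec M) := by
  intro y hy
  by_cases hy' : y ∈ hexagon M
  · exact ⟨y, hy, retMap_of_mem_hexagon hφ hy'⟩
  have hyl := sec_subset hy
  obtain ⟨δ, hδ, h⟩ := hM.eventually_not_mem_sec hφ hyl hy'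
  obtain ⟨t, ht, hts⟩ := (hM.exists_hit_large hφ hyl 0).2
  -- the last hit before time zero
  have hK : IsCompact {s | s ∈ Icc t (-δ) ∧ φ s y ∈ sec M} :=
    isCompact_Icc.inter_right (isClosed_sec.preimage (hφ.continuous_right hyl))
  have htδ : t ≤ -δ := by
    by_contra! hlt
    exact h t ht.ne (by rw [abs_of_neg ht]; linarith) hts
  obtain ⟨s, ⟨⟨hs1, hs2⟩, hs3⟩, hmax⟩ := hK.exists_isGreatest ⟨t, ⟨le_rfl, htδ⟩, hts⟩
  have hs' : φ s y ∉ hexagon M := fun hh =>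
    hy' (((hM.isPeriodicOrbit_hexagon hφ).mem_iff hφ hyl s).1 hh)
  refine ⟨φ s y, hs3, ?_⟩
  have e : φ (-s) (φ s y) = y := hφ.neg_apply hyl s
  rw [retMap_eq hs' (t := -s) (by linarith) (by rwa [e]), e]
  intro u hu1 hu2 hm
  rw [← hφ.add hyl] at hm
  rcases le_or_gt (u + s) (-δ) with hle | hgt
  · have := hmax ⟨⟨by linarith, hle⟩, hm⟩
    linarith
  · exact h (u + s) (by linarith) (by rw [abs_of_neg (by linarith)]; linarith) hm

lemma IsCyclic.hasDerivWithinAt_flow {y : Phase} (hy : y ∈ levelSet M) (hy' : y ∉ hexagon M) :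
    (∃ r, HasDerivWithinAt (fun t => φ t y) (vel M r) (Iic 0) 0) ∧
      ∃ r, HasDerivWithinAt (fun t => φ t y) (vel M r) (Ici 0) 0 := by
  have line : ∀ r, HasDerivAt (fun t : ℝ => y + t • vel M r) (vel M r) 0 := fun r => by
    simpa using ((hasDerivAt_id (0 : ℝ)).smul_const (vel M r)).const_add y
  constructor
  · obtain ⟨r, δ, hδ, h⟩ := hM.flow_line hφ hy hy' (Or.inr rfl)
    refine ⟨r, (line r).hasDerivWithinAt.congr_of_eventuallyEq ?_ (by simp [hφ.zero])⟩
    filter_upwards [self_mem_nhdsWithin, nhdsWithin_le_nhds (Ioi_mem_nhds (neg_lt_zero.2 hδ))]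
      with t ht ht'
    have h1 : t ≤ 0 := ht
    have h2 : -δ < t := ht'
    simpa using h (-t) (by linarith) (by linarith)
  · obtain ⟨r, δ, hδ, h⟩ := hM.flow_line hφ hy hy' (Or.inl rfl)
    refine ⟨r, (line r).hasDerivWithinAt.congr_of_eventuallyEq ?_ (by simp [hφ.zero])⟩
    filter_upwards [self_mem_nhdsWithin, nhdsWithin_le_nhds (Iio_mem_nhds hδ)] with t ht ht'
    simpa using h t ht (le_of_lt ht')

/-- Orbits cross the section transversally. Injectivity of the flow box holds because the return
time is bounded below near `y`; its image is a neighbourhood because the hitting time is continuous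
just before the section. -/
theorem IsCyclic.crossesTransversally {y : Phase} (hy : y ∈ sec M) (hy' : y ∉ hexagon M) :
    CrossesTransversally φ (levelSet M) (sec M) (secTri M) y := by
  have hyl := sec_subset hy
  obtain ⟨⟨r₁, h₁⟩, r₂, h₂⟩ := hM.hasDerivWithinAt_flow hφ hyl hy'
  refine ⟨⟨vel M r₁, vel M r₂, h₁, h₂, fun k _ => ⟨hM.vel_not_mem_triDir r₁ k,
    hM.vel_not_mem_triDir r₂ k⟩⟩, ?_⟩
  obtain ⟨δ, hδ, hn⟩ := hM.eventually_not_mem_sec hφ hyl hy'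
  have hτ := (hM.isLeast_retTime hφ hy hy').1.1
  set ε := min δ (retTime M φ y / 4) with hε
  have hε0 : 0 < ε := by positivity
  have hU : {z | z ∈ sec M → retTime M φ y / 2 < retTime M φ z} ∈ 𝓝 y := by
    have := ((hM.continuousOn_ret hφ).1 y hy).eventually (lt_mem_nhds (half_lt_self hτ))
    rwa [eventually_nhdsWithin_iff] at this
  have hUh : ∀ z ∈ sec M, retTime M φ y / 2 < retTime M φ z → z ∉ hexagon M := by
    intro z _ h hh
    rw [retTime_of_mem_hexagon hh] at h
    linarith
  refine ⟨ε, hε0, _, hU, ?_, ?_⟩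
  · have key : ∀ s s' z z', s ∈ Ioo (-ε) ε → s' ∈ Ioo (-ε) ε → z ∈ sec M → z' ∈ sec M →
        retTime M φ y / 2 < retTime M φ z' → φ s z = φ s' z' → ¬ s < s' := by
      intro s s' z z' hs hs' hz hz' h' e hlt
      have e2 : z = φ (s' - s) z' := by
        have := congrArg (φ (-s)) e
        rw [hφ.neg_apply (sec_subset hz), ← hφ.add (sec_subset hz')] at this
        rw [← sub_eq_neg_add] at this
        exact this
      have := (hM.isLeast_retTime hφ hz' (hUh z' hz' h')).2 ⟨sub_pos.2 hlt, by rwa [← e2]⟩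
      have h4 : ε ≤ retTime M φ y / 4 := min_le_right _ _
      linarith [hs.1, hs'.2]
    rintro ⟨s, z⟩ ⟨hs, hz, hzU⟩ ⟨s', z'⟩ ⟨hs', hz', hzU'⟩ e
    simp only at e hs hs' hz hz'
    obtain rfl : s = s' := le_antisymm (not_lt.1 (key s' s z' z hs' hs hz' hz (hzU hz) e.symm))
      (not_lt.1 (key s s' z z' hs hs' hz hz' (hzU' hz') e))
    have := congrArg (φ (-s)) e
    rw [hφ.neg_apply (sec_subset hz), hφ.neg_apply (sec_subset hz')] at this
    rw [this]
  · set a := ε / 2 with ha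
    have ha0 : 0 < a := by positivity
    have haε : a < ε := half_lt_self hε0
    have haδ : a < δ := haε.trans_le (min_le_left _ _)
    set y₀ := φ (-a) y with hy₀
    have hy₀l : y₀ ∈ levelSet M := hφ.mem y hyl _
    have hy₀s : y₀ ∉ sec M := hn (-a) (by linarith) (by rwa [abs_neg, abs_of_pos ha0])
    have hadd : ∀ t, φ t y₀ = φ (t - a) y := fun t => by rw [hy₀, ← hφ.add hyl]; rfl
    have hhit : hitTime M φ y₀ = a := by
      refine IsLeast.csInf_eq ⟨⟨ha0.le, by rw [hadd, sub_self, hφ.zero]; exact hy⟩, fun t ht => ?_⟩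
      by_contra! hlt
      refine hn (t - a) (by linarith) ?_ (by rw [← hadd]; exact ht.2)
      rw [abs_of_neg (by linarith)]
      linarith [ht.1]
    have hback : Tendsto (φ (-a)) (𝓝[levelSet M] y) (𝓝[levelSet M \ sec M] y₀) := by
      refine tendsto_nhdsWithin_iff.2 ⟨hφ.continuousOn_left (-a) y hyl, ?_⟩
      have := (hφ.continuousOn_left (-a) y hyl).eventually
        (isClosed_sec.isOpen_compl.mem_nhds hy₀s)
      filter_upwards [this, self_mem_nhdsWithin] with x hx hxl
      exact ⟨hφ.mem x hxl _, hx⟩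
    have hT : Tendsto (fun x => hitTime M φ (φ (-a) x)) (𝓝[levelSet M] y) (𝓝 a) := by
      have := (hM.continuousOn_hitTime hφ y₀ ⟨hy₀l, hy₀s⟩).tendsto
      rw [hhit] at this
      exact this.comp hback
    have hpair : Tendsto (fun x => (hitTime M φ (φ (-a) x), φ (-a) x)) (𝓝[levelSet M] y)
        (𝓝[univ ×ˢ levelSet M] (a, y₀)) := by
      refine tendsto_nhdsWithin_iff.2 ⟨hT.prodMk_nhds (hback.mono_right nhdsWithin_le_nhds), ?_⟩
      filter_upwards [self_mem_nhdsWithin] with x hxl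
      exact ⟨mem_univ _, hφ.mem x hxl _⟩
    have hland : Tendsto (fun x => φ (hitTime M φ (φ (-a) x)) (φ (-a) x)) (𝓝[levelSet M] y)
        (𝓝 y) := by
      have := (hφ.cont (a, y₀) ⟨mem_univ _, hy₀l⟩).tendsto.comp hpair
      simpa only [Function.comp_def, hadd a, sub_self, hφ.zero] using this
    filter_upwards [hback.eventually self_mem_nhdsWithin,
      hT.eventually (Ioo_mem_nhds (by linarith : a - ε < a) (by linarith : a < a + ε)),
      hland.eventually hU, self_mem_nhdsWithin] with x hx1 hx2 hx3 hx4
    refine ⟨(a - hitTime M φ (φ (-a) x), φ (hitTime M φ (φ (-a) x)) (φ (-a) x)),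
      ⟨⟨by linarith [hx2.2], by linarith [hx2.1]⟩, hM.flow_hitTime hφ hx1.1 hx1.2, hx3⟩, ?_⟩
    simp only
    rw [← hφ.add (hφ.mem x hx4 _), sub_add_cancel, ← hφ.add hx4, add_neg_cancel, hφ.zero]

end pieces

variable {M : Matrix (Fin 3) (Fin 3) ℝ} {φ : ℝ → Phase → Phase}

/-! ### Piecewise affinity of the return map -/

/-- Adjoining a vertex `v` of a polytope on the negative side of a hyperplane, while the old ones
lie on its nonnegative side, amounts on the nonnegative side to adjoining the points where the
segments from `v` to the old vertices cross the hyperplane. -/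
lemma exists_convexHull_insert_inter {E : Type*} [AddCommGroup E] [Module ℝ E] (G : Finset E)
    (c : E →ₗ[ℝ] ℝ) (hG : ∀ g ∈ G, 0 ≤ c g) (hne : G.Nonempty) {v : E} (hv : c v < 0) :
    ∃ G' : Finset E, convexHull ℝ (insert v (G : Set E)) ∩ {x | 0 ≤ c x} =
      convexHull ℝ (G' : Set E) := by
  classical
  let X : E → E := fun g => (c g - c v)⁻¹ • (c g • v + (-c v) • g)
  have hX : ∀ g, 0 ≤ c g → X g ∈ segment ℝ v g ∧ c (X g) = 0 := by
    intro g hg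
    have hd : 0 < c g - c v := by linarith
    constructor
    · refine ⟨(c g - c v)⁻¹ * c g, (c g - c v)⁻¹ * (-c v), by positivity,
        mul_nonneg (by positivity) (by linarith), ?_, by simp only [X, smul_add, smul_smul]⟩
      field_simp
      ring
    · simp only [X, map_smul, map_add, smul_eq_mul]
      ring
  have hcv : ∀ x ∈ convexHull ℝ ((G ∪ G.image X : Finset E) : Set E), 0 ≤ c x := by
    intro x hx
    refine convexHull_min ?_ ((convex_Ici (0 : ℝ)).linear_preimage c) hx
    intro y hy
    rw [Finset.mem_coe, Finset.mem_union, Finset.mem_image] at hy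
    rcases hy with hy | ⟨g, hg, rfl⟩
    · exact hG y hy
    · exact (hX g (hG g hg)).2.ge
  refine ⟨G ∪ G.image X, Subset.antisymm ?_ fun x hx => ⟨?_, hcv x hx⟩⟩
  · rintro x ⟨hx, hcx : 0 ≤ c x⟩
    rw [convexHull_insert (by simpa using hne), convexJoin_singleton_left] at hx
    obtain ⟨y, hy, a, b, ha, hb, hab, rfl⟩ := by simpa only [mem_iUnion] using hx
    have hd : 0 < -c v := by linarith
    have hcy : 0 ≤ c y :=
      convexHull_min (fun g hg => hG g hg) ((convex_Ici (0 : ℝ)).linear_preimage c) hy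
    have hsub : convexHull ℝ (G : Set E) ⊆ convexHull ℝ ((G ∪ G.image X : Finset E) : Set E) :=
      convexHull_mono (by simp)
    have hXy : X y ∈ convexHull ℝ ((G ∪ G.image X : Finset E) : Set E) := by
      obtain ⟨w, hw0, hw1, hwy⟩ := Finset.mem_convexHull'.1 hy
      have hcw : ∑ g ∈ G, w g * c g = c y := by simp [← hwy]
      have e : X y = ∑ g ∈ G, ((c y - c v)⁻¹ * (w g * (c g - c v))) • X g := by
        have : ∀ g ∈ G, ((c y - c v)⁻¹ * (w g * (c g - c v))) • X g =
            (c y - c v)⁻¹ • ((w g * c g) • v + (-c v) • w g • g) := by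
          intro g hg
          have : c g - c v ≠ 0 := by linarith [hG g hg]
          simp only [X, smul_add, smul_smul]
          congr 2 <;> field_simp
        rw [Finset.sum_congr rfl this, ← Finset.smul_sum, Finset.sum_add_distrib,
          ← Finset.smul_sum, ← Finset.sum_smul, hcw, hwy]
      rw [e]
      refine (convex_convexHull ℝ _).sum_mem (fun g hg => ?_) ?_ fun g hg => ?_
      · have := hG g hg
        exact mul_nonneg (inv_nonneg.2 (by linarith)) (mul_nonneg (hw0 g hg) (by linarith))
      · have : c y - c v ≠ 0 := by linarith
        simp only [mul_sub, ← Finset.mul_sum, Finset.sum_sub_distrib, hcw, ← Finset.sum_mul, hw1]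
        field_simp
      · exact subset_convexHull ℝ _ (by simpa using Or.inr ⟨g, hg, rfl⟩)
    have hcx' : 0 ≤ a * c v + b * c y := by simpa using hcx
    rcases hcy.eq_or_lt with h0 | h0
    · have ha0 : a = 0 := by
        rw [← h0] at hcx'
        nlinarith
      obtain rfl : b = 1 := by linarith
      simpa [ha0] using hsub hy
    · refine (convex_convexHull ℝ _).segment_subset hXy (hsub hy)
        ⟨a * (c y - c v) / c y, 1 - a * (c y - c v) / c y, ?_, ?_, by ring, ?_⟩
      · exact div_nonneg (mul_nonneg ha (by linarith)) h0.le
      · rw [sub_nonneg, div_le_one h0]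
        obtain rfl : b = 1 - a := by linarith
        nlinarith
      · have h1 : c y - c v ≠ 0 := by linarith
        obtain rfl : b = 1 - a := by linarith
        simp only [X, smul_add, smul_smul, add_assoc, ← add_smul]
        congr 2 <;> field_simp
        ring
  · refine convexHull_min ?_ (convex_convexHull ℝ _) hx
    intro y hy
    rw [Finset.mem_coe, Finset.mem_union, Finset.mem_image] at hy
    rcases hy with hy | ⟨g, hg, rfl⟩
    · exact subset_convexHull ℝ _ (mem_insert_of_mem _ hy)
    · exact (convex_convexHull ℝ _).segment_subset (subset_convexHull ℝ _ (mem_insert _ _))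
        (subset_convexHull ℝ _ (mem_insert_of_mem _ hg)) (hX g (hG g hg)).1

/-- A polytope cut by a half-space is a polytope. -/
lemma exists_convexHull_inter {E : Type*} [AddCommGroup E] [Module ℝ E] (F : Finset E)
    (c : E →ₗ[ℝ] ℝ) :
    ∃ G : Finset E, convexHull ℝ (F : Set E) ∩ {x | 0 ≤ c x} = convexHull ℝ (G : Set E) := by
  classical
  rcases (F.filter fun v => 0 ≤ c v).eq_empty_or_nonempty with he | hne
  · refine ⟨∅, ?_⟩
    rw [Finset.coe_empty, convexHull_empty, eq_empty_iff_forall_notMem]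
    rintro x ⟨hx, hcx : 0 ≤ c x⟩
    have : c x < 0 := convexHull_min (fun v hv => by
      by_contra h
      exact Finset.notMem_empty v (he ▸ Finset.mem_filter.2 ⟨hv, not_lt.1 h⟩))
      ((convex_Iio (0 : ℝ)).linear_preimage c) hx
    linarith
  · have key : ∀ N : Finset E, (∀ v ∈ N, c v < 0) → ∃ G : Finset E,
        convexHull ℝ ((N ∪ F.filter fun v => 0 ≤ c v : Finset E) : Set E) ∩ {x | 0 ≤ c x} =
          convexHull ℝ (G : Set E) := by
      intro N
      induction N using Finset.induction_on with
      | empty =>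
        refine fun _ => ⟨F.filter fun v => 0 ≤ c v, ?_⟩
        rw [Finset.empty_union, inter_eq_left]
        exact convexHull_min (fun v hv => (Finset.mem_filter.1 hv).2)
          ((convex_Ici (0 : ℝ)).linear_preimage c)
      | insert v N hvN ih =>
        intro hN
        obtain ⟨G, hG⟩ := ih fun u hu => hN u (Finset.mem_insert_of_mem hu)
        have hv : c v < 0 := hN v (Finset.mem_insert_self _ _)
        have hGs : ∀ g ∈ convexHull ℝ (G : Set E),
            g ∈ convexHull ℝ ((N ∪ F.filter fun v => 0 ≤ c v : Finset E) : Set E) ∧ 0 ≤ c g :=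
          fun g hg => by rw [← hG] at hg; exact hg
        have hFG : ∀ u ∈ F.filter fun v => 0 ≤ c v, u ∈ convexHull ℝ (G : Set E) := by
          intro u hu
          rw [← hG]
          exact ⟨subset_convexHull ℝ _ (Finset.mem_union_right _ hu), (Finset.mem_filter.1 hu).2⟩
        have hGne : G.Nonempty := by
          obtain ⟨u, hu⟩ := hne
          rw [← Finset.coe_nonempty, ← convexHull_nonempty_iff (𝕜 := ℝ)]
          exact ⟨u, hFG u hu⟩
        obtain ⟨G', hG'⟩ := exists_convexHull_insert_inter G c
          (fun g hg => (hGs g (subset_convexHull ℝ _ hg)).2) hGne hv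
        refine ⟨G', ?_⟩
        rw [← hG', Finset.insert_union, Finset.coe_insert]
        refine Subset.antisymm ?_ ?_
        · rintro x ⟨hx, hcx : 0 ≤ c x⟩
          refine ⟨?_, hcx⟩
          rw [convexHull_insert (by
            obtain ⟨u, hu⟩ := hne
            exact ⟨u, Finset.mem_union_right _ hu⟩), convexJoin_singleton_left] at hx
          obtain ⟨y, hy, a, b, ha, hb, hab, rfl⟩ := by simpa only [mem_iUnion] using hx
          have hcx' : 0 ≤ a * c v + b * c y := by simpa using hcx
          have hcy : 0 ≤ c y := by
            by_contra! h
            rcases ha.eq_or_lt with rfl | ha'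
            · nlinarith
            · nlinarith
          have hy' : y ∈ convexHull ℝ (G : Set E) := by rw [← hG]; exact ⟨hy, hcy⟩
          exact (convex_convexHull ℝ _) (subset_convexHull ℝ _ (mem_insert _ _))
            (convexHull_mono (subset_insert _ _) hy') ha hb hab
        · rintro x ⟨hx, hcx⟩
          refine ⟨convexHull_min ?_ (convex_convexHull ℝ _) hx, hcx⟩
          rintro u (rfl | hu)
          · exact subset_convexHull ℝ _ (mem_insert _ _)
          · exact convexHull_mono (subset_insert _ _) (hGs u (subset_convexHull ℝ _ hu)).1
    obtain ⟨G, hG⟩ := key (F.filter fun v => ¬ 0 ≤ c v)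
      fun v hv => not_le.1 (Finset.mem_filter.1 hv).2
    refine ⟨G, ?_⟩
    rwa [Finset.union_comm, Finset.filter_union_filter_not_eq] at hG

/-- A polytope cut by finitely many half-spaces is a polytope. -/
lemma exists_convexHull_inter_list {E : Type*} [AddCommGroup E] [Module ℝ E]
    (C : List (E →ₗ[ℝ] ℝ)) (F : Finset E) :
    ∃ G : Finset E, convexHull ℝ (F : Set E) ∩ {x | ∀ c ∈ C, 0 ≤ c x} =
      convexHull ℝ (G : Set E) := by
  induction C generalizing F with
  | nil => exact ⟨F, by simp⟩
  | cons c C ih =>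
    obtain ⟨G, hG⟩ := exists_convexHull_inter F c
    obtain ⟨G', hG'⟩ := ih G
    refine ⟨G', ?_⟩
    rw [← hG', ← hG, inter_assoc]
    congr 1
    ext x
    simp

/-- The pieces of the return map are intersections of triangles with domains of branches. -/
lemma IsCyclic.isPiecewiseAffineOn (hM : IsCyclic M)
    (hφ : IsUniqueFlow (hamField M M) (levelSet M) φ) :
    IsPiecewiseAffineOn (retMap M φ) (sec M) := by
  classical
  obtain ⟨n, P, s, hv, hc⟩ := hM.exists_pieces hφ
  have hG : ∀ j : {j : Fin 4 × Fin n // s j.2 = afterRegion j.1}, ∃ G : Finset Phase,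
      face M (secFace j.1.1) ∩ (P j.1.2).dom = convexHull ℝ (G : Set Phase) := by
    rintro ⟨⟨k, i⟩, hi⟩
    obtain ⟨G, hG⟩ := exists_convexHull_inter_list (P i).cons ((secFace k).image (vert M))
    refine ⟨G, ?_⟩
    rw [← hG, Finset.coe_image, hM.convexHull_vert (isFace_secFace k)]
    rfl
  choose G hG using hG
  let e := Fintype.equivFin {j : Fin 4 × Fin n // s j.2 = afterRegion j.1}
  refine ⟨_, fun m => G (e.symm m), ?_, fun m => ⟨(P (e.symm m).1.2).map.toAffineMap, ?_⟩⟩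
  · refine Subset.antisymm (fun z hz => ?_) (iUnion_subset fun m z hz => ?_)
    · obtain ⟨k, hk⟩ := mem_iUnion.1 hz
      obtain ⟨i, hi, hd⟩ := hc _ z (hM.secFace_subset k hk)
      refine mem_iUnion.2 ⟨e ⟨(k, i), hi⟩, ?_⟩
      dsimp only
      rw [Equiv.symm_apply_apply, ← hG]
      exact ⟨hk, hd⟩
    · rw [← hG] at hz
      exact mem_iUnion.2 ⟨_, hz.1⟩
  · intro z hz
    rw [← hG] at hz
    exact hM.retMap_piece hz.1 ((e.symm m).2 ▸ hv _) hz.2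

variable {M : Matrix (Fin 3) (Fin 3) ℝ} {φ : ℝ → Phase → Phase}

/-! ### The area on the section -/

/-- The affine parametrization of the plane of the triangle `k`. -/
def secPar (M : Matrix (Fin 3) (Fin 3) ℝ) (k : Fin 4) (s : ℝ × ℝ) : Phase :=
  secTri M k 0 + s.1 • (secTri M k 1 - secTri M k 0) + s.2 • (secTri M k 2 - secTri M k 0)

/-- The barycentric coordinates of `secPar M k s`. -/
def parWeight (k : Fin 4) (s : ℝ × ℝ) (v : Vtx) : ℝ :=
  if v = secVtx k 0 then 1 - s.1 - s.2 else if v = secVtx k 1 then s.1 else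
    if v = secVtx k 2 then s.2 else 0

lemma parWeight_vtx (k : Fin 4) (s : ℝ × ℝ) (i : Fin 3) :
    parWeight k s (secVtx k i) = ![1 - s.1 - s.2, s.1, s.2] i := by
  have hinj : Function.Injective (secVtx k) := by revert k; decide
  fin_cases i <;> simp [parWeight, hinj.eq_iff]

lemma mem_secFace (k : Fin 4) (i : Fin 3) : secVtx k i ∈ secFace k :=
  Finset.mem_image_of_mem _ (Finset.mem_univ _)

lemma parWeight_of_not_mem {k : Fin 4} {v : Vtx} (hv : v ∉ secFace k) (s : ℝ × ℝ) :
    parWeight k s v = 0 := by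
  have : ∀ i, v ≠ secVtx k i := fun i h => hv (h ▸ mem_secFace k i)
  simp [parWeight, this]

lemma parWeight_own (k : Fin 4) (s : ℝ × ℝ) : parWeight k s (Sum.inl (afterRegion k).1) = 0 ∧
    parWeight k s (Sum.inr (afterRegion k).2) = 0 :=
  ⟨parWeight_of_not_mem (by revert k; decide) s, parWeight_of_not_mem (by revert k; decide) s⟩

lemma bary_parWeight (k : Fin 4) (s : ℝ × ℝ) : bary M (parWeight k s) = secPar M k s := by
  rw [bary_apply, sum_eq_secFace k _ fun v hv => by rw [parWeight_of_not_mem hv, zero_smul]]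
  simp only [parWeight_vtx, secPar, secTri, Matrix.cons_val]
  module

lemma sum_parWeight (k : Fin 4) (s : ℝ × ℝ) : ∑ v, parWeight k s v = 1 := by
  rw [sum_eq_secFace k _ fun v hv => parWeight_of_not_mem hv s]
  simp only [parWeight_vtx, Matrix.cons_val]
  ring

lemma IsCyclic.gap_secPar (hM : IsCyclic M) (k : Fin 4) (s : ℝ × ℝ) (v : Vtx) :
    gap M (afterRegion k) v (secPar M k s) = parWeight k s v := by
  rw [← bary_parWeight, hM.gap_bary (parWeight_own k s).1 (parWeight_own k s).2]

lemma IsCyclic.secPar_mem_regionSpan (hM : IsCyclic M) (k : Fin 4) (s : ℝ × ℝ) :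
    secPar M k s ∈ regionSpan M (afterRegion k) := by
  rw [← bary_parWeight]
  exact hM.bary_mem_regionSpan (parWeight_own k s).1 (parWeight_own k s).2 (sum_parWeight k s)

lemma IsCyclic.injective_secPar (hM : IsCyclic M) (k : Fin 4) :
    Function.Injective (secPar M k) := by
  intro s t h
  have (v : Vtx) : parWeight k s v = parWeight k t v := by
    rw [← hM.gap_secPar k s v, h, hM.gap_secPar]
  have h1 := this (secVtx k 1)
  have h2 := this (secVtx k 2)
  simp only [parWeight_vtx, Matrix.cons_val] at h1 h2
  exact Prod.ext h1 h2

lemma continuous_secPar (k : Fin 4) : Continuous (secPar M k) := by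
  unfold secPar
  fun_prop

lemma IsCyclic.exists_secPar (hM : IsCyclic M) {k : Fin 4} {z : Phase}
    (hz : z ∈ face M (secFace k)) : ∃ s, secPar M k s = z := by
  have hr := hM.secFace_subset k hz
  obtain ⟨s, hs⟩ := hM.mem_secPlane hr.1 (l := k) fun v hv => by
    rw [← congrFun (hM.coord_eq hr) v]; exact hz.2 v hv
  exact ⟨s, hs⟩

lemma IsCyclic.coord_secPar (hM : IsCyclic M) {k : Fin 4} {s : ℝ × ℝ}
    (hs : 0 ≤ s.1 ∧ 0 ≤ s.2 ∧ s.1 + s.2 ≤ 1) (v : Vtx) :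
    coord M (secPar M k s) v = parWeight k s v := by
  rw [← bary_parWeight, hM.coord_bary (parWeight_own k s).1 (parWeight_own k s).2
    (sum_parWeight k s)]
  intro v
  unfold parWeight
  split_ifs <;> linarith

/-- The parameters of the triangle `k`. -/
def simplexPar : Set (ℝ × ℝ) := {s | 0 ≤ s.1 ∧ 0 ≤ s.2 ∧ s.1 + s.2 ≤ 1}

lemma IsCyclic.mem_simplexPar (hM : IsCyclic M) {k : Fin 4} {s : ℝ × ℝ}
    (h : secPar M k s ∈ face M (secFace k)) : s ∈ simplexPar := by
  have hr := hM.secFace_subset k h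
  have (i : Fin 3) : 0 ≤ ![1 - s.1 - s.2, s.1, s.2] i := by
    rw [← parWeight_vtx k s i, ← hM.gap_secPar]
    exact hr.2 _
  have h0 := this 0
  simp only [Matrix.cons_val] at h0
  exact ⟨this 1, this 2, by linarith⟩

lemma IsCyclic.secPar_mem_face (hM : IsCyclic M) (k : Fin 4) {s : ℝ × ℝ} (hs : s ∈ simplexPar) :
    secPar M k s ∈ face M (secFace k) := by
  have hr : secPar M k s ∈ region M (afterRegion k) := by
    rw [← bary_parWeight]
    refine hM.bary_mem_region (parWeight_own k s).1 (parWeight_own k s).2 (sum_parWeight k s) ?_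
    intro v
    obtain ⟨h1, h2, h3⟩ := hs
    unfold parWeight
    split_ifs <;> linarith
  exact ⟨region_subset hM hr, fun v hv => by rw [hM.coord_secPar hs, parWeight_of_not_mem hv]⟩

lemma volume_line (c : ℝ × ℝ →ₗ[ℝ] ℝ) (hc : c ≠ 0) (a : ℝ) : volume {s | c s = a} = 0 := by
  let A : AffineSubspace ℝ (ℝ × ℝ) :=
    { carrier := {s | c s = a}
      smul_vsub_vadd_mem' := fun t p q r (hp : c p = a) (hq : c q = a) (hr : c r = a) => by
        show c _ = a
        simp [hp, hq, hr] }
  refine Measure.addHaar_affineSubspace volume A fun h => hc ?_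
  have hA : ∀ s, c s = a := fun s => by
    have : s ∈ A := h ▸ AffineSubspace.mem_top ℝ _ s
    exact this
  refine LinearMap.ext fun s => ?_
  rw [hA s, ← hA 0, map_zero, LinearMap.zero_apply]

lemma IsCyclic.volume_inter_face (hM : IsCyclic M) {k l : Fin 4} (hkl : k ≠ l) :
    volume (simplexPar ∩ secPar M k ⁻¹' face M (secFace l)) = 0 := by
  obtain ⟨i, hi⟩ : ∃ i, secVtx k i ∉ secFace l := by revert k l; decide
  have hsub : simplexPar ∩ secPar M k ⁻¹' face M (secFace l) ⊆
      {s | ![1 - s.1 - s.2, s.1, s.2] i = 0} := by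
    rintro s ⟨hs, hz⟩
    have := hz.2 _ hi
    rwa [hM.coord_secPar hs, parWeight_vtx] at this
  refine measure_mono_null hsub ?_
  have h1 : (LinearMap.fst ℝ ℝ ℝ) ≠ 0 := fun h => by
    simpa using congrArg (fun f => f (1, 0)) h
  have h2 : (LinearMap.snd ℝ ℝ ℝ) ≠ 0 := fun h => by
    simpa using congrArg (fun f => f (0, 1)) h
  have h3 : (LinearMap.fst ℝ ℝ ℝ + LinearMap.snd ℝ ℝ ℝ) ≠ 0 := fun h => by
    simpa using congrArg (fun f => f (0, 1)) h
  fin_cases i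
  · refine measure_mono_null (fun s (hs : 1 - s.1 - s.2 = 0) => ?_) (volume_line _ h3 1)
    show s.1 + s.2 = 1
    linarith
  · exact volume_line _ h1 0
  · exact volume_line _ h2 0

/-- The density of the area on the triangle `k` in the coordinates `secPar M k`. -/
def secDensity (M : Matrix (Fin 3) (Fin 3) ℝ) (k : Fin 4) : ℝ :=
  symp M (secTri M k 1 - secTri M k 0) (secTri M k 2 - secTri M k 0)

lemma sympArea_apply {E : Set Phase} (hE : MeasurableSet E) : sympArea M (secTri M) E =
    ∑ k, ENNReal.ofReal |secDensity M k| * volume (secPar M k ⁻¹' E ∩ simplexPar) := by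
  rw [sympArea, Measure.finsetSum_apply]
  refine Finset.sum_congr rfl fun k _ => ?_
  have e : triArea M (secTri M k) = ENNReal.ofReal |secDensity M k| •
    (volume.restrict simplexPar).map (secPar M k) := rfl
  rw [e, Measure.smul_apply, smul_eq_mul, Measure.map_apply
    (continuous_secPar (M := M) k).measurable hE,
    Measure.restrict_apply ((continuous_secPar (M := M) k).measurable hE)]

lemma IsCyclic.sympArea_of_subset_face (hM : IsCyclic M) {k : Fin 4} {B : Set Phase}
    (hB : MeasurableSet B) (hk : B ⊆ face M (secFace k)) : sympArea M (secTri M) B =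
      ENNReal.ofReal |secDensity M k| * volume (secPar M k ⁻¹' B) := by
  rw [sympArea_apply hB, Finset.sum_eq_single k]
  · rw [inter_eq_left.2 (show secPar M k ⁻¹' B ⊆ simplexPar from
      fun s hs => hM.mem_simplexPar (hk hs))]
  · intro l _ hl
    rw [measure_mono_null _ (hM.volume_inter_face hl), mul_zero]
    exact fun s hs => ⟨hs.2, hk hs.1⟩
  · simp

lemma IsCyclic.sympArea_inter_sec (hM : IsCyclic M) {E : Set Phase} (hE : MeasurableSet E) :
    sympArea M (secTri M) (E ∩ sec M) = sympArea M (secTri M) E := by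
  rw [sympArea_apply hE, sympArea_apply (hE.inter isClosed_sec.measurableSet)]
  refine Finset.sum_congr rfl fun k _ => ?_
  congr 2
  ext s
  exact ⟨fun h => ⟨h.1.1, h.2⟩,
    fun h => ⟨⟨h.1, mem_iUnion.2 ⟨k, hM.secPar_mem_face k h.2⟩⟩, h.2⟩⟩

lemma volume_image_affine (a d e : ℝ × ℝ) (U : Set (ℝ × ℝ)) :
    volume ((fun s : ℝ × ℝ => a + s.1 • d + s.2 • e) '' U) =
      ENNReal.ofReal |d.1 * e.2 - e.1 * d.2| * volume U := by
  let L := Matrix.toLin (Module.Basis.finTwoProd ℝ) (Module.Basis.finTwoProd ℝ)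
    !![d.1, e.1; d.2, e.2]
  have h : (fun s : ℝ × ℝ => a + s.1 • d + s.2 • e) = (fun y => a + y) ∘ L := by
    funext s
    simp only [L, Function.comp_apply, Matrix.toLin_finTwoProd_apply]
    ext <;> simp [add_assoc, mul_comm]
  rw [h, image_comp, image_add_left, measure_preimage_add, Measure.addHaar_image_linearMap,
    LinearMap.det_toLin, Matrix.det_fin_two_of]

lemma IsCyclic.symp_vert (hM : IsCyclic M) (k m : Fin 3) :
    symp M (vert M (Sum.inl k)) (vert M (Sum.inr m)) =
      M.adjugate m k / (M.det * qStar M m * pStar M k) - 1 / val M := by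
  have h1 := hM.p_pos k
  have h2 := (hM.q_pos m).ne'
  have h3 := hM.det_ne
  have hs : ∑ i, (vert M (Sum.inr m)).1 i = 1 := (hM.vert_mem _).1
  have e1 : (vert M (Sum.inl k)).1 ⬝ᵥ Matrix.mulVec M (vert M (Sum.inr m)).2 = val M := by
    simp only [dotProduct, pay_eq, hM.pay_vert, Sum.elim_inr, add_zero]
    rw [← Finset.sum_mul, (hM.vert_mem _).1, one_mul]
  have e2 : (vert M (Sum.inr m)).1 ⬝ᵥ Matrix.mulVec M (vert M (Sum.inl k)).2 =
      val M + 1 - (vert M (Sum.inr m)).1 k / pStar M k := by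
    simp only [dotProduct, pay_eq, hM.pay_vert, Sum.elim_inl, mul_add, mul_sub,
      Finset.sum_add_distrib, Finset.sum_sub_distrib, ← Finset.sum_mul, hs, mul_ite, mul_zero,
      Finset.sum_ite_eq', Finset.mem_univ, if_true]
    ring
  rw [symp, e1, e2]
  simp only [vert, Sum.elim_inr]
  field_simp
  ring

lemma IsCyclic.symp_vert_inl (hM : IsCyclic M) (k l : Fin 3) :
    symp M (vert M (Sum.inl k)) (vert M (Sum.inl l)) = 0 := by
  have key : ∀ k : Fin 3, pStar M ⬝ᵥ Matrix.mulVec M (vert M (Sum.inl k)).2 = val M := by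
    intro k
    have := (hM.p_pos k).ne'
    simp only [dotProduct, pay_eq, hM.pay_vert, Sum.elim_inl, mul_add, mul_sub,
      Finset.sum_add_distrib, Finset.sum_sub_distrib, ← Finset.sum_mul, hM.p_sum, mul_ite,
      mul_zero, Finset.sum_ite_eq', Finset.mem_univ, if_true]
    field_simp
    ring
  have e : ∀ k : Fin 3, (vert M (Sum.inl k)).1 = pStar M := fun k => rfl
  rw [symp, e, e, key, key, sub_self]

/-- The identities behind the nonvanishing of the area form on the section: two by two minors of the
adjugate matrix are entries of `M` times the determinant. -/
lemma adjugate_minors (M : Matrix (Fin 3) (Fin 3) ℝ) :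
    M.adjugate 0 0 * ∑ i, M.adjugate i 2 - M.adjugate 0 2 * ∑ i, M.adjugate i 0 =
      M.det * (M 1 1 - M 1 2) ∧
    M.adjugate 2 0 * ∑ i, M.adjugate i 2 - M.adjugate 2 2 * ∑ i, M.adjugate i 0 =
      M.det * (M 1 0 - M 1 1) ∧
    M.adjugate 2 0 * ∑ i, M.adjugate i 1 - M.adjugate 2 1 * ∑ i, M.adjugate i 0 =
      M.det * (M 2 1 - M 2 0) ∧
    M.adjugate 1 0 * ∑ i, M.adjugate i 1 - M.adjugate 1 1 * ∑ i, M.adjugate i 0 =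
      M.det * (M 2 0 - M 2 2) := by
  simp only [Matrix.adjugate_fin_three, Matrix.det_fin_three, Fin.sum_univ_three, Matrix.of_apply,
    Matrix.cons_val]
  refine ⟨?_, ?_, ?_, ?_⟩ <;> ring

/-- The density is a nonzero multiple of a difference of two entries of `M`. -/
lemma IsCyclic.secDensity_ne_zero (hM : IsCyclic M) (k : Fin 4) : secDensity M k ≠ 0 := by
  have key : ∀ {m l : Fin 3} {d : ℝ}, M.adjugate m 0 * ∑ i, M.adjugate i l -
      M.adjugate m l * ∑ i, M.adjugate i 0 = M.det * d → d ≠ 0 →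
      symp M (vert M (Sum.inl 0)) (vert M (Sum.inr m)) -
        symp M (vert M (Sum.inl l)) (vert M (Sum.inr m)) ≠ 0 := by
    intro m l d h hd h'
    have h1 := (hM.p_pos 0).ne'
    have h2 := (hM.p_pos l).ne'
    have h3 := (hM.q_pos m).ne'
    have h4 := hM.det_ne
    have h5 := hM.adjSum_ne
    have hS : ∀ j, ∑ i, M.adjugate i j = adjSum M * pStar M j := fun j => by
      rw [pStar]; field_simp
    rw [hM.symp_vert, hM.symp_vert, sub_sub_sub_cancel_right, sub_eq_zero,
      div_eq_div_iff (by positivity) (by positivity)] at h'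
    rw [hS, hS] at h
    have : M.det * qStar M m * (M.det * d) = 0 := by
      rw [← h]
      linear_combination adjSum M * h'
    simp [hd, h3, h4] at this
  obtain ⟨m0, m1, m2, m3⟩ := adjugate_minors M
  have o := fun i j k l (h : i - j < k - l) => (hM.order i j k l h).ne
  simp only [secDensity, sub_eq_add_neg, ← neg_one_smul ℝ (secTri M k 0), symp_add_left,
    symp_add_right, symp_smul_left, symp_smul_right, symp_self]
  fin_cases k <;>
    simp only [secTri, secVtx, Fin.zero_eta, Fin.mk_one, Fin.reduceFinMk, Matrix.cons_val,
      hM.symp_vert_inl, symp_swap (vert M (Sum.inr _)) (vert M (Sum.inl _))]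
  · have := key m0 (sub_ne_zero.2 (o 1 1 1 2 (by decide)).symm)
    contrapose! this
    linear_combination this
  · have := key m1 (sub_ne_zero.2 (o 1 1 1 0 (by decide)))
    contrapose! this
    linear_combination -this
  · have := key m2 (sub_ne_zero.2 (o 2 1 2 0 (by decide)).symm)
    contrapose! this
    linear_combination this
  · have := key m3 (sub_ne_zero.2 (o 2 2 2 0 (by decide)))
    contrapose! this
    linear_combination -this

/-- Each branch of the return map preserves area, because it is the restriction of a composition of
maps along the flow that preserve the symplectic form on the hyperplanes of constant energy. -/
lemma IsCyclic.sympArea_image (hM : IsCyclic M) {k : Fin 4} {P : Piece}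
    (hP : P.Valid M φ (afterRegion k)) {B : Set Phase} (hB : MeasurableSet B)
    (hB' : MeasurableSet (P.map '' B)) (hk : B ⊆ face M (secFace k)) (hd : B ⊆ P.dom) :
    sympArea M (secTri M) (P.map '' B) = sympArea M (secTri M) B := by
  have hl : P.map '' B ⊆ face M (secFace P.tgt) := by
    rintro _ ⟨z, hz, rfl⟩
    exact hP.mem z (hM.secFace_subset k (hk hz)) (hd hz)
  -- in the parameters of the two triangles the branch is an affine map; its determinant is the quotient
  -- of the two densities because the branch preserves the symplectic form
  obtain ⟨a, ha : secPar M P.tgt a = _⟩ := hP.span _ (hM.secPar_mem_regionSpan k (0, 0))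
  obtain ⟨b, hb : secPar M P.tgt b = _⟩ := hP.span _ (hM.secPar_mem_regionSpan k (1, 0))
  obtain ⟨c, hc : secPar M P.tgt c = _⟩ := hP.span _ (hM.secPar_mem_regionSpan k (0, 1))
  have hsymp := hP.symp _ (hM.secPar_mem_regionSpan k (0, 0)) _
    (hM.secPar_mem_regionSpan k (1, 0)) _ (hM.secPar_mem_regionSpan k (0, 1))
  have hA : ∀ s : ℝ × ℝ, P.map (secPar M k s) =
      secPar M P.tgt (a + s.1 • (b - a) + s.2 • (c - a)) := by
    intro s
    have e1 : secPar M k s = secPar M k (0, 0) + s.1 • (secPar M k (1, 0) - secPar M k (0, 0)) +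
        s.2 • (secPar M k (0, 1) - secPar M k (0, 0)) := by
      simp only [secPar]; module
    rw [e1]
    simp only [map_add, map_smul, map_sub, ← ha, ← hb, ← hc]
    simp only [secPar, Prod.fst_add, Prod.snd_add, Prod.smul_fst, Prod.smul_snd, Prod.fst_sub,
      Prod.snd_sub, smul_eq_mul]
    module
  have hpre : secPar M P.tgt ⁻¹' (P.map '' B) =
      (fun s : ℝ × ℝ => a + s.1 • (b - a) + s.2 • (c - a)) '' (secPar M k ⁻¹' B) := by
    ext t
    constructor
    · rintro ⟨z, hz, e⟩
      obtain ⟨s, rfl⟩ := hM.exists_secPar (hk hz)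
      exact ⟨s, hz, hM.injective_secPar _ (by rw [← e, hA])⟩
    · rintro ⟨s, hs, rfl⟩
      exact ⟨_, hs, hA s⟩
  have hdet : secDensity M k = secDensity M P.tgt *
      ((b - a).1 * (c - a).2 - (c - a).1 * (b - a).2) := by
    have e1 : secDensity M k = symp M (secPar M k (1, 0) - secPar M k (0, 0))
        (secPar M k (0, 1) - secPar M k (0, 0)) := by simp [secDensity, secPar]
    have e2 : ∀ b, secPar M P.tgt b - secPar M P.tgt a =
        (b - a).1 • (secTri M P.tgt 1 - secTri M P.tgt 0) +
        (b - a).2 • (secTri M P.tgt 2 - secTri M P.tgt 0) := by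
      intro b
      simp only [secPar, Prod.fst_sub, Prod.snd_sub]
      module
    rw [e1, ← hsymp, ← ha, ← hb, ← hc, e2, e2, secDensity]
    simp only [symp_add_left, symp_add_right, symp_smul_left, symp_smul_right, symp_self,
      symp_swap (secTri M P.tgt 2 - secTri M P.tgt 0) (secTri M P.tgt 1 - secTri M P.tgt 0)]
    ring
  rw [hM.sympArea_of_subset_face hB hk, hM.sympArea_of_subset_face hB' hl, hpre,
    volume_image_affine, hdet, abs_mul, ENNReal.ofReal_mul (abs_nonneg _), mul_assoc]

/-- The return map preserves area. -/
lemma IsCyclic.sympArea_preimage (hM : IsCyclic M)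
    (hφ : IsUniqueFlow (hamField M M) (levelSet M) φ) {E : Set Phase} (hE : MeasurableSet E) :
    sympArea M (secTri M) (sec M ∩ retMap M φ ⁻¹' E) = sympArea M (secTri M) E := by
  obtain ⟨n, P, s, hv, hc⟩ := hM.exists_pieces hφ
  set R := retMap M φ
  set D := sec M ∩ R ⁻¹' E
  have hcont : ContinuousOn R (sec M) := (hM.continuousOn_ret hφ).2
  have hinj : InjOn R (sec M) := hM.injOn_retMap hφ
  have hD : MeasurableSet D := by
    have := (isClosed_sec (M := M)).measurableSet.subtype_image
      ((continuousOn_iff_continuous_domRestrict.1 hcont).measurable hE)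
    rwa [domRestrict_eq, preimage_comp, Subtype.image_preimage_coe] at this
  have himg : R '' D = E ∩ sec M := by
    ext y
    constructor
    · rintro ⟨z, hz, rfl⟩
      exact ⟨hz.2, hM.retMap_mem hφ hz.1⟩
    · rintro ⟨hyE, hy⟩
      obtain ⟨z, hz, rfl⟩ := hM.surjOn_retMap hφ hy
      exact ⟨z, ⟨hz, hyE⟩, rfl⟩
  -- partition the set into countably many pieces, each in a triangle and in the domain of a branch
  let J := {j : Fin 4 × Fin n // s j.2 = afterRegion j.1}
  let e := Fintype.equivFin J
  let K : ℕ → Set Phase := fun m => if h : m < Fintype.card J then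
    D ∩ (face M (secFace (e.symm ⟨m, h⟩).1.1) ∩ (P (e.symm ⟨m, h⟩).1.2).dom) else ∅
  have hKm : ∀ m, MeasurableSet (K m) := by
    intro m
    simp only [K]
    split_ifs with h
    · exact hD.inter ((isClosed_face _).measurableSet.inter (isClosed_dom _).measurableSet)
    · exact MeasurableSet.empty
  have hKD : ⋃ m, K m = D := by
    refine Subset.antisymm (iUnion_subset fun m z hz => ?_) fun z hz => ?_
    · simp only [K] at hz
      split_ifs at hz with h
      · exact hz.1
      · exact hz.elim
    · obtain ⟨k, hk⟩ := mem_iUnion.1 hz.1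
      obtain ⟨i, hi, hd⟩ := hc _ z (hM.secFace_subset k hk)
      refine mem_iUnion.2 ⟨e ⟨(k, i), hi⟩, ?_⟩
      simp only [K, Fin.is_lt, dif_pos, Fin.eta, Equiv.symm_apply_apply]
      exact ⟨hz, hk, hd⟩
  have hB : ∀ m, MeasurableSet (disjointed K m) := fun m => MeasurableSet.disjointed hKm m
  have hBD : ∀ m, disjointed K m ⊆ D := fun m =>
    (disjointed_subset K m).trans (hKD ▸ subset_iUnion K m)
  have hBs : ∀ m, disjointed K m ⊆ sec M := fun m => (hBD m).trans inter_subset_left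
  have hRB : ∀ m, MeasurableSet (R '' disjointed K m) := fun m =>
    (hB m).image_of_continuousOn_injOn (hcont.mono (hBs m)) (hinj.mono (hBs m))
  have hkey : ∀ m, sympArea M (secTri M) (R '' disjointed K m) =
      sympArea M (secTri M) (disjointed K m) := by
    intro m
    have hs := disjointed_subset K m
    by_cases h : m < Fintype.card J
    · obtain ⟨⟨⟨k, i⟩, hi⟩, hj⟩ : ∃ j, j = e.symm ⟨m, h⟩ := ⟨_, rfl⟩
      simp only [K, dif_pos h, ← hj] at hs
      have hk : disjointed K m ⊆ face M (secFace k) := fun z hz => (hs hz).2.1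
      have hd : disjointed K m ⊆ (P i).dom := fun z hz => (hs hz).2.2
      have heq : R '' disjointed K m = (P i).map '' disjointed K m :=
        image_congr fun z hz => hM.retMap_piece (hk hz) (hi ▸ hv i) (hd hz)
      rw [heq]
      exact hM.sympArea_image (hi ▸ hv i) (hB m) (heq ▸ hRB m) hk hd
    · have : disjointed K m = ∅ := by
        simp only [K, dif_neg h] at hs
        exact subset_empty_iff.1 hs
      rw [this, image_empty]
  rw [← hM.sympArea_inter_sec hE, ← himg, ← hKD, ← iUnion_disjointed, image_iUnion,
    measure_iUnion (disjoint_disjointed K) hB, measure_iUnion _ hRB]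
  · exact tsum_congr fun m => (hkey m).symm
  · intro m m' hmm
    exact (disjoint_disjointed K hmm).image hinj (hBs m) (hBs m')

/-! ### Horseshoes of planar maps in cross form -/

/-- Two affine relations `(s, t) ↦ (s', t')` of the plane in cross form:
`s' = a s + b t' + k` and `t = c s + d t' + m`. Hyperbolicity amounts to small coefficients. -/
structure CrossForm where
  /-- coefficient of `s` in `s'` -/
  a : Bool → ℝ
  /-- coefficient of `t'` in `s'` -/
  b : Bool → ℝ
  /-- constant term of `s'` -/
  k : Bool → ℝ
  /-- coefficient of `s` in `t` -/
  c : Bool → ℝ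
  /-- coefficient of `t'` in `t` -/
  d : Bool → ℝ
  /-- constant term of `t` -/
  m : Bool → ℝ

namespace CrossForm

/-- The new first coordinate. -/
def fst (C : CrossForm) (i : Bool) (s t : ℝ) : ℝ := C.a i * s + C.b i * t + C.k i

/-- The old second coordinate. -/
def snd (C : CrossForm) (i : Bool) (s t : ℝ) : ℝ := C.c i * s + C.d i * t + C.m i

/-- The two relations are hyperbolic, they map the square `[-1, 1]²` across itself, and their
domains are separated by the line `t = 0`. -/
structure IsHorseshoe (C : CrossForm) : Prop where
  small : ∀ i, |C.a i| ≤ 1 / 4 ∧ |C.b i| ≤ 1 / 4 ∧ |C.c i| ≤ 1 / 4 ∧ |C.d i| ≤ 1 / 4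
  k_le : ∀ i, |C.a i| + |C.b i| + |C.k i| ≤ 9 / 10
  m_le : ∀ i, |C.c i| + |C.d i| + |C.m i| ≤ 9 / 10
  d_ne : C.d false ≠ 0
  neg : C.m false + |C.c false| + |C.d false| < 0
  pos : 0 < C.m true - |C.c true| - |C.d true|

variable {C : CrossForm}

/-- `x` is an orbit with itinerary `ξ` in the square. -/
def IsOrbit (C : CrossForm) (ξ : ℤ → Bool) (x : ℤ → ℝ × ℝ) : Prop :=
  ∀ n, |(x n).1| ≤ 9 / 10 ∧ |(x n).2| ≤ 9 / 10 ∧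
    (x (n + 1)).1 = C.fst (ξ n) (x n).1 (x (n + 1)).2 ∧
    (x n).2 = C.snd (ξ n) (x n).1 (x (n + 1)).2

lemma abs_affine_le {a b k s t : ℝ} (h : |a| + |b| + |k| ≤ 9 / 10) (hs : |s| ≤ 1) (ht : |t| ≤ 1) :
    |a * s + b * t + k| ≤ 9 / 10 := by
  have h1 : |a * s| ≤ |a| := by
    rw [abs_mul]; exact mul_le_of_le_one_right (abs_nonneg _) hs
  have h2 : |b * t| ≤ |b| := by
    rw [abs_mul]; exact mul_le_of_le_one_right (abs_nonneg _) ht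
  linarith [abs_add_le (a * s + b * t) k, abs_add_le (a * s) (b * t)]

lemma abs_affine_sub_le {a b k s t s' t' r : ℝ} (ha : |a| ≤ 1 / 4) (hb : |b| ≤ 1 / 4)
    (hs : |s - s'| ≤ r) (ht : |t - t'| ≤ r) :
    |(a * s + b * t + k) - (a * s' + b * t' + k)| ≤ 1 / 2 * r := by
  have e : (a * s + b * t + k) - (a * s' + b * t' + k) = a * (s - s') + b * (t - t') := by ring
  have h1 : |a * (s - s')| ≤ 1 / 4 * r := by
    rw [abs_mul]; exact mul_le_mul ha hs (abs_nonneg _) (by norm_num)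
  have h2 : |b * (t - t')| ≤ 1 / 4 * r := by
    rw [abs_mul]; exact mul_le_mul hb ht (abs_nonneg _) (by norm_num)
  rw [e]
  linarith [abs_add_le (a * (s - s')) (b * (t - t'))]

/-- Successive approximations to the orbit with itinerary `ξ`. -/
def approx (C : CrossForm) (ξ : ℤ → Bool) : ℕ → ℤ → ℝ × ℝ
  | 0, _ => 0
  | j + 1, n => (C.fst (ξ (n - 1)) (C.approx ξ j (n - 1)).1 (C.approx ξ j n).2,
      C.snd (ξ n) (C.approx ξ j n).1 (C.approx ξ j (n + 1)).2)

lemma IsHorseshoe.abs_approx_le (h : C.IsHorseshoe) (ξ : ℤ → Bool) (j : ℕ) (n : ℤ) :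
    |(C.approx ξ j n).1| ≤ 9 / 10 ∧ |(C.approx ξ j n).2| ≤ 9 / 10 := by
  induction j generalizing n with
  | zero => simp only [approx, Prod.fst_zero, Prod.snd_zero, abs_zero]; norm_num
  | succ j ih =>
    have ih' := fun n => (⟨(ih n).1.trans (by norm_num), (ih n).2.trans (by norm_num)⟩ :
      |(C.approx ξ j n).1| ≤ 1 ∧ |(C.approx ξ j n).2| ≤ 1)
    exact ⟨abs_affine_le (h.k_le _) (ih' _).1 (ih' _).2,
      abs_affine_le (h.m_le _) (ih' _).1 (ih' _).2⟩

lemma IsHorseshoe.dist_approx_le (h : C.IsHorseshoe) (ξ : ℤ → Bool) (j : ℕ) (n : ℤ) :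
    dist (C.approx ξ j n) (C.approx ξ (j + 1) n) ≤ 1 * (1 / 2) ^ j := by
  induction j generalizing n with
  | zero =>
    have := h.abs_approx_le ξ 1 n
    rw [dist_comm, Prod.dist_eq, Real.dist_eq, Real.dist_eq]
    simp only [zero_add, show C.approx ξ 0 n = 0 from rfl, Prod.fst_zero, Prod.snd_zero, sub_zero]
    exact max_le (by linarith [this.1]) (by linarith [this.2])
  | succ j ih =>
    simp only [Prod.dist_eq, max_le_iff, Real.dist_eq] at ih ⊢
    rw [show (1 : ℝ) * (1 / 2) ^ (j + 1) = 1 / 2 * (1 * (1 / 2) ^ j) by ring]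
    exact ⟨abs_affine_sub_le (h.small _).1 (h.small _).2.1 (ih _).1 (ih _).2,
      abs_affine_sub_le (h.small _).2.2.1 (h.small _).2.2.2 (ih _).1 (ih _).2⟩

lemma approx_shift (ξ : ℤ → Bool) (j : ℕ) (n : ℤ) :
    C.approx (fun n => ξ (n + 1)) j n = C.approx ξ j (n + 1) := by
  induction j generalizing n with
  | zero => rfl
  | succ j ih => simp only [approx, ih, sub_add_cancel, add_sub_cancel_right]

lemma continuous_approx (j : ℕ) (n : ℤ) : Continuous fun ξ : ℤ → Bool => C.approx ξ j n := by
  induction j generalizing n with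
  | zero => exact continuous_const
  | succ j ih =>
    have hc : ∀ (f : Bool → ℝ) (n : ℤ), Continuous fun ξ : ℤ → Bool => f (ξ n) := fun f n =>
      (continuous_of_discreteTopology (f := f)).comp (continuous_apply n)
    refine Continuous.prodMk ?_ ?_
    · exact (((hc C.a _).mul (ih _).fst).add ((hc C.b _).mul (ih _).snd)).add (hc C.k _)
    · exact (((hc C.c _).mul (ih _).fst).add ((hc C.d _).mul (ih _).snd)).add (hc C.m _)

/-- Each itinerary is realised by an orbit that depends continuously on it. -/
lemma IsHorseshoe.exists_orbits (h : C.IsHorseshoe) : ∃ X : (ℤ → Bool) → ℤ → ℝ × ℝ,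
    (∀ ξ, C.IsOrbit ξ (X ξ)) ∧ (Continuous fun ξ => X ξ 0) ∧
    ∀ ξ n, X (fun j => ξ (j + 1)) n = X ξ (n + 1) := by
  have hX : ∀ (ξ : ℤ → Bool) (n : ℤ), ∃ x, Tendsto (fun j => C.approx ξ j n) atTop (𝓝 x) :=
    fun ξ n => cauchySeq_tendsto_of_complete
      (cauchySeq_of_le_geometric _ _ (by norm_num) fun j => h.dist_approx_le ξ j n)
  choose X hX using hX
  have hd : ∀ ξ n j, dist (C.approx ξ j n) (X ξ n) ≤ 1 * (1 / 2) ^ j / (1 - 1 / 2) := fun ξ n =>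
    dist_le_of_le_geometric_of_tendsto _ _ (by norm_num) (fun j => h.dist_approx_le ξ j n) (hX ξ n)
  have h1 : ∀ ξ n, Tendsto (fun j => (C.approx ξ j n).1) atTop (𝓝 (X ξ n).1) := fun ξ n =>
    (continuous_fst.tendsto _).comp (hX ξ n)
  have h2 : ∀ ξ n, Tendsto (fun j => (C.approx ξ j n).2) atTop (𝓝 (X ξ n).2) := fun ξ n =>
    (continuous_snd.tendsto _).comp (hX ξ n)
  refine ⟨X, fun ξ n => ⟨?_, ?_, ?_, ?_⟩, ?_, fun ξ n => ?_⟩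
  · exact le_of_tendsto (h1 ξ n).abs (Eventually.of_forall fun j => (h.abs_approx_le ξ j n).1)
  · exact le_of_tendsto (h2 ξ n).abs (Eventually.of_forall fun j => (h.abs_approx_le ξ j n).2)
  · refine tendsto_nhds_unique ((tendsto_add_atTop_iff_nat 1).2 (h1 ξ (n + 1))) ?_
    simp only [approx, add_sub_cancel_right]
    exact (((h1 ξ n).const_mul _).add ((h2 ξ (n + 1)).const_mul _)).add_const _
  · refine tendsto_nhds_unique ((tendsto_add_atTop_iff_nat 1).2 (h2 ξ n)) ?_
    exact (((h1 ξ n).const_mul _).add ((h2 ξ (n + 1)).const_mul _)).add_const _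
  · refine continuous_of_uniform_approx_of_continuous fun u hu => ?_
    obtain ⟨ε, hε, hεu⟩ := Metric.mem_uniformity_dist.1 hu
    obtain ⟨j, hj⟩ := exists_pow_lt_of_lt_one (half_pos hε) (by norm_num : (1 / 2 : ℝ) < 1)
    refine ⟨fun ξ => C.approx ξ j 0, continuous_approx j 0, fun ξ => hεu ?_⟩
    rw [dist_comm]
    refine (hd ξ 0 j).trans_lt ?_
    rw [show (1 : ℝ) * (1 / 2) ^ j / (1 - 1 / 2) = 2 * (1 / 2) ^ j by ring]
    linarith
  · refine tendsto_nhds_unique (hX _ n) ?_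
    simp only [approx_shift]
    exact hX ξ (n + 1)

/-- The contracting eigenvector `(1, y)`, with eigenvalue `l`, of a linear map in cross form. By the
symmetry of cross forms under time reversal, this also gives the expanding eigenvector. -/
lemma exists_eigen {a b c d : ℝ} (ha : |a| ≤ 1 / 4) (hb : |b| ≤ 1 / 4) (hc : |c| ≤ 1 / 4)
    (hd : |d| ≤ 1 / 4) : ∃ l y : ℝ, |l| < 1 ∧ |y| < 1 ∧ l = a + b * (l * y) ∧ y = c + d * (l * y) := by
  obtain ⟨a1, a2⟩ := abs_le.1 ha
  obtain ⟨d1, d2⟩ := abs_le.1 hd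
  have hbc : |b * c| ≤ 1 / 4 * (1 / 4) := by
    rw [abs_mul]; exact mul_le_mul hb hc (abs_nonneg _) (by norm_num)
  obtain ⟨e1, e2⟩ := abs_le.1 hbc
  have hf : ContinuousOn (fun l : ℝ => (l - a) * (1 - d * l) - b * c * l) (Icc (-1) 1) := by fun_prop
  obtain ⟨l, hl, h0⟩ := intermediate_value_Icc (by norm_num : (-1 : ℝ) ≤ 1) hf
    (show (0 : ℝ) ∈ _ from ⟨by nlinarith, by nlinarith⟩)
  have hl' : |l| ≤ 1 := abs_le.2 hl
  have hdl : |d * l| ≤ 1 / 4 * 1 := by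
    rw [abs_mul]; exact mul_le_mul hd hl' (abs_nonneg _) (by norm_num)
  have hpos : 3 / 4 ≤ 1 - d * l := by linarith [(abs_le.1 hdl).2]
  have hy : |c / (1 - d * l)| ≤ 1 / 3 := by
    rw [abs_div, abs_of_pos (by linarith : 0 < 1 - d * l), div_le_iff₀ (by linarith)]
    linarith
  have hl2 : l = a + b * (l * (c / (1 - d * l))) := by
    have hne : 1 - d * l ≠ 0 := by linarith
    have e : b * c * l = (l - a) * (1 - d * l) := by
      dsimp only at h0
      linarith
    rw [show b * (l * (c / (1 - d * l))) = b * c * l / (1 - d * l) by ring, e,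
      mul_div_cancel_right₀ _ hne]
    ring
  refine ⟨l, c / (1 - d * l), ?_, by linarith, hl2, ?_⟩
  · have h3 : |l * (c / (1 - d * l))| ≤ 1 * (1 / 3) := by
      rw [abs_mul]; exact mul_le_mul hl' hy (abs_nonneg _) (by norm_num)
    have h4 : |b * (l * (c / (1 - d * l)))| ≤ 1 / 4 * (1 * (1 / 3)) := by
      rw [abs_mul]; exact mul_le_mul hb h3 (abs_nonneg _) (by norm_num)
    rw [hl2]
    linarith [abs_add_le a (b * (l * (c / (1 - d * l))))]
  · have : 1 - d * l ≠ 0 := by linarith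
    field_simp
    ring

/-- A bounded half-orbit of a linear map in cross form lies on the contracting eigenline. -/
lemma eigen_of_bounded {a b c d l y : ℝ} (hb : |b| ≤ 1 / 4) (hd : |d| ≤ 1 / 4) (hy : |y| < 1)
    (hl : l = a + b * (l * y)) (hy' : y = c + d * (l * y)) {u v : ℕ → ℝ} {B : ℝ}
    (hu : ∀ n, |u n| ≤ B) (hv : ∀ n, |v n| ≤ B) (h1 : ∀ n, u (n + 1) = a * u n + b * v (n + 1))
    (h2 : ∀ n, v n = c * u n + d * v (n + 1)) (n : ℕ) : v n = l ^ n * (y * u 0) ∧ u n = l ^ n * u 0 := by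
  have hby : |b * y| ≤ 1 / 4 * 1 := by
    rw [abs_mul]; exact mul_le_mul hb hy.le (abs_nonneg _) (by norm_num)
  have hpos : 3 / 4 ≤ 1 - b * y := by linarith [(abs_le.1 hby).2]
  have hne : 1 - b * y ≠ 0 := by linarith
  have hw : ∀ n, v n - y * u n = d / (1 - b * y) * (v (n + 1) - y * u (n + 1)) := by
    intro n
    have e1 := h1 n
    have e2 := h2 n
    rw [div_mul_eq_mul_div, eq_div_iff hne]
    linear_combination (1 - b * y) * e2 - (1 - b * y) * u n * hy' + d * y * e1 - d * y * u n * hl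
  have hκ : |d / (1 - b * y)| ≤ 1 / 2 := by
    rw [abs_div, abs_of_pos (by linarith : 0 < 1 - b * y), div_le_iff₀ (by linarith)]
    linarith
  have hB : ∀ n, |v n - y * u n| ≤ 2 * B := by
    intro n
    have : |y * u n| ≤ 1 * B := by
      rw [abs_mul]; exact mul_le_mul hy.le (hu n) (abs_nonneg _) (by norm_num)
    linarith [abs_sub (v n) (y * u n), hv n]
  have hpow : ∀ j n, |v n - y * u n| ≤ (1 / 2) ^ j * (2 * B) := by
    intro j
    induction j with
    | zero => intro n; simpa using hB n
    | succ j ih =>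
      intro n
      rw [hw n, abs_mul, pow_succ']
      calc _ ≤ 1 / 2 * ((1 / 2) ^ j * (2 * B)) :=
            mul_le_mul hκ (ih _) (abs_nonneg _) (by norm_num)
        _ = _ := by ring
  have hzero : ∀ n, v n = y * u n := by
    intro n
    have ht : Tendsto (fun j : ℕ => (1 / 2 : ℝ) ^ j * (2 * B)) atTop (𝓝 (0 * (2 * B))) :=
      (tendsto_pow_atTop_nhds_zero_of_lt_one (by norm_num) (by norm_num)).mul_const _
    have := ge_of_tendsto' ht fun j => hpow j n
    rw [zero_mul] at this
    linarith [abs_nonpos_iff.1 this]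
  have hun : ∀ n, u n = l ^ n * u 0 := by
    intro n
    induction n with
    | zero => simp
    | succ n ih =>
      have e1 := h1 n
      rw [hzero (n + 1)] at e1
      have : (1 - b * y) * (u (n + 1) - l * u n) = 0 := by linear_combination e1 - u n * hl
      have := (mul_eq_zero.1 this).resolve_left hne
      rw [pow_succ', mul_assoc, ← ih]
      linarith
  exact ⟨by rw [hzero n, hun n]; ring, hun n⟩

end CrossForm

/-! ### Saddles, homoclinic points and horseshoes from a cross form -/

/-- The affine parametrization of a plane. -/
def planePt (x₀ d₁ d₂ : Phase) (p : ℝ × ℝ) : Phase := x₀ + p.1 • d₁ + p.2 • d₂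

lemma continuous_planePt (x₀ d₁ d₂ : Phase) : Continuous (planePt x₀ d₁ d₂) := by
  unfold planePt
  fun_prop

lemma injective_planePt {x₀ d₁ d₂ : Phase} (hd : LinearIndependent ℝ ![d₁, d₂]) :
    Function.Injective (planePt x₀ d₁ d₂) := by
  intro p q h
  have e : (p.1 - q.1) • d₁ + (p.2 - q.2) • d₂ = 0 := by
    have := sub_eq_zero.2 h
    rw [← this, planePt, planePt]
    module
  obtain ⟨h1, h2⟩ := LinearIndependent.pair_iff.1 hd _ _ e
  exact Prod.ext (sub_eq_zero.1 h1) (sub_eq_zero.1 h2)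

lemma linearIndependent_pair {d₁ d₂ : Phase} (hd : LinearIndependent ℝ ![d₁, d₂]) {x y : ℝ}
    (hx : |x| < 1) (hy : |y| < 1) : LinearIndependent ℝ ![d₁ + y • d₂, x • d₁ + d₂] := by
  rw [LinearIndependent.pair_iff] at hd ⊢
  intro s t e
  obtain ⟨h1, h2⟩ := hd (s + t * x) (s * y + t) (by rw [← e]; module)
  have hxy : |x * y| < 1 := by
    rw [abs_mul]; exact mul_lt_one_of_nonneg_of_lt_one_left (abs_nonneg _) hx hy.le
  have hs : s * (1 - x * y) = 0 := by linear_combination h1 - x * h2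
  have hne : 1 - x * y ≠ 0 := by linarith [(abs_lt.1 hxy).2]
  obtain rfl := (mul_eq_zero.1 hs).resolve_right hne
  exact ⟨rfl, by linarith⟩

namespace CrossForm

variable {C : CrossForm} {x₀ d₁ d₂ : Phase} {g : Phase → Phase}

/-- In the given parametrization of a plane, `g` satisfies the two affine relations. -/
def Realizes (C : CrossForm) (g : Phase → Phase) (x₀ d₁ d₂ : Phase) : Prop :=
  ∀ i s t, |s| ≤ 1 → |t| ≤ 1 →
    g (planePt x₀ d₁ d₂ (s, C.snd i s t)) = planePt x₀ d₁ d₂ (C.fst i s t, t)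

lemma Realizes.apply (hr : C.Realizes g x₀ d₁ d₂) {ξ : ℤ → Bool} {x : ℤ → ℝ × ℝ}
    (hx : C.IsOrbit ξ x) (n : ℤ) {u v u' v' : ℝ} (hu : |u| ≤ 1 / 10) (hv : |v'| ≤ 1 / 10)
    (e1 : u' = C.a (ξ n) * u + C.b (ξ n) * v') (e2 : v = C.c (ξ n) * u + C.d (ξ n) * v') :
    g (planePt x₀ d₁ d₂ (x n + (u, v))) = planePt x₀ d₁ d₂ (x (n + 1) + (u', v')) := by
  obtain ⟨h1, -, h3, h4⟩ := hx n
  obtain ⟨-, h2, -⟩ := hx (n + 1)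
  have := hr (ξ n) ((x n).1 + u) ((x (n + 1)).2 + v')
    ((abs_add_le _ _).trans (by linarith)) ((abs_add_le _ _).trans (by linarith))
  rw [show x n + (u, v) = ((x n).1 + u, C.snd (ξ n) ((x n).1 + u) ((x (n + 1)).2 + v')) from
      Prod.ext rfl (by rw [Prod.snd_add, h4, e2]; simp only [snd]; ring), this]
  congr 1
  exact Prod.ext (by rw [Prod.fst_add, h3, e1]; simp only [fst]; ring) rfl

lemma Realizes.apply_orbit (hr : C.Realizes g x₀ d₁ d₂) {ξ : ℤ → Bool} {x : ℤ → ℝ × ℝ}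
    (hx : C.IsOrbit ξ x) (n : ℤ) :
    g (planePt x₀ d₁ d₂ (x n)) = planePt x₀ d₁ d₂ (x (n + 1)) := by
  have := hr.apply hx n (u := 0) (v := 0) (u' := 0) (v' := 0) (by norm_num) (by norm_num)
    (by ring) (by ring)
  simpa only [Prod.mk_zero_zero, add_zero] using this

/-- The symbol of an orbit is determined by the position with respect to the line `t = 0`. -/
lemma IsHorseshoe.symbol_iff (h : C.IsHorseshoe) {ξ : ℤ → Bool} {x : ℤ → ℝ × ℝ}
    (hx : C.IsOrbit ξ x) (n : ℤ) : ξ n = true ↔ 0 < (x n).2 := by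
  obtain ⟨h1, -, -, h4⟩ := hx n
  obtain ⟨-, h2, -⟩ := hx (n + 1)
  have key : |C.c (ξ n) * (x n).1 + C.d (ξ n) * (x (n + 1)).2| ≤ |C.c (ξ n)| + |C.d (ξ n)| := by
    refine (abs_add_le _ _).trans (add_le_add ?_ ?_) <;> rw [abs_mul] <;>
      exact mul_le_of_le_one_right (abs_nonneg _) (by linarith)
  obtain ⟨k1, k2⟩ := abs_le.1 key
  have hn := h.neg
  have hp := h.pos
  rw [h4, snd]
  cases hξ : ξ n
  · rw [hξ] at k1 k2
    simp only [Bool.false_eq_true, false_iff, not_lt]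
    linarith
  · rw [hξ] at k1 k2
    simp only [true_iff]
    linarith

section consequences

variable (h : C.IsHorseshoe) (hd : LinearIndependent ℝ ![d₁, d₂])
include h hd

lemma IsHorseshoe.hasHorseshoe {R : Phase → Phase} {N : ℕ} (hN : 0 < N) {S D : Set Phase}
    (hinj : InjOn R S) (hmaps : MapsTo R S S) (hr : C.Realizes R^[N] x₀ d₁ d₂)
    (hS : ∀ p : ℝ × ℝ, |p.1| ≤ 9 / 10 → |p.2| ≤ 9 / 10 → planePt x₀ d₁ d₂ p ∈ S)
    (hD : ∀ p : ℝ × ℝ, |p.1| ≤ 9 / 10 → |p.2| ≤ 9 / 10 → planePt x₀ d₁ d₂ p ∈ D) :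
    HasHorseshoe R D := by
  obtain ⟨X, hX, hcont, hshift⟩ := h.exists_orbits
  have hinjN : InjOn R^[N] S := hinj.iterate hmaps N
  have hXS : ∀ ξ n, planePt x₀ d₁ d₂ (X ξ n) ∈ S := fun ξ n =>
    hS _ (hX ξ n).1 (hX ξ n).2.1
  refine ⟨N, hN, fun ξ => planePt x₀ d₁ d₂ (X ξ 0), (continuous_planePt _ _ _).comp hcont, ?_,
    fun ξ => ⟨hD _ (hX ξ 0).1 (hX ξ 0).2.1, ?_⟩⟩
  · intro ξ ξ' e
    have key : ∀ n, planePt x₀ d₁ d₂ (X ξ n) = planePt x₀ d₁ d₂ (X ξ' n) := by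
      intro n
      induction n using Int.induction_on with
      | zero => exact e
      | succ i ih => rw [← hr.apply_orbit (hX ξ), ← hr.apply_orbit (hX ξ'), ih]
      | pred i ih =>
        refine hinjN (hXS _ _) (hXS _ _) ?_
        rw [hr.apply_orbit (hX ξ), hr.apply_orbit (hX ξ'), sub_add_cancel, ih]
    funext n
    rw [Bool.eq_iff_iff, h.symbol_iff (hX ξ), h.symbol_iff (hX ξ'),
      injective_planePt hd (key n)]
  · rw [hr.apply_orbit (hX ξ), ← hshift]

/-- The constant itinerary gives a saddle, and the itinerary that differs from it in a single place
gives a homoclinic point: its forward orbit is on the stable line of the saddle, and its backward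
orbit is on the unstable line. -/
lemma IsHorseshoe.exists_saddle {R : Phase → Phase} {N : ℕ} (hN : 0 < N) {S : Set Phase}
    {T : Fin 4 → Fin 3 → Phase} {k : Fin 4} (hinj : InjOn R^[N] S)
    (hr : C.Realizes R^[N] x₀ d₁ d₂)
    (hS : ∀ p : ℝ × ℝ, |p.1| ≤ 1 → |p.2| ≤ 1 → planePt x₀ d₁ d₂ p ∈ S)
    (hT : ∀ p : ℝ × ℝ, |p.1| ≤ 9 / 10 → |p.2| ≤ 9 / 10 →
      planePt x₀ d₁ d₂ p ∈ intrinsicInterior ℝ (tri (T k)))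
    (hd₁ : d₁ ∈ triDir (T k)) (hd₂ : d₂ ∈ triDir (T k)) :
    ∃ x y, IsSaddle R T N x ∧ IsTransverseHomoclinic R S T N x y := by
  obtain ⟨X, hX, -, hshift⟩ := h.exists_orbits
  obtain ⟨ha, hb, hc, hdd⟩ := h.small false
  obtain ⟨ha', hb', hc', hdd'⟩ := h.small true
  obtain ⟨l, y, hl1, hy1, hl, hy⟩ := exists_eigen ha hb hc hdd
  obtain ⟨μ, x, hμ1, hx1, hμ, hx⟩ := exists_eigen hdd hc hb ha
  have hμ0 : μ ≠ 0 := by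
    rintro rfl
    exact h.d_ne (by linarith)
  set ξ₀ : ℤ → Bool := fun _ => false with hξ₀
  set p := X ξ₀ 0 with hp
  have hconst : ∀ n, X ξ₀ n = p := by
    intro n
    have hs : ∀ n, X ξ₀ n = X ξ₀ (n + 1) := fun n => hshift ξ₀ n
    induction n using Int.induction_on with
    | zero => rfl
    | succ i ih => rw [← hs, ih]
    | pred i ih => rw [hs, sub_add_cancel, ih]
  -- the iterate near the fixed point, in displacements from `p`
  have hfix : ∀ {u v u' v' : ℝ}, |u| ≤ 1 / 10 → |v'| ≤ 1 / 10 →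
      u' = C.a false * u + C.b false * v' → v = C.c false * u + C.d false * v' →
      R^[N] (planePt x₀ d₁ d₂ (p + (u, v))) = planePt x₀ d₁ d₂ (p + (u', v')) := by
    intro u v u' v' hu hv e1 e2
    have := hr.apply (hX ξ₀) 0 hu hv e1 e2
    rwa [hconst, hconst] at this
  have hpl : ∀ (q : ℝ × ℝ) (s t : ℝ), planePt x₀ d₁ d₂ (q + (s, t)) =
      planePt x₀ d₁ d₂ q + s • d₁ + t • d₂ := by
    intro q s t
    simp only [planePt, Prod.fst_add, Prod.snd_add]
    module
  have hmem : ∀ s t : ℝ, s • d₁ + t • d₂ ∈ triDir (T k) := fun s t =>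
    Submodule.add_mem _ (Submodule.smul_mem _ _ hd₁) (Submodule.smul_mem _ _ hd₂)
  have hle : ∀ {r s B : ℝ}, |r| < 1 → |s| ≤ B → |r * s| ≤ B := by
    intro r s B hr hs
    rw [abs_mul]
    exact (mul_le_of_le_one_left (abs_nonneg _) hr.le).trans hs
  refine ⟨planePt x₀ d₁ d₂ p, ?_⟩
  -- the homoclinic itinerary
  set ξ : ℤ → Bool := fun n => decide (n = -1) with hξ
  have hξt : ξ (-1) = true := by simp [hξ]
  have hξf : ∀ n, n ≠ -1 → ξ n = false := fun n hn => by simp [hξ, hn]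
  have hOb : ∀ n, |(X ξ n).1 - p.1| ≤ 2 ∧ |(X ξ n).2 - p.2| ≤ 2 := fun n => by
    obtain ⟨b1, b2, -⟩ := hX ξ n
    obtain ⟨b3, b4, -⟩ := hX ξ₀ 0
    exact ⟨(abs_sub _ _).trans (by linarith), (abs_sub _ _).trans (by linarith)⟩
  have hrel : ∀ n, n ≠ -1 → (X ξ (n + 1)).1 - p.1 = C.a false * ((X ξ n).1 - p.1) +
      C.b false * ((X ξ (n + 1)).2 - p.2) ∧ (X ξ n).2 - p.2 = C.c false * ((X ξ n).1 - p.1) +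
      C.d false * ((X ξ (n + 1)).2 - p.2) := by
    intro n hn
    obtain ⟨-, -, f1, f2⟩ := hX ξ n
    obtain ⟨-, -, f3, f4⟩ := hX ξ₀ 0
    rw [hξf n hn] at f1 f2
    rw [hconst, hconst] at f3 f4
    simp only [fst, snd, hξ₀] at f1 f2 f3 f4
    constructor
    · linear_combination f1 - f3
    · linear_combination f2 - f4
  -- bounded forward orbits of the linearisation lie on the stable line, bounded backward orbits on
  -- the unstable line
  have hfwd := fun n : ℕ => eigen_of_bounded hb hdd hy1 hl hy (B := 2)
    (u := fun n : ℕ => (X ξ n).1 - p.1) (v := fun n : ℕ => (X ξ n).2 - p.2)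
    (fun n => (hOb n).1) (fun n => (hOb n).2)
    (fun n => by simpa using (hrel n (by lia)).1) (fun n => by simpa using (hrel n (by lia)).2) n
  have hbwd := fun n : ℕ => eigen_of_bounded hc ha hx1 hμ hx (B := 2)
    (u := fun n : ℕ => (X ξ (-1 - n)).2 - p.2) (v := fun n : ℕ => (X ξ (-1 - n)).1 - p.1)
    (fun n => (hOb _).2) (fun n => (hOb _).1)
    (fun n => by
      have := (hrel (-1 - (n + 1 : ℕ)) (by lia)).2
      rw [show (-1 : ℤ) - (n + 1 : ℕ) + 1 = -1 - n by lia] at this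
      linarith)
    (fun n => by
      have := (hrel (-1 - (n + 1 : ℕ)) (by lia)).1
      rw [show (-1 : ℤ) - (n + 1 : ℕ) + 1 = -1 - n by lia] at this
      linarith) n
  simp only [Nat.cast_zero, sub_zero] at hfwd hbwd
  have htl : Tendsto (fun n : ℕ => l ^ n) atTop (𝓝 0) := tendsto_pow_atTop_nhds_zero_of_abs_lt_one hl1
  have htμ : Tendsto (fun n : ℕ => μ ^ n) atTop (𝓝 0) :=
    tendsto_pow_atTop_nhds_zero_of_abs_lt_one hμ1
  have hpowl : ∀ (n : ℕ) {s : ℝ}, |s| ≤ 1 / 10 → |l ^ n * s| ≤ 1 / 10 := by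
    intro n s hs
    rw [abs_mul, abs_pow]
    exact (mul_le_of_le_one_left (abs_nonneg _) (pow_le_one₀ (abs_nonneg _) hl1.le)).trans hs
  have hpowμ : ∀ (n : ℕ) {s : ℝ}, |s| ≤ 1 / 10 → |μ ^ n * s| ≤ 1 / 10 := by
    intro n s hs
    rw [abs_mul, abs_pow]
    exact (mul_le_of_le_one_left (abs_nonneg _) (pow_le_one₀ (abs_nonneg _) hμ1.le)).trans hs
  -- the displacement at time `-1` that is stretched to `t` at time `0`
  have hρ0 : 3 / 4 ≤ 1 - C.c true * x := by
    have : |C.c true * x| ≤ 1 / 4 * 1 := by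
      rw [abs_mul]; exact mul_le_mul hc' hx1.le (abs_nonneg _) (by norm_num)
    linarith [(abs_le.1 this).2]
  obtain ⟨ρ, hρ⟩ : ∃ ρ, ρ = C.c true * (ρ * x) + C.d true := by
    refine ⟨C.d true / (1 - C.c true * x), ?_⟩
    have : 1 - C.c true * x ≠ 0 := by linarith
    field_simp
    ring
  have hρ1 : |ρ| < 1 := by
    have e : ρ = C.d true / (1 - C.c true * x) := by
      rw [eq_div_iff (by linarith)]
      linear_combination hρ
    rw [e, abs_div, abs_of_pos (by linarith : 0 < 1 - C.c true * x), div_lt_one (by linarith)]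
    linarith
  -- the branch `true` maps the unstable line at time `-1` to a line of direction `(z, 1)` at time `0`
  obtain ⟨z, hz⟩ : ∃ z, z = C.a true * (ρ * x) + C.b true := ⟨_, rfl⟩
  have hz1 : |z| < 1 := by
    have h1 : |C.a true * (ρ * x)| ≤ 1 / 4 * 1 := by
      rw [abs_mul]; exact mul_le_mul ha' (hle hρ1 hx1.le) (abs_nonneg _) (by norm_num)
    rw [hz]
    linarith [abs_add_le (C.a true * (ρ * x)) (C.b true)]
  refine ⟨planePt x₀ d₁ d₂ (X ξ 0), ?_, ?_, k, hT _ (hX ξ 0).1 (hX ξ 0).2.1, d₁ + y • d₂, ?_,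
    z • d₁ + d₂, ?_, linearIndependent_pair hd hz1 hy1, 1 / 10, by norm_num, fun s hs => ⟨?_, ?_⟩⟩
  · refine ⟨hN, ?_, k, hT _ (hX ξ₀ 0).1 (hX ξ₀ 0).2.1, d₁ + y • d₂, ?_, x • d₁ + d₂, ?_,
      linearIndependent_pair hd hx1 hy1, l, μ⁻¹, hl1, ?_, |μ| / 20, by positivity,
      fun s t hs ht => ?_⟩
    · have := hr.apply_orbit (hX ξ₀) 0
      rwa [hconst, hconst] at this
    · simpa using hmem 1 y
    · simpa using hmem x 1
    · rw [abs_inv]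
      exact one_lt_inv_iff₀.2 ⟨abs_pos.2 hμ0, hμ1⟩
    · have hs' : |s| ≤ 1 / 20 := by linarith
      have ht' : |t| ≤ 1 / 20 := by linarith
      have htμ' : |μ⁻¹ * t| ≤ 1 / 20 := by
        rw [abs_mul, abs_inv, inv_mul_le_iff₀ (abs_pos.2 hμ0)]
        linarith
      have e1 := hfix (u := s + t * x) (v := s * y + t) (u' := l * s + μ⁻¹ * t * x)
        (v' := l * s * y + μ⁻¹ * t) ?_ ?_ ?_ ?_
      · rw [hpl, hpl] at e1
        convert e1 using 1
        · congr 1; module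
        · module
      · have := hle hx1 ht'
        rw [mul_comm t x]
        linarith [abs_add_le s (x * t)]
      · have := hle hy1 (hle hl1 hs')
        rw [mul_comm _ y]
        linarith [abs_add_le (y * (l * s)) (μ⁻¹ * t)]
      · have hx' : μ⁻¹ * x = C.b false * μ⁻¹ + C.a false * x := by
          field_simp
          linear_combination hx
        linear_combination s * hl + t * hx'
      · have hμ' : 1 = C.d false * μ⁻¹ + C.c false * x := by
          field_simp
          linear_combination hμ
        linear_combination s * hy + t * hμ'
  · -- if the homoclinic point were the saddle, its preimage would be the saddle too, but the symbols at
    -- time `-1` differ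
    intro e
    have e' := injective_planePt hd e
    have h1 : ¬ 0 < p.2 := by
      rw [← h.symbol_iff (hX ξ₀) 0]
      simp [hξ₀]
    have h2 := (h.symbol_iff (hX ξ) (-1)).1 hξt
    have hpS : ∀ q : ℝ × ℝ, |q.1| ≤ 9 / 10 → |q.2| ≤ 9 / 10 → planePt x₀ d₁ d₂ q ∈ S :=
      fun q h1 h2 => hS q (h1.trans (by norm_num)) (h2.trans (by norm_num))
    have key := hinj (hpS _ (hX ξ (-1)).1 (hX ξ (-1)).2.1) (hpS _ (hX ξ₀ 0).1 (hX ξ₀ 0).2.1) (by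
      have e1 := hr.apply_orbit (hX ξ) (-1)
      have e2 := hr.apply_orbit (hX ξ₀) 0
      rw [neg_add_cancel, e'] at e1
      rw [hconst, hconst] at e2
      rw [e1, ← hp, e2])
    rw [injective_planePt hd key, ← hp] at h2
    exact h1 h2
  · simpa using hmem 1 y
  · simpa using hmem z 1
  · -- a segment of the stable line through the homoclinic point shrinks by `l` at each step
    have horb : ∀ n : ℕ, (R^[N])^[n] (planePt x₀ d₁ d₂ (X ξ 0) + s • (d₁ + y • d₂)) =
        planePt x₀ d₁ d₂ (X ξ n + (l ^ n * s, l ^ n * s * y)) := by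
      intro n
      induction n with
      | zero =>
        rw [hpl]
        simp only [Function.iterate_zero, id, Nat.cast_zero, pow_zero, one_mul]
        module
      | succ n ih =>
        rw [Function.iterate_succ_apply', ih]
        have hf := hξf n (by lia)
        have := hr.apply (hX ξ) n (u := l ^ n * s) (v := l ^ n * s * y) (u' := l ^ (n + 1) * s)
          (v' := l ^ (n + 1) * s * y) (hpowl n hs.le)
          (by rw [mul_comm]; exact hle hy1 (hpowl _ hs.le))
          (by rw [hf]; linear_combination l ^ n * s * hl)
          (by rw [hf]; linear_combination l ^ n * s * hy)
        rw [this, Nat.cast_succ]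
    refine ⟨?_, ?_⟩
    · have := horb 0
      rw [Function.iterate_zero, id] at this
      rw [this]
      obtain ⟨b1, b2, -⟩ := hX ξ 0
      refine hS _ ((abs_add_le _ _).trans ?_) ((abs_add_le _ _).trans ?_)
      · have := hpowl 0 hs.le
        simp only [Nat.cast_zero] at *
        linarith
      · have := hle hy1 (hpowl 0 hs.le)
        rw [mul_comm _ y]
        simp only [Nat.cast_zero] at *
        linarith
    · simp only [horb]
      refine ((continuous_planePt x₀ d₁ d₂).tendsto p).comp ?_
      have h1 : ∀ n : ℕ, X ξ n + (l ^ n * s, l ^ n * s * y) =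
          (p.1 + l ^ n * ((X ξ 0).1 - p.1 + s), p.2 + l ^ n * (y * ((X ξ 0).1 - p.1) + s * y)) := by
        intro n
        obtain ⟨w1, w2⟩ := hfwd n
        exact Prod.ext (by rw [Prod.fst_add]; linear_combination w2)
          (by rw [Prod.snd_add]; linear_combination w1)
      simp only [h1]
      have := ((htl.mul_const ((X ξ 0).1 - p.1 + s)).const_add p.1).prodMk_nhds
        ((htl.mul_const (y * ((X ξ 0).1 - p.1) + s * y)).const_add p.2)
      simpa using this
  · -- backward orbits of a segment on the image of the unstable line
    have hmemS : ∀ (n : ℤ) {u v : ℝ}, |u| ≤ 1 / 10 → |v| ≤ 1 / 10 →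
        planePt x₀ d₁ d₂ (X ξ n + (u, v)) ∈ S := by
      intro n u v hu hv
      obtain ⟨b1, b2, -⟩ := hX ξ n
      exact hS _ ((abs_add_le _ _).trans (by simp only; linarith))
        ((abs_add_le _ _).trans (by simp only; linarith))
    have hsρ : |ρ * s| ≤ 1 / 10 := hle hρ1 hs.le
    refine ⟨fun n => Nat.casesOn n (planePt x₀ d₁ d₂ (X ξ 0 + (s * z, s)))
      fun n => planePt x₀ d₁ d₂ (X ξ (-1 - n) + (μ ^ n * (ρ * s) * x, μ ^ n * (ρ * s))), ?_, ?_, ?_⟩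
    · show planePt x₀ d₁ d₂ (X ξ 0 + (s * z, s)) = _
      rw [hpl]
      module
    · intro n
      rcases n with _ | n
      · refine ⟨hmemS 0 (by rw [mul_comm]; exact hle hz1 hs.le) hs.le, ?_⟩
        have := hr.apply (hX ξ) (-1) (u := μ ^ 0 * (ρ * s) * x) (v := μ ^ 0 * (ρ * s)) (u' := s * z)
          (v' := s) (by rw [mul_comm]; exact hle hx1 (hpowμ 0 hsρ)) hs.le
          (by rw [hξt, pow_zero]; linear_combination s * hz)
          (by rw [hξt, pow_zero]; linear_combination s * hρ)
        simpa using this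
      · refine ⟨hmemS _ (by rw [mul_comm]; exact hle hx1 (hpowμ n hsρ)) (hpowμ n hsρ), ?_⟩
        have hf := hξf (-1 - (n + 1 : ℕ)) (by lia)
        have := hr.apply (hX ξ) (-1 - (n + 1 : ℕ)) (u := μ ^ (n + 1) * (ρ * s) * x)
          (v := μ ^ (n + 1) * (ρ * s)) (u' := μ ^ n * (ρ * s) * x) (v' := μ ^ n * (ρ * s))
          (by rw [mul_comm]; exact hle hx1 (hpowμ _ hsρ)) (hpowμ _ hsρ)
          (by rw [hf]; linear_combination μ ^ n * (ρ * s) * hx)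
          (by rw [hf]; linear_combination μ ^ n * (ρ * s) * hμ)
        rwa [show (-1 : ℤ) - (n + 1 : ℕ) + 1 = -1 - n by lia] at this
    · rw [← tendsto_add_atTop_iff_nat 1]
      refine ((continuous_planePt x₀ d₁ d₂).tendsto p).comp ?_
      have h1 : ∀ n : ℕ, X ξ (-1 - n) + (μ ^ n * (ρ * s) * x, μ ^ n * (ρ * s)) =
          (p.1 + μ ^ n * (x * ((X ξ (-1)).2 - p.2) + ρ * s * x),
            p.2 + μ ^ n * ((X ξ (-1)).2 - p.2 + ρ * s)) := by
        intro n
        obtain ⟨w1, w2⟩ := hbwd n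
        exact Prod.ext (by rw [Prod.fst_add]; linear_combination w1)
          (by rw [Prod.snd_add]; linear_combination w2)
      simp only [h1]
      have := ((htμ.mul_const (x * ((X ξ (-1)).2 - p.2) + ρ * s * x)).const_add p.1).prodMk_nhds
        ((htμ.mul_const ((X ξ (-1)).2 - p.2 + ρ * s)).const_add p.2)
      simpa using this

end consequences

end CrossForm

variable {M : Matrix (Fin 3) (Fin 3) ℝ} {φ : ℝ → Phase → Phase}

/-! ### The return map along a given itinerary -/

/-- The map `stepMap M r e` in barycentric coordinates. -/
def stepW (M : Matrix (Fin 3) (Fin 3) ℝ) (r : Fin 3 × Fin 3) (e : Vtx) :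
    (Vtx → ℝ) →ₗ[ℝ] (Vtx → ℝ) :=
  LinearMap.id - (LinearMap.proj e : (Vtx → ℝ) →ₗ[ℝ] ℝ).smulRight ((rate M r e)⁻¹ • rate M r)

lemma stepW_apply (r : Fin 3 × Fin 3) (e : Vtx) (w : Vtx → ℝ) (v : Vtx) :
    stepW M r e w v = w v - w e * ((rate M r e)⁻¹ * rate M r v) := by
  simp [stepW]

/-- The composition of the maps `stepW` along successive exits. -/
def walk (M : Matrix (Fin 3) (Fin 3) ℝ) :
    Fin 3 × Fin 3 → List Vtx → (Vtx → ℝ) →ₗ[ℝ] (Vtx → ℝ)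
  | _, [] => LinearMap.id
  | r, e :: es => walk M (next r e) es ∘ₗ stepW M r e

/-- The region that is reached after the given exits. -/
def endRegion : Fin 3 × Fin 3 → List Vtx → Fin 3 × Fin 3
  | r, [] => r
  | r, e :: es => endRegion (next r e) es

/-- The orbit leaves successively through the relative interiors of the given facets. -/
def Good (M : Matrix (Fin 3) (Fin 3) ℝ) : Fin 3 × Fin 3 → List Vtx → (Vtx → ℝ) → Prop
  | _, [], _ => True
  | r, e :: es, w => 0 < w e ∧
      (∀ v, v ≠ Sum.inl r.1 → v ≠ Sum.inr r.2 → v ≠ e → 0 < stepW M r e w v) ∧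
      Good M (next r e) es (stepW M r e w)

/-- Only the last of the given exits is through the section, namely through the triangle `l`. -/
def IsRun (l : Fin 4) : Fin 3 × Fin 3 → List Vtx → Prop
  | _, [] => False
  | r, e :: es => IsExit r e ∧
      ((es = [] ∧ secExit r e = some l) ∨ (secExit r e = none ∧ IsRun l (next r e) es))

instance (l : Fin 4) (r : Fin 3 × Fin 3) (es : List Vtx) : Decidable (IsRun l r es) := by
  induction es generalizing r with
  | nil => exact instDecidableFalse
  | cons e es ih =>
    have := ih (next r e)
    unfold IsRun
    infer_instance

lemma walk_append (r : Fin 3 × Fin 3) (es es' : List Vtx) (w : Vtx → ℝ) :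
    walk M r (es ++ es') w = walk M (endRegion r es) es' (walk M r es w) := by
  induction es generalizing r w with
  | nil => rfl
  | cons e es ih => exact ih _ _

lemma good_append {r : Fin 3 × Fin 3} {es es' : List Vtx} {w : Vtx → ℝ} :
    Good M r (es ++ es') w ↔ Good M r es w ∧ Good M (endRegion r es) es' (walk M r es w) := by
  induction es generalizing r w with
  | nil => simp [Good, walk, endRegion]
  | cons e es ih =>
    simp only [List.cons_append, Good, ih, walk, endRegion, LinearMap.comp_apply, and_assoc]

lemma convex_good (r : Fin 3 × Fin 3) (es : List Vtx) : Convex ℝ {w | Good M r es w} := by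
  induction es generalizing r with
  | nil => exact convex_univ
  | cons e es ih =>
    intro w hw w' hw' a b ha hb hab
    have key : ∀ {x y : ℝ}, 0 < x → 0 < y → 0 < a * x + b * y := fun {x y} hx hy =>
      (convex_Ioi (0 : ℝ)) hx hy ha hb hab
    refine ⟨key hw.1 hw'.1, fun v h1 h2 h3 => ?_, ?_⟩
    · rw [map_add, map_smul, map_smul]
      exact key (hw.2.1 v h1 h2 h3) (hw'.2.1 v h1 h2 h3)
    · rw [map_add, map_smul, map_smul]
      exact ih _ hw.2.2 hw'.2.2 ha hb hab

lemma Good.smul {r : Fin 3 × Fin 3} {es : List Vtx} {w : Vtx → ℝ} (h : Good M r es w) {c : ℝ}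
    (hc : 0 < c) : Good M r es (c • w) := by
  induction es generalizing r w with
  | nil => trivial
  | cons e es ih =>
    refine ⟨mul_pos hc h.1, fun v h1 h2 h3 => ?_, ?_⟩
    · rw [map_smul]
      exact mul_pos hc (h.2.1 v h1 h2 h3)
    · rw [map_smul]
      exact ih h.2.2

/-- Barycentric coordinates of a point of the region `r`. -/
structure IsWeight (r : Fin 3 × Fin 3) (w : Vtx → ℝ) : Prop where
  fst : w (Sum.inl r.1) = 0
  snd : w (Sum.inr r.2) = 0
  sum : ∑ v, w v = 1
  nonneg : ∀ v, 0 ≤ w v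

section run

variable (hM : IsCyclic M)
include hM

lemma IsCyclic.bary_stepW {r : Fin 3 × Fin 3} {w : Vtx → ℝ} (hw : IsWeight r w) {e : Vtx}
    (he : IsExit r e) : bary M (stepW M r e w) = stepMap M r e (bary M w) ∧
      ∀ v, gap M r v (stepMap M r e (bary M w)) = stepW M r e w v := by
  have hne := (hM.rate_neg he).ne
  have hg : ∀ v, gap M r v (stepMap M r e (bary M w)) = stepW M r e w v := by
    intro v
    rw [stepMap_apply, hM.gap_add_vel, exitTime_apply, hM.gap_bary hw.fst hw.snd,
      hM.gap_bary hw.fst hw.snd, stepW_apply]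
    field_simp
    ring
  refine ⟨?_, hg⟩
  have hs : stepMap M r e (bary M w) ∈ regionSpan M r := by
    rw [stepMap_apply]
    exact hM.add_vel_mem_regionSpan (hM.bary_mem_regionSpan hw.fst hw.snd hw.sum) _
  rw [← hM.bary_gap hs]
  congr 1
  funext v
  rw [hg]

lemma IsCyclic.firstExit_bary {r : Fin 3 × Fin 3} {w : Vtx → ℝ} (hw : IsWeight r w) {e : Vtx}
    (he : IsExit r e)
    (hg : ∀ v, v ≠ Sum.inl r.1 → v ≠ Sum.inr r.2 → v ≠ e → 0 < stepW M r e w v) :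
    FirstExit M r e (bary M w) := by
  refine ⟨hM.bary_mem_region hw.fst hw.snd hw.sum hw.nonneg, he, fun e' he' => ?_⟩
  by_cases hee : e' = e
  · rw [hee]
  have h1 : e' ≠ Sum.inl r.1 := by rintro rfl; exact absurd he' (by clear * -; revert r; decide)
  have h2 : e' ≠ Sum.inr r.2 := by rintro rfl; exact absurd he' (by clear * -; revert r; decide)
  have h3 := hg e' h1 h2 hee
  have n1 := hM.rate_neg he
  have n2 := hM.rate_neg he'
  rw [exitTime_apply, exitTime_apply, hM.gap_bary hw.fst hw.snd, hM.gap_bary hw.fst hw.snd,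
    le_div_iff₀ (neg_pos.2 n2)]
  rw [stepW_apply] at h3
  have : w e / -rate M r e * -rate M r e' = w e * ((rate M r e)⁻¹ * rate M r e') := by
    field_simp
  rw [this]
  linarith

lemma IsCyclic.isWeight_stepW {r : Fin 3 × Fin 3} {w : Vtx → ℝ} (hw : IsWeight r w) {e : Vtx}
    (h : FirstExit M r e (bary M w)) : IsWeight (next r e) (stepW M r e w) := by
  obtain ⟨hb, hg⟩ := hM.bary_stepW hw h.isExit
  obtain ⟨m1, m2⟩ := h.stepMap_mem hM
  have hg' : ∀ v, gap M (next r e) v (stepMap M r e (bary M w)) = stepW M r e w v := fun v => by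
    rw [(hM.gap_next (hM.gap_stepMap h.isExit _)).1, hg]
  refine ⟨?_, ?_, ?_, fun v => ?_⟩
  · rw [← hg', gap_own₁]
  · rw [← hg', gap_own₂]
  · simp only [← hg']
    exact hM.sum_gap m2.1
  · rw [← hg']
    exact m2.2 v

omit hM in
/-- Landing in the relative interior of a facet that is not part of the section. -/
lemma landing_not_inSec (r : Fin 3 × Fin 3) (e : Vtx) (he : IsExit r e) (h : secExit r e = none)
    (F : Finset Vtx) (hF : ∀ v, v ≠ Sum.inl r.1 → v ≠ Sum.inr r.2 → v ≠ e → v ∈ F) : ¬ InSec F := by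
  have key : ∀ r e, IsExit r e → secExit r e = none → ∀ l, ∃ v, v ≠ Sum.inl r.1 ∧
      v ≠ Sum.inr r.2 ∧ v ≠ e ∧ v ∉ secFace l := by decide +kernel
  rintro ⟨l, hl⟩
  obtain ⟨v, h1, h2, h3, h4⟩ := key r e he h l
  exact h4 (hl (hF v h1 h2 h3))

/-- The orbit along an itinerary: it follows the barycentric coordinates and avoids the section until
its end. -/
lemma IsCyclic.exists_run (hφ : IsUniqueFlow (hamField M M) (levelSet M) φ) {l : Fin 4}
    {r : Fin 3 × Fin 3} {es : List Vtx} {w : Vtx → ℝ} (hw : IsWeight r w) (hg : Good M r es w)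
    (hr : IsRun l r es) : IsWeight (endRegion r es) (walk M r es w) ∧
      (∀ v, v ∉ secFace l → walk M r es w v = 0) ∧
      ∃ t, 0 < t ∧ φ t (bary M w) = bary M (walk M r es w) ∧
        ∀ s, 0 < s → s < t → φ s (bary M w) ∉ sec M := by
  induction es generalizing r w with
  | nil => exact hr.elim
  | cons e es ih =>
    have hF := hM.firstExit_bary hw hr.1 hg.2.1
    have hw' := hM.isWeight_stepW hw hF
    obtain ⟨hb, hgap⟩ := hM.bary_stepW hw hr.1
    have hfl := hF.flow_exitTime hM hφ
    have ht : 0 < exitTime M r e (bary M w) := by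
      rw [exitTime_apply, hM.gap_bary hw.fst hw.snd]
      exact div_pos hg.1 (neg_pos.2 (hM.rate_neg hr.1))
    have hno := fun s h0 hs => hF.flow_not_mem_sec hM hφ (t := s) h0 hs
    rcases hr.2 with ⟨rfl, hl⟩ | ⟨hn, hr'⟩
    · refine ⟨hw', fun v hv => ?_, _, ht, by rw [hfl, ← hb]; rfl, hno⟩
      show stepW M r e w v = 0
      rw [← hgap]
      by_cases h1 : v = Sum.inl r.1
      · rw [h1, gap_own₁]
      by_cases h2 : v = Sum.inr r.2
      · rw [h2, gap_own₂]
      by_cases h3 : v = e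
      · rw [h3, hM.gap_stepMap hr.1]
      · exact absurd ((mem_secFace_of_secExit r e l hl v).2 ⟨h1, h2, h3⟩) hv
    · obtain ⟨hw2, hz, t, ht', hf, hno'⟩ := ih hw' hg.2.2 hr'
      have hx : bary M w ∈ levelSet M := region_subset hM hF.mem
      have hadd : ∀ s, φ s (bary M w) = φ (s - exitTime M r e (bary M w))
          (bary M (stepW M r e w)) := fun s => by
        rw [hb, ← hfl, ← hφ.add hx, sub_add_cancel]
      refine ⟨hw2, hz, t + exitTime M r e (bary M w), by linarith, ?_, fun s h0 hs => ?_⟩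
      · rw [hadd, add_sub_cancel_right, hf]
        rfl
      · rcases lt_trichotomy s (exitTime M r e (bary M w)) with h | h | h
        · exact hno s h0 h
        · rw [h, hfl, mem_sec_iff_supp (region_subset hM (hF.stepMap_mem hM).1)]
          refine landing_not_inSec r e hr.1 hn _ fun v h1 h2 h3 => ?_
          rw [mem_supp, hM.coord_eq (hF.stepMap_mem hM).1]
          simp only [hgap]
          exact (hg.2.1 v h1 h2 h3).ne'
        · rw [hadd]
          exact hno' _ (by linarith) (by linarith)

/-- The return map along an itinerary that ends with the first return. -/
lemma IsCyclic.retMap_run (hφ : IsUniqueFlow (hamField M M) (levelSet M) φ) {l : Fin 4}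
    {r : Fin 3 × Fin 3} {es : List Vtx} {w : Vtx → ℝ} (hw : IsWeight r w) (hg : Good M r es w)
    (hr : IsRun l r es) : IsWeight (endRegion r es) (walk M r es w) ∧
      (∀ v, v ∉ secFace l → walk M r es w v = 0) ∧
      retMap M φ (bary M w) = bary M (walk M r es w) := by
  obtain ⟨hw', hz, t, ht, hf, hno⟩ := hM.exists_run hφ hw hg hr
  refine ⟨hw', hz, ?_⟩
  have hx : bary M w ∈ levelSet M :=
    region_subset hM (hM.bary_mem_region hw.fst hw.snd hw.sum hw.nonneg)
  rw [retMap_eq _ ht _ hno, hf]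
  · intro hh
    refine hno (t / 2) (by linarith) (by linarith) (hM.hexagon_subset ?_)
    exact ((hM.isPeriodicOrbit_hexagon hφ).mem_iff hφ hx _).2 hh
  · rw [hf]
    refine mem_iUnion.2 ⟨l, ?_, fun v hv => ?_⟩
    · exact region_subset hM (hM.bary_mem_region hw'.fst hw'.snd hw'.sum hw'.nonneg)
    · rw [hM.coord_bary hw'.fst hw'.snd hw'.sum hw'.nonneg, hz v hv]

end run

/-! ### The interior of the triangles of the section -/

lemma exists_secPar_of_mem_affineSpan {k : Fin 4} {y : Phase}
    (hy : y ∈ affineSpan ℝ (range (secTri M k))) : ∃ s, secPar M k s = y := by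
  obtain ⟨w, hw, rfl⟩ := eq_affineCombination_of_mem_affineSpan_of_fintype hy
  rw [Finset.affineCombination_eq_linear_combination _ _ _ hw, Fin.sum_univ_three]
  rw [Fin.sum_univ_three] at hw
  refine ⟨(w 1, w 2), ?_⟩
  obtain h : w 0 = 1 - w 1 - w 2 := by linarith
  rw [secPar, h]
  module

/-- Points with positive coordinates at the vertices of a triangle lie in its relative interior. -/
lemma IsCyclic.mem_intrinsicInterior (hM : IsCyclic M) {k : Fin 4} {w : Vtx → ℝ}
    (h0 : ∀ v, v ∉ secFace k → w v = 0) (hs : ∑ v, w v = 1) (hpos : ∀ v ∈ secFace k, 0 < w v) :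
    bary M w ∈ intrinsicInterior ℝ (tri (secTri M k)) := by
  have hown : Sum.inl (afterRegion k).1 ∉ secFace k ∧ Sum.inr (afterRegion k).2 ∉ secFace k := by
    clear * -; revert k; decide
  have hmem : ∀ y ∈ affineSpan ℝ (range (secTri M k)),
      (∀ v ∈ secFace k, 0 < gap M (afterRegion k) v y) → y ∈ tri (secTri M k) := by
    intro y hy hg
    obtain ⟨s, rfl⟩ := exists_secPar_of_mem_affineSpan hy
    have h : ∀ i, 0 < ![1 - s.1 - s.2, s.1, s.2] i := fun i => by
      rw [← parWeight_vtx k s i, ← hM.gap_secPar]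
      exact hg _ (mem_secFace k i)
    rw [hM.tri_secTri]
    have h3 := h 0
    simp only [Matrix.cons_val] at h3
    exact hM.secPar_mem_face k ⟨(h 1).le, (h 2).le, by linarith⟩
  have hgap : ∀ v, gap M (afterRegion k) v (bary M w) = w v :=
    hM.gap_bary (h0 _ hown.1) (h0 _ hown.2)
  have hw : bary M w ∈ tri (secTri M k) := by
    have hr := hM.bary_mem_region (h0 _ hown.1) (h0 _ hown.2) hs fun v => by
      by_cases hv : v ∈ secFace k
      · exact (hpos v hv).le
      · exact (h0 v hv).ge
    rw [hM.tri_secTri]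
    refine ⟨region_subset hM hr, fun v hv => ?_⟩
    rw [hM.coord_eq hr]
    simp only [hgap]
    exact h0 v hv
  have e : affineSpan ℝ (tri (secTri M k)) = affineSpan ℝ (range (secTri M k)) :=
    affineSpan_convexHull _
  rw [_root_.mem_intrinsicInterior]
  refine ⟨⟨bary M w, subset_affineSpan ℝ _ hw⟩, ?_, rfl⟩
  rw [mem_interior_iff_mem_nhds]
  have hopen : IsOpen {y : affineSpan ℝ (tri (secTri M k)) |
      ∀ v, v ∈ secFace k → 0 < gap M (afterRegion k) v y} := by
    simp only [ofPred_forall]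
    refine isOpen_iInter_of_finite fun v => isOpen_iInter_of_finite fun _ => ?_
    exact isOpen_lt continuous_const ((continuous_gap _ v).comp continuous_subtype_val)
  refine mem_of_superset (hopen.mem_nhds fun v hv => by
    dsimp only
    rw [hgap]
    exact hpos v hv) fun y hy => hmem y (e ▸ y.2) hy

lemma bary_mem_triDir {k : Fin 4} {w : Vtx → ℝ} (h0 : ∀ v, v ∉ secFace k → w v = 0)
    (hs : ∑ v, w v = 0) : bary M w ∈ triDir (secTri M k) := by
  rw [sum_eq_secFace k _ h0] at hs
  rw [bary_apply, sum_eq_secFace k _ fun v hv => by rw [h0 v hv, zero_smul]]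
  have e : w (secVtx k 0) = -w (secVtx k 1) - w (secVtx k 2) := by linarith
  have h : ∀ i, secTri M k i - secTri M k 0 ∈ triDir (secTri M k) := fun i =>
    vsub_mem_vectorSpan ℝ (mem_range_self i) (mem_range_self 0)
  have := Submodule.add_mem _ (Submodule.smul_mem _ (w (secVtx k 1)) (h 1))
    (Submodule.smul_mem _ (w (secVtx k 2)) (h 2))
  convert this using 1
  rw [e]
  simp only [secTri]
  module

/-! ### Computations at the golden mean -/

/-- The number `σ = (√5 - 1) / 2`. -/
def golden : ℝ := (Real.sqrt 5 - 1) / 2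

lemma golden_sq : golden * golden = 1 - golden := by
  have : Real.sqrt 5 * Real.sqrt 5 = 5 := Real.mul_self_sqrt (by norm_num)
  unfold golden
  linear_combination this / 4

lemma golden_bounds : 0.6180339887 < golden ∧ golden < 0.6180339888 := by
  have h1 : (2.2360679774 : ℝ) < Real.sqrt 5 := Real.lt_sqrt_of_sq_lt (by norm_num)
  have h2 : Real.sqrt 5 < 2.2360679776 := (Real.sqrt_lt' (by norm_num)).2 (by norm_num)
  unfold golden
  constructor <;> linarith

/-- The element `a + b σ` of the ring `ℤ[σ]`. -/
def zval (z : ℤ × ℤ) : ℝ := z.1 + z.2 * golden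

/-- The product in the ring `ℤ[σ]`, where `σ² = 1 - σ`. -/
def zmul (x y : ℤ × ℤ) : ℤ × ℤ :=
  (x.1 * y.1 + x.2 * y.2, x.1 * y.2 + x.2 * y.1 - x.2 * y.2)

lemma zval_mul (x y : ℤ × ℤ) : zval (zmul x y) = zval x * zval y := by
  simp only [zval, zmul]
  push_cast
  linear_combination -(x.2 * y.2 : ℝ) * golden_sq

lemma zval_sub (x y : ℤ × ℤ) : zval (x - y) = zval x - zval y := by
  simp only [zval, Prod.fst_sub, Prod.snd_sub]
  push_cast
  ring

/-- A sufficient condition for positivity in `ℤ[σ]`. -/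
def zpos (z : ℤ × ℤ) : Prop :=
  0 < 10 ^ 10 * z.1 + 6180339887 * z.2 ∧ 0 < 10 ^ 10 * z.1 + 6180339888 * z.2

instance (z : ℤ × ℤ) : Decidable (zpos z) := inferInstanceAs (Decidable (_ ∧ _))

lemma zpos.zval_pos {z : ℤ × ℤ} (h : zpos z) : 0 < zval z := by
  obtain ⟨h1, h2⟩ := h
  have h1' : (0 : ℝ) < 10 ^ 10 * z.1 + 6180339887 * z.2 := by exact_mod_cast h1
  have h2' : (0 : ℝ) < 10 ^ 10 * z.1 + 6180339888 * z.2 := by exact_mod_cast h2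
  obtain ⟨b1, b2⟩ := golden_bounds
  unfold zval
  rcases le_total (0 : ℝ) z.2 with h | h <;> nlinarith

/-- The entries of `matB σ`. -/
def entryZ (i j : Fin 3) : ℤ × ℤ := ![(1, 0), (0, 1), (0, 0)] (i - j)

lemma matB_golden (i j : Fin 3) : matB golden i j = zval (entryZ i j) := by
  fin_cases i <;> fin_cases j <;> simp [matB, entryZ, zval]

/-- Three times the rates of the game `matB σ`. -/
def rateZ (r : Fin 3 × Fin 3) : Vtx → ℤ × ℤ :=
  Sum.elim (fun k => entryZ r.1 r.2 - entryZ k r.2) (fun l => entryZ r.1 l - entryZ r.1 r.2)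

lemma golden_pos : 0 < golden := by linarith [golden_bounds.1]

lemma adjSum_golden : adjSum (matB golden) ≠ 0 ∧ (∀ i, pStar (matB golden) i = 1 / 3) ∧
    ∀ i, qStar (matB golden) i = 1 / 3 := by
  have h := golden_sq
  have hp := golden_pos
  have hs : adjSum (matB golden) = 3 * (1 - golden + golden * golden) := by
    simp only [adjSum, matB, Matrix.adjugate_fin_three, Fin.sum_univ_three, Matrix.of_apply,
      Matrix.cons_val]
    ring
  have hne : 1 - golden + golden * golden ≠ 0 := by nlinarith [sq_nonneg (golden - 1 / 2)]
  refine ⟨by rw [hs]; positivity, fun i => ?_, fun i => ?_⟩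
  · rw [pStar, hs, div_eq_div_iff (by positivity) (by norm_num)]
    fin_cases i <;> simp only [matB, Matrix.adjugate_fin_three, Fin.sum_univ_three,
      Matrix.of_apply, Matrix.cons_val, Fin.zero_eta, Fin.mk_one, Fin.reduceFinMk] <;> ring
  · rw [qStar, hs, div_eq_div_iff (by positivity) (by norm_num)]
    fin_cases i <;> simp only [matB, Matrix.adjugate_fin_three, Fin.sum_univ_three,
      Matrix.of_apply, Matrix.cons_val, Fin.zero_eta, Fin.mk_one, Fin.reduceFinMk] <;> ring

lemma rate_golden (r : Fin 3 × Fin 3) (v : Vtx) :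
    rate (matB golden) r v = 1 / 3 * zval (rateZ r v) := by
  obtain ⟨-, h1, h2⟩ := adjSum_golden
  rcases v with k | l
  · simp only [rate, rateZ, Sum.elim_inl, h1, matB_golden, zval_sub]
  · simp only [rate, rateZ, Sum.elim_inr, h2, matB_golden, zval_sub]

/-- The inverse of a negative rate. -/
def zinv (z : ℤ × ℤ) : ℤ × ℤ :=
  if z = (-1, 0) then (-1, 0) else if z = (0, -1) then (-1, -1) else (-2, -1)

lemma zmul_zinv (r : Fin 3 × Fin 3) (e : Vtx) (he : IsExit r e) :
    zmul (rateZ r e) (zinv (rateZ r e)) = (1, 0) := by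
  revert r e; decide

/-- The map `stepW` for the game `matB σ`, in exact arithmetic. -/
def stepZ (r : Fin 3 × Fin 3) (e : Vtx) (z : Vtx → ℤ × ℤ) (v : Vtx) : ℤ × ℤ :=
  z v - zmul (z e) (zmul (zinv (rateZ r e)) (rateZ r v))

lemma stepW_golden {r : Fin 3 × Fin 3} {e : Vtx} (he : IsExit r e) (z : Vtx → ℤ × ℤ) :
    stepW (matB golden) r e (fun v => zval (z v)) = fun v => zval (stepZ r e z v) := by
  have h : zval (rateZ r e) * zval (zinv (rateZ r e)) = 1 := by
    rw [← zval_mul, zmul_zinv r e he]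
    simp [zval]
  have hne : zval (rateZ r e) ≠ 0 := left_ne_zero_of_mul_eq_one h
  funext v
  rw [stepW_apply, stepZ, zval_sub, zval_mul, zval_mul, rate_golden, rate_golden,
    eq_inv_of_mul_eq_one_right h]
  field_simp

/-- All the given moves are exits. -/
def Exits : Fin 3 × Fin 3 → List Vtx → Prop
  | _, [] => True
  | r, e :: es => IsExit r e ∧ Exits (next r e) es

instance (r : Fin 3 × Fin 3) (es : List Vtx) : Decidable (Exits r es) := by
  induction es generalizing r with
  | nil => exact instDecidableTrue
  | cons e es ih =>
    have := ih (next r e)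
    exact inferInstanceAs (Decidable (_ ∧ _))

/-- The map `walk` for the game `matB σ`, in exact arithmetic. -/
def walkZ : Fin 3 × Fin 3 → List Vtx → (Vtx → ℤ × ℤ) → Vtx → ℤ × ℤ
  | _, [], z => z
  | r, e :: es, z => walkZ (next r e) es (stepZ r e z)

/-- The condition `Good` for the game `matB σ`, in exact arithmetic. -/
def GoodZ : Fin 3 × Fin 3 → List Vtx → (Vtx → ℤ × ℤ) → Prop
  | _, [], _ => True
  | r, e :: es, z => zpos (z e) ∧
      (∀ v, v ≠ Sum.inl r.1 → v ≠ Sum.inr r.2 → v ≠ e → zpos (stepZ r e z v)) ∧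
      GoodZ (next r e) es (stepZ r e z)

instance (r : Fin 3 × Fin 3) (es : List Vtx) (z : Vtx → ℤ × ℤ) : Decidable (GoodZ r es z) := by
  induction es generalizing r z with
  | nil => exact instDecidableTrue
  | cons e es ih =>
    have := ih (next r e) (stepZ r e z)
    exact inferInstanceAs (Decidable (_ ∧ _ ∧ _))

lemma walk_golden {r : Fin 3 × Fin 3} {es : List Vtx} (he : Exits r es) (z : Vtx → ℤ × ℤ) :
    walk (matB golden) r es (fun v => zval (z v)) = fun v => zval (walkZ r es z v) := by
  induction es generalizing r z with
  | nil => rfl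
  | cons e es ih =>
    show walk _ _ es (stepW _ r e _) = _
    rw [stepW_golden he.1, ih he.2]
    rfl

lemma GoodZ.good {r : Fin 3 × Fin 3} {es : List Vtx} (he : Exits r es) {z : Vtx → ℤ × ℤ}
    (h : GoodZ r es z) : Good (matB golden) r es (fun v => zval (z v)) := by
  induction es generalizing r z with
  | nil => trivial
  | cons e es ih =>
    refine ⟨h.1.zval_pos, fun v h1 h2 h3 => ?_, ?_⟩
    · rw [stepW_golden he.1]
      exact (h.2.1 v h1 h2 h3).zval_pos
    · rw [stepW_golden he.1]
      exact ih he.2 h.2.2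

lemma isCyclic_golden : IsCyclic (matB golden) := by
  obtain ⟨b1, b2⟩ := golden_bounds
  obtain ⟨-, h1, h2⟩ := adjSum_golden
  refine ⟨fun i j k l h => ?_, ?_, fun i => by rw [h1]; norm_num, fun i => by rw [h2]; norm_num⟩
  · rw [matB_golden, matB_golden, ← sub_pos, ← zval_sub]
    refine zpos.zval_pos ?_
    revert i j k l
    decide
  · have := golden_pos
    have hd : (matB golden).det = 1 + golden ^ 3 := by
      simp only [matB, Matrix.det_fin_three, Matrix.of_apply, Matrix.cons_val]
      ring
    rw [hd]
    positivity

/-! ### Continuity in the matrix -/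

lemma continuousAt_equilibrium {M₀ : Matrix (Fin 3) (Fin 3) ℝ} (h : adjSum M₀ ≠ 0) (i : Fin 3) :
    ContinuousAt (fun M => pStar M i) M₀ ∧ ContinuousAt (fun M => qStar M i) M₀ := by
  have ha : ∀ i j : Fin 3, Continuous fun M : Matrix (Fin 3) (Fin 3) ℝ => M.adjugate i j :=
    fun i j => (continuous_id.matrix_adjugate).matrix_elem i j
  have hs : Continuous fun M : Matrix (Fin 3) (Fin 3) ℝ => adjSum M :=
    continuous_finsetSum _ fun i _ => continuous_finsetSum _ fun j _ => ha i j
  exact ⟨(continuous_finsetSum _ fun j _ => ha j i).continuousAt.div hs.continuousAt h,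
    (continuous_finsetSum _ fun j _ => ha i j).continuousAt.div hs.continuousAt h⟩

lemma continuousAt_rate {M₀ : Matrix (Fin 3) (Fin 3) ℝ} (h : adjSum M₀ ≠ 0) (r : Fin 3 × Fin 3)
    (v : Vtx) : ContinuousAt (fun M => rate M r v) M₀ := by
  have he : ∀ i j : Fin 3, ContinuousAt (fun M : Matrix (Fin 3) (Fin 3) ℝ => M i j) M₀ :=
    fun i j => (continuous_id.matrix_elem i j).continuousAt
  rcases v with k | l
  · exact (continuousAt_equilibrium h k).1.mul ((he _ _).sub (he _ _))
  · exact (continuousAt_equilibrium h l).2.mul ((he _ _).sub (he _ _))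

lemma eventually_isCyclic {M₀ : Matrix (Fin 3) (Fin 3) ℝ} (h : IsCyclic M₀) :
    ∀ᶠ M in 𝓝 M₀, IsCyclic M := by
  have he : ∀ i j : Fin 3, ContinuousAt (fun M : Matrix (Fin 3) (Fin 3) ℝ => M i j) M₀ :=
    fun i j => (continuous_id.matrix_elem i j).continuousAt
  have h1 : ∀ᶠ M in 𝓝 M₀, ∀ i j k l : Fin 3, i - j < k - l → M k l < M i j := by
    simp only [eventually_all]
    exact fun i j k l hlt => (he k l).eventually_lt (he i j) (h.order i j k l hlt)
  have h2 : ∀ᶠ M in 𝓝 M₀, M.det ≠ 0 :=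
    (continuous_id.matrix_det).continuousAt.eventually_ne h.det_ne
  have h3 : ∀ᶠ M in 𝓝 M₀, ∀ i, 0 < pStar M i := eventually_all.2 fun i =>
    continuousAt_const.eventually_lt (continuousAt_equilibrium h.adjSum_ne i).1 (h.p_pos i)
  have h4 : ∀ᶠ M in 𝓝 M₀, ∀ i, 0 < qStar M i := eventually_all.2 fun i =>
    continuousAt_const.eventually_lt (continuousAt_equilibrium h.adjSum_ne i).2 (h.q_pos i)
  filter_upwards [h1, h2, h3, h4] with M a b c d
  exact ⟨a, b, c, d⟩

lemma IsCyclic.continuousAt_stepW {M₀ : Matrix (Fin 3) (Fin 3) ℝ} (h : IsCyclic M₀)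
    {r : Fin 3 × Fin 3} {e : Vtx} (he : IsExit r e)
    {W : Matrix (Fin 3) (Fin 3) ℝ → Vtx → ℝ} (hW : ContinuousAt W M₀) :
    ContinuousAt (fun M => stepW M r e (W M)) M₀ := by
  have hW' := fun v => continuousAt_pi.1 hW v
  refine continuousAt_pi.2 fun v => ?_
  simp only [stepW_apply]
  exact (hW' v).sub ((hW' e).mul (((continuousAt_rate h.adjSum_ne r e).inv₀ (h.rate_neg he).ne).mul
    (continuousAt_rate h.adjSum_ne r v)))

lemma IsCyclic.continuousAt_walk {M₀ : Matrix (Fin 3) (Fin 3) ℝ} (h : IsCyclic M₀)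
    {r : Fin 3 × Fin 3} {es : List Vtx} (he : Exits r es)
    {W : Matrix (Fin 3) (Fin 3) ℝ → Vtx → ℝ} (hW : ContinuousAt W M₀) :
    ContinuousAt (fun M => walk M r es (W M)) M₀ := by
  induction es generalizing r W with
  | nil => exact hW
  | cons e es ih => exact ih he.2 (h.continuousAt_stepW he.1 hW)

lemma IsCyclic.eventually_good {M₀ : Matrix (Fin 3) (Fin 3) ℝ} (h : IsCyclic M₀)
    {r : Fin 3 × Fin 3} {es : List Vtx} (he : Exits r es)
    {W : Matrix (Fin 3) (Fin 3) ℝ → Vtx → ℝ} (hW : ContinuousAt W M₀) (hg : Good M₀ r es (W M₀)) :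
    ∀ᶠ M in 𝓝 M₀, Good M r es (W M) := by
  induction es generalizing r W with
  | nil => exact Eventually.of_forall fun _ => trivial
  | cons e es ih =>
    have hs := h.continuousAt_stepW he.1 hW
    have h1 : ∀ᶠ M in 𝓝 M₀, 0 < W M e :=
      continuousAt_const.eventually_lt (continuousAt_pi.1 hW e) hg.1
    have h2 : ∀ᶠ M in 𝓝 M₀, ∀ v, v ≠ Sum.inl r.1 → v ≠ Sum.inr r.2 → v ≠ e →
        0 < stepW M r e (W M) v := by
      simp only [eventually_all]
      exact fun v h1 h2 h3 => continuousAt_const.eventually_lt (continuousAt_pi.1 hs v)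
        (hg.2.1 v h1 h2 h3)
    filter_upwards [h1, h2, ih he.2 hs hg.2.2] with M a b c
    exact ⟨a, b, c⟩

variable {M : Matrix (Fin 3) (Fin 3) ℝ} {φ : ℝ → Phase → Phase}

/-! ### The horseshoe near the golden mean -/

/-- Barycentric coordinates supported on the triangle with vertices `inl 0`, `inl 1`, `inr 2`. -/
def boxVec (a b c : ℝ) : Vtx → ℝ := Sum.elim ![a, b, 0] ![0, 0, c]

/-- A vector `boxVec` with integer entries, in exact arithmetic. -/
def vecZ (a b c : ℤ) : Vtx → ℤ × ℤ := Sum.elim ![(a, 0), (b, 0), 0] ![0, 0, (c, 0)]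

lemma boxVec_eq (a b c : ℤ) : boxVec a b c = fun v => zval (vecZ a b c v) := by
  funext v
  rcases v with i | i <;> fin_cases i <;> simp [boxVec, vecZ, zval]

/-- The centre of the box in which the horseshoe is found. The data of the box are rational
approximations, so that at `σ` all computations take place in `ℤ[σ]`. -/
def boxC : Vtx → ℝ := (1 / 100 : ℝ) • boxVec (57 : ℤ) (21 : ℤ) (22 : ℤ)

/-- The first side of the box, close to the contracting directions. -/
def boxS : Vtx → ℝ := (1 / 100 : ℝ) • boxVec (7 : ℤ) (6 : ℤ) (-13 : ℤ)

/-- The second side of the box, close to the expanding directions. -/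
def boxU : Vtx → ℝ := (1 / 100 : ℝ) • boxVec (-2 : ℤ) (5 : ℤ) (-3 : ℤ)

/-- The point of the box with coordinates `s` and `t`. -/
def boxPt (s t : ℝ) : Vtx → ℝ := boxC + s • boxS + t • boxU

/-- The coordinate along `boxS`. -/
def coordS (w : Vtx → ℝ) : ℝ := 100 / 47 * (5 * w (Sum.inl 0) + 2 * w (Sum.inl 1))

/-- The coordinate along `boxU`. -/
def coordU (w : Vtx → ℝ) : ℝ := 100 / 47 * (-6 * w (Sum.inl 0) + 7 * w (Sum.inl 1))

lemma boxPt_eq (s t : ℝ) : boxPt s t = boxVec (57 / 100 + 7 / 100 * s - 2 / 100 * t)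
    (21 / 100 + 6 / 100 * s + 5 / 100 * t) (22 / 100 - 13 / 100 * s - 3 / 100 * t) := by
  funext v
  rcases v with i | i <;> fin_cases i <;>
    simp [boxPt, boxC, boxS, boxU, boxVec] <;> ring

lemma eq_boxPt {w : Vtx → ℝ} (h : ∀ v, v ∉ secFace 2 → w v = 0) (hs : ∑ v, w v = 1) :
    w = boxPt (coordS (w - boxC)) (coordU (w - boxC)) := by
  rw [sum_eq_secFace 2 _ h] at hs
  simp only [secVtx, Matrix.cons_val] at hs
  rw [boxPt_eq]
  funext v
  rcases v with i | i <;> fin_cases i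
  · simp [boxC, boxVec, coordS, coordU]
    ring
  · simp [boxC, boxVec, coordS, coordU]
    ring
  · exact h _ (by decide)
  · exact h _ (by decide)
  · exact h _ (by decide)
  · simp [boxC, boxVec, coordS, coordU]
    linarith

lemma boxPt_of_not_mem {v : Vtx} (hv : v ∉ secFace 2) (s t : ℝ) : boxPt s t v = 0 := by
  rw [boxPt_eq]
  rcases v with i | i <;> fin_cases i <;> first | rfl | exact absurd (by decide) hv

lemma sum_boxPt (s t : ℝ) : ∑ v, boxPt s t v = 1 := by
  rw [sum_eq_secFace 2 _ fun v hv => boxPt_of_not_mem hv s t, boxPt_eq]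
  simp [secVtx, boxVec]
  ring

lemma boxPt_pos {s t : ℝ} (hs : |s| ≤ 1) (ht : |t| ≤ 1) {v : Vtx} (hv : v ∈ secFace 2) :
    0 < boxPt s t v := by
  obtain ⟨s1, s2⟩ := abs_le.1 hs
  obtain ⟨t1, t2⟩ := abs_le.1 ht
  rw [boxPt_eq]
  rcases v with i | i <;> fin_cases i <;>
    first
    | exact absurd hv (by decide)
    | (simp only [boxVec, Sum.elim_inl, Sum.elim_inr, Matrix.cons_val, Fin.zero_eta, Fin.mk_one,
        Fin.reduceFinMk]
       linarith)

lemma isWeight_boxPt {s t : ℝ} (hs : |s| ≤ 1) (ht : |t| ≤ 1) : IsWeight (2, 0) (boxPt s t) := by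
  refine ⟨boxPt_of_not_mem (by decide) s t, boxPt_of_not_mem (by decide) s t, sum_boxPt s t,
    fun v => ?_⟩
  by_cases hv : v ∈ secFace 2
  · exact (boxPt_pos hs ht hv).le
  · exact (boxPt_of_not_mem hv s t).ge

/-- The exits of the two itineraries up to the first return. -/
def itin₁ : Bool → List Vtx
  | false => [.inl 1, .inl 0, .inr 2, .inr 1, .inl 1, .inr 2]
  | true => [.inl 1, .inl 0, .inr 1, .inl 1, .inr 2]

/-- The exits of the two itineraries between the first and the second return. -/
def itin₂ : Bool → List Vtx
  | false => [.inl 2, .inr 1, .inr 0]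
  | true => [.inl 0, .inl 2, .inr 1, .inr 0]

lemma exits_itin (i : Bool) : Exits (2, 0) (itin₁ i ++ itin₂ i) := by revert i; decide

lemma isRun_itin (i : Bool) : IsRun 0 (2, 0) (itin₁ i) ∧
    IsRun 2 (endRegion (2, 0) (itin₁ i)) (itin₂ i) := by revert i; decide

/-- The linear map in barycentric coordinates that describes the second return along an
itinerary. -/
def ret₂ (M : Matrix (Fin 3) (Fin 3) ℝ) (i : Bool) : (Vtx → ℝ) →ₗ[ℝ] (Vtx → ℝ) :=
  walk M (2, 0) (itin₁ i ++ itin₂ i)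

/-- The second return along an itinerary in the coordinates of the box: `(s, t)` is mapped to
`(p s + q t + u, r s + w t + v)`. -/
def retCoef (M : Matrix (Fin 3) (Fin 3) ℝ) (i : Bool) : Fin 6 → ℝ :=
  ![coordS (ret₂ M i boxS), coordS (ret₂ M i boxU), coordS (ret₂ M i boxC - boxC),
    coordU (ret₂ M i boxS), coordU (ret₂ M i boxU), coordU (ret₂ M i boxC - boxC)]

/-- The second return in cross form. -/
def retCross (M : Matrix (Fin 3) (Fin 3) ℝ) : CrossForm where
  a i := retCoef M i 0 - retCoef M i 1 * retCoef M i 3 / retCoef M i 4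
  b i := retCoef M i 1 / retCoef M i 4
  k i := retCoef M i 2 - retCoef M i 1 * retCoef M i 5 / retCoef M i 4
  c i := -retCoef M i 3 / retCoef M i 4
  d i := 1 / retCoef M i 4
  m i := -retCoef M i 5 / retCoef M i 4

/-- The middle `t = stripT i + stripC i * s` of the strip of the box where the itinerary `i` is
followed. The constants approximate the coefficients `m` and `c` of the cross form at `σ`. -/
def stripT : Bool → ℝ
  | false => (-742 : ℤ) / 1000
  | true => (646 : ℤ) / 1000

/-- The slope of the strip. -/
def stripC : Bool → ℝ
  | false => (25 : ℤ) / 1000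
  | true => (-44 : ℤ) / 1000

/-- The open conditions on `M` that guarantee the horseshoe. The strips have half-width
`13 / 1000 = 1 / 1000 + 113 / 10000 + 7 / 10000`, the total error allowed by the bounds for `c`, `d`
and `m`, and it suffices to control the itineraries at their corners. -/
structure HasBox (M : Matrix (Fin 3) (Fin 3) ℝ) : Prop where
  good : ∀ i, ∀ s ∈ ({-1, 1} : Finset ℝ), ∀ τ ∈ ({-1, 1} : Finset ℝ),
    Good M (2, 0) (itin₁ i ++ itin₂ i) (boxPt s (stripT i + stripC i * s + 13 / 1000 * τ))
  ne : ∀ i, retCoef M i 4 ≠ 0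
  a_lt : ∀ i, |(retCross M).a i - 0| < 1 / 50
  b_lt : ∀ i, |(retCross M).b i - 0| < 1 / 10
  k_lt : ∀ i, |(retCross M).k i - 0| < 7 / 10
  c_lt : ∀ i, |(retCross M).c i - stripC i| < 1 / 1000
  d_lt : ∀ i, |(retCross M).d i - 0| < 113 / 10000
  m_lt : ∀ i, |(retCross M).m i - stripT i| < 7 / 10000

/-- The bounds in `HasBox` leave room for the inequalities of `CrossForm.IsHorseshoe`. -/
lemma HasBox.isHorseshoe (h : HasBox M) : (retCross M).IsHorseshoe := by
  have ha := h.a_lt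
  have hb := h.b_lt
  have hk := h.k_lt
  have hd := h.d_lt
  simp only [sub_zero] at ha hb hk hd
  have hc : ∀ i, |(retCross M).c i| < 1 / 20 := by
    intro i
    have := abs_lt.1 (h.c_lt i)
    rw [abs_lt]
    cases i <;> simp only [stripC] at this <;> push_cast at this <;> constructor <;> linarith
  have hm0 := abs_lt.1 (h.m_lt false)
  have hm1 := abs_lt.1 (h.m_lt true)
  simp only [stripT] at hm0 hm1
  push_cast at hm0 hm1
  refine ⟨fun i => ⟨?_, ?_, ?_, ?_⟩, fun i => ?_, fun i => ?_, ?_, ?_, ?_⟩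
  · linarith [ha i]
  · linarith [hb i]
  · linarith [hc i]
  · linarith [hd i]
  · linarith [ha i, hb i, hk i]
  · have : |(retCross M).m i| < 8 / 10 := by
      rw [abs_lt]
      cases i <;> constructor <;> linarith
    linarith [hc i, hd i]
  · exact one_div_ne_zero (h.ne false)
  · linarith [hc false, hd false]
  · linarith [hc true, hd true]

/-- A doubly affine family in a convex set is controlled by its four corners. -/
lemma convex_parallelogram_mem {E : Type*} [AddCommGroup E] [Module ℝ E] {K : Set E}
    (hK : Convex ℝ K) {f : ℝ → ℝ → E}
    (hf : ∀ s t, f s t = (1 / 2 * (1 + s)) • ((1 / 2 * (1 + t)) • f 1 1 + (1 / 2 * (1 - t)) • f 1 (-1)) +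
      (1 / 2 * (1 - s)) • ((1 / 2 * (1 + t)) • f (-1) 1 + (1 / 2 * (1 - t)) • f (-1) (-1)))
    (h : ∀ s ∈ ({-1, 1} : Finset ℝ), ∀ t ∈ ({-1, 1} : Finset ℝ), f s t ∈ K) {s t : ℝ}
    (hs : |s| ≤ 1) (ht : |t| ≤ 1) : f s t ∈ K := by
  obtain ⟨s1, s2⟩ := abs_le.1 hs
  obtain ⟨t1, t2⟩ := abs_le.1 ht
  rw [hf]
  have e : ∀ s ∈ ({-1, 1} : Finset ℝ),
      (1 / 2 * (1 + t)) • f s 1 + (1 / 2 * (1 - t)) • f s (-1) ∈ K := fun s hs =>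
    hK (h s hs 1 (by simp)) (h s hs (-1) (by simp)) (by linarith) (by linarith) (by ring)
  exact hK (e 1 (by simp)) (e (-1) (by simp)) (by linarith) (by linarith) (by ring)

lemma HasBox.good_strip (h : HasBox M) (i : Bool) {s t : ℝ} (hs : |s| ≤ 1)
    (ht : |t - (stripT i + stripC i * s)| ≤ 13 / 1000) :
    Good M (2, 0) (itin₁ i ++ itin₂ i) (boxPt s t) := by
  have := convex_parallelogram_mem (convex_good (M := M) (2, 0) (itin₁ i ++ itin₂ i))
    (f := fun s τ => boxPt s (stripT i + stripC i * s + 13 / 1000 * τ))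
    (fun s τ => by simp only [boxPt]; module) (h.good i) hs
    (t := 1000 / 13 * (t - (stripT i + stripC i * s)))
    (by rw [abs_mul, abs_of_pos (by norm_num : (0 : ℝ) < 1000 / 13)]; linarith)
  have e : stripT i + stripC i * s + 13 / 1000 * (1000 / 13 * (t - (stripT i + stripC i * s))) = t := by
    ring
  simp only [e] at this
  exact this

lemma bary_boxPt (p : ℝ × ℝ) :
    bary M (boxPt p.1 p.2) = planePt (bary M boxC) (bary M boxS) (bary M boxU) p := by
  simp only [boxPt, planePt, map_add, map_smul]

/-- In the box, the second iterate of the return map is given by the cross form. -/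
lemma HasBox.realizes (h : HasBox M) (hM : IsCyclic M)
    (hφ : IsUniqueFlow (hamField M M) (levelSet M) φ) :
    (retCross M).Realizes (retMap M φ)^[2] (bary M boxC) (bary M boxS) (bary M boxU) := by
  intro i s t hs ht
  set t₁ := (retCross M).snd i s t with ht₁
  have hstrip : |t₁ - (stripT i + stripC i * s)| ≤ 13 / 1000 := by
    have e : t₁ - (stripT i + stripC i * s) = ((retCross M).c i - stripC i) * s +
        ((retCross M).d i - 0) * t + ((retCross M).m i - stripT i) := by
      rw [ht₁, CrossForm.snd]; ring
    have k1 : |((retCross M).c i - stripC i) * s| ≤ 1 / 1000 * 1 := by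
      rw [abs_mul]; exact mul_le_mul (h.c_lt i).le hs (abs_nonneg _) (by norm_num)
    have k2 : |((retCross M).d i - 0) * t| ≤ 113 / 10000 * 1 := by
      rw [abs_mul]; exact mul_le_mul (h.d_lt i).le ht (abs_nonneg _) (by norm_num)
    have k3 := h.m_lt i
    rw [e]
    refine (abs_add_le _ _).trans ((add_le_add_left (abs_add_le _ _) _).trans ?_)
    linarith
  have ht₁' : |t₁| ≤ 1 := by
    have hst : |stripT i + stripC i * s| ≤ 9 / 10 := by
      obtain ⟨s1, s2⟩ := abs_le.1 hs
      rw [abs_le]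
      cases i <;> simp only [stripT, stripC] <;> push_cast <;> constructor <;> linarith
    obtain ⟨a1, a2⟩ := abs_le.1 hstrip
    obtain ⟨b1, b2⟩ := abs_le.1 hst
    exact abs_le.2 ⟨by linarith, by linarith⟩
  obtain ⟨g1, g2⟩ := good_append.1 (h.good_strip i hs hstrip)
  obtain ⟨r1, r2⟩ := isRun_itin i
  obtain ⟨w1, -, e1⟩ := hM.retMap_run hφ (isWeight_boxPt hs ht₁') g1 r1
  obtain ⟨w2, z2, e2⟩ := hM.retMap_run hφ w1 g2 r2
  have hw : walk M (endRegion (2, 0) (itin₁ i)) (itin₂ i) (walk M (2, 0) (itin₁ i) (boxPt s t₁)) =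
      ret₂ M i (boxPt s t₁) := (walk_append _ _ _ _).symm
  rw [hw] at e2 z2 w2
  have hlin : ret₂ M i (boxPt s t₁) - boxC = (ret₂ M i boxC - boxC) + s • ret₂ M i boxS +
      t₁ • ret₂ M i boxU := by
    rw [boxPt, map_add, map_add, map_smul, map_smul]; abel
  have hne := h.ne i
  have hS : coordS (ret₂ M i (boxPt s t₁) - boxC) = (retCross M).fst i s t := by
    have : coordS (ret₂ M i (boxPt s t₁) - boxC) =
        retCoef M i 0 * s + retCoef M i 1 * t₁ + retCoef M i 2 := by
      rw [hlin]
      simp only [coordS, retCoef, Pi.add_apply, Pi.smul_apply, smul_eq_mul, Matrix.cons_val]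
      ring
    rw [this, ht₁]
    simp only [CrossForm.fst, CrossForm.snd, retCross]
    field_simp
    ring
  have hU : coordU (ret₂ M i (boxPt s t₁) - boxC) = t := by
    have : coordU (ret₂ M i (boxPt s t₁) - boxC) =
        retCoef M i 3 * s + retCoef M i 4 * t₁ + retCoef M i 5 := by
      rw [hlin]
      simp only [coordU, retCoef, Pi.add_apply, Pi.smul_apply, smul_eq_mul, Matrix.cons_val]
      ring
    rw [this, ht₁]
    simp only [CrossForm.snd, retCross]
    field_simp
    ring
  rw [← bary_boxPt, ← bary_boxPt]
  show retMap M φ (retMap M φ _) = _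
  dsimp only
  rw [e1, e2, eq_boxPt z2 w2.sum, hS, hU]

/-! ### The box at the golden mean -/

/-- The coordinates, multiplied by `47`, of one percent of a vector with entries in `ℤ[σ]`. -/
def coordZ (z : Vtx → ℤ × ℤ) : (ℤ × ℤ) × (ℤ × ℤ) :=
  ((5 * (z (.inl 0)).1 + 2 * (z (.inl 1)).1, 5 * (z (.inl 0)).2 + 2 * (z (.inl 1)).2),
    (-6 * (z (.inl 0)).1 + 7 * (z (.inl 1)).1, -6 * (z (.inl 0)).2 + 7 * (z (.inl 1)).2))

lemma coord_zval (z : Vtx → ℤ × ℤ) :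
    coordS ((1 / 100 : ℝ) • fun v => zval (z v)) = zval (coordZ z).1 / 47 ∧
      coordU ((1 / 100 : ℝ) • fun v => zval (z v)) = zval (coordZ z).2 / 47 := by
  simp only [coordS, coordU, coordZ, zval, Pi.smul_apply, smul_eq_mul]
  push_cast
  constructor <;> ring

/-- The numerators of the coefficients `retCoef` for the game `matB σ`. -/
def retCoefZ : Bool → Fin 6 → ℤ × ℤ
  | false => ![(37, -42), (-306, -176), (800, -1762), (12, -194), (3065, 1922), (4962, -2924)]
  | true => ![(-161, 244), (-236, -16), (-468, 964), (588, -650), (3263, 1636), (148, -4710)]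

lemma ret₂_golden (i : Bool) (z : Vtx → ℤ × ℤ) :
    ret₂ (matB golden) i ((1 / 100 : ℝ) • fun v => zval (z v)) =
      (1 / 100 : ℝ) • fun v => zval (walkZ (2, 0) (itin₁ i ++ itin₂ i) z v) := by
  rw [map_smul, ret₂, walk_golden (exits_itin i)]

lemma coordZ_walkZ (i : Bool) :
    coordZ (walkZ (2, 0) (itin₁ i ++ itin₂ i) (vecZ 7 6 (-13))) =
        (retCoefZ i 0, retCoefZ i 3) ∧
      coordZ (walkZ (2, 0) (itin₁ i ++ itin₂ i) (vecZ (-2) 5 (-3))) =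
        (retCoefZ i 1, retCoefZ i 4) ∧
      coordZ (walkZ (2, 0) (itin₁ i ++ itin₂ i) (vecZ 57 21 22) - vecZ 57 21 22) =
        (retCoefZ i 2, retCoefZ i 5) := by
  revert i; decide +kernel

lemma retCoef_golden (i : Bool) (k : Fin 6) :
    retCoef (matB golden) i k = zval (retCoefZ i k) / 47 := by
  obtain ⟨h1, h2, h3⟩ := coordZ_walkZ i
  have e3 : ret₂ (matB golden) i boxC - boxC = (1 / 100 : ℝ) • fun v =>
      zval ((walkZ (2, 0) (itin₁ i ++ itin₂ i) (vecZ 57 21 22) - vecZ 57 21 22) v) := by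
    rw [boxC, boxVec_eq, ret₂_golden, ← smul_sub]
    congr 1
    funext v
    rw [Pi.sub_apply, Pi.sub_apply, zval_sub]
  have c1 := coord_zval (walkZ (2, 0) (itin₁ i ++ itin₂ i) (vecZ 7 6 (-13)))
  have c2 := coord_zval (walkZ (2, 0) (itin₁ i ++ itin₂ i) (vecZ (-2) 5 (-3)))
  have c3 := coord_zval (walkZ (2, 0) (itin₁ i ++ itin₂ i) (vecZ 57 21 22) - vecZ 57 21 22)
  rw [← ret₂_golden, ← boxVec_eq, h1] at c1
  rw [← ret₂_golden, ← boxVec_eq, h2] at c2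
  rw [← e3, h3] at c3
  fin_cases k
  exacts [c1.1, c2.1, c3.1, c1.2, c2.2, c3.2]

lemma abs_div_sub_lt {n d x e : ℝ} (hd : 0 < d) (h1 : (x - e) * d < n) (h2 : n < (x + e) * d) :
    |n / d - x| < e := by
  rw [← lt_div_iff₀ hd] at h1
  rw [← div_lt_iff₀ hd] at h2
  exact abs_lt.2 ⟨by linarith, by linarith⟩

lemma retCoef_golden_ne (i : Bool) : retCoef (matB golden) i 4 ≠ 0 := by
  have := golden_pos
  rw [retCoef_golden]
  cases i <;> simp only [retCoefZ, zval, Matrix.cons_val] <;> push_cast <;> positivity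

/-- The cross form at the golden mean as quotients of elements of `ℤ[σ]`. -/
lemma retCross_golden (i : Bool) :
    let z : Fin 6 → ℝ := fun k => zval (retCoefZ i k)
    (retCross (matB golden)).a i = (z 0 * z 4 - z 1 * z 3) / (47 * z 4) ∧
    (retCross (matB golden)).b i = z 1 / z 4 ∧
    (retCross (matB golden)).k i = (z 2 * z 4 - z 1 * z 5) / (47 * z 4) ∧
    (retCross (matB golden)).c i = -z 3 / z 4 ∧
    (retCross (matB golden)).d i = 47 / z 4 ∧
    (retCross (matB golden)).m i = -z 5 / z 4 := by
  intro z
  have h := retCoef_golden_ne i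
  rw [retCoef_golden] at h
  have hz : z 4 ≠ 0 := fun e => h (by rw [show zval (retCoefZ i 4) = z 4 from rfl, e, zero_div])
  simp only [retCross, retCoef_golden]
  refine ⟨?_, ?_, ?_, ?_, ?_, ?_⟩
  all_goals
    simp only [show ∀ k, zval (retCoefZ i k) = z k from fun _ => rfl]
    field_simp

lemma retCross_golden_lt (i : Bool) :
    |(retCross (matB golden)).a i - 0| < 1 / 50 ∧
    |(retCross (matB golden)).b i - 0| < 1 / 10 ∧
    |(retCross (matB golden)).k i - 0| < 7 / 10 ∧
    |(retCross (matB golden)).c i - stripC i| < 1 / 1000 ∧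
    |(retCross (matB golden)).d i - 0| < 113 / 10000 ∧
    |(retCross (matB golden)).m i - stripT i| < 7 / 10000 := by
  obtain ⟨b1, b2⟩ := golden_bounds
  obtain ⟨ha, hb, hk, hc, hd, hm⟩ := retCross_golden i
  rw [ha, hb, hk, hc, hd, hm]
  simp only [← zval_mul, ← zval_sub]
  cases i
  all_goals
    simp only [retCoefZ, zval, zmul, stripC, stripT, Matrix.cons_val, Prod.fst_sub, Prod.snd_sub]
    norm_num only
    refine ⟨?_, ?_, ?_, ?_, ?_, ?_⟩ <;> apply abs_div_sub_lt <;> linarith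

/-- The corners of the strips, in units of `10⁻⁵`. -/
def cornerZ : Bool → Bool → Bool → Vtx → ℤ × ℤ
  | false, false, false => vecZ 51560 11100 37340
  | false, false, true => vecZ 51508 11230 37262
  | false, true, false => vecZ 65460 23350 11190
  | false, true, true => vecZ 65408 23480 11112
  | true, false, false => vecZ 48646 18385 32969
  | true, false, true => vecZ 48594 18515 32891
  | true, true, false => vecZ 62822 29945 7233
  | true, true, true => vecZ 62770 30075 7155

lemma goodZ_cornerZ (i s t : Bool) : GoodZ (2, 0) (itin₁ i ++ itin₂ i) (cornerZ i s t) := by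
  revert i s t; decide +kernel

lemma good_corner (i s t : Bool) : Good (matB golden) (2, 0) (itin₁ i ++ itin₂ i)
    (boxPt (bif s then 1 else -1)
      (stripT i + stripC i * (bif s then 1 else -1) + 13 / 1000 * (bif t then 1 else -1))) := by
  have h := ((goodZ_cornerZ i s t).good (exits_itin i)).smul (c := 1 / 10 ^ 5) (by norm_num)
  convert h using 1
  rw [boxPt_eq]
  cases i <;> cases s <;> cases t <;> simp only [cornerZ, ← boxVec_eq, cond_true, cond_false, stripT, stripC] <;>
    (funext v
     rcases v with j | j <;> fin_cases j <;> simp [boxVec] <;> norm_num)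

lemma hasBox_golden : HasBox (matB golden) where
  good i s hs τ hτ := by
    simp only [Finset.mem_insert, Finset.mem_singleton] at hs hτ
    rcases hs with rfl | rfl <;> rcases hτ with rfl | rfl
    exacts [good_corner i false false, good_corner i false true, good_corner i true false,
      good_corner i true true]
  ne := retCoef_golden_ne
  a_lt i := (retCross_golden_lt i).1
  b_lt i := (retCross_golden_lt i).2.1
  k_lt i := (retCross_golden_lt i).2.2.1
  c_lt i := (retCross_golden_lt i).2.2.2.1
  d_lt i := (retCross_golden_lt i).2.2.2.2.1
  m_lt i := (retCross_golden_lt i).2.2.2.2.2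

variable {M₀ : Matrix (Fin 3) (Fin 3) ℝ}

lemma IsCyclic.continuousAt_retCoef (h : IsCyclic M₀) (i : Bool) (k : Fin 6) :
    ContinuousAt (fun M => retCoef M i k) M₀ := by
  have hS : Continuous coordS := by unfold coordS; fun_prop
  have hU : Continuous coordU := by unfold coordU; fun_prop
  have hw : ∀ w : Vtx → ℝ, ContinuousAt (fun M => ret₂ M i w) M₀ := fun w =>
    h.continuousAt_walk (exits_itin i) continuousAt_const
  have hc : ContinuousAt (fun M => ret₂ M i boxC - boxC) M₀ := (hw boxC).sub continuousAt_const
  fin_cases k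
  exacts [hS.continuousAt.comp (hw boxS), hS.continuousAt.comp (hw boxU), hS.continuousAt.comp hc,
    hU.continuousAt.comp (hw boxS), hU.continuousAt.comp (hw boxU), hU.continuousAt.comp hc]

/-- The conditions of `HasBox` are open. -/
lemma HasBox.eventually (hM : IsCyclic M₀) (h : HasBox M₀) : ∀ᶠ M in 𝓝 M₀, HasBox M := by
  have hc := hM.continuousAt_retCoef
  have lt : ∀ {f : Matrix (Fin 3) (Fin 3) ℝ → ℝ} {x e : ℝ}, ContinuousAt f M₀ →
      |f M₀ - x| < e → ∀ᶠ M in 𝓝 M₀, |f M - x| < e := fun hf hlt =>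
    (hf.sub continuousAt_const).abs.eventually_lt continuousAt_const hlt
  have h0 : ∀ᶠ M in 𝓝 M₀, ∀ i, ∀ s ∈ ({-1, 1} : Finset ℝ), ∀ τ ∈ ({-1, 1} : Finset ℝ),
      Good M (2, 0) (itin₁ i ++ itin₂ i) (boxPt s (stripT i + stripC i * s + 13 / 1000 * τ)) := by
    refine eventually_all.2 fun i => (eventually_all_finset _).2 fun s hs =>
      (eventually_all_finset _).2 fun τ hτ => ?_
    exact hM.eventually_good (exits_itin i) continuousAt_const (h.good i s hs τ hτ)
  have h1 : ∀ᶠ M in 𝓝 M₀, ∀ i, retCoef M i 4 ≠ 0 :=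
    eventually_all.2 fun i => (hc i 4).eventually_ne (h.ne i)
  have ha := eventually_all.2 fun i =>
    lt ((hc i 0).sub (((hc i 1).mul (hc i 3)).div (hc i 4) (h.ne i))) (h.a_lt i)
  have hb := eventually_all.2 fun i => lt ((hc i 1).div (hc i 4) (h.ne i)) (h.b_lt i)
  have hk := eventually_all.2 fun i =>
    lt ((hc i 2).sub (((hc i 1).mul (hc i 5)).div (hc i 4) (h.ne i))) (h.k_lt i)
  have hc' := eventually_all.2 fun i => lt ((hc i 3).neg.div (hc i 4) (h.ne i)) (h.c_lt i)
  have hd := eventually_all.2 fun i =>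
    lt (continuousAt_const.div (hc i 4) (h.ne i)) (h.d_lt i)
  have hm := eventually_all.2 fun i => lt ((hc i 5).neg.div (hc i 4) (h.ne i)) (h.m_lt i)
  filter_upwards [h0, h1, ha, hb, hk, hc', hd, hm] with M a b c d e f g k
  exact ⟨a, b, c, d, e, f, g, k⟩

/-! ### Saddle and horseshoe of the return map -/

variable {M : Matrix (Fin 3) (Fin 3) ℝ} {φ : ℝ → Phase → Phase}

/-- A point with three positive barycentric coordinates is not on the hexagon. -/
lemma IsCyclic.boxPt_mem (hM : IsCyclic M) {p : ℝ × ℝ} (h1 : |p.1| ≤ 1) (h2 : |p.2| ≤ 1) :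
    planePt (bary M boxC) (bary M boxS) (bary M boxU) p ∈ sec M \ hexagon M ∧
      planePt (bary M boxC) (bary M boxS) (bary M boxU) p ∈
        intrinsicInterior ℝ (tri (secTri M 2)) := by
  have hw := isWeight_boxPt h1 h2
  have hc := hM.coord_bary hw.fst hw.snd hw.sum hw.nonneg
  have hx : bary M (boxPt p.1 p.2) ∈ levelSet M :=
    region_subset hM (hM.bary_mem_region hw.fst hw.snd hw.sum hw.nonneg)
  rw [← bary_boxPt]
  refine ⟨⟨mem_iUnion.2 ⟨2, hx, fun v hv => ?_⟩, fun hh => ?_⟩,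
    hM.mem_intrinsicInterior (fun v hv => boxPt_of_not_mem hv _ _) hw.sum
      fun v hv => boxPt_pos h1 h2 hv⟩
  · rw [hc]
    exact boxPt_of_not_mem hv _ _
  · obtain ⟨i, hi⟩ := (hM.mem_hexagon_iff_supp hx).1 hh
    have hsub : secFace 2 ⊆ hexEdge i := fun v hv => hi <| mem_supp.2 <| by
      rw [hc]
      exact (boxPt_pos h1 h2 hv).ne'
    revert hsub
    clear * -
    revert i
    decide

lemma IsCyclic.linearIndependent_box (hM : IsCyclic M) :
    LinearIndependent ℝ ![bary M boxS, bary M boxU] := by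
  refine LinearIndependent.pair_iff.2 fun s t h => ?_
  have e : bary M (s • boxS + t • boxU) = bary M 0 := by
    rw [map_add, map_smul, map_smul, map_zero, h]
  have hg : ∀ v, (s • boxS + t • boxU) v = 0 := fun v => by
    rw [← hM.gap_bary (r := (2, 0)) (w := s • boxS + t • boxU) (by simp [boxS, boxU, boxVec])
      (by simp [boxS, boxU, boxVec]) v, e, hM.gap_bary rfl rfl, Pi.zero_apply]
  have h1 := hg (.inl 0)
  have h2 := hg (.inl 1)
  simp [boxS, boxU, boxVec] at h1 h2
  constructor <;> linarith

lemma box_mem_triDir : bary M boxS ∈ triDir (secTri M 2) ∧ bary M boxU ∈ triDir (secTri M 2) := by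
  have h : ∀ a b c : ℝ, a + b + c = 0 → bary M (boxVec a b c) ∈ triDir (secTri M 2) := by
    intro a b c h
    have h0 : ∀ v, v ∉ secFace 2 → boxVec a b c v = 0 := by
      intro v hv
      rcases v with i | i <;> fin_cases i <;> first | rfl | exact absurd (by decide) hv
    refine bary_mem_triDir h0 ?_
    rw [sum_eq_secFace 2 _ h0]
    simp only [secVtx, boxVec, Matrix.cons_val, Sum.elim_inl, Sum.elim_inr]
    linarith
  unfold boxS boxU
  rw [map_smul, map_smul]
  exact ⟨Submodule.smul_mem _ _ (h _ _ _ (by norm_num)),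
    Submodule.smul_mem _ _ (h _ _ _ (by norm_num))⟩

lemma HasBox.exists_saddle (h : HasBox M) (hM : IsCyclic M)
    (hφ : IsUniqueFlow (hamField M M) (levelSet M) φ) :
    ∃ x y, IsSaddle (retMap M φ) (secTri M) 2 x ∧
      IsTransverseHomoclinic (retMap M φ) (sec M) (secTri M) 2 x y :=
  h.isHorseshoe.exists_saddle hM.linearIndependent_box two_pos
    ((hM.injOn_retMap hφ).iterate (fun _ => hM.retMap_mem hφ) 2) (h.realizes hM hφ)
    (fun _ h1 h2 => (hM.boxPt_mem h1 h2).1.1)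
    (fun _ h1 h2 => (hM.boxPt_mem (by linarith) (by linarith)).2) box_mem_triDir.1 box_mem_triDir.2

lemma HasBox.hasHorseshoe (h : HasBox M) (hM : IsCyclic M)
    (hφ : IsUniqueFlow (hamField M M) (levelSet M) φ) :
    HasHorseshoe (retMap M φ) (sec M \ hexagon M) :=
  h.isHorseshoe.hasHorseshoe hM.linearIndependent_box two_pos (hM.injOn_retMap hφ)
    (fun _ => hM.retMap_mem hφ) (h.realizes hM hφ)
    (fun _ h1 h2 => (hM.boxPt_mem (by linarith) (by linarith)).1.1)
    (fun _ h1 h2 => (hM.boxPt_mem (by linarith) (by linarith)).1)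

/-- All matrices with entries close to those of `matB σ` are cyclic and have the box. -/
lemma exists_nhds_golden : ∃ η : ℝ, 0 < η ∧ ∀ M : Matrix (Fin 3) (Fin 3) ℝ,
    (∀ i j, |M i j - matB golden i j| < η) → IsCyclic M ∧ HasBox M := by
  have h := (eventually_isCyclic isCyclic_golden).and (hasBox_golden.eventually isCyclic_golden)
  obtain ⟨η, hη, hs⟩ := (Metric.eventually_nhds_iff (α := Fin 3 → Fin 3 → ℝ)
    (x := matB golden) (p := fun M => IsCyclic M ∧ HasBox M)).1 h
  exact ⟨η, hη, fun M hM => hs ((dist_pi_lt_iff hη).2 fun i => (dist_pi_lt_iff hη).2 fun j => hM i j)⟩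

lemma abs_matB_sub_le (β β' : ℝ) (i j : Fin 3) : |matB β i j - matB β' i j| ≤ |β - β'| := by
  fin_cases i <;> fin_cases j <;> simp [matB]

end PWHam

end

theorem mainTheorem6 :
    ∃ δ : ℝ, 0 < δ ∧ ∀ β : ℝ, |β - (Real.sqrt 5 - 1) / 2| < δ →
    ∃ ε : ℝ, 0 < ε ∧ ∀ M : Matrix (Fin 3) (Fin 3) ℝ,
      (∀ i j, |M i j - PWHam.matB β i j| < ε) →
      Nonempty (PWHam.levelSet M ≃ₜ Metric.sphere (0 : EuclideanSpace ℝ (Fin 4)) 1) ∧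
      ∃ φ : ℝ → PWHam.Phase → PWHam.Phase, PWHam.IsFlow M M φ ∧
      ∃ Γ : Set PWHam.Phase,
        -- `Γ` is a hexagonal periodic orbit, on which both best responses are multivalued
        PWHam.IsPeriodicOrbit φ (PWHam.levelSet M) Γ ∧
        PWHam.IsHexagon Γ ∧
        (∀ x ∈ Γ, (PWHam.bestRespP M x.2).Nontrivial ∧ (PWHam.bestRespQ M x.1).Nontrivial) ∧
      ∃ S : Set PWHam.Phase, S ⊆ PWHam.levelSet M ∧
        PWHam.IsDiscWithBoundary S Γ ∧
      -- `S` is a union of four triangles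
      ∃ T : Fin 4 → Fin 3 → PWHam.Phase, PWHam.IsTriangulation T S ∧
        -- every orbit off `Γ` meets `S` infinitely often, always transversally
        (∀ x ∈ PWHam.levelSet M \ Γ, ∀ t₀ : ℝ,
          (∃ t, t₀ < t ∧ φ t x ∈ S) ∧ (∃ t, t < t₀ ∧ φ t x ∈ S)) ∧
        (∀ x ∈ PWHam.levelSet M \ Γ, ∀ t : ℝ, φ t x ∈ S →
          PWHam.CrossesTransversally φ (PWHam.levelSet M) S T (φ t x)) ∧
      -- the first return time `τ` and the first return map `R`, extended to `∂S = Γ`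
      ∃ (τ : PWHam.Phase → ℝ) (R : PWHam.Phase → PWHam.Phase),
        (∀ z ∈ S \ Γ, IsLeast {t : ℝ | 0 < t ∧ φ t z ∈ S} (τ z)) ∧
        (∀ z ∈ S \ Γ, R z = φ (τ z) z) ∧
        (∀ z' ∈ Γ, Filter.Tendsto τ (nhdsWithin z' (S \ Γ)) (nhds 0)) ∧
        ContinuousOn R S ∧
        (∀ z ∈ Γ, R z = z) ∧
        -- `R` is piecewise affine and preserves the area induced by the symplectic form
        PWHam.IsPiecewiseAffineOn R S ∧
        (∀ k, PWHam.symp M (T k 1 - T k 0) (T k 2 - T k 0) ≠ 0) ∧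
        (∀ E : Set PWHam.Phase, MeasurableSet E →
          PWHam.sympArea M T (S ∩ R ⁻¹' E) = PWHam.sympArea M T E) ∧
        -- homoclinic intersections and horseshoes
        (∃ (N : ℕ) (x y : PWHam.Phase),
          PWHam.IsSaddle R T N x ∧ PWHam.IsTransverseHomoclinic R S T N x y) ∧
        PWHam.HasHorseshoe R (S \ Γ) := by
  obtain ⟨η, hη, h⟩ := PWHam.exists_nhds_golden
  refine ⟨η / 2, half_pos hη, fun β hβ => ⟨η / 2, half_pos hη, fun M hβM => ?_⟩⟩
  obtain ⟨hM, hB⟩ : PWHam.IsCyclic M ∧ PWHam.HasBox M := h M fun i j => by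
    have h1 := PWHam.abs_matB_sub_le β PWHam.golden i j
    have h2 := abs_sub_le (M i j) (PWHam.matB β i j) (PWHam.matB PWHam.golden i j)
    have h3 : |β - PWHam.golden| < η / 2 := hβ
    linarith [hβM i j]
  obtain ⟨φ, hφ⟩ := hM.exists_flow
  have hΓ := hM.isPeriodicOrbit_hexagon hφ
  refine ⟨hM.nonempty_homeomorph_sphere, φ, hM.isFlow hφ, PWHam.hexagon M, hΓ, hM.isHexagon,
    fun x hx => PWHam.hexagon_nontrivial hx, PWHam.sec M, fun x hx => PWHam.sec_subset hx,
    hM.isDiscWithBoundary, PWHam.secTri M, hM.isTriangulation,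
    fun x hx t₀ => hM.exists_hit_large hφ hx.1 t₀,
    fun x hx t hs => hM.crossesTransversally hφ hs fun ht => hx.2 ((hΓ.mem_iff hφ hx.1 t).1 ht),
    PWHam.retTime M φ, PWHam.retMap M φ, fun z hz => hM.isLeast_retTime hφ hz.1 hz.2,
    fun z _ => rfl, fun z' hz' => hM.tendsto_retTime hφ hz', (hM.continuousOn_ret hφ).2,
    fun z hz => PWHam.retMap_of_mem_hexagon hφ hz, hM.isPiecewiseAffineOn hφ,
    hM.secDensity_ne_zero, fun E hE => hM.sympArea_preimage hφ hE, ?_, hB.hasHorseshoe hM hφ⟩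
  obtain ⟨x, y, h⟩ := hB.exists_saddle hM hφ
  exact ⟨2, x, y, h⟩
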